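/- **Setting.** Let $\Omega\subset\mathbb R^3$ be a bounded open nonempty convex polyhedron, $k\ge 1$ an integer, $T>0$, and $c_{\rm M}>0$, $c_0\ge 0$. Let $\Omega_h$ be a conforming decomposition of $\Omega$ into finitely many tetrahedra $E$ of diameter $h_E$, $h=\max_E h_E$, shape regular in the sense that each $E$ is star shaped with respect to a ball of radius $\rho_E$ with $h_E\le c_{\rm M}\rho_E$. Let $\Sigma_h$ and $\Sigma_h^{\rm int}$ be the sets of all faces and of internal faces, $h_f$ the diameter of a face $f$, $\omega_f$ the union of the elements having $f$ as a face, and $\boldsymbol n_f$ a fixed unit normal to $f$ (outward on $\partial\Omega$). On internal faces $[\![\phi]\!]_f(x)=\lim_{s\to0^+}(\phi(x-s\boldsymbol n_f)-\phi(x+s\boldsymbol n_f))$ and $\{\!\{\phi\}\!\}_f(x)=\tfrac12\lim_{s\to0^+}(\phi(x-s\boldsymbol n_f)+\phi(x+s\boldsymbol n_f))$; on boundary faces both denote the trace of $\phi$. The operators $\nabla_h,\epsilon_h$ are the elementwise gradient and symmetric gradient; $(\cdot,\cdot)$ and $(\cdot,\cdot)_f$ are the $L^2$ inner products on $\Omega$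 and $f$ (differential operators being applied elementwise), and $\|\cdot\|$, $\|\cdot\|_f$ the corresponding norms. **Spaces.** $\boldsymbol V^h_k=[\mathbb P_k(\Omega_h)]^3\cap \boldsymbol H_0({\rm div},\Omega)$ (piecewise polynomials of degree $\le k$), $\boldsymbol Z^h_k=\{\boldsymbol v\in \boldsymbol V^h_k:\ {\rm div}\,\boldsymbol v=0\}$, and $\boldsymbol W^h_k$ is the space of continuous fields in $[\mathbb P_k(\Omega_h)]^3$ with vanishing normal component on $\partial\Omega$. **BDM interpolant.** For $\boldsymbol v\in \boldsymbol H^1_0(\Omega)\cap \boldsymbol W^{k+1}_\infty(\Omega_h)$ the interpolant $\mathcal I_V\boldsymbol v$ is the field whose restriction to each $E\in\Omega_h$ is the vector polynomial of degree $\le k$ such that $\int_f(\boldsymbol v-\mathcal I_V\boldsymbol v)\cdot\boldsymbol n_f\,q=0$ for every face $f$ of $E$ and every $q\in\mathbb P_k(f)$ and, if $k\ge2$, $\int_E(\boldsymbol v-\mathcal I_V\boldsymbol v)\cdot(\boldsymbol p+\boldsymbol x\times\boldsymbol q)=0$ for all $\boldsymbol p,\boldsymbol q\in[\mathbb P_{k-2}(E)]^3$.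 **Discrete problem.** Let $\nu_{\rm S},\nu_{\rm M},\mu_a>0$, $\boldsymbol f,\boldsymbol G\in L^2(0,T;\boldsymbol L^2(\Omega))$, and $\boldsymbol u_0,\boldsymbol B_0\in \boldsymbol H_0({\rm div}^0,\Omega)$ (the solenoidal fields of $\boldsymbol H_0({\rm div},\Omega)$). Put $$a^{\rm S}_h(\boldsymbol u,\boldsymbol v)=(\epsilon_h(\boldsymbol u),\epsilon_h(\boldsymbol v))-\sum_{f\in\Sigma_h}\left[(\{\!\{\epsilon_h(\boldsymbol u)\boldsymbol n_f\}\!\}_f,[\![\boldsymbol v]\!]_f)_f+([\![\boldsymbol u]\!]_f,\{\!\{\epsilon_h(\boldsymbol v)\boldsymbol n_f\}\!\}_f)_f\right]+\mu_a\sum_{f\in\Sigma_h}h_f^{-1}([\![\boldsymbol u]\!]_f,[\![\boldsymbol v]\!]_f)_f,$$ $$c_h(\boldsymbol\chi;\boldsymbol u,\boldsymbol v)=((\nabla_h\boldsymbol u)\boldsymbol\chi,\boldsymbol v)-\sum_{f\in\Sigma_h^{\rm int}}((\boldsymbol\chi\cdot\boldsymbol n_f)[\![\boldsymbol u]\!]_f,\{\!\{\boldsymbol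 v\}\!\}_f)_f+\sum_{f\in\Sigma_h^{\rm int}}(|\boldsymbol\chi\cdot\boldsymbol n_f|[\![\boldsymbol u]\!]_f,[\![\boldsymbol v]\!]_f)_f,$$ $$J_h(\boldsymbol\Theta;\boldsymbol u,\boldsymbol v)=\sum_{f\in\Sigma_h^{\rm int}}\max\{\|\boldsymbol\Theta\|_{L^\infty(\omega_f)}^2,1\}\left(([\![\boldsymbol u]\!]_f,[\![\boldsymbol v]\!]_f)_f+h_f^2([\![\nabla_h\boldsymbol u]\!]_f,[\![\nabla_h\boldsymbol v]\!]_f)_f\right),$$ $$a^{\rm M}(\boldsymbol B,\boldsymbol H)=({\rm curl}\,\boldsymbol B,{\rm curl}\,\boldsymbol H)+({\rm div}\,\boldsymbol B,{\rm div}\,\boldsymbol H),\qquad d(\boldsymbol\Theta;\boldsymbol H,\boldsymbol v)=({\rm curl}\,\boldsymbol H\times\boldsymbol\Theta,\boldsymbol v).$$ Let $(\boldsymbol u_h,\boldsymbol B_h):[0,T]\to \boldsymbol Z^h_k\times \boldsymbol W^h_k$ be absolutely continuous in time and satisfy, for a.e. $t\in(0,T)$ and all $(\boldsymbol v_h,\boldsymbol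 H_h)\in \boldsymbol Z^h_k\times \boldsymbol W^h_k$, $$\begin{aligned}&(\partial_t\boldsymbol u_h,\boldsymbol v_h)+(\partial_t\boldsymbol B_h,\boldsymbol H_h)+\nu_{\rm S}a^{\rm S}_h(\boldsymbol u_h,\boldsymbol v_h)+\nu_{\rm M}a^{\rm M}(\boldsymbol B_h,\boldsymbol H_h)+J_h(\boldsymbol B_h;\boldsymbol u_h,\boldsymbol v_h)+c_h(\boldsymbol u_h;\boldsymbol u_h,\boldsymbol v_h)\\&\quad-d(\boldsymbol B_h;\boldsymbol B_h,\boldsymbol v_h)+d(\boldsymbol B_h;\boldsymbol H_h,\boldsymbol u_h)+({\rm div}\,\boldsymbol B_h,{\rm div}\,\boldsymbol H_h)=(\boldsymbol f,\boldsymbol v_h)+(\boldsymbol G,\boldsymbol H_h),\end{aligned}$$ and let the discrete initial values be $L^2$-stable with respect to the initial data: $\|\boldsymbol u_h(0)\|\le c_0\|\boldsymbol u_0\|$ and $\|\boldsymbol B_h(0)\|\le c_0\|\boldsymbol B_0\|$. **Norm and constants.** Put $$\begin{aligned}\|\boldsymbol v\|_{\rm stab}^2(t)={}&\nu_{\rm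 S}\Big(\|\epsilon_h(\boldsymbol v)\|^2+\mu_a\sum_{f\in\Sigma_h}h_f^{-1}\|[\![\boldsymbol v]\!]_f\|_f^2\Big)+\sum_{f\in\Sigma_h^{\rm int}}\big\||\boldsymbol u_h(t)\cdot\boldsymbol n_f|^{1/2}[\![\boldsymbol v]\!]_f\big\|_f^2\\&+\sum_{f\in\Sigma_h^{\rm int}}\max\{\|\boldsymbol B_h(t)\|_{L^\infty(\omega_f)}^2,1\}\left(\|[\![\boldsymbol v]\!]_f\|_f^2+h_f^2\|[\![\nabla_h\boldsymbol v]\!]_f\|_f^2\right),\end{aligned}$$ $$\gamma_{\rm data}^2=\|\boldsymbol f\|_{L^1(0,T;L^2)}^2+\|\boldsymbol G\|_{L^1(0,T;L^2)}^2+\|\boldsymbol u_0\|^2+\|\boldsymbol B_0\|^2,\qquad \Lambda_{\rm stab}^2=\max\{\nu_{\rm S}(1+\mu_a+\mu_a^{-1}),\,h(\gamma_{\rm data}^2+1)\}.$$ **Proposition (Interpolation error estimate for the velocity field).** There is $\mu_0>0$ depending only on $\Omega,k,c_{\rm M}$, and there is $C>0$ depending only on $\Omega,k,c_{\rm M},T,c_0$,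 such that the following holds whenever $\mu_a\ge\mu_0$. For every velocity field $\boldsymbol u$ with $\boldsymbol u(t)\in \boldsymbol H^1_0(\Omega)\cap \boldsymbol W^{k+1}_\infty(\Omega_h)$ for a.e. $t\in(0,T)$ (in particular for the velocity of a weak solution of the MHD system with loads $\boldsymbol f,\boldsymbol G$ and initial data $\boldsymbol u_0,\boldsymbol B_0$ that has this regularity), for a.e. $t\in(0,T)$, $$\|\boldsymbol u(t)-\mathcal I_V\boldsymbol u(t)\|_{\rm stab}^2(t)\le C\,\Lambda_{\rm stab}^2\,\|\boldsymbol u(t)\|_{\boldsymbol W^{k+1}_\infty(\Omega_h)}^2\,h^{2k}.$$ -/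

import Mathlib

open MeasureTheory Set Filter Topology
open scoped RealInnerProductSpace ContDiff Matrix ENNReal

namespace MHD

/-- Euclidean space `ℝ³`. -/
abbrev E3 := EuclideanSpace ℝ (Fin 3)

/-! ### Domain and mesh -/

/-- A (bounded, open, nonempty) convex polyhedron. -/
structure IsConvexPolyhedron (Ω : Set E3) : Prop where
  isOpen : IsOpen Ω
  nonempty : Ω.Nonempty
  convex : Convex ℝ Ω
  closure_eq : ∃ s : Finset E3, closure Ω = convexHull ℝ (s : Set E3)

/-- A conforming decomposition of `Ω` into finitely many closed tetrahedra. A tetrahedron is given by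
the set of its four (affinely independent) vertices; two tetrahedra meet exactly in the simplex
spanned by their common vertices. -/
structure TetMesh (Ω : Set E3) where
  elems : Finset (Finset E3)
  card_elem : ∀ K ∈ elems, K.card = 4
  indep : ∀ K ∈ elems, AffineIndependent ℝ ((↑) : K → E3)
  conforming : ∀ K ∈ elems, ∀ L ∈ elems,
    convexHull ℝ (K : Set E3) ∩ convexHull ℝ (L : Set E3)
      = convexHull ℝ ((K : Set E3) ∩ (L : Set E3))
  cover : (⋃ K ∈ elems, convexHull ℝ (K : Set E3)) = closure Ω

/-- The closed simplex with a given set of vertices. -/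
def cell (K : Finset E3) : Set E3 := convexHull ℝ (K : Set E3)

/-- The open simplex: interior of a tetrahedron. -/
def openCell (K : Finset E3) : Set E3 := interior (cell K)

namespace TetMesh

variable {Ω : Set E3} (M : TetMesh Ω)

open scoped Classical in
/-- The faces of the mesh, each given by its three vertices. -/
noncomputable def faces : Finset (Finset E3) :=
  M.elems.biUnion fun K => K.powersetCard 3

open scoped Classical in
/-- The elements that have `f` as a face. -/
noncomputable def elemsOf (f : Finset E3) : Finset (Finset E3) :=
  M.elems.filter fun K => f ⊆ K

open scoped Classical in
/-- The internal faces: those shared by two elements. -/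
noncomputable def intFaces : Finset (Finset E3) :=
  M.faces.filter fun f => ∃ K ∈ M.elemsOf f, ∃ L ∈ M.elemsOf f, K ≠ L

/-- The patch `ω_f`: union of the elements that have `f` as a face. -/
def patch (f : Finset E3) : Set E3 := ⋃ K ∈ M.elemsOf f, cell K

/-- The mesh size `h`, the largest diameter of an element. -/
noncomputable def meshSize : ℝ := sSup ((fun K => Metric.diam (cell K)) '' (M.elems : Set (Finset E3)))

/-- Shape regularity: each element is star shaped with respect to a ball whose radius `ρ` satisfies
`h_E ≤ c_M ρ`. -/
def ShapeRegular (cM : ℝ) : Prop :=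
  ∀ K ∈ M.elems, ∃ (x : E3) (ρ : ℝ), 0 < ρ ∧ Metric.ball x ρ ⊆ cell K ∧
    (∀ y ∈ Metric.ball x ρ, StarConvex ℝ y (cell K)) ∧ Metric.diam (cell K) ≤ cM * ρ

/-- A choice of a unit normal on each face, outward to the domain on boundary faces. -/
structure Normals where
  n : Finset E3 → E3
  unit : ∀ f ∈ M.faces, ‖n f‖ = 1
  orth : ∀ f ∈ M.faces, ∀ x ∈ f, ∀ y ∈ f, ⟪n f, y - x⟫ = 0
  outward : ∀ f ∈ M.faces, f ∉ M.intFaces → ∀ K ∈ M.elemsOf f, ∀ x ∈ f, ∀ a ∈ K, a ∉ f →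
    ⟪n f, a - x⟫ < 0

end TetMesh

/-! ### Pointwise differential operators -/

/-- The gradient matrix `(∇v)ᵢⱼ = ∂ⱼ vᵢ`. -/
noncomputable def gradM (v : E3 → E3) (x : E3) : Matrix (Fin 3) (Fin 3) ℝ :=
  Matrix.of fun i j => fderiv ℝ v x (EuclideanSpace.single j 1) i

/-- The symmetric gradient. -/
noncomputable def symGrad (v : E3 → E3) (x : E3) : Matrix (Fin 3) (Fin 3) ℝ :=
  (2⁻¹ : ℝ) • (gradM v x + (gradM v x)ᵀ)

/-- The divergence. -/
noncomputable def divg (v : E3 → E3) (x : E3) : ℝ := (gradM v x).trace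

/-- The curl. -/
noncomputable def curl (v : E3 → E3) (x : E3) : E3 :=
  !₂[gradM v x 2 1 - gradM v x 1 2, gradM v x 0 2 - gradM v x 2 0, gradM v x 1 0 - gradM v x 0 1]

/-- The vector product on `E3`. -/
noncomputable def cross (a b : E3) : E3 := WithLp.toLp 2 (a.ofLp ⨯₃ b.ofLp)

/-- The Frobenius inner product of matrices. -/
def frob (A B : Matrix (Fin 3) (Fin 3) ℝ) : ℝ := ∑ i, ∑ j, A i j * B i j

/-- Matrix times vector, on `E3`. -/
noncomputable def mulV (A : Matrix (Fin 3) (Fin 3) ℝ) (a : E3) : E3 := WithLp.toLp 2 (A *ᵥ a.ofLp)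

/-! ### Integrals, jumps and averages -/

/-- The `L²(Ω)` inner product. -/
noncomputable def ip (Ω : Set E3) (v w : E3 → E3) : ℝ := ∫ x in Ω, ⟪v x, w x⟫

/-- The `L²(Ω)` norm. -/
noncomputable def l2Norm (Ω : Set E3) (v : E3 → E3) : ℝ := √(∫ x in Ω, ‖v x‖ ^ 2)

/-- Integral over a face with respect to surface area. -/
noncomputable def faceInt (f : Finset E3) (g : E3 → ℝ) : ℝ :=
  ∫ x in cell f, g x ∂(Measure.euclideanHausdorffMeasure 2 : Measure E3)

namespace TetMesh

variable {Ω : Set E3} (M : TetMesh Ω)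

/-- Elementwise integral `∑_E ∫_E g`. -/
noncomputable def brokenInt (g : E3 → ℝ) : ℝ := ∑ K ∈ M.elems, ∫ x in openCell K, g x

open scoped Classical in
/-- The jump on a face: limit of `φ (x - s n_f) - φ (x + s n_f)` as `s → 0⁺` on internal faces, and
the trace from inside the domain on boundary faces. -/
noncomputable def jump {F : Type*} [AddCommGroup F] [TopologicalSpace F] (N : M.Normals)
    (f : Finset E3) (φ : E3 → F) (x : E3) : F :=
  if f ∈ M.intFaces then limUnder (𝓝[>] (0 : ℝ)) fun s => φ (x - s • N.n f) - φ (x + s • N.n f)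
  else limUnder (𝓝[>] (0 : ℝ)) fun s => φ (x - s • N.n f)

open scoped Classical in
/-- The average on a face. -/
noncomputable def avg {F : Type*} [AddCommGroup F] [Module ℝ F] [TopologicalSpace F] (N : M.Normals)
    (f : Finset E3) (φ : E3 → F) (x : E3) : F :=
  if f ∈ M.intFaces then
    limUnder (𝓝[>] (0 : ℝ)) fun s => (2⁻¹ : ℝ) • (φ (x - s • N.n f) + φ (x + s • N.n f))
  else limUnder (𝓝[>] (0 : ℝ)) fun s => φ (x - s • N.n f)

end TetMesh

/-- The `L^∞` norm over a set. -/
noncomputable def supNorm (S : Set E3) (v : E3 → E3) : ℝ :=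
  (eLpNorm v ∞ (volume.restrict S)).toReal

/-! ### Polynomials -/

/-- The vector field with given polynomial components. -/
noncomputable def polyField (P : Fin 3 → MvPolynomial (Fin 3) ℝ) (x : E3) : E3 :=
  WithLp.toLp 2 fun i => MvPolynomial.eval x.ofLp (P i)

/-- `v` coincides on `S` with a vector polynomial of degree at most `k`. -/
def IsPolyOn (k : ℕ) (S : Set E3) (v : E3 → E3) : Prop :=
  ∃ P : Fin 3 → MvPolynomial (Fin 3) ℝ,
    (∀ i, (P i).totalDegree ≤ k) ∧ ∀ x ∈ S, v x = polyField P x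

/-! ### Function spaces on the domain -/

/-- `v ∈ L²(Ω)³` has distributional divergence `g` in `Ω` and vanishing normal trace on the boundary
(through Green's formula against smooth functions on the closure). -/
def HasDivZeroNormal (Ω : Set E3) (v : E3 → E3) (g : E3 → ℝ) : Prop :=
  ∀ q : E3 → ℝ, ContDiff ℝ ∞ q → HasCompactSupport q →
    ∫ x in Ω, ⟪v x, gradient q x⟫ = - ∫ x in Ω, g x * q x

/-- `H₀(div, Ω)`. -/
def MemH0Div (Ω : Set E3) (v : E3 → E3) : Prop :=
  MemLp v 2 (volume.restrict Ω) ∧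
    ∃ g : E3 → ℝ, MemLp g 2 (volume.restrict Ω) ∧ HasDivZeroNormal Ω v g

/-- `H₀(div⁰, Ω)`. -/
def MemH0DivFree (Ω : Set E3) (v : E3 → E3) : Prop :=
  MemLp v 2 (volume.restrict Ω) ∧ HasDivZeroNormal Ω v 0

/-- `H¹₀(Ω)³`: the closure of the test fields in `H¹`. -/
def MemH10 (Ω : Set E3) (v : E3 → E3) : Prop :=
  MemLp v 2 (volume.restrict Ω) ∧
    ∃ G : E3 → E3 →L[ℝ] E3, MemLp G 2 (volume.restrict Ω) ∧
      ∃ φ : ℕ → E3 → E3,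
        (∀ m, ContDiff ℝ ∞ (φ m) ∧ HasCompactSupport (φ m) ∧ tsupport (φ m) ⊆ Ω) ∧
        Tendsto (fun m => eLpNorm (φ m - v) 2 (volume.restrict Ω)) atTop (𝓝 0) ∧
        Tendsto (fun m => eLpNorm (fderiv ℝ (φ m) - G) 2 (volume.restrict Ω)) atTop (𝓝 0)

/-- `g` is the weak derivative of order `j` of `v` in the open set `U`, and it is in `L^∞(U)`. -/
def IsWeakDeriv (U : Set E3) (j : ℕ) (v : E3 → E3) (g : E3 → E3 [×j]→L[ℝ] E3) : Prop :=
  MemLp g ∞ (volume.restrict U) ∧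
    ∀ φ : E3 → ℝ, ContDiff ℝ ∞ φ → HasCompactSupport φ → tsupport φ ⊆ U → ∀ y : Fin j → E3,
      ∫ x in U, iteratedFDeriv ℝ j φ x y • v x = (-1 : ℝ) ^ j • ∫ x in U, φ x • g x y

/-- The Sobolev space `W^{m,∞}(U)³`. -/
def MemWInf (U : Set E3) (m : ℕ) (v : E3 → E3) : Prop :=
  MemLp v ∞ (volume.restrict U) ∧ ∀ j ≤ m, ∃ g, IsWeakDeriv U j v g

open scoped Classical in
/-- The weak derivative of order `j` (unique almost everywhere), or `0` if there is none. -/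
noncomputable def weakDeriv (U : Set E3) (j : ℕ) (v : E3 → E3) : E3 → E3 [×j]→L[ℝ] E3 :=
  if h : ∃ g, IsWeakDeriv U j v g then h.choose else 0

namespace TetMesh

variable {Ω : Set E3} (M : TetMesh Ω)

/-- The broken Sobolev norm of `W^{m,∞}(Ω_h)³`: the largest of the `L^∞` norms of the weak
derivatives up to order `m` on the elements. -/
noncomputable def brokenWInfNorm (m : ℕ) (v : E3 → E3) : ℝ :=
  (⨆ K ∈ M.elems, ⨆ j ∈ Finset.range (m + 1),
    eLpNorm (weakDeriv (openCell K) j v) ∞ (volume.restrict (openCell K))).toReal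

/-- `v ∈ H¹₀(Ω)³ ∩ W^{m+1,∞}(Ω_h)³`. A function of `W^{m+1,∞}` on an open tetrahedron has a
representative of class `C^m`; as usual `v` denotes that representative in each element, so that
traces on faces, and for `m ≥ 1` elementwise gradients, can be taken pointwise. -/
def MemVW (m : ℕ) (v : E3 → E3) : Prop :=
  MemH10 Ω v ∧ ∀ K ∈ M.elems, MemWInf (openCell K) (m + 1) v ∧ ContDiffOn ℝ m v (openCell K)

/-! ### Discrete spaces and the interpolation operator -/

/-- The BDM space `V_h = [P_k(Ω_h)]³ ∩ H₀(div, Ω)`. -/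
def MemVh (k : ℕ) (v : E3 → E3) : Prop :=
  (∀ K ∈ M.elems, IsPolyOn k (openCell K) v) ∧ MemH0Div Ω v

/-- The discrete kernel `Z_h`: the divergence-free fields of `V_h`. -/
def MemZh (k : ℕ) (v : E3 → E3) : Prop :=
  M.MemVh k v ∧ MemH0DivFree Ω v

/-- The magnetic space `W_h = [P_k^cont(Ω_h)]³ ∩ H¹ₙ(Ω)`: continuous piecewise polynomials with
vanishing normal component on the boundary faces. -/
def MemWh (N : M.Normals) (k : ℕ) (H : E3 → E3) : Prop :=
  (∀ K ∈ M.elems, IsPolyOn k (cell K) H) ∧ ContinuousOn H (closure Ω) ∧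
    ∀ f ∈ M.faces, f ∉ M.intFaces → ∀ x ∈ cell f, ⟪H x, N.n f⟫ = 0

/-- `w` is the BDM interpolant of order `k` of `v`: on each element, `w` is a vector polynomial `P` of
degree at most `k` with the same degrees of freedom as `v`, namely
* the moments of the normal component on each face against the polynomials of degree `≤ k`;
* for `k ≥ 2`, the moments on the element against the fields `p + x × q` with vector polynomials `p`,
  `q` of degree `≤ k - 2` (the first-kind Nédélec space of degree `k - 1`).
The trace of `v` on a face of `E` is taken from inside `E`. -/
def IsBDMInterpolant (N : M.Normals) (k : ℕ) (v w : E3 → E3) : Prop :=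
  ∀ K ∈ M.elems, ∃ P : Fin 3 → MvPolynomial (Fin 3) ℝ,
    (∀ i, (P i).totalDegree ≤ k) ∧ (∀ x ∈ openCell K, w x = polyField P x) ∧
    (∀ f ∈ M.faces, f ⊆ K → ∀ q : MvPolynomial (Fin 3) ℝ, q.totalDegree ≤ k →
      faceInt f (fun x => ⟪extendFrom (openCell K) v x - polyField P x, N.n f⟫
        * MvPolynomial.eval x.ofLp q) = 0) ∧
    (∀ p q : Fin 3 → MvPolynomial (Fin 3) ℝ,
      (∀ i, (p i).totalDegree + 2 ≤ k) → (∀ i, (q i).totalDegree + 2 ≤ k) →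
      ∫ x in openCell K, ⟪v x - polyField P x, polyField p x + cross x (polyField q x)⟫ = 0)

/-! ### Discrete forms (the tuning parameters `μ_c`, `μ_{J₁}`, `μ_{J₂}` being one) -/

/-- `max {‖Θ‖²_{L^∞(ω_f)}, 1}`. -/
noncomputable def cipWeight (f : Finset E3) (Θ : E3 → E3) : ℝ := max (supNorm (M.patch f) Θ ^ 2) 1

/-- The interior penalty form `a^S_h`. -/
noncomputable def aSh (N : M.Normals) (μa : ℝ) (u v : E3 → E3) : ℝ :=
  M.brokenInt (fun x => frob (symGrad u x) (symGrad v x))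
  - ∑ f ∈ M.faces, faceInt f (fun x =>
      ⟪M.avg N f (fun y => mulV (symGrad u y) (N.n f)) x, M.jump N f v x⟫)
  - ∑ f ∈ M.faces, faceInt f (fun x =>
      ⟪M.jump N f u x, M.avg N f (fun y => mulV (symGrad v y) (N.n f)) x⟫)
  + μa * ∑ f ∈ M.faces, (Metric.diam (cell f))⁻¹ *
      faceInt f (fun x => ⟪M.jump N f u x, M.jump N f v x⟫)

/-- The normal component `χ · n_f` on a face (both traces agree for `χ` in `H(div)`). -/
noncomputable def normalComp (N : M.Normals) (f : Finset E3) (χ : E3 → E3) (x : E3) : ℝ :=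
  ⟪M.avg N f χ x, N.n f⟫

/-- The upwinded convective form `c_h(χ; u, v)`. -/
noncomputable def ch (N : M.Normals) (χ u v : E3 → E3) : ℝ :=
  M.brokenInt (fun x => ⟪mulV (gradM u x) (χ x), v x⟫)
  - ∑ f ∈ M.intFaces, faceInt f (fun x =>
      M.normalComp N f χ x * ⟪M.jump N f u x, M.avg N f v x⟫)
  + ∑ f ∈ M.intFaces, faceInt f (fun x =>
      |M.normalComp N f χ x| * ⟪M.jump N f u x, M.jump N f v x⟫)

/-- The continuous interior penalty form `J_h(Θ; u, v)`. -/
noncomputable def Jh (N : M.Normals) (Θ u v : E3 → E3) : ℝ :=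
  ∑ f ∈ M.intFaces, M.cipWeight f Θ *
    (faceInt f (fun x => ⟪M.jump N f u x, M.jump N f v x⟫)
      + Metric.diam (cell f) ^ 2 *
        faceInt f (fun x => frob (M.jump N f (gradM u) x) (M.jump N f (gradM v) x)))

/-- The form `(div B, div H)`. -/
noncomputable def divDiv (B H : E3 → E3) : ℝ := M.brokenInt (fun x => divg B x * divg H x)

/-- The form `a^M(B, H) = (curl B, curl H) + (div B, div H)`. -/
noncomputable def aM (B H : E3 → E3) : ℝ :=
  M.brokenInt (fun x => ⟪curl B x, curl H x⟫) + M.divDiv B H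

/-- The coupling form `d(Θ; H, v) = (curl H × Θ, v)`. -/
noncomputable def dForm (Θ H v : E3 → E3) : ℝ :=
  M.brokenInt (fun x => ⟪cross (curl H x) (Θ x), v x⟫)

/-- The form `A_{3f}((χ, Θ); (u, B), (v, H))` of the three-field method. -/
noncomputable def A3f (N : M.Normals) (νS νM μa : ℝ) (χ Θ u B v H : E3 → E3) : ℝ :=
  νS * M.aSh N μa u v + νM * M.aM B H + M.Jh N Θ u v + M.ch N χ u v
    - M.dForm Θ B v + M.dForm Θ H u + M.divDiv B H

/-! ### The stabilized norm -/

/-- `‖u‖²_{1,h}`. -/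
noncomputable def norm1hSq (N : M.Normals) (μa : ℝ) (u : E3 → E3) : ℝ :=
  M.brokenInt (fun x => frob (symGrad u x) (symGrad u x))
  + μa * ∑ f ∈ M.faces, (Metric.diam (cell f))⁻¹ * faceInt f (fun x => ‖M.jump N f u x‖ ^ 2)

/-- The squared upwind seminorm `|u|²_{upw,χ}`. -/
noncomputable def upwSq (N : M.Normals) (χ u : E3 → E3) : ℝ :=
  ∑ f ∈ M.intFaces, faceInt f (fun x => |M.normalComp N f χ x| * ‖M.jump N f u x‖ ^ 2)

/-- The squared CIP seminorm `|u|²_{cip,Θ}`. -/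
noncomputable def cipSq (N : M.Normals) (Θ u : E3 → E3) : ℝ :=
  ∑ f ∈ M.intFaces, M.cipWeight f Θ *
    (faceInt f (fun x => ‖M.jump N f u x‖ ^ 2)
      + Metric.diam (cell f) ^ 2 *
        faceInt f (fun x => frob (M.jump N f (gradM u) x) (M.jump N f (gradM u) x)))

/-- The squared stabilized velocity norm `‖u‖²_{(χ,Θ)}`. -/
noncomputable def stabSq (N : M.Normals) (νS μa : ℝ) (χ Θ u : E3 → E3) : ℝ :=
  νS * M.norm1hSq N μa u + M.upwSq N χ u + M.cipSq N Θ u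

/-! ### The semidiscrete problem -/

/-- `(u_h, B_h)` satisfies the three-field semidiscrete equations with loads `F`, `G` on `(0, T)`: it
takes values in `Z_h × W_h`, is absolutely continuous in time, and for a.e. `t`
`(∂ₜu_h, v) + (∂ₜB_h, H) + A_{3f}((u_h, B_h); (u_h, B_h), (v, H)) = (F, v) + (G, H)`
for all `(v, H) ∈ Z_h × W_h`. -/
structure IsThreeFieldSolution (N : M.Normals) (k : ℕ) (νS νM μa T : ℝ)
    (F G : ℝ → Lp E3 2 (volume.restrict Ω)) (uh Bh : ℝ → E3 → E3) : Prop where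
  mem_Zh : ∀ t ∈ Icc 0 T, M.MemZh k (uh t)
  mem_Wh : ∀ t ∈ Icc 0 T, M.MemWh N k (Bh t)
  ac_u : ∀ v, M.MemZh k v → AbsolutelyContinuousOnInterval (fun t => ip Ω (uh t) v) 0 T
  ac_B : ∀ H, M.MemWh N k H → AbsolutelyContinuousOnInterval (fun t => ip Ω (Bh t) H) 0 T
  equation : ∀ᵐ t ∂(volume.restrict (Ioo 0 T)), ∀ v H, M.MemZh k v → M.MemWh N k H →
    HasDerivAt (fun s => ip Ω (uh s) v + ip Ω (Bh s) H)
      (ip Ω (F t) v + ip Ω (G t) H - M.A3f N νS νM μa (uh t) (Bh t) (uh t) (Bh t) v H) t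

end TetMesh

/-! ### Data -/

/-- `γ²_data`: squared `L¹(0,T;L²)` norms of the loads plus squared `L²` norms of the initial data. -/
noncomputable def gammaDataSq {Ω : Set E3} (T : ℝ) (F G : ℝ → Lp E3 2 (volume.restrict Ω))
    (u₀ B₀ : Lp E3 2 (volume.restrict Ω)) : ℝ :=
  (∫ t in Ioo 0 T, ‖F t‖) ^ 2 + (∫ t in Ioo 0 T, ‖G t‖) ^ 2 + ‖u₀‖ ^ 2 + ‖B₀‖ ^ 2

/-- `Λ²_stab = max {ν_S (1 + μ_a + μ_a⁻¹), h (γ²_data + 1)}`. -/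
noncomputable def lambdaStabSq (νS μa h γsq : ℝ) : ℝ :=
  max (νS * (1 + μa + μa⁻¹)) (h * (γsq + 1))

end MHD

open MHD

/-! The weights in the stabilized norm contain `|u_h · n_f|` and the squared maximum norm of `B_h`
on a patch, and neither is bounded uniformly in `h`. The remedy is to measure the interpolation
error in the maximum norm, so that each face term is at most (squared jump) · (weight) · (area),
with squared jump of order `h_f ^ (2k + 2)` and area of order `h_f ^ 2`. An inverse inequality
bounds the weight by `1` plus a multiple of the squared `L²` norm of the discrete field on the patch
divided by `|K|`. Since `h_f ^ 3` is controlled by `|K|`, summation over faces leaves `h ^ (2k + 1)`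
times `|Ω|` plus the squared global `L²` norms of `u_h` and `B_h` (`sum_patchSq_le`, `stabSq_le`).
These norms are bounded by the data through the energy estimate `energy_le`. This produces the term
`h (γ² + 1)` of `Λ²`, while the viscous and penalty terms produce `ν_S (1 + μ_a)`.

Local error (`exists_interp_error`): on an element let `Q` be a Taylor polynomial of `v` and `P` the
interpolant. Then `P - Q` is the interpolant of `v - Q`, which is small by `exists_approx`. So only
maximum-norm stability of the interpolation is needed, together with an inverse inequality for the
gradient. Stability holds on the reference tetrahedron because the degrees of freedom are unisolvent
and the space is finite-dimensional; it is carried to `K` by the Piola transform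
(`BDMOrth.pullback`), with the condition number of the affine map as the only loss.

Unisolvence: if all moments of `p` vanish, the normal component vanishes on the faces, then `div p =
0`, and `p` is orthogonal to all gradients. The Koszul identity upgrades the interior moments to
orthogonality against all polynomial fields of degree `k - 1`. On the reference tetrahedron `pᵢ = xᵢ
S` with `deg S ≤ k - 1`, so `∫ xᵢ S² = 0` and `p = 0`.

Energy: on the diagonal the two coupling terms cancel, the penalty form is nonnegative once `μ_a ≥
μ₀`, and the convective form reduces to its upwind part, because a solenoidal piecewise polynomial
field has zero elementwise divergence and continuous normal components. Hence `A3f` is nonnegative,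
and the squared norm `φ` of the discrete solution satisfies `φ' ≤ 2 (‖F‖ + ‖G‖) √φ`. -/

namespace MHD

/-! ### Polynomial functions -/

/-- The polynomial function on `E3` defined by a polynomial. -/
noncomputable def evalFun : MvPolynomial (Fin 3) ℝ →ₗ[ℝ] (E3 → ℝ) where
  toFun P x := MvPolynomial.eval x.ofLp P
  map_add' P Q := by ext x; simp
  map_smul' c P := by ext x; simp

lemma evalFun_apply (P : MvPolynomial (Fin 3) ℝ) (x : E3) :
    evalFun P x = MvPolynomial.eval x.ofLp P := rfl

/-- Polynomial functions of degree at most `k`. -/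
noncomputable def polyFun (k : ℕ) : Submodule ℝ (E3 → ℝ) :=
  (MvPolynomial.restrictTotalDegree (Fin 3) ℝ k).map evalFun

lemma mem_polyFun {k : ℕ} {g : E3 → ℝ} :
    g ∈ polyFun k ↔ ∃ P : MvPolynomial (Fin 3) ℝ, P.totalDegree ≤ k ∧ evalFun P = g := by
  simp [polyFun, Submodule.mem_map, MvPolynomial.mem_restrictTotalDegree]

lemma evalFun_mem {k : ℕ} {P : MvPolynomial (Fin 3) ℝ} (h : P.totalDegree ≤ k) :
    evalFun P ∈ polyFun k := mem_polyFun.2 ⟨P, h, rfl⟩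

instance (k : ℕ) : FiniteDimensional ℝ (polyFun k) := by
  unfold polyFun; infer_instance

lemma polyFun_mono {k l : ℕ} (h : k ≤ l) : polyFun k ≤ polyFun l := by
  intro g hg
  obtain ⟨P, hP, rfl⟩ := mem_polyFun.1 hg
  exact evalFun_mem (hP.trans h)

lemma const_mem_polyFun (k : ℕ) (c : ℝ) : (fun _ => c) ∈ polyFun k :=
  mem_polyFun.2 ⟨MvPolynomial.C c, by simp, by ext x; simp [evalFun_apply]⟩

lemma coord_mem_polyFun (i : Fin 3) : (fun x : E3 => x i) ∈ polyFun 1 :=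
  mem_polyFun.2 ⟨MvPolynomial.X i, by simp, by ext x; simp [evalFun_apply]⟩

lemma mul_mem_polyFun {k l : ℕ} {f g : E3 → ℝ} (hf : f ∈ polyFun k) (hg : g ∈ polyFun l) :
    (fun x => f x * g x) ∈ polyFun (k + l) := by
  obtain ⟨P, hP, rfl⟩ := mem_polyFun.1 hf
  obtain ⟨Q, hQ, rfl⟩ := mem_polyFun.1 hg
  exact mem_polyFun.2 ⟨P * Q, (MvPolynomial.totalDegree_mul _ _).trans (add_le_add hP hQ),
    by ext x; simp [evalFun_apply]⟩

lemma add_mem_polyFun {k : ℕ} {f g : E3 → ℝ} (hf : f ∈ polyFun k) (hg : g ∈ polyFun k) :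
    (fun x => f x + g x) ∈ polyFun k := (polyFun k).add_mem hf hg

lemma sub_mem_polyFun {k : ℕ} {f g : E3 → ℝ} (hf : f ∈ polyFun k) (hg : g ∈ polyFun k) :
    (fun x => f x - g x) ∈ polyFun k := (polyFun k).sub_mem hf hg

lemma const_mul_mem_polyFun {k : ℕ} (c : ℝ) {f : E3 → ℝ} (hf : f ∈ polyFun k) :
    (fun x => c * f x) ∈ polyFun k := (polyFun k).smul_mem c hf

lemma sum_mem_polyFun {ι : Type*} {k : ℕ} (s : Finset ι) {f : ι → E3 → ℝ}
    (hf : ∀ i ∈ s, f i ∈ polyFun k) : (fun x => ∑ i ∈ s, f i x) ∈ polyFun k := by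
  have := (polyFun k).sum_mem hf
  convert this using 1
  ext x; simp

lemma prod_mem_polyFun {ι : Type*} (s : Finset ι) {d : ι → ℕ} {f : ι → E3 → ℝ}
    (hf : ∀ i ∈ s, f i ∈ polyFun (d i)) :
    (fun x => ∏ i ∈ s, f i x) ∈ polyFun (∑ i ∈ s, d i) := by
  classical
  induction s using Finset.induction_on with
  | empty => simpa using const_mem_polyFun 0 1
  | insert a s ha ih =>
    simp only [Finset.prod_insert ha, Finset.sum_insert ha]
    exact mul_mem_polyFun (hf a (by simp)) (ih fun i hi => hf i (by simp [hi]))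

lemma pow_mem_polyFun {k : ℕ} {f : E3 → ℝ} (hf : f ∈ polyFun k) (n : ℕ) :
    (fun x => f x ^ n) ∈ polyFun (n * k) := by
  simpa using prod_mem_polyFun (Finset.range n) (d := fun _ => k) (f := fun _ => f)
    (fun _ _ => hf)

/-- Polynomials composed with affine maps. -/
lemma comp_mem_polyFun {k : ℕ} {f : E3 → ℝ} (hf : f ∈ polyFun k) {Φ : E3 → E3}
    (hΦ : ∀ i, (fun x => Φ x i) ∈ polyFun 1) : (fun x => f (Φ x)) ∈ polyFun k := by
  obtain ⟨P, hP, rfl⟩ := mem_polyFun.1 hf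
  have : (fun x => evalFun P (Φ x))
      = fun x => ∑ d ∈ P.support, P.coeff d * ∏ i, Φ x i ^ d i := by
    ext x; rw [evalFun_apply, MvPolynomial.eval_eq']
  rw [this]
  refine sum_mem_polyFun _ fun d hd => const_mul_mem_polyFun _ ?_
  have h1 : ∑ i, d i * 1 ≤ k := by
    have := MvPolynomial.le_totalDegree hd
    rw [Finsupp.sum_fintype _ _ (by simp)] at this
    simpa using this.trans hP
  exact polyFun_mono h1 (prod_mem_polyFun _ fun i _ => pow_mem_polyFun (hΦ i) (d i))

/-- Links formal and Fréchet derivatives, so that degrees of derivatives can be read off from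
monomials. -/
lemma hasFDerivAt_evalFun (P : MvPolynomial (Fin 3) ℝ) (x : E3) :
    HasFDerivAt (evalFun P) (∑ i, evalFun (MvPolynomial.pderiv i P) x •
      (EuclideanSpace.proj i : E3 →L[ℝ] ℝ)) x := by
  induction P using MvPolynomial.induction_on with
  | C a =>
    have : evalFun (MvPolynomial.C a) = fun _ => a := by ext; simp [evalFun_apply]
    rw [this]
    simpa using hasFDerivAt_const a x
  | add p q hp hq =>
    rw [map_add]
    refine (hp.add hq).congr_fderiv ?_
    ext w; simp [add_mul, Finset.sum_add_distrib]
  | mul_X p n hp =>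
    have : evalFun (p * MvPolynomial.X n) = fun x => evalFun p x * x n := by
      ext; simp [evalFun_apply]
    rw [this]
    have h2 : HasFDerivAt (fun x : E3 => x n) (EuclideanSpace.proj n : E3 →L[ℝ] ℝ) x :=
      (EuclideanSpace.proj n : E3 →L[ℝ] ℝ).hasFDerivAt
    refine (hp.mul h2).congr_fderiv ?_
    ext w
    fin_cases n <;>
      simp [evalFun_apply, Fin.sum_univ_three, MvPolynomial.pderiv_X] <;>
      ring

/-- Truncated subtraction is harmless: a monomial with `d i = 0` is killed, and any other has degree
at least one. -/
lemma totalDegree_pderiv_le {k : ℕ} {P : MvPolynomial (Fin 3) ℝ} (hP : P.totalDegree ≤ k)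
    (i : Fin 3) : (MvPolynomial.pderiv i P).totalDegree ≤ k - 1 := by
  conv_lhs => rw [P.as_sum, map_sum]
  refine MvPolynomial.totalDegree_finsetSum_le fun d hd => ?_
  rw [MvPolynomial.pderiv_monomial]
  by_cases h0 : d i = 0
  · simp [h0]
  refine (MvPolynomial.totalDegree_monomial_le _ _).trans ?_
  have h1 := (MvPolynomial.le_totalDegree hd).trans hP
  rw [Finsupp.sum_fintype _ _ (by simp)] at h1 ⊢
  fin_cases i <;> simp [Fin.sum_univ_three] at h0 h1 ⊢ <;> omega

lemma contDiff_of_mem_polyFun {k : ℕ} {f : E3 → ℝ} (hf : f ∈ polyFun k) {n : WithTop ℕ∞} :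
    ContDiff ℝ n f := by
  obtain ⟨P, hP, rfl⟩ := mem_polyFun.1 hf
  have : evalFun P = fun x => ∑ d ∈ P.support, P.coeff d * ∏ i, x i ^ d i := by
    ext x; rw [evalFun_apply, MvPolynomial.eval_eq']
  rw [this]
  fun_prop

lemma fderiv_mem_polyFun {k : ℕ} {f : E3 → ℝ} (hf : f ∈ polyFun k) (w : E3) :
    (fun x => fderiv ℝ f x w) ∈ polyFun (k - 1) := by
  obtain ⟨P, hP, rfl⟩ := mem_polyFun.1 hf
  have : (fun x => fderiv ℝ (evalFun P) x w)
      = fun x => ∑ i, w i * evalFun (MvPolynomial.pderiv i P) x := by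
    ext x
    rw [(hasFDerivAt_evalFun P x).fderiv]
    simp [mul_comm]
  rw [this]
  exact sum_mem_polyFun _ fun i _ =>
    const_mul_mem_polyFun _ (evalFun_mem (totalDegree_pderiv_le hP i))

lemma analyticOnNhd_of_mem_polyFun {k : ℕ} {f : E3 → ℝ} (hf : f ∈ polyFun k) :
    AnalyticOnNhd ℝ f univ :=
  contDiff_omega_iff_analyticOnNhd.1 (contDiff_of_mem_polyFun hf)

/-- Identity theorem for analytic functions. It turns norms over an open set into genuine norms on
polynomial spaces. -/
lemma polyFun_eq_zero_of_isOpen {k : ℕ} {f : E3 → ℝ} (hf : f ∈ polyFun k) {U : Set E3}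
    (hU : IsOpen U) (hne : U.Nonempty) (h : ∀ x ∈ U, f x = 0) : f = 0 := by
  obtain ⟨x, hx⟩ := hne
  refine (analyticOnNhd_of_mem_polyFun hf).eq_of_eventuallyEq (z₀ := x)
    (fun y _ => analyticAt_const) ?_
  filter_upwards [hU.mem_nhds hx] with y hy
  simp [h y hy]

lemma evalFun_injective {P : MvPolynomial (Fin 3) ℝ} (h : evalFun P = 0) : P = 0 := by
  refine MvPolynomial.funext fun x => ?_
  simpa [evalFun_apply] using congrFun h (WithLp.toLp 2 x)

/-! ### Polynomial vector fields -/

/-- Vector fields with polynomial components of degree at most `k`. -/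
noncomputable def polyVec (k : ℕ) : Submodule ℝ (E3 → E3) where
  carrier := {w | ∀ i, (fun x => w x i) ∈ polyFun k}
  add_mem' ha hb i := (polyFun k).add_mem (ha i) (hb i)
  zero_mem' _ := (polyFun k).zero_mem
  smul_mem' c _ hw i := (polyFun k).smul_mem c (hw i)

instance (k : ℕ) : FiniteDimensional ℝ (polyVec k) := by
  let T : polyVec k →ₗ[ℝ] (Fin 3 → polyFun k) :=
    { toFun := fun w i => ⟨fun x => w.1 x i, w.2 i⟩
      map_add' := fun a b => by ext i x; rfl
      map_smul' := fun c a => by ext i x; rfl }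
  refine FiniteDimensional.of_injective T fun a b h => ?_
  ext x i
  exact congrFun (congrArg Subtype.val (congrFun h i)) x

lemma polyVec_mono {k l : ℕ} (h : k ≤ l) : polyVec k ≤ polyVec l :=
  fun _ hw i => polyFun_mono h (hw i)

lemma polyField_mem {k : ℕ} {P : Fin 3 → MvPolynomial (Fin 3) ℝ} (h : ∀ i, (P i).totalDegree ≤ k) :
    polyField P ∈ polyVec k := fun i => evalFun_mem (h i)

lemma exists_polyField {k : ℕ} {w : E3 → E3} (hw : w ∈ polyVec k) :
    ∃ P : Fin 3 → MvPolynomial (Fin 3) ℝ, (∀ i, (P i).totalDegree ≤ k) ∧ w = polyField P := by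
  choose P hP h using fun i => mem_polyFun.1 (hw i)
  refine ⟨P, hP, ?_⟩
  ext x i
  exact (congrFun (h i) x).symm

lemma isPolyOn_iff {k : ℕ} {S : Set E3} {v : E3 → E3} :
    IsPolyOn k S v ↔ ∃ w ∈ polyVec k, EqOn v w S := by
  constructor
  · rintro ⟨P, hP, h⟩
    exact ⟨_, polyField_mem hP, h⟩
  · rintro ⟨w, hw, h⟩
    obtain ⟨P, hP, rfl⟩ := exists_polyField hw
    exact ⟨P, hP, h⟩

lemma contDiff_of_mem_polyVec {k : ℕ} {w : E3 → E3} (hw : w ∈ polyVec k) {n : WithTop ℕ∞} :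
    ContDiff ℝ n w :=
  (contDiff_piLp 2).2 fun i => contDiff_of_mem_polyFun (hw i)

lemma inner_mem_polyFun {k l : ℕ} {v w : E3 → E3} (hv : v ∈ polyVec k) (hw : w ∈ polyVec l) :
    (fun x => ⟪v x, w x⟫) ∈ polyFun (k + l) := by
  simp only [PiLp.inner_apply]
  refine sum_mem_polyFun _ fun i _ => ?_
  simpa [mul_comm] using mul_mem_polyFun (hv i) (hw i)

lemma const_mem_polyVec (k : ℕ) (c : E3) : (fun _ => c) ∈ polyVec k :=
  fun i => const_mem_polyFun k (c i)

lemma inner_const_mem_polyFun {k : ℕ} {v : E3 → E3} (hv : v ∈ polyVec k) (c : E3) :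
    (fun x => ⟪v x, c⟫) ∈ polyFun k := by
  simpa using inner_mem_polyFun hv (const_mem_polyVec 0 c)

lemma clm_comp_mem_polyVec {k : ℕ} {v : E3 → E3} (hv : v ∈ polyVec k) (A : E3 →L[ℝ] E3) :
    (fun x => A (v x)) ∈ polyVec k := by
  intro i
  have : (fun x => A (v x) i) = fun x => ∑ j, A (EuclideanSpace.single j 1) i * v x j := by
    ext x
    conv_lhs => rw [← (EuclideanSpace.basisFun (Fin 3) ℝ).sum_repr (v x)]
    simp [mul_comm]
  rw [this]
  exact sum_mem_polyFun _ fun j _ => const_mul_mem_polyFun _ (hv j)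

lemma affine_mem_polyVec (A : E3 →L[ℝ] E3) (b : E3) : (fun x => A x + b) ∈ polyVec 1 :=
  (polyVec 1).add_mem (clm_comp_mem_polyVec (v := fun x => x) (fun i => coord_mem_polyFun i) A)
    (const_mem_polyVec 1 b)

lemma comp_mem_polyVec {k : ℕ} {v Φ : E3 → E3} (hv : v ∈ polyVec k) (hΦ : Φ ∈ polyVec 1) :
    (fun x => v (Φ x)) ∈ polyVec k := fun i => comp_mem_polyFun (hv i) hΦ

lemma fderiv_apply_coord {w : E3 → E3} {x : E3} (hw : DifferentiableAt ℝ w x) (d : E3)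
    (i : Fin 3) : fderiv ℝ w x d i = fderiv ℝ (fun y => w y i) x d := by
  have : HasFDerivAt (fun y => w y i) ((EuclideanSpace.proj i : E3 →L[ℝ] ℝ).comp (fderiv ℝ w x)) x :=
    (EuclideanSpace.proj i : E3 →L[ℝ] ℝ).hasFDerivAt.comp x hw.hasFDerivAt
  rw [this.fderiv]; rfl

lemma gradM_mem_polyFun {k : ℕ} {w : E3 → E3} (hw : w ∈ polyVec k) (i j : Fin 3) :
    (fun x => gradM w x i j) ∈ polyFun (k - 1) := by
  have : (fun x => gradM w x i j)
      = fun x => fderiv ℝ (fun y => w y i) x (EuclideanSpace.single j 1) := by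
    ext x
    exact fderiv_apply_coord ((contDiff_of_mem_polyVec hw (n := 1)).differentiable
      (by norm_num) x) _ _
  rw [this]
  exact fderiv_mem_polyFun (hw i) _

lemma divg_mem_polyFun {k : ℕ} {w : E3 → E3} (hw : w ∈ polyVec k) : divg w ∈ polyFun (k - 1) := by
  have : divg w = fun x => ∑ i, gradM w x i i := rfl
  rw [this]
  exact sum_mem_polyFun _ fun i _ => gradM_mem_polyFun hw i i

lemma cross_mem_polyVec {k l : ℕ} {v w : E3 → E3} (hv : v ∈ polyVec k) (hw : w ∈ polyVec l) :
    (fun x => cross (v x) (w x)) ∈ polyVec (k + l) := by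
  intro i
  fin_cases i <;> simp [cross, cross_apply] <;>
  exact sub_mem_polyFun (mul_mem_polyFun (hv _) (hw _)) (mul_mem_polyFun (hv _) (hw _))

/-! ### Standard simplices -/

/-- The open standard simplex in `ℝⁿ`. -/
def openSimplex (n : ℕ) : Set (Fin n → ℝ) := {x | (∀ i, 0 < x i) ∧ ∑ i, x i < 1}

/-- The closed standard simplex in `ℝⁿ`. -/
def closedSimplex (n : ℕ) : Set (Fin n → ℝ) := {x | (∀ i, 0 ≤ x i) ∧ ∑ i, x i ≤ 1}

lemma isOpen_openSimplex (n : ℕ) : IsOpen (openSimplex n) := by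
  refine (isOpen_iff_mem_nhds.2 fun x hx => ?_)
  have h1 : ∀ᶠ y in 𝓝 x, ∀ i, 0 < y i := by
    rw [eventually_all]
    exact fun i => (continuous_apply i).continuousAt.eventually (lt_mem_nhds (hx.1 i))
  have h2 : ∀ᶠ y : Fin n → ℝ in 𝓝 x, ∑ i, y i < 1 := by
    have : Continuous fun y : Fin n → ℝ => ∑ i, y i := by fun_prop
    exact this.continuousAt.eventually (gt_mem_nhds hx.2)
  filter_upwards [h1, h2] with y a b using ⟨a, b⟩

lemma isClosed_closedSimplex (n : ℕ) : IsClosed (closedSimplex n) := by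
  have : closedSimplex n = (⋂ i, {x : Fin n → ℝ | 0 ≤ x i}) ∩ {x | ∑ i, x i ≤ 1} := by
    ext x; simp [closedSimplex]
  rw [this]
  exact (isClosed_iInter fun i => isClosed_le continuous_const (continuous_apply i)).inter
    (isClosed_le (by fun_prop) continuous_const)

lemma openSimplex_subset (n : ℕ) : openSimplex n ⊆ closedSimplex n :=
  fun _ hx => ⟨fun i => (hx.1 i).le, hx.2.le⟩

lemma closedSimplex_subset_Icc (n : ℕ) : closedSimplex n ⊆ Icc 0 1 := by
  intro x hx
  refine ⟨hx.1, fun i => ?_⟩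
  exact (Finset.single_le_sum (fun j _ => hx.1 j) (Finset.mem_univ i)).trans hx.2

lemma isCompact_closedSimplex (n : ℕ) : IsCompact (closedSimplex n) :=
  isCompact_Icc.of_isClosed_subset (isClosed_closedSimplex n) (closedSimplex_subset_Icc n)

lemma convex_closedSimplex (n : ℕ) : Convex ℝ (closedSimplex n) := by
  intro x hx y hy a b ha hb hab
  refine ⟨fun i => ?_, ?_⟩
  · have := hx.1 i; have := hy.1 i
    simp only [Pi.add_apply, Pi.smul_apply, smul_eq_mul]; positivity
  · simp only [Pi.add_apply, Pi.smul_apply, smul_eq_mul, Finset.sum_add_distrib, ← Finset.mul_sum]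
    nlinarith [hx.2, hy.2]

/-- Moving from `x` towards the barycentre `z` enters the open simplex at once. -/
lemma closedSimplex_subset_closure (n : ℕ) : closedSimplex n ⊆ closure (openSimplex n) := by
  intro x hx
  set z : Fin n → ℝ := fun _ => 1 / ((n : ℝ) + 1)
  have hz : 0 < 1 / ((n : ℝ) + 1) := by positivity
  have hzs : ∑ i, z i < 1 := by
    simp only [z, Finset.sum_const, Finset.card_univ, Fintype.card_fin, nsmul_eq_mul]
    rw [mul_one_div, div_lt_one (by positivity)]; linarith
  have h1 : Tendsto (fun t : ℝ => (1 - t) • x + t • z) (𝓝[>] 0) (𝓝 x) := by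
    have : Continuous fun t : ℝ => (1 - t) • x + t • z := by fun_prop
    have h := this.tendsto 0
    simp only [sub_zero, one_smul, zero_smul, add_zero] at h
    exact h.mono_left nhdsWithin_le_nhds
  refine mem_closure_of_tendsto h1 ?_
  filter_upwards [Ioo_mem_nhdsGT (zero_lt_one' ℝ)] with t ht
  refine ⟨fun i => ?_, ?_⟩
  · have h2 : 0 ≤ (1 - t) * x i := mul_nonneg (by linarith [ht.2]) (hx.1 i)
    have h3 : 0 < t * z i := mul_pos ht.1 hz
    simp only [Pi.add_apply, Pi.smul_apply, smul_eq_mul]; linarith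
  · simp only [Pi.add_apply, Pi.smul_apply, smul_eq_mul, Finset.sum_add_distrib, ← Finset.mul_sum]
    nlinarith [hx.2, ht.1, ht.2]

lemma convex_openSimplex (n : ℕ) : Convex ℝ (openSimplex n) := by
  intro x hx y hy a b ha hb hab
  refine ⟨fun i => ?_, ?_⟩
  · simp only [Pi.add_apply, Pi.smul_apply, smul_eq_mul]
    rcases ha.eq_or_lt with rfl | ha
    · have : b = 1 := by linarith
      simp [this, hy.1 i]
    · have := mul_pos ha (hx.1 i); have := mul_nonneg hb (hy.1 i).le; linarith
  · simp only [Pi.add_apply, Pi.smul_apply, smul_eq_mul, Finset.sum_add_distrib, ← Finset.mul_sum]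
    rcases ha.eq_or_lt with rfl | ha
    · have : b = 1 := by linarith
      simp [this, hy.2]
    · nlinarith [hx.2, hy.2]

/-- The frontier of a convex set is Lebesgue-null. -/
lemma closedSimplex_ae_eq (n : ℕ) : closedSimplex n =ᵐ[volume] openSimplex n := by
  refine Filter.EventuallyLE.antisymm ?_ (openSimplex_subset n).eventuallyLE
  refine ((closedSimplex_subset_closure n).eventuallyLE).trans ?_
  rw [ae_le_set]
  refine measure_mono_null ?_ ((convex_openSimplex n).addHaar_frontier volume)
  rw [frontier, (isOpen_openSimplex n).interior_eq]

lemma openSimplex_nonempty (n : ℕ) : (openSimplex n).Nonempty := by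
  rw [← closure_nonempty_iff]
  exact ⟨0, closedSimplex_subset_closure n ⟨fun _ => le_rfl, by simp⟩⟩

lemma volume_openSimplex_pos (n : ℕ) : 0 < volume.real (openSimplex n) := by
  refine ENNReal.toReal_pos ((isOpen_openSimplex n).measure_pos _ (openSimplex_nonempty n)).ne' ?_
  exact ((measure_mono (openSimplex_subset n)).trans_lt
    (isCompact_closedSimplex n).measure_lt_top).ne

/-- The affine parametrization of the simplex with vertices `p i`. -/
noncomputable def simplexMap {n : ℕ} (p : Fin (n + 1) → E3) (x : Fin n → ℝ) : E3 :=
  p 0 + ∑ i, x i • (p i.succ - p 0)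

lemma continuous_simplexMap {n : ℕ} (p : Fin (n + 1) → E3) : Continuous (simplexMap p) := by
  unfold simplexMap; fun_prop

lemma simplexMap_combo {n : ℕ} (p : Fin (n + 1) → E3) (x y : Fin n → ℝ) {a b : ℝ}
    (hab : a + b = 1) :
    simplexMap p (a • x + b • y) = a • simplexMap p x + b • simplexMap p y := by
  simp only [simplexMap, Pi.add_apply, Pi.smul_apply, smul_eq_mul, add_smul, mul_smul,
    Finset.sum_add_distrib, smul_add, Finset.smul_sum]
  have : p 0 = a • p 0 + b • p 0 := by rw [← add_smul, hab, one_smul]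
  conv_lhs => enter [1]; rw [this]
  abel

lemma simplexMap_image_closed {n : ℕ} (p : Fin (n + 1) → E3) :
    simplexMap p '' closedSimplex n = convexHull ℝ (range p) := by
  apply subset_antisymm
  · rintro _ ⟨x, hx, rfl⟩
    have h : simplexMap p x = ∑ i : Fin (n + 1),
        (Fin.cons (1 - ∑ i, x i) x : Fin (n + 1) → ℝ) i • p i := by
      rw [Fin.sum_univ_succ]
      simp only [simplexMap, Fin.cons_zero, Fin.cons_succ, smul_sub, Finset.sum_sub_distrib,
        sub_smul, one_smul, Finset.sum_smul]
      abel
    rw [h]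
    refine (convex_convexHull ℝ _).sum_mem (fun i _ => ?_) ?_
      (fun i _ => subset_convexHull ℝ _ (mem_range_self i))
    · refine Fin.cases ?_ (fun j => ?_) i
      · simpa using hx.2
      · simpa using hx.1 j
    · rw [Fin.sum_univ_succ]; simp
  · refine convexHull_min ?_ ?_
    · rintro _ ⟨i, rfl⟩
      refine Fin.cases ⟨0, ⟨fun _ => le_rfl, by simp⟩, by simp [simplexMap]⟩ (fun j => ?_) i
      refine ⟨Pi.single j 1, ⟨fun i => ?_, by simp⟩, ?_⟩
      · by_cases h : i = j
        · subst h; simp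
        · simp [h]
      · simp [simplexMap, Pi.single_apply]
    · rintro _ ⟨x, hx, rfl⟩ _ ⟨y, hy, rfl⟩ a b ha hb hab
      exact ⟨_, convex_closedSimplex n hx hy ha hb hab, simplexMap_combo p x y hab⟩

/-- Change of variables for a parametrized simplex. -/
lemma setIntegral_simplex {n : ℕ} {p : Fin (n + 1) → E3} {μ : Measure E3} {c : ℝ≥0∞}
    (he : MeasurableEmbedding (simplexMap p))
    (hμ : μ.restrict (range (simplexMap p)) = c • volume.map (simplexMap p)) (g : E3 → ℝ) :
    ∫ x in convexHull ℝ (range p), g x ∂μ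
      = c.toReal * ∫ y in openSimplex n, g (simplexMap p y) := by
  rw [← simplexMap_image_closed]
  have hs : simplexMap p '' closedSimplex n ⊆ range (simplexMap p) := image_subset_range _ _
  rw [← Measure.restrict_restrict_of_subset hs, hμ, Measure.restrict_smul, integral_smul_measure,
    he.setIntegral_map, preimage_image_eq _ he.injective,
    setIntegral_congr_set (closedSimplex_ae_eq n), smul_eq_mul]

/-- With the face normal as first axis, the matrix parametrizing a tetrahedron over that face
becomes block triangular. -/
lemma exists_orthonormalBasis_first {n : E3} (hn : ‖n‖ = 1) :
    ∃ o : OrthonormalBasis (Fin 3) ℝ E3, o 0 = n := by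
  have h : Orthonormal ℝ (({0} : Set (Fin 3)).domRestrict (fun _ => n)) := by
    refine ⟨fun i => hn, fun i j hij => ?_⟩
    exact absurd (Subsingleton.elim i j) hij
  obtain ⟨b, hb⟩ := h.exists_orthonormalBasis_extension_of_card_eq (by simp)
  exact ⟨b, hb 0 rfl⟩

/-- Simultaneous parametrization of a triangle and of the tetrahedra over it. -/
lemma exists_simplex_param {a b c n : E3} (hn : ‖n‖ = 1) (hb : ⟪n, b - a⟫ = 0)
    (hc : ⟪n, c - a⟫ = 0) (hli : LinearIndependent ℝ ![b - a, c - a]) :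
    ∃ J : ℝ, 0 < J ∧
      (∀ g : E3 → ℝ, ∫ x in convexHull ℝ (range ![a, b, c]), g x
          ∂(Measure.euclideanHausdorffMeasure 2 : Measure E3)
        = J * ∫ y in openSimplex 2, g (simplexMap ![a, b, c] y)) ∧
      ∀ v : E3, ⟪n, v - a⟫ ≠ 0 → ∀ g : E3 → ℝ, ∫ x in convexHull ℝ (range ![a, v, b, c]), g x
        = (J * |⟪n, v - a⟫|) * ∫ y in openSimplex 3, g (simplexMap ![a, v, b, c] y) := by
  obtain ⟨o, ho⟩ := exists_orthonormalBasis_first hn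
  have rep : ∀ w : E3, w = ⟪n, w⟫ • n + ⟪o 1, w⟫ • o 1 + ⟪o 2, w⟫ • o 2 := by
    intro w
    conv_lhs => rw [← o.sum_repr' w]
    rw [Fin.sum_univ_three, ho]
  set b1 := ⟪o 1, b - a⟫ with hb1
  set b2 := ⟪o 2, b - a⟫ with hb2
  set c1 := ⟪o 1, c - a⟫ with hc1
  set c2 := ⟪o 2, c - a⟫ with hc2
  have eb : b - a = b1 • o 1 + b2 • o 2 := by
    have := rep (b - a); rw [hb] at this; simpa using this
  have ec : c - a = c1 • o 1 + c2 • o 2 := by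
    have := rep (c - a); rw [hc] at this; simpa using this
  -- Coordinates of the two edges in the plane of the triangle. The constant `J = |det m|` serves
  -- the area and the volume formula alike, which yields volume as height times area.
  set m : Matrix (Fin 2) (Fin 2) ℝ := !![b1, c1; b2, c2] with hm
  have hdet : m.det = b1 * c2 - c1 * b2 := by rw [hm, Matrix.det_fin_two_of]
  have hdet0 : m.det ≠ 0 := by
    intro h0
    rw [hdet] at h0
    rw [LinearIndependent.pair_iff] at hli
    have h1 := hli c2 (-b2) (by
      rw [eb, ec]
      have : c2 • (b1 • o 1 + b2 • o 2) + -b2 • (c1 • o 1 + c2 • o 2)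
        = (b1 * c2 - c1 * b2) • o 1 := by module
      rw [this, h0, zero_smul])
    have h2 := hli c1 (-b1) (by
      rw [eb, ec]
      have : c1 • (b1 • o 1 + b2 • o 2) + -b1 • (c1 • o 1 + c2 • o 2)
        = -(b1 * c2 - c1 * b2) • o 2 := by module
      rw [this, h0, neg_zero, zero_smul])
    have h3 := hli 1 0 (by
      rw [eb]
      have e1 : b1 = 0 := by linarith [h2.2]
      have e2 : b2 = 0 := by linarith [h1.2]
      simp [e1, e2])
    simp at h3
  refine ⟨|m.det|, abs_pos.2 hdet0, ?_, ?_⟩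
  · -- the triangle
    let κ : EuclideanSpace ℝ (Fin 2) → E3 := fun y => a + (y 0 • o 1 + y 1 • o 2)
    -- An isometric parametrization of the plane carries planar Lebesgue measure to the normalized
    -- two-dimensional Hausdorff measure, so no further constant appears.
    have hκ : Isometry κ := by
      refine Isometry.of_dist_eq fun x y => ?_
      have : κ x - κ y = (x 0 - y 0) • o 1 + (x 1 - y 1) • o 2 := by
        simp only [κ]; module
      rw [dist_eq_norm, this, dist_eq_norm, EuclideanSpace.norm_eq (x - y), Fin.sum_univ_two]
      rw [← Real.sqrt_sq (norm_nonneg ((x 0 - y 0) • o 1 + (x 1 - y 1) • o 2))]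
      congr 1
      rw [@norm_add_sq_real, norm_smul, norm_smul, inner_smul_left, inner_smul_right,
        o.orthonormal.2 (by decide : (1 : Fin 3) ≠ 2)]
      simp
    have hlin : Function.Injective (Matrix.toLin' m) :=
      Matrix.mulVec_injective_of_isUnit
        ((Matrix.isUnit_iff_isUnit_det m).2 (isUnit_iff_ne_zero.2 hdet0))
    have hmm : MeasurableEmbedding (Matrix.toLin' m) :=
      (LinearMap.isClosedEmbedding_of_injective (LinearMap.ker_eq_bot.2 hlin)).measurableEmbedding
    have hcomp : simplexMap ![a, b, c] = κ ∘ (WithLp.toLp 2) ∘ (Matrix.toLin' m) := by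
      ext1 y
      simp only [simplexMap, κ, Function.comp, Fin.sum_univ_two, Matrix.toLin'_apply]
      simp only [Matrix.cons_val_zero, Fin.succ_zero_eq_one, Matrix.cons_val_one,
        Fin.succ_one_eq_two, Matrix.cons_val, eb, ec, hm, Matrix.mulVec, dotProduct,
        Fin.sum_univ_two, Matrix.of_apply, Matrix.cons_val']
      simp
      module
    have hT : MeasurableEmbedding (WithLp.toLp 2 : (Fin 2 → ℝ) → EuclideanSpace ℝ (Fin 2)) :=
      (MeasurableEquiv.toLp 2 (Fin 2 → ℝ)).measurableEmbedding
    have hκm : MeasurableEmbedding κ := hκ.isClosedEmbedding.measurableEmbedding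
    have hemb : MeasurableEmbedding (simplexMap ![a, b, c]) := by
      rw [hcomp]; exact hκm.comp (hT.comp hmm)
    have hrange : range (simplexMap ![a, b, c]) = range κ := by
      rw [hcomp, range_comp, range_comp]
      have h1 : range (Matrix.toLin' m) = univ := by
        rw [Set.range_eq_univ]
        exact LinearMap.injective_iff_surjective.1 hlin
      rw [h1, image_univ, (WithLp.toLp_surjective 2).range_eq, image_univ]
    have hmeas : (Measure.euclideanHausdorffMeasure 2 : Measure E3).restrict
        (range (simplexMap ![a, b, c]))
        = ENNReal.ofReal |m.det| • volume.map (simplexMap ![a, b, c]) := by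
      rw [hrange, ← hκ.map_euclideanHausdorffMeasure,
        EuclideanSpace.euclideanHausdorffMeasure_eq_volume, hcomp,
        ← Measure.map_map hκm.measurable (hT.comp hmm).measurable,
        ← Measure.map_map hT.measurable hmm.measurable,
        Real.map_matrix_volume_pi_eq_smul_volume_pi hdet0, Measure.map_smul, Measure.map_smul,
        (PiLp.volume_preserving_toLp (Fin 2)).map_eq, smul_smul, ← ENNReal.ofReal_mul (abs_nonneg _),
        ← abs_mul, mul_inv_cancel₀ hdet0]
      simp
    intro g
    rw [setIntegral_simplex hemb hmeas, ENNReal.toReal_ofReal (abs_nonneg _)]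
  · intro v hv g
    set H := ⟪n, v - a⟫ with hH
    set v1 := ⟪o 1, v - a⟫
    set v2 := ⟪o 2, v - a⟫
    have ev : v - a = H • n + v1 • o 1 + v2 • o 2 := rep (v - a)
    -- The base edges have no normal component, so the determinant factors as `det m` times the
    -- height `H`.
    set M : Matrix (Fin 3) (Fin 3) ℝ := !![H, 0, 0; v1, b1, c1; v2, b2, c2] with hM
    have hMdet : M.det = m.det * H := by
      rw [hdet, hM, Matrix.det_fin_three]
      simp
      ring
    have hM0 : M.det ≠ 0 := by rw [hMdet]; exact mul_ne_zero hdet0 hv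
    have hlin : Function.Injective (Matrix.toLin' M) :=
      Matrix.mulVec_injective_of_isUnit
        ((Matrix.isUnit_iff_isUnit_det M).2 (isUnit_iff_ne_zero.2 hM0))
    have hmm : MeasurableEmbedding (Matrix.toLin' M) :=
      (LinearMap.isClosedEmbedding_of_injective (LinearMap.ker_eq_bot.2 hlin)).measurableEmbedding
    have hT : MeasurableEmbedding (WithLp.toLp 2 : (Fin 3 → ℝ) → E3) :=
      (MeasurableEquiv.toLp 2 (Fin 3 → ℝ)).measurableEmbedding
    let O : E3 → E3 := fun y => a + o.repr.symm y
    have hO : Isometry O := (isometry_add_left a).comp o.repr.symm.isometry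
    have hOm : MeasurableEmbedding O := hO.isClosedEmbedding.measurableEmbedding
    have hOp : volume.map O = (volume : Measure E3) := by
      have : O = (fun y => a + y) ∘ o.repr.symm := rfl
      rw [this, ← Measure.map_map (measurable_const_add a)
        o.repr.symm.continuous.measurable,
        o.measurePreserving_repr_symm.map_eq, map_add_left_eq_self]
    have hcomp : simplexMap ![a, v, b, c] = O ∘ (WithLp.toLp 2) ∘ (Matrix.toLin' M) := by
      ext1 y
      have hrs : ∀ z : E3, o.repr.symm z = ∑ i, z i • o i := fun z => by
        rw [OrthonormalBasis.sum_repr_symm]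
      simp only [simplexMap, O, Function.comp, Matrix.toLin'_apply, hrs]
      rw [Fin.sum_univ_three, Fin.sum_univ_three, ho]
      simp only [Matrix.cons_val_zero, Fin.succ_zero_eq_one, Matrix.cons_val_one,
        Fin.succ_one_eq_two, Matrix.cons_val, ev, eb, hM, Matrix.mulVec, dotProduct,
        Fin.sum_univ_three, Matrix.of_apply, Matrix.cons_val']
      have h3 : (![a, v, b, c] : Fin 4 → E3) (Fin.succ 2) = c := rfl
      rw [h3, ec]
      simp
      module
    have hemb : MeasurableEmbedding (simplexMap ![a, v, b, c]) := by
      rw [hcomp]; exact hOm.comp (hT.comp hmm)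
    have hrange : range (simplexMap ![a, v, b, c]) = univ := by
      rw [hcomp, range_comp, range_comp]
      have h1 : range (Matrix.toLin' M) = univ := by
        rw [Set.range_eq_univ]
        exact LinearMap.injective_iff_surjective.1 hlin
      rw [h1, image_univ, (WithLp.toLp_surjective 2).range_eq, image_univ]
      rw [Set.range_eq_univ]
      intro z
      exact ⟨o.repr (z - a), by simp [O]⟩
    have hmeas : (volume : Measure E3).restrict (range (simplexMap ![a, v, b, c]))
        = ENNReal.ofReal |M.det| • volume.map (simplexMap ![a, v, b, c]) := by
      rw [hrange, Measure.restrict_univ, hcomp,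
        ← Measure.map_map hOm.measurable (hT.comp hmm).measurable,
        ← Measure.map_map hT.measurable hmm.measurable,
        Real.map_matrix_volume_pi_eq_smul_volume_pi hM0, Measure.map_smul, Measure.map_smul,
        (PiLp.volume_preserving_toLp (Fin 3)).map_eq, hOp, smul_smul,
        ← ENNReal.ofReal_mul (abs_nonneg _), ← abs_mul, mul_inv_cancel₀ hM0]
      simp
    rw [setIntegral_simplex hemb hmeas, ENNReal.toReal_ofReal (abs_nonneg _), hMdet, abs_mul]

/-! ### Integration along an edge of a simplex -/

lemma simplexMap_cons (a v b c : E3) (r : ℝ) (y : Fin 2 → ℝ) :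
    simplexMap ![a, v, b, c] (Fin.cons r y) = simplexMap ![a, b, c] y + r • (v - a) := by
  simp only [simplexMap, Fin.sum_univ_succ, Fin.cons_zero, Fin.cons_succ, Finset.univ_eq_empty,
    Finset.sum_empty]
  simp
  abel

lemma cons_mem_openSimplex {n : ℕ} {r : ℝ} {y : Fin n → ℝ} :
    (Fin.cons r y : Fin (n + 1) → ℝ) ∈ openSimplex (n + 1)
      ↔ y ∈ openSimplex n ∧ r ∈ Ioo 0 (1 - ∑ i, y i) := by
  simp only [openSimplex, mem_ofPred_eq, Fin.forall_fin_succ, Fin.cons_zero, Fin.cons_succ,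
    Fin.sum_univ_succ, mem_Ioo]
  constructor
  · rintro ⟨⟨h1, h2⟩, h3⟩
    exact ⟨⟨h2, by linarith⟩, h1, by linarith⟩
  · rintro ⟨⟨h2, h3⟩, h1, h4⟩
    exact ⟨⟨h1, h2⟩, by linarith⟩

lemma integrableOn_openSimplex {n : ℕ} {F : (Fin n → ℝ) → ℝ} (hF : Continuous F) :
    IntegrableOn F (openSimplex n) :=
  (hF.continuousOn.integrableOn_compact (isCompact_closedSimplex n)).mono_set (openSimplex_subset n)

/-- Fubini in the first barycentric variable and the fundamental theorem of calculus: each segment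
in direction `v - a` starts on the triangle `a b c` and ends on `v b c`. -/
lemma integral_deriv_simplexMap {g : E3 → ℝ} (hg : ContDiff ℝ 1 g) (a v b c : E3) :
    ∫ x in openSimplex 3, fderiv ℝ g (simplexMap ![a, v, b, c] x) (v - a)
      = (∫ y in openSimplex 2, g (simplexMap ![v, b, c] y))
        - ∫ y in openSimplex 2, g (simplexMap ![a, b, c] y) := by
  set F : (Fin 3 → ℝ) → ℝ := fun x => fderiv ℝ g (simplexMap ![a, v, b, c] x) (v - a) with hF
  have hFc : Continuous F :=
    ((hg.continuous_fderiv (by norm_num)).comp (continuous_simplexMap _)).clm_apply continuous_const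
  have hme : MeasurePreserving (MeasurableEquiv.piFinSuccAbove (fun _ : Fin 3 => ℝ) 0).symm
      (volume.prod volume) volume := (volume_preserving_piFinSuccAbove (fun _ => ℝ) 0).symm
  set e := (MeasurableEquiv.piFinSuccAbove (fun _ : Fin 3 => ℝ) 0).symm with he
  have hes : ∀ r (y : Fin 2 → ℝ), e (r, y) = Fin.cons r y := fun r y => by
    simp [he, MeasurableEquiv.piFinSuccAbove, Fin.insertNthEquiv]
  have hind : Integrable ((openSimplex 3).indicator F) :=
    (integrableOn_openSimplex hFc).integrable_indicator (isOpen_openSimplex 3).measurableSet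
  have hind2 : Integrable (fun z => (openSimplex 3).indicator F (e z)) (volume.prod volume) :=
    (hme.integrable_comp_emb e.measurableEmbedding).2 hind
  rw [← integral_indicator (isOpen_openSimplex 3).measurableSet,
    ← hme.integral_comp e.measurableEmbedding, integral_prod_symm _ hind2,
    ← integral_sub, ← integral_indicator (isOpen_openSimplex 2).measurableSet]
  · refine integral_congr_ae (Eventually.of_forall fun y => ?_)
    simp only [hes]
    by_cases hy : y ∈ openSimplex 2
    · rw [indicator_of_mem hy]
      have h1 : (fun r : ℝ => (openSimplex 3).indicator F (Fin.cons r y : Fin 3 → ℝ))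
          = (Ioo 0 (1 - ∑ i, y i)).indicator fun r => F (Fin.cons r y : Fin 3 → ℝ) := by
        ext r
        by_cases hr : r ∈ Ioo 0 (1 - ∑ i, y i)
        · rw [indicator_of_mem hr, indicator_of_mem (cons_mem_openSimplex.2 ⟨hy, hr⟩)]
        · rw [indicator_of_notMem hr, indicator_of_notMem
            fun h => hr (cons_mem_openSimplex.1 h).2]
      have hT : 0 ≤ 1 - ∑ i, y i := by linarith [hy.2]
      rw [h1, integral_indicator measurableSet_Ioo, ← integral_Ioc_eq_integral_Ioo,
        ← intervalIntegral.integral_of_le hT]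
      have hd : ∀ r ∈ uIcc 0 (1 - ∑ i, y i), HasDerivAt
          (fun r : ℝ => g (simplexMap ![a, b, c] y + r • (v - a)))
          (F (Fin.cons r y : Fin 3 → ℝ)) r := by
        intro r _
        simp only [hF, simplexMap_cons]
        have h2 : HasDerivAt (fun r : ℝ => simplexMap ![a, b, c] y + r • (v - a)) (v - a) r := by
          simpa using ((hasDerivAt_id r).smul_const (v - a)).const_add (simplexMap ![a, b, c] y)
        exact ((hg.differentiable (by norm_num)) _).hasFDerivAt.comp_hasDerivAt r h2
      rw [intervalIntegral.integral_eq_sub_of_hasDerivAt hd]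
      -- At the upper endpoint `r = 1 - ∑ yᵢ` the weight of `a` has been transferred entirely to
      -- `v`.
      · congr 2
        · simp only [simplexMap, Fin.sum_univ_two]
          simp
          module
        · simp
      · refine Continuous.intervalIntegrable ?_ _ _
        have : Continuous fun r : ℝ => (Fin.cons r y : Fin 3 → ℝ) := by
          refine continuous_pi fun i => ?_
          refine Fin.cases ?_ (fun j => ?_) i
          · simpa using continuous_id'
          · simpa using continuous_const
        exact hFc.comp this
    · rw [indicator_of_notMem hy]
      have h1 : (fun r : ℝ => (openSimplex 3).indicator F (Fin.cons r y : Fin 3 → ℝ)) = 0 := by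
        ext r
        rw [indicator_of_notMem fun h => hy (cons_mem_openSimplex.1 h).1]; rfl
      rw [h1]; simp
  · exact integrableOn_openSimplex (hg.continuous.comp (continuous_simplexMap _))
  · exact integrableOn_openSimplex (hg.continuous.comp (continuous_simplexMap _))

/-! ### Triangles -/

/-- Three affinely independent points. -/
structure IsTri (f : Finset E3) : Prop where
  card : f.card = 3
  indep : AffineIndependent ℝ ((↑) : f → E3)

/-- Four affinely independent points. -/
structure IsTet (K : Finset E3) : Prop where
  card : K.card = 4
  indep : AffineIndependent ℝ ((↑) : K → E3)

/-- The relative interior of a simplex: the points with positive barycentric coordinates. -/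
def openFace (f : Finset E3) : Set E3 :=
  {x | ∃ w : E3 → ℝ, (∀ y ∈ f, 0 < w y) ∧ ∑ y ∈ f, w y = 1 ∧ ∑ y ∈ f, w y • y = x}

lemma openFace_subset_cell (f : Finset E3) : openFace f ⊆ cell f := by
  rintro _ ⟨w, h0, h1, rfl⟩
  exact (convex_convexHull ℝ _).sum_mem (fun y hy => (h0 y hy).le) h1
    fun y hy => subset_convexHull ℝ _ hy

lemma AffineIndependent.linearIndependent_pair {f : Finset E3}
    (hf : AffineIndependent ℝ ((↑) : f → E3)) {a b c : E3} (ha : a ∈ f) (hb : b ∈ f) (hc : c ∈ f)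
    (hab : a ≠ b) (hac : a ≠ c) (hbc : b ≠ c) : LinearIndependent ℝ ![b - a, c - a] := by
  have h := (affineIndependent_iff_linearIndependent_vsub ℝ _ (⟨a, ha⟩ : f)).1 hf
  have h2 := h.comp (![⟨⟨b, hb⟩, fun h => hab (congrArg Subtype.val h).symm⟩,
    ⟨⟨c, hc⟩, fun h => hac (congrArg Subtype.val h).symm⟩] : Fin 2 → _) (by
      intro i j hij
      fin_cases i <;> fin_cases j <;> simp_all)
  have h3 : ![b - a, c - a] = (fun i : { x : f // x ≠ ⟨a, ha⟩ } => (i : E3) -ᵥ a) ∘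
      (![⟨⟨b, hb⟩, fun h => hab (congrArg Subtype.val h).symm⟩,
    ⟨⟨c, hc⟩, fun h => hac (congrArg Subtype.val h).symm⟩] : Fin 2 → _) := by
    ext1 i
    fin_cases i <;> rfl
  rw [h3]
  exact h2

lemma exists_unit_normal (u v : E3) : ∃ n : E3, ‖n‖ = 1 ∧ ⟪n, u⟫ = 0 ∧ ⟪n, v⟫ = 0 := by
  have hlt : Submodule.span ℝ (Set.range ![u, v]) ≠ ⊤ := by
    intro h
    have h1 := finrank_range_le_card (R := ℝ) ![u, v]
    rw [Set.finrank, h] at h1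
    simp at h1
  obtain ⟨n, hn, hn0⟩ := Submodule.exists_mem_ne_zero_of_ne_bot
    (fun h => hlt (Submodule.orthogonal_eq_bot_iff.1 h))
  rw [Submodule.mem_orthogonal] at hn
  have hu := hn u (Submodule.subset_span ⟨0, rfl⟩)
  have hv := hn v (Submodule.subset_span ⟨1, rfl⟩)
  refine ⟨‖n‖⁻¹ • n, ?_, ?_, ?_⟩
  · rw [norm_smul, norm_inv, norm_norm, inv_mul_cancel₀ (norm_ne_zero_iff.2 hn0)]
  · rw [inner_smul_left, real_inner_comm, hu, mul_zero]
  · rw [inner_smul_left, real_inner_comm, hv, mul_zero]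

lemma simplexMap_image_openSimplex {a b c : E3} (hab : a ≠ b) (hac : a ≠ c) (hbc : b ≠ c)
    {f : Finset E3} (hf : (f : Set E3) = {a, b, c}) :
    simplexMap ![a, b, c] '' openSimplex 2 = openFace f := by
  classical
  have hf' : f = {a, b, c} := by
    apply Finset.coe_injective; rw [hf]; simp
  subst hf'
  have hs : ∀ w : E3 → ℝ, ∑ y ∈ ({a, b, c} : Finset E3), w y = w a + (w b + w c) := fun w => by
    rw [Finset.sum_insert (by simp [hab, hac]), Finset.sum_pair hbc]
  have hs' : ∀ w : E3 → E3, ∑ y ∈ ({a, b, c} : Finset E3), w y = w a + (w b + w c) := fun w => by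
    rw [Finset.sum_insert (by simp [hab, hac]), Finset.sum_pair hbc]
  ext x
  constructor
  · rintro ⟨y, hy, rfl⟩
    have hy2 := hy.2
    rw [Fin.sum_univ_two] at hy2
    refine ⟨fun z => if z = a then 1 - y 0 - y 1 else if z = b then y 0 else y 1, ?_, ?_, ?_⟩
    · intro z _
      dsimp only
      split_ifs
      · linarith
      · exact hy.1 0
      · exact hy.1 1
    · rw [hs]; simp [hab.symm, hac.symm, hbc.symm]
    · rw [hs']
      simp only [if_true, hab.symm, hac.symm, hbc.symm, if_false, simplexMap, Fin.sum_univ_two]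
      simp
      module
  · rintro ⟨w, h0, h1, rfl⟩
    rw [hs] at h1
    have ha := h0 a (by simp)
    have hb := h0 b (by simp)
    have hc := h0 c (by simp)
    refine ⟨![w b, w c], ⟨fun i => ?_, ?_⟩, ?_⟩
    · fin_cases i
      · simpa using hb
      · simpa using hc
    · simp [Fin.sum_univ_two]; linarith
    · rw [hs']
      have : w a = 1 - w b - w c := by linarith
      simp only [simplexMap, Fin.sum_univ_two, this]
      simp
      module

lemma range_triple (a b c : E3) : range ![a, b, c] = {a, b, c} := by
  ext x; simp only [mem_range, Fin.exists_fin_succ]; simp [eq_comm]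

lemma range_quadruple (a b c d : E3) : range ![a, b, c, d] = {a, b, c, d} := by
  ext x; simp only [mem_range, Fin.exists_fin_succ]; simp [eq_comm]

/-- Parametrization of a triangle. -/
lemma exists_faceInt_eq {f : Finset E3} (hi : AffineIndependent ℝ ((↑) : f → E3)) {a b c : E3}
    (hf : (f : Set E3) = {a, b, c}) (hab : a ≠ b) (hac : a ≠ c) (hbc : b ≠ c) :
    ∃ J : ℝ, 0 < J ∧ ∀ g : E3 → ℝ,
      faceInt f g = J * ∫ y in openSimplex 2, g (simplexMap ![a, b, c] y) := by
  obtain ⟨n, hn, hb, hc⟩ := exists_unit_normal (b - a) (c - a)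
  have ma : a ∈ f := by rw [← Finset.mem_coe, hf]; simp
  have mb : b ∈ f := by rw [← Finset.mem_coe, hf]; simp
  have mc : c ∈ f := by rw [← Finset.mem_coe, hf]; simp
  obtain ⟨J, hJ, h, -⟩ := exists_simplex_param hn hb hc
    (AffineIndependent.linearIndependent_pair hi ma mb mc hab hac hbc)
  refine ⟨J, hJ, fun g => ?_⟩
  rw [faceInt, cell, hf, ← range_triple]
  exact h g

lemma IsTri.exists_vertices {f : Finset E3} (hf : IsTri f) : ∃ a b c : E3,
    a ≠ b ∧ a ≠ c ∧ b ≠ c ∧ (f : Set E3) = {a, b, c} := by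
  classical
  obtain ⟨a, b, c, hab, hac, hbc, rfl⟩ := Finset.card_eq_three.1 hf.card
  exact ⟨a, b, c, hab, hac, hbc, by simp⟩

lemma IsTri.exists_param {f : Finset E3} (hf : IsTri f) : ∃ p : Fin 3 → E3,
    simplexMap p '' openSimplex 2 = openFace f ∧ ∃ J : ℝ, 0 < J ∧ ∀ g : E3 → ℝ,
      faceInt f g = J * ∫ y in openSimplex 2, g (simplexMap p y) := by
  obtain ⟨a, b, c, hab, hac, hbc, h⟩ := hf.exists_vertices
  exact ⟨![a, b, c], simplexMap_image_openSimplex hab hac hbc h,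
    exists_faceInt_eq hf.indep h hab hac hbc⟩

/-- The area of a triangle. -/
noncomputable def area (f : Finset E3) : ℝ := faceInt f fun _ => 1

/-- The relative boundary of a triangle is negligible. This matters because one-sided limits across
a face are only controlled on the open face. -/
lemma faceInt_congr {f : Finset E3} (hf : IsTri f) {g g' : E3 → ℝ}
    (h : ∀ x ∈ openFace f, g x = g' x) : faceInt f g = faceInt f g' := by
  obtain ⟨p, hp, J, hJ, hint⟩ := hf.exists_param
  rw [hint, hint, setIntegral_congr_fun (isOpen_openSimplex 2).measurableSet fun y hy =>
    h _ (hp ▸ mem_image_of_mem _ hy)]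

lemma faceInt_const {f : Finset E3} (c : ℝ) : faceInt f (fun _ => c) = c * area f := by
  simp [faceInt, area]
  ring

lemma area_pos {f : Finset E3} (hf : IsTri f) : 0 < area f := by
  obtain ⟨p, hp, J, hJ, hint⟩ := hf.exists_param
  rw [area, hint]
  simpa using mul_pos hJ (volume_openSimplex_pos 2)

lemma faceInt_nonneg {f : Finset E3} (hf : IsTri f) {g : E3 → ℝ}
    (h : ∀ x ∈ openFace f, 0 ≤ g x) : 0 ≤ faceInt f g := by
  obtain ⟨p, hp, J, hJ, hint⟩ := hf.exists_param
  rw [hint]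
  exact mul_nonneg hJ.le (setIntegral_nonneg (isOpen_openSimplex 2).measurableSet
    fun y hy => h _ (hp ▸ mem_image_of_mem _ hy))

/-- No measurability of `g` is required, since a non-integrable function has integral zero. Jumps
can therefore be estimated from pointwise bounds alone. -/
lemma abs_faceInt_le {f : Finset E3} (hf : IsTri f) {g : E3 → ℝ} {C : ℝ}
    (h : ∀ x ∈ openFace f, |g x| ≤ C) : |faceInt f g| ≤ C * area f := by
  obtain ⟨p, hp, J, hJ, hint⟩ := hf.exists_param
  have hfin : volume (openSimplex 2) < ⊤ := (measure_mono (openSimplex_subset 2)).trans_lt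
    (isCompact_closedSimplex 2).measure_lt_top
  have := norm_setIntegral_le_of_norm_le_const (μ := volume) hfin
    (f := fun y => g (simplexMap p y)) (C := C)
    (fun y hy => h _ (hp ▸ mem_image_of_mem _ hy))
  rw [area, hint, hint, abs_mul, abs_of_pos hJ]
  simp only [Real.norm_eq_abs] at this
  simp only [integral_const, measureReal_restrict_apply_univ, smul_eq_mul, mul_one]
  nlinarith

lemma faceInt_le {f : Finset E3} (hf : IsTri f) {g : E3 → ℝ} {C : ℝ}
    (h0 : ∀ x ∈ openFace f, 0 ≤ g x) (h : ∀ x ∈ openFace f, g x ≤ C) :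
    faceInt f g ≤ C * area f :=
  (le_abs_self _).trans (abs_faceInt_le hf fun x hx => by rw [abs_of_nonneg (h0 x hx)]; exact h x hx)

/-- Continuous functions on a closed triangle are integrable. -/
lemma integrableOn_cell_face {f : Finset E3} (hf : IsTri f) {g : E3 → ℝ}
    (hg : ContinuousOn g (cell f)) : IntegrableOn g (cell f)
      (Measure.euclideanHausdorffMeasure 2 : Measure E3) := by
  have hc : IsCompact (cell f) := f.finite_toSet.isCompact_convexHull ℝ
  have hfin : (Measure.euclideanHausdorffMeasure 2 : Measure E3) (cell f) ≠ ⊤ := by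
    -- An infinite measure would have real value zero, against the positivity of the area.
    intro h
    have h1 := area_pos hf
    rw [area, faceInt] at h1
    simp [Measure.real, h] at h1
  obtain ⟨C, hC⟩ := hc.exists_bound_of_continuousOn hg
  exact IntegrableOn.of_bound (lt_top_iff_ne_top.2 hfin)
    (hg.aestronglyMeasurable hc.isClosed.measurableSet) C
    (ae_restrict_of_forall_mem hc.isClosed.measurableSet hC)

lemma faceInt_add {f : Finset E3} (hf : IsTri f) {g g' : E3 → ℝ}
    (hg : ContinuousOn g (cell f)) (hg' : ContinuousOn g' (cell f)) :
    faceInt f (fun x => g x + g' x) = faceInt f g + faceInt f g' :=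
  integral_add (integrableOn_cell_face hf hg) (integrableOn_cell_face hf hg')

lemma faceInt_sub {f : Finset E3} (hf : IsTri f) {g g' : E3 → ℝ}
    (hg : ContinuousOn g (cell f)) (hg' : ContinuousOn g' (cell f)) :
    faceInt f (fun x => g x - g' x) = faceInt f g - faceInt f g' :=
  integral_sub (integrableOn_cell_face hf hg) (integrableOn_cell_face hf hg')

lemma faceInt_const_mul {f : Finset E3} (c : ℝ) (g : E3 → ℝ) :
    faceInt f (fun x => c * g x) = c * faceInt f g := integral_const_mul c _

lemma faceInt_mono {f : Finset E3} (hf : IsTri f) {g g' : E3 → ℝ}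
    (hg : ContinuousOn g (cell f)) (hg' : ContinuousOn g' (cell f))
    (h : ∀ x ∈ openFace f, g x ≤ g' x) : faceInt f g ≤ faceInt f g' := by
  have := faceInt_nonneg hf (g := fun x => g' x - g x) fun x hx => sub_nonneg.2 (h x hx)
  rw [faceInt_sub hf hg' hg] at this
  linarith

/-- A nonnegative continuous function with vanishing face integral vanishes on the face. -/
lemma eq_zero_of_faceInt_eq_zero {f : Finset E3} (hf : IsTri f) {g : E3 → ℝ}
    (hg : Continuous g) (h0 : ∀ x, 0 ≤ g x) (h : faceInt f g = 0) :
    ∀ x ∈ openFace f, g x = 0 := by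
  obtain ⟨p, hp, J, hJ, hint⟩ := hf.exists_param
  rw [hint, mul_eq_zero, or_iff_right hJ.ne', setIntegral_eq_zero_iff_of_nonneg_ae
    (Eventually.of_forall fun y => h0 _)
    (integrableOn_openSimplex (hg.comp (continuous_simplexMap p)))] at h
  have h2 := Measure.eqOn_open_of_ae_eq h (isOpen_openSimplex 2)
    (hg.comp (continuous_simplexMap p)).continuousOn continuousOn_const
  intro x hx
  rw [← hp] at hx
  obtain ⟨y, hy, rfl⟩ := hx
  exact h2 hy

/-! ### Tetrahedra: barycentric coordinates and the divergence theorem -/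

namespace IsTet

variable {K : Finset E3} (hK : IsTet K)

include hK in
lemma affineSpan_eq_top : affineSpan ℝ (range ((↑) : K → E3)) = ⊤ := by
  rw [hK.indep.affineSpan_eq_top_iff_card_eq_finrank_add_one]
  simp [hK.card]

/-- The vertices as an affine basis. -/
noncomputable def basis : AffineBasis K ℝ E3 := ⟨(↑), hK.indep, hK.affineSpan_eq_top⟩

/-- The barycentric coordinates. -/
noncomputable def coord (v : K) : E3 →ᵃ[ℝ] ℝ := hK.basis.coord v

lemma coord_self (v : K) : hK.coord v v = 1 := hK.basis.coord_apply_eq v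

lemma coord_ne {v u : K} (h : v ≠ u) : hK.coord v u = 0 := hK.basis.coord_apply_ne h

lemma sum_coord (x : E3) : ∑ v : K, hK.coord v x = 1 := hK.basis.sum_coord_apply_eq_one x

lemma sum_coord_smul (x : E3) : ∑ v : K, hK.coord v x • (v : E3) = x :=
  hK.basis.linear_combination_coord_eq_self x

lemma continuous_coord (v : K) : Continuous (hK.coord v) :=
  continuous_barycentric_coord hK.basis v

lemma range_basis : range hK.basis = (K : Set E3) := by
  have : ⇑hK.basis = ((↑) : K → E3) := rfl
  rw [this]; simp

lemma cell_eq : cell K = {x | ∀ v, 0 ≤ hK.coord v x} := by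
  rw [cell, ← hK.range_basis, hK.basis.convexHull_eq_nonneg_coord]; rfl

lemma openCell_eq : openCell K = {x | ∀ v, 0 < hK.coord v x} := by
  rw [openCell, cell, ← hK.range_basis, hK.basis.interior_convexHull]; rfl

lemma coord_sum {w : E3 → ℝ} (hw : ∑ y ∈ K, w y = 1) (v : K) :
    hK.coord v (∑ y ∈ K, w y • y) = w v := by
  have h1 : ∑ y ∈ K, w y • y = Finset.univ.affineCombination ℝ hK.basis (fun u : K => w u) := by
    rw [Finset.affineCombination_eq_linear_combination _ _ _ (by
      rw [Finset.sum_coe_sort K w]; exact hw)]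
    exact (Finset.sum_coe_sort K fun y => w y • y).symm
  rw [h1]
  exact hK.basis.coord_apply_combination_of_mem (Finset.mem_univ v)
    (by rw [Finset.sum_coe_sort K w]; exact hw)

/-- The linear part of a barycentric coordinate through a normal of the opposite face. -/
lemma inner_eq_coord {v x n : E3} (hv : v ∈ K) (hn : ∀ y ∈ K, y ≠ v → ⟪n, y - x⟫ = 0) (z : E3) :
    ⟪n, z - x⟫ = ⟪n, v - x⟫ * hK.coord ⟨v, hv⟩ z := by
  have h1 : z - x = ∑ u : K, hK.coord u z • ((u : E3) - x) := by
    simp only [smul_sub, Finset.sum_sub_distrib, ← Finset.sum_smul, hK.sum_coord,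
      hK.sum_coord_smul, one_smul]
  conv_lhs => rw [h1]
  rw [inner_sum, Finset.sum_eq_single ⟨v, hv⟩]
  · rw [inner_smul_right, mul_comm]
  · intro u _ hu
    rw [inner_smul_right, hn u u.2 fun h => hu (Subtype.ext h), mul_zero]
  · simp

-- Otherwise the linear form `⟪n, · - x⟫` would vanish at all vertices and hence identically;
-- evaluation at `x + n` gives `‖n‖² = 0`.
include hK in
lemma inner_ne_zero {v x n : E3} (hv : v ∈ K) (hn : ∀ y ∈ K, y ≠ v → ⟪n, y - x⟫ = 0)
    (hn0 : n ≠ 0) : ⟪n, v - x⟫ ≠ 0 := by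
  intro h
  have h1 := hK.inner_eq_coord hv hn (x + n)
  rw [h, zero_mul, add_sub_cancel_left, inner_self_eq_zero] at h1
  exact hn0 h1

include hK in
lemma isTri_of_subset {f : Finset E3} (hf : f ⊆ K) (hc : f.card = 3) : IsTri f := by
  refine ⟨hc, ?_⟩
  have := hK.indep.comp_embedding (⟨fun x : f => (⟨x, hf x.2⟩ : K), fun a b h => by
    ext1; simpa using h⟩ : f ↪ K)
  exact this

open scoped Classical in
include hK in
lemma isTri_erase {v : E3} (hv : v ∈ K) : IsTri (K.erase v) :=
  hK.isTri_of_subset (K.erase_subset v) (by rw [Finset.card_erase_of_mem hv, hK.card])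

open scoped Classical in
include hK in
/-- Every face is obtained by removing a vertex. -/
lemma exists_eq_erase {f : Finset E3} (hf : f ⊆ K) (hc : f.card = 3) :
    ∃ v ∈ K, f = K.erase v := by
  have h1 : (K \ f).card = 1 := by rw [Finset.card_sdiff_of_subset hf, hK.card, hc]
  obtain ⟨v, hv⟩ := Finset.card_eq_one.1 h1
  have hvm : v ∈ K \ f := by rw [hv]; simp
  rw [Finset.mem_sdiff] at hvm
  refine ⟨v, hvm.1, ?_⟩
  refine Finset.eq_of_subset_of_card_le (fun y hy => Finset.mem_erase.2
    ⟨fun h => hvm.2 (h ▸ hy), hf hy⟩) ?_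
  rw [Finset.card_erase_of_mem hvm.1, hK.card, hc]

lemma isBounded_cell (K : Finset E3) : Bornology.IsBounded (cell K) :=
  (isBounded_convexHull.2 K.finite_toSet.isBounded)

lemma isCompact_cell (K : Finset E3) : IsCompact (cell K) := K.finite_toSet.isCompact_convexHull ℝ

include hK in
lemma openCell_nonempty : (openCell K).Nonempty := by
  rw [openCell, cell, ← hK.range_basis]
  exact ⟨_, hK.basis.centroid_mem_interior_convexHull⟩

lemma isOpen_openCell (K : Finset E3) : IsOpen (openCell K) := isOpen_interior

lemma convex_openCell (K : Finset E3) : Convex ℝ (openCell K) := (convex_convexHull ℝ _).interior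

lemma openCell_subset_cell (K : Finset E3) : openCell K ⊆ cell K := interior_subset

include hK in
lemma cell_subset_closure : cell K ⊆ closure (openCell K) := by
  have := (convex_convexHull ℝ (K : Set E3)).closure_interior_eq_closure_of_nonempty_interior
    hK.openCell_nonempty
  exact subset_closure.trans this.ge

lemma cell_ae_eq (K : Finset E3) : (cell K : Set E3) =ᵐ[volume] openCell K := by
  refine Filter.EventuallyLE.antisymm ?_ (openCell_subset_cell K).eventuallyLE
  rw [ae_le_set]
  refine measure_mono_null ?_ ((convex_convexHull ℝ (K : Set E3)).addHaar_frontier volume)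
  rw [frontier]
  exact sdiff_subset_sdiff_left subset_closure

lemma setIntegral_openCell (K : Finset E3) (g : E3 → ℝ) :
    ∫ x in openCell K, g x = ∫ x in cell K, g x := (setIntegral_congr_set (cell_ae_eq K)).symm

lemma volume_openCell_lt_top (K : Finset E3) : volume (openCell K) < ⊤ :=
  (measure_mono (openCell_subset_cell K)).trans_lt (isCompact_cell K).measure_lt_top

include hK in
lemma volume_openCell_pos : 0 < volume.real (openCell K) :=
  ENNReal.toReal_pos ((isOpen_openCell K).measure_pos _ hK.openCell_nonempty).ne'
    (volume_openCell_lt_top K).ne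

/-- The coefficient `|K| / |T₃|` in the change of variables from the standard simplex. -/
noncomputable def jac (K : Finset E3) : ℝ := volume.real (cell K) / volume.real (openSimplex 3)

/-- The coefficient `|f| / |T₂|` in the change of variables from the standard simplex. -/
noncomputable def faceJac (f : Finset E3) : ℝ := area f / volume.real (openSimplex 2)

end IsTet

/-- Integrating the constant `1` determines the Jacobian, so it does not depend on how the vertices
are ordered. -/
lemma IsTri.faceInt_eq {f : Finset E3} (hi : IsTri f) {a b c : E3}
    (hf : (f : Set E3) = {a, b, c}) (hab : a ≠ b) (hac : a ≠ c) (hbc : b ≠ c) (g : E3 → ℝ) :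
    faceInt f g = IsTet.faceJac f * ∫ y in openSimplex 2, g (simplexMap ![a, b, c] y) := by
  obtain ⟨J, hJ, h⟩ := exists_faceInt_eq hi.indep hf hab hac hbc
  have h1 := h fun _ => 1
  have h2 := volume_openSimplex_pos 2
  simp only [integral_const, measureReal_restrict_apply_univ, smul_eq_mul, mul_one] at h1
  rw [h, IsTet.faceJac, area, h1, mul_div_assoc, div_self h2.ne', mul_one]

namespace IsTet

variable {K : Finset E3} (hK : IsTet K)

open scoped Classical in
include hK in
/-- Parametrization of a tetrahedron over a face: volume is height times area. -/
lemma setIntegral_eq {a v b c : E3} (hKe : (K : Set E3) = {a, v, b, c}) (hv : v ∉ ({a, b, c} : Set E3))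
    (hab : a ≠ b) (hac : a ≠ c) (hbc : b ≠ c) {n : E3} (hn : ‖n‖ = 1) (hb : ⟪n, b - a⟫ = 0)
    (hc : ⟪n, c - a⟫ = 0) :
    jac K = faceJac (K.erase v) * |⟪n, v - a⟫| ∧
    ∀ g : E3 → ℝ, ∫ x in cell K, g x
      = jac K * ∫ y in openSimplex 3, g (simplexMap ![a, v, b, c] y) := by
  have mem : ∀ z, z ∈ K ↔ z ∈ ({a, v, b, c} : Set E3) := fun z => by rw [← hKe]; simp
  have ha : a ∈ K := (mem a).2 (by simp)
  have hb' : b ∈ K := (mem b).2 (by simp)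
  have hc' : c ∈ K := (mem c).2 (by simp)
  have hv' : v ∈ K := (mem v).2 (by simp)
  simp only [mem_insert_iff, mem_singleton_iff, not_or] at hv
  have hfe : ((K.erase v : Finset E3) : Set E3) = {a, b, c} := by
    ext z
    simp only [Finset.coe_erase, hKe, Set.mem_sdiff, mem_insert_iff, mem_singleton_iff]
    constructor
    · rintro ⟨h | h | h | h, h2⟩ <;> simp_all
    · rintro (rfl | rfl | rfl)
      · exact ⟨by simp, Ne.symm hv.1⟩
      · exact ⟨by simp, Ne.symm hv.2.1⟩
      · exact ⟨by simp, Ne.symm hv.2.2⟩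
  have hH : ⟪n, v - a⟫ ≠ 0 := by
    refine hK.inner_ne_zero hv' (fun y hy hyv => ?_) (by rintro rfl; simp at hn)
    rcases (mem y).1 hy with rfl | rfl | rfl | rfl
    · simp
    · exact absurd rfl hyv
    · exact hb
    · exact hc
  obtain ⟨J, hJ, h1, h2⟩ := exists_simplex_param hn hb hc
    (AffineIndependent.linearIndependent_pair hK.indep ha hb' hc' hab hac hbc)
  have h3 := h2 v hH
  rw [range_quadruple, ← hKe] at h3
  change ∀ g : E3 → ℝ, ∫ x in cell K, g x = _ at h3
  have h4 : J = faceJac (K.erase v) := by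
    have h5 := h1 fun _ => 1
    rw [range_triple, ← hfe] at h5
    change faceInt (K.erase v) _ = _ at h5
    rw [faceJac, area, h5]
    have := volume_openSimplex_pos 2
    simp only [integral_const, measureReal_restrict_apply_univ, smul_eq_mul, mul_one]
    rw [mul_div_assoc, div_self this.ne', mul_one]
  have h5 : jac K = J * |⟪n, v - a⟫| := by
    have h6 := h3 fun _ => 1
    have := volume_openSimplex_pos 3
    simp only [integral_const, measureReal_restrict_apply_univ, smul_eq_mul, mul_one] at h6
    rw [jac, h6, mul_div_assoc, div_self this.ne', mul_one]
  exact ⟨by rw [h5, h4], fun g => by rw [h3, h5]⟩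

open scoped Classical in
/-- Outward unit normals of a tetrahedron, indexed by the opposite vertices. -/
structure OutwardNormals (K : Finset E3) (ν : E3 → E3) : Prop where
  unit : ∀ v ∈ K, ‖ν v‖ = 1
  orth : ∀ v ∈ K, ∀ x ∈ K.erase v, ∀ y ∈ K.erase v, ⟪ν v, y - x⟫ = 0
  outward : ∀ v ∈ K, ∀ x ∈ K.erase v, ⟪ν v, v - x⟫ < 0

-- Divergence theorem for a constant direction along an edge: that direction is tangent to the two
-- faces containing the edge, so only the faces opposite its endpoints contribute.
open scoped Classical in
include hK in
lemma edge_integral {ν : E3 → E3} (hν : OutwardNormals K ν) {g : E3 → ℝ} (hg : ContDiff ℝ 1 g)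
    {a v : E3} (ha : a ∈ K) (hv : v ∈ K) (hav : a ≠ v) :
    ∫ x in cell K, fderiv ℝ g x (v - a)
      = -⟪ν a, a - v⟫ * faceInt (K.erase a) g + ⟪ν v, v - a⟫ * faceInt (K.erase v) g := by
  have h2 : ((K.erase v).erase a).card = 2 := by
    rw [Finset.card_erase_of_mem (Finset.mem_erase.2 ⟨hav, ha⟩), Finset.card_erase_of_mem hv,
      hK.card]
  obtain ⟨b, c, hbc, hbce⟩ := Finset.card_eq_two.1 h2
  have mb : b ∈ (K.erase v).erase a := by rw [hbce]; simp
  have mc : c ∈ (K.erase v).erase a := by rw [hbce]; simp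
  simp only [Finset.mem_erase] at mb mc
  obtain ⟨hba, hbv, hbK⟩ := mb
  obtain ⟨hca, hcv, hcK⟩ := mc
  have hmem : ∀ z, z ∈ K ↔ z = a ∨ z = v ∨ z = b ∨ z = c := by
    intro z
    have h3 := Finset.ext_iff.1 hbce z
    simp only [Finset.mem_erase, Finset.mem_insert, Finset.mem_singleton] at h3
    constructor
    · intro hz
      by_cases h4 : z = a
      · exact Or.inl h4
      by_cases h5 : z = v
      · exact Or.inr (Or.inl h5)
      exact Or.inr (Or.inr (h3.1 ⟨h4, h5, hz⟩))
    · rintro (rfl | rfl | rfl | rfl) <;> assumption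
  have hKe : (K : Set E3) = {a, v, b, c} := by ext z; simp [hmem]
  have hKe2 : (K : Set E3) = {v, a, b, c} := by rw [hKe, Set.insert_comm]
  have fe : ((K.erase v : Finset E3) : Set E3) = {a, b, c} := by
    ext z; simp only [Finset.coe_erase, hKe, Set.mem_sdiff, mem_insert_iff, mem_singleton_iff]
    grind
  have fe2 : ((K.erase a : Finset E3) : Set E3) = {v, b, c} := by
    ext z; simp only [Finset.coe_erase, hKe, Set.mem_sdiff, mem_insert_iff, mem_singleton_iff]
    grind
  obtain ⟨j1, hint⟩ := hK.setIntegral_eq hKe (v := v) (by simp [hav.symm, hbv.symm, hcv.symm])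
    hba.symm hca.symm hbc (hν.unit v hv)
    (hν.orth v hv a (by simp [hav, ha]) b (by simp [hbv, hbK]))
    (hν.orth v hv a (by simp [hav, ha]) c (by simp [hcv, hcK]))
  obtain ⟨j2, -⟩ := hK.setIntegral_eq hKe2 (v := a) (by simp [hav, hba.symm, hca.symm])
    hbv.symm hcv.symm hbc (hν.unit a ha)
    (hν.orth a ha v (by simp [hav.symm, hv]) b (by simp [hba, hbK]))
    (hν.orth a ha v (by simp [hav.symm, hv]) c (by simp [hca, hcK]))
  rw [abs_of_neg (hν.outward v hv a (by simp [hav, ha]))] at j1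
  rw [abs_of_neg (hν.outward a ha v (by simp [hav.symm, hv]))] at j2
  rw [hint, integral_deriv_simplexMap hg,
    (hK.isTri_erase hv).faceInt_eq fe hba.symm hca.symm hbc,
    (hK.isTri_erase ha).faceInt_eq fe2 hbv.symm hcv.symm hbc, mul_sub]
  -- The same volume factor is written as height times area over one face in the first term and over
  -- the other face in the second.
  conv_lhs => enter [1]; rw [j2]
  conv_lhs => enter [2]; rw [j1]
  ring

open scoped Classical in
include hK in
/-- The divergence theorem on a tetrahedron for the field `g w` with a constant vector `w`. -/
theorem integral_fderiv {ν : E3 → E3} (hν : OutwardNormals K ν) {g : E3 → ℝ} (hg : ContDiff ℝ 1 g)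
    (w : E3) :
    ∫ x in cell K, fderiv ℝ g x w = ∑ v ∈ K, ⟪ν v, w⟫ * faceInt (K.erase v) g := by
  have hne : K.Nonempty := Finset.card_pos.1 (by rw [hK.card]; norm_num)
  obtain ⟨a, ha⟩ := hne
  -- The derivatives of the barycentric coordinates along `w` are the coefficients of `w` in the
  -- edges issuing from `a`; this reduces the claim to `edge_integral`.
  set l : K → ℝ := fun v => (hK.coord v).linear w with hl
  have lin : ∀ v : K, l v = hK.coord v (a + w) - hK.coord v a := by
    intro v
    have := (hK.coord v).linearMap_vsub (a + w) a
    simpa [hl] using this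
  have hsum0 : ∑ v, l v = 0 := by
    simp only [lin, Finset.sum_sub_distrib, hK.sum_coord, sub_self]
  have hsumw : ∑ v, l v • ((v : E3) - a) = w := by
    simp only [smul_sub, Finset.sum_sub_distrib, ← Finset.sum_smul, hsum0, zero_smul, sub_zero]
    simp only [lin, sub_smul, Finset.sum_sub_distrib, hK.sum_coord_smul, add_sub_cancel_left]
  have hin : ∀ v : K, ∀ x ∈ K.erase (v : E3), ⟪ν v, w⟫ = ⟪ν v, v - x⟫ * l v := by
    intro v x hx
    have h1 := hK.inner_eq_coord (x := x) v.2
      (fun y hy hyv => hν.orth v v.2 x hx y (Finset.mem_erase.2 ⟨hyv, hy⟩))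
    have h2 : ⟪ν v, w⟫ = ⟪ν v, a + w - x⟫ - ⟪ν v, a - x⟫ := by
      rw [← inner_sub_right]; congr 1; abel
    rw [h2, h1, h1 a, lin v]
    ring
  have hint : ∀ d : E3, IntegrableOn (fun x => fderiv ℝ g x d) (cell K) := fun d =>
    ((hg.continuous_fderiv (by norm_num)).clm_apply
      continuous_const).continuousOn.integrableOn_compact (isCompact_cell K)
  have e1 : ∫ x in cell K, fderiv ℝ g x w
      = ∑ v : K, l v * ∫ x in cell K, fderiv ℝ g x ((v : E3) - a) := by
    conv_lhs => rw [← hsumw]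
    simp only [map_sum, map_smul, smul_eq_mul]
    rw [integral_finsetSum _ fun v _ => (hint _).const_mul _]
    simp only [integral_const_mul]
  have e2 : ∀ v : K, l v * ∫ x in cell K, fderiv ℝ g x ((v : E3) - a)
      = (if (v : E3) = a then 0 else -l v * ⟪ν a, a - v⟫ * faceInt (K.erase a) g)
        + (if (v : E3) = a then 0 else ⟪ν v, w⟫ * faceInt (K.erase v) g) := by
    intro v
    split_ifs with h
    · rw [h]; simp
    · rw [hK.edge_integral hν hg ha v.2 (Ne.symm h),
        hin v a (Finset.mem_erase.2 ⟨Ne.symm h, ha⟩)]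
      ring
  rw [e1, Finset.sum_congr rfl fun v _ => e2 v, Finset.sum_add_distrib]
  -- Every edge contributes to the face opposite `a`. Since the `l v` sum to zero, these
  -- contributions collapse to the single term belonging to `a`.
  have e3 : ∑ v : K, (if (v : E3) = a then 0 else -l v * ⟪ν a, a - v⟫ * faceInt (K.erase a) g)
      = ⟪ν a, w⟫ * faceInt (K.erase a) g := by
    have h1 : ∃ x, x ∈ K.erase a := Finset.card_pos.1 (by
      rw [Finset.card_erase_of_mem ha, hK.card]; norm_num)
    obtain ⟨x, hx⟩ := h1
    have h2 : ∀ v : K, (if (v : E3) = a then 0 else -l v * ⟪ν a, a - v⟫ * faceInt (K.erase a) g)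
        = -(if v = ⟨a, ha⟩ then 0 else l v) * ⟪ν a, a - x⟫ * faceInt (K.erase a) g := by
      intro v
      by_cases h : (v : E3) = a
      · have : v = ⟨a, ha⟩ := Subtype.ext h
        simp [this]
      · have h' : v ≠ ⟨a, ha⟩ := fun h2 => h (congrArg Subtype.val h2)
        rw [if_neg h, if_neg h']
        have h3 := hν.orth a ha x hx v (Finset.mem_erase.2 ⟨h, v.2⟩)
        have h4 : ⟪ν a, a - (v : E3)⟫ = ⟪ν a, a - x⟫ := by
          have : a - (v : E3) = (a - x) - ((v : E3) - x) := by abel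
          rw [this, inner_sub_right, h3, sub_zero]
        rw [h4]
    rw [Finset.sum_congr rfl fun v _ => h2 v, ← Finset.sum_mul, ← Finset.sum_mul,
      Finset.sum_neg_distrib, hin ⟨a, ha⟩ x hx]
    have h5 : ∑ v : K, (if v = ⟨a, ha⟩ then 0 else l v) = - l ⟨a, ha⟩ := by
      have h6 := Finset.sum_erase_add Finset.univ l (Finset.mem_univ (⟨a, ha⟩ : K))
      rw [hsum0] at h6
      have h7 : ∑ v : K, (if v = ⟨a, ha⟩ then 0 else l v)
          = ∑ v ∈ Finset.univ.erase (⟨a, ha⟩ : K), l v := by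
        rw [← Finset.sum_erase_add Finset.univ _ (Finset.mem_univ (⟨a, ha⟩ : K)), if_pos rfl,
          add_zero]
        exact Finset.sum_congr rfl fun v hv => if_neg (Finset.ne_of_mem_erase hv)
      linarith
    rw [h5]; ring
  have e4 : ∑ v : K, (if (v : E3) = a then 0 else ⟪ν v, w⟫ * faceInt (K.erase v) g)
      = ∑ v ∈ K.erase a, ⟪ν v, w⟫ * faceInt (K.erase v) g := by
    rw [Finset.sum_coe_sort K fun v => if v = a then 0 else ⟪ν v, w⟫ * faceInt (K.erase v) g,
      ← Finset.sum_erase_add K _ ha, if_pos rfl, add_zero]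
    exact Finset.sum_congr rfl fun v hv => if_neg (Finset.ne_of_mem_erase hv)
  rw [e3, e4, ← Finset.sum_erase_add K _ ha, add_comm]

lemma divg_eq_sum {F : E3 → E3} {x : E3} (hF : DifferentiableAt ℝ F x) :
    divg F x = ∑ i, fderiv ℝ (fun y => F y i) x (EuclideanSpace.single i 1) := by
  simp only [divg, gradM, Matrix.trace, Matrix.diag, Matrix.of_apply]
  exact Finset.sum_congr rfl fun i _ => fderiv_apply_coord hF _ i

open scoped Classical in
include hK in
/-- The divergence theorem on a tetrahedron. -/
theorem integral_divg {ν : E3 → E3} (hν : OutwardNormals K ν) {F : E3 → E3} (hF : ContDiff ℝ 1 F) :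
    ∫ x in cell K, divg F x = ∑ v ∈ K, faceInt (K.erase v) fun x => ⟪F x, ν v⟫ := by
  have hFi : ∀ i, ContDiff ℝ 1 fun x => F x i := (contDiff_piLp 2).1 hF
  have e1 : ∀ x, divg F x = ∑ i, fderiv ℝ (fun y => F y i) x (EuclideanSpace.single i 1) :=
    fun x => divg_eq_sum (hF.differentiable (by norm_num) x)
  simp only [e1]
  rw [integral_finsetSum]
  · simp only [hK.integral_fderiv hν (hFi _)]
    rw [Finset.sum_comm]
    refine Finset.sum_congr rfl fun v hv => ?_
    have htri := hK.isTri_erase hv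
    have h2 : ∀ x, ⟪F x, ν v⟫ = ∑ i, ν v i * F x i := fun x => by
      rw [PiLp.inner_apply]; simp
    simp only [h2]
    rw [faceInt, integral_finsetSum _ fun i _ =>
      (integrableOn_cell_face htri (hFi i).continuous.continuousOn).const_mul _]
    refine Finset.sum_congr rfl fun i _ => ?_
    rw [integral_const_mul, EuclideanSpace.inner_single_right]
    simp [faceInt]
  · intro i _
    exact (((hFi i).continuous_fderiv (by norm_num)).clm_apply
      continuous_const).continuousOn.integrableOn_compact (isCompact_cell K)

/-- Unit normals can be oriented outward. -/
lemma exists_outwardNormals {m : E3 → E3} (hK : IsTet K) (hm : ∀ v ∈ K, m v ≠ 0)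
    (ho : ∀ v ∈ K, ∀ x ∈ K, ∀ y ∈ K, x ≠ v → y ≠ v → ⟪m v, y - x⟫ = 0) :
    ∃ c : E3 → ℝ, OutwardNormals K fun v => c v • m v := by
  classical
  have h1 : ∀ v ∈ K, ∃ c : ℝ, ‖c • m v‖ = 1 ∧ ∀ x ∈ K.erase v, ⟪c • m v, v - x⟫ < 0 := by
    intro v hv
    obtain ⟨x, hx⟩ : ∃ x, x ∈ K.erase v := Finset.card_pos.1 (by
      rw [Finset.card_erase_of_mem hv, hK.card]; norm_num)
    have hx' := Finset.mem_erase.1 hx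
    have hne := hK.inner_ne_zero (x := x) hv (fun y hy hyv => ho v hv x hx'.2 y hy hx'.1 hyv)
      (hm v hv)
    have hcst : ∀ y ∈ K.erase v, ⟪m v, v - y⟫ = ⟪m v, v - x⟫ := by
      intro y hy
      have hy' := Finset.mem_erase.1 hy
      have : v - y = (v - x) - (y - x) := by abel
      rw [this, inner_sub_right, ho v hv x hx'.2 y hy'.2 hx'.1 hy'.1, sub_zero]
    have hnp : 0 < ‖m v‖ := norm_pos_iff.2 (hm v hv)
    rcases hne.lt_or_gt with h | h
    · refine ⟨‖m v‖⁻¹, ?_, fun y hy => ?_⟩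
      · rw [norm_smul, norm_inv, norm_norm, inv_mul_cancel₀ hnp.ne']
      · rw [real_inner_smul_left, hcst y hy]
        exact mul_neg_of_pos_of_neg (inv_pos.2 hnp) h
    · refine ⟨-‖m v‖⁻¹, ?_, fun y hy => ?_⟩
      · rw [norm_smul, norm_neg, norm_inv, norm_norm, inv_mul_cancel₀ hnp.ne']
      · rw [real_inner_smul_left, hcst y hy]
        exact mul_neg_of_neg_of_pos (neg_lt_zero.2 (inv_pos.2 hnp)) h
  choose! c hc using h1
  refine ⟨c, fun v hv => (hc v hv).1, fun v hv x hx y hy => ?_, fun v hv => (hc v hv).2⟩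
  rw [Finset.mem_erase] at hx hy
  rw [real_inner_smul_left, ho v hv x hx.2 y hy.2 hx.1 hy.1, mul_zero]

end IsTet

/-! ### Equivalence of norms on finite-dimensional spaces -/

/-- `S ∘ T⁻¹` is linear on the finite-dimensional range of `T`, hence bounded. The constants on the
reference tetrahedron come from this fact. -/
lemma exists_bound_of_injective {W F G : Type*} [AddCommGroup W] [Module ℝ W]
    [FiniteDimensional ℝ W] [NormedAddCommGroup F] [NormedSpace ℝ F] [NormedAddCommGroup G]
    [NormedSpace ℝ G] (T : W →ₗ[ℝ] F) (hT : Function.Injective T) (S : W →ₗ[ℝ] G) :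
    ∃ C : ℝ, 0 < C ∧ ∀ w, ‖S w‖ ≤ C * ‖T w‖ := by
  let e := LinearEquiv.ofInjective T hT
  have : FiniteDimensional ℝ (LinearMap.range T) := inferInstance
  let L := LinearMap.toContinuousLinearMap (S ∘ₗ (e.symm : LinearMap.range T →ₗ[ℝ] W))
  refine ⟨‖L‖ + 1, by positivity, fun w => ?_⟩
  have h1 : S w = L (e w) := by simp [L]
  have h2 : ‖(e w : LinearMap.range T)‖ = ‖T w‖ := rfl
  rw [h1]
  refine (L.le_opNorm _).trans ?_
  rw [h2]
  have := norm_nonneg (T w)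
  nlinarith

/-! ### The reference tetrahedron -/

/-- The standard basis vectors of `E3`. -/
noncomputable def stdE (i : Fin 3) : E3 := EuclideanSpace.single i 1

lemma stdE_apply (i j : Fin 3) : stdE i j = if j = i then 1 else 0 := by
  simp [stdE]

lemma inner_stdE (i : Fin 3) (x : E3) : ⟪stdE i, x⟫ = x i := by
  simp [stdE, EuclideanSpace.inner_single_left]

lemma stdE_injective : Function.Injective stdE := by
  intro i j h
  have := congrArg (fun x : E3 => x i) h
  simp only [stdE_apply] at this
  by_contra hne
  simp [hne] at this

lemma stdE_ne_zero (i : Fin 3) : stdE i ≠ 0 := by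
  intro h
  have := congrArg (fun x : E3 => x i) h
  simp [stdE_apply] at this

open scoped Classical in
/-- The reference tetrahedron. -/
noncomputable def refTet : Finset E3 := insert 0 (Finset.univ.image stdE)

lemma mem_refTet {x : E3} : x ∈ refTet ↔ x = 0 ∨ ∃ i, x = stdE i := by
  simp [refTet, eq_comm]

lemma isTet_refTet : IsTet refTet := by
  classical
  have hcard : refTet.card = 4 := by
    rw [refTet, Finset.card_insert_of_notMem, Finset.card_image_of_injective _ stdE_injective]
    · simp
    · simp [stdE_ne_zero]
  refine ⟨hcard, ?_⟩
  have h1 : affineSpan ℝ (refTet : Set E3) = ⊤ := by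
    rw [AffineSubspace.affineSpan_eq_top_iff_vectorSpan_eq_top_of_nonempty _ _ _
      ⟨0, by simp [refTet]⟩, eq_top_iff]
    intro x _
    have : x = ∑ i, x i • (stdE i -ᵥ 0) := by
      ext j
      simp [stdE_apply]
    rw [this]
    refine Submodule.sum_mem _ fun i _ => Submodule.smul_mem _ _ ?_
    exact vsub_mem_vectorSpan ℝ (by simp [refTet]) (by simp [refTet])
  have h2 := affineIndependent_iff_finrank_vectorSpan_eq ℝ ((↑) : refTet → E3) (n := 3)
    (by simp [hcard])
  rw [h2]
  have h3 : vectorSpan ℝ (range ((↑) : refTet → E3)) = ⊤ := by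
    rw [← direction_affineSpan]
    simp [h1]
  rw [h3]; simp

lemma refTet_coord_stdE {i : Fin 3} (h : stdE i ∈ refTet) (x : E3) :
    isTet_refTet.coord ⟨stdE i, h⟩ x = x i := by
  have := isTet_refTet.inner_eq_coord (x := 0) (n := stdE i) h (fun y hy hne => by
    rcases mem_refTet.1 hy with rfl | ⟨j, rfl⟩
    · simp
    · rw [sub_zero, inner_stdE, stdE_apply, if_neg]
      rintro rfl; exact hne rfl) x
  rw [sub_zero, sub_zero, inner_stdE, inner_stdE, stdE_apply, if_pos rfl, one_mul] at this
  exact this.symm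

lemma stdE_mem_refTet (i : Fin 3) : stdE i ∈ refTet := mem_refTet.2 (Or.inr ⟨i, rfl⟩)

lemma zero_mem_refTet : (0 : E3) ∈ refTet := mem_refTet.2 (Or.inl rfl)

lemma pos_of_mem_openCell_refTet {x : E3} (hx : x ∈ openCell refTet) (i : Fin 3) : 0 < x i := by
  rw [isTet_refTet.openCell_eq] at hx
  rw [← refTet_coord_stdE (stdE_mem_refTet i)]
  exact hx _

lemma norm_le_one_of_mem_cell_refTet {x : E3} (hx : x ∈ cell refTet) : ‖x‖ ≤ 1 := by
  have : cell refTet ⊆ Metric.closedBall 0 1 := by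
    refine convexHull_min (fun y hy => ?_) (convex_closedBall _ _)
    rcases mem_refTet.1 hy with rfl | ⟨j, rfl⟩
    · simp
    · simp [stdE]
  simpa using this hx

namespace IsTet

variable {K : Finset E3} (hK : IsTet K)

open scoped Classical in
lemma mem_openFace_erase {v : E3} (hv : v ∈ K) {x : E3} (h0 : hK.coord ⟨v, hv⟩ x = 0)
    (hpos : ∀ u : K, (u : E3) ≠ v → 0 < hK.coord u x) : x ∈ openFace (K.erase v) := by
  set w : E3 → ℝ := fun y => if h : y ∈ K then hK.coord ⟨y, h⟩ x else 0 with hw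
  have hw' : ∀ u : K, w u = hK.coord u x := fun u => by simp [hw]
  have hwv : w v = 0 := by rw [hw' ⟨v, hv⟩, h0]
  refine ⟨w, fun y hy => ?_, ?_, ?_⟩
  · rw [Finset.mem_erase] at hy
    rw [hw' ⟨y, hy.2⟩]
    exact hpos _ hy.1
  · rw [Finset.sum_erase _ hwv, ← hK.sum_coord x, ← Finset.sum_coe_sort K w]
    exact Finset.sum_congr rfl fun u _ => hw' u
  · rw [Finset.sum_erase _ (by rw [hwv, zero_smul]),
      ← Finset.sum_coe_sort K fun y => w y • y]
    conv_rhs => rw [← hK.sum_coord_smul x]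
    exact Finset.sum_congr rfl fun u _ => by rw [hw']

open scoped Classical in
lemma coord_of_mem_openFace {v : E3} (hv : v ∈ K) {x : E3} (hx : x ∈ openFace (K.erase v)) :
    hK.coord ⟨v, hv⟩ x = 0 ∧ ∀ u : K, (u : E3) ≠ v → 0 < hK.coord u x := by
  obtain ⟨w, h0, h1, rfl⟩ := hx
  set w' : E3 → ℝ := fun y => if y = v then 0 else w y with hw'
  have e0 : ∀ y ∈ K.erase v, w y = w' y := fun y hy => by
    simp [hw', Finset.ne_of_mem_erase hy]
  have e1 : ∑ y ∈ K.erase v, w y • y = ∑ y ∈ K, w' y • y := by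
    rw [Finset.sum_congr rfl fun y hy => by rw [e0 y hy], Finset.sum_erase _ (by simp [hw'])]
  have e2 : ∑ y ∈ K, w' y = 1 := by
    rw [← h1, Finset.sum_congr rfl e0, Finset.sum_erase _ (by simp)]
  rw [e1]
  refine ⟨by rw [hK.coord_sum e2]; simp [hw'], fun u hu => ?_⟩
  rw [hK.coord_sum e2, ← e0 u (Finset.mem_erase.2 ⟨hu, u.2⟩)]
  exact h0 u (Finset.mem_erase.2 ⟨hu, u.2⟩)

end IsTet

/-- An affine isomorphism from the reference tetrahedron onto `K`. -/
structure RefMap (K : Finset E3) where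
  A : E3 ≃L[ℝ] E3
  b : E3
  image : (fun x => A x + b) '' (refTet : Set E3) = K

/-! ### Transport of cells, integrals and norms by the affine map. -/

namespace RefMap

variable {K : Finset E3} (Φ : RefMap K)

/-- The underlying map. -/
noncomputable def map (x : E3) : E3 := Φ.A x + Φ.b

/-- The inverse map. -/
noncomputable def inv (x : E3) : E3 := Φ.A.symm (x - Φ.b)

@[simp] lemma inv_map (x : E3) : Φ.inv (Φ.map x) = x := by simp [map, inv]

@[simp] lemma map_inv (x : E3) : Φ.map (Φ.inv x) = x := by simp [map, inv]

lemma map_injective : Function.Injective Φ.map := Function.LeftInverse.injective Φ.inv_map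

lemma map_mem_polyVec : Φ.map ∈ polyVec 1 := affine_mem_polyVec (Φ.A : E3 →L[ℝ] E3) Φ.b

lemma inv_mem_polyVec : Φ.inv ∈ polyVec 1 := by
  have : Φ.inv = fun x => (Φ.A.symm : E3 →L[ℝ] E3) x + (-Φ.A.symm Φ.b) := by
    ext1 x; simp [inv, sub_eq_add_neg]
  rw [this]
  exact affine_mem_polyVec _ _

lemma map_sub_map (x y : E3) : Φ.map x - Φ.map y = Φ.A (x - y) := by simp [map]

lemma image_cell : Φ.map '' cell refTet = cell K := by
  let f : E3 →ᵃ[ℝ] E3 := (Φ.A : E3 →ₗ[ℝ] E3).toAffineMap + AffineMap.const ℝ E3 Φ.b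
  have hf : ⇑f = Φ.map := by ext1 x; simp [f, map]
  rw [cell, cell, ← hf, AffineMap.image_convexHull, hf]
  congr 1
  exact Φ.image

lemma map_mem_cell {x : E3} (hx : x ∈ cell refTet) : Φ.map x ∈ cell K :=
  Φ.image_cell ▸ mem_image_of_mem _ hx

lemma inv_mem_cell {x : E3} (hx : x ∈ cell K) : Φ.inv x ∈ cell refTet := by
  rw [← Φ.image_cell] at hx
  obtain ⟨y, hy, rfl⟩ := hx
  simpa using hy

lemma map_mem {x : E3} (hx : x ∈ refTet) : Φ.map x ∈ K := by
  have : Φ.map x ∈ (K : Set E3) := Φ.image ▸ mem_image_of_mem _ hx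
  exact this

lemma inv_mem {x : E3} (hx : x ∈ K) : Φ.inv x ∈ refTet := by
  have h : x ∈ (K : Set E3) := hx
  rw [← Φ.image] at h
  obtain ⟨y, hy, rfl⟩ := h
  have : Φ.inv (Φ.map y) ∈ refTet := by simpa using hy
  exact this

lemma hasFDerivAt_map (x : E3) : HasFDerivAt Φ.map (Φ.A : E3 →L[ℝ] E3) x :=
  (Φ.A : E3 →L[ℝ] E3).hasFDerivAt.add_const Φ.b

/-- Change of variables on the element. -/
lemma setIntegral (g : E3 → ℝ) : ∫ x in cell K, g x
    = (volume.real (cell K) / volume.real (cell refTet)) * ∫ x in cell refTet, g (Φ.map x) := by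
  have hm : MeasurableSet (cell refTet) := (IsTet.isCompact_cell _).isClosed.measurableSet
  have h1 : ∀ g : E3 → ℝ, ∫ x in cell K, g x
      = |(Φ.A : E3 →L[ℝ] E3).det| * ∫ x in cell refTet, g (Φ.map x) := by
    intro g
    rw [← Φ.image_cell, integral_image_eq_integral_abs_det_fderiv_smul volume hm
      (fun x _ => (Φ.hasFDerivAt_map x).hasFDerivWithinAt) Φ.map_injective.injOn]
    simp only [smul_eq_mul, integral_const_mul]
  -- The constant function identifies the determinant as a ratio of volumes.
  have h2 := h1 fun _ => 1
  simp only [integral_const, measureReal_restrict_apply_univ, smul_eq_mul, mul_one] at h2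
  have h3 : volume.real (cell refTet) ≠ 0 := by
    have := isTet_refTet.volume_openCell_pos
    rw [measureReal_congr (IsTet.cell_ae_eq refTet)]
    exact this.ne'
  rw [h1, h2, mul_div_assoc, div_self h3, mul_one]

/-- Change of variables on the faces. -/
lemma exists_faceInt {f f' : Finset E3} (hf : IsTri f) (hf' : IsTri f')
    (h : Φ.map '' (f : Set E3) = f') : ∃ J : ℝ, 0 < J ∧
      ∀ g : E3 → ℝ, faceInt f' g = J * faceInt f fun x => g (Φ.map x) := by
  obtain ⟨a, b, c, hab, hac, hbc, hfe⟩ := hf.exists_vertices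
  have hfe' : (f' : Set E3) = {Φ.map a, Φ.map b, Φ.map c} := by
    rw [← h, hfe]; simp [image_insert_eq]
  obtain ⟨J, hJ, h1⟩ := exists_faceInt_eq hf.indep hfe hab hac hbc
  obtain ⟨J', hJ', h2⟩ := exists_faceInt_eq hf'.indep hfe' (Φ.map_injective.ne hab)
    (Φ.map_injective.ne hac) (Φ.map_injective.ne hbc)
  refine ⟨J' / J, div_pos hJ' hJ, fun g => ?_⟩
  have h3 : ∀ y, simplexMap ![Φ.map a, Φ.map b, Φ.map c] y = Φ.map (simplexMap ![a, b, c] y) := by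
    intro y
    simp [simplexMap, map]
    module
  rw [h1, h2]
  simp only [h3]
  field_simp

/-- The columns of `A` are edges of `K`, and each of the three coordinates of `x` is at most `‖x‖`.
-/
lemma norm_A_le : ‖(Φ.A : E3 →L[ℝ] E3)‖ ≤ 3 * Metric.diam (cell K) := by
  refine ContinuousLinearMap.opNorm_le_bound _ (by positivity) fun x => ?_
  have hx : x = ∑ i, x i • stdE i := by
    ext j; simp [stdE_apply]
  have h1 : ∀ i, ‖Φ.A (stdE i)‖ ≤ Metric.diam (cell K) := by
    intro i
    have h2 : Φ.A (stdE i) = Φ.map (stdE i) - Φ.map 0 := by rw [map_sub_map, sub_zero]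
    rw [h2, ← dist_eq_norm]
    exact Metric.dist_le_diam_of_mem (IsTet.isBounded_cell K)
      (subset_convexHull ℝ _ (Φ.map_mem (stdE_mem_refTet i)))
      (subset_convexHull ℝ _ (Φ.map_mem zero_mem_refTet))
  conv_lhs => rw [hx]
  simp only [map_sum, map_smul, ContinuousLinearEquiv.coe_coe]
  refine (norm_sum_le _ _).trans ?_
  have h3 : ∀ i ∈ Finset.univ, ‖x i • Φ.A (stdE i)‖ ≤ ‖x‖ * Metric.diam (cell K) := fun i _ => by
    rw [norm_smul]
    exact mul_le_mul (PiLp.norm_apply_le x i) (h1 i) (norm_nonneg _) (norm_nonneg _)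
  refine (Finset.sum_le_sum h3).trans ?_
  simp only [Finset.sum_const, Finset.card_univ, Fintype.card_fin, nsmul_eq_mul]
  apply le_of_eq
  push_cast; ring

/-- The inverse map sends a ball of radius `ρ` into the reference tetrahedron, which lies in the
unit ball, so displacements within the ball have images of norm at most two. -/
lemma norm_A_symm_le {x : E3} {ρ : ℝ} (hρ : 0 < ρ) (hb : Metric.ball x ρ ⊆ cell K) :
    ‖(Φ.A.symm : E3 →L[ℝ] E3)‖ ≤ 4 / ρ := by
  refine ContinuousLinearMap.opNorm_le_bound _ (by positivity) fun w => ?_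
  rcases eq_or_ne w 0 with rfl | hw
  · simp
  have hwn : 0 < ‖w‖ := norm_pos_iff.2 hw
  -- Half the radius keeps the displaced point inside the open ball; this is why `4 / ρ` appears
  -- rather than `2 / ρ`.
  set t : ℝ := ρ / 2 / ‖w‖ with ht
  have htp : 0 < t := by positivity
  have h1 : x + t • w ∈ cell K := by
    apply hb
    rw [mem_ball_iff_norm, add_sub_cancel_left, norm_smul, Real.norm_of_nonneg htp.le, ht,
      div_mul_cancel₀ _ hwn.ne']
    linarith
  have h2 : x ∈ cell K := hb (Metric.mem_ball_self hρ)
  have h3 : Φ.inv (x + t • w) - Φ.inv x = t • Φ.A.symm w := by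
    rw [inv, inv, ← map_sub, ← map_smul]; congr 1; abel
  have h4 : t * ‖Φ.A.symm w‖ ≤ 2 := by
    have := norm_sub_le (Φ.inv (x + t • w)) (Φ.inv x)
    rw [h3, norm_smul, Real.norm_of_nonneg htp.le] at this
    linarith [norm_le_one_of_mem_cell_refTet (Φ.inv_mem_cell h1),
      norm_le_one_of_mem_cell_refTet (Φ.inv_mem_cell h2)]
  have h5 : 4 / ρ * ‖w‖ = 2 / t := by rw [ht]; field_simp; norm_num
  rw [h5, le_div_iff₀ htp]
  simpa [mul_comm] using h4

end RefMap

/-- The edges from one vertex form a basis; the linear part sends the standard basis to it. -/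
lemma IsTet.exists_refMap {K : Finset E3} (hK : IsTet K) : Nonempty (RefMap K) := by
  classical
  obtain ⟨a, ha⟩ : K.Nonempty := Finset.card_pos.1 (by rw [hK.card]; norm_num)
  let B := hK.basis.basisOf ⟨a, ha⟩
  have hcard : Fintype.card { j : K // j ≠ ⟨a, ha⟩ } = 3 := by
    rw [Fintype.card_subtype_compl]; simp [hK.card]
  let e := Fintype.equivFinOfCardEq hcard
  let L := (EuclideanSpace.basisFun (Fin 3) ℝ).toBasis.equiv (B.reindex e) (Equiv.refl _)
  have hL : ∀ i, L (stdE i) = ((e.symm i : K) : E3) - a := by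
    intro i
    have h1 : stdE i = (EuclideanSpace.basisFun (Fin 3) ℝ).toBasis i := by simp [stdE]
    rw [h1, Module.Basis.equiv_apply]
    simp only [Equiv.refl_apply, Module.Basis.reindex_apply, B, AffineBasis.basisOf_apply]
    rfl
  refine ⟨⟨L.toContinuousLinearEquiv, a, ?_⟩⟩
  ext z
  simp only [mem_image, Finset.mem_coe]
  constructor
  · rintro ⟨x, hx, rfl⟩
    rcases mem_refTet.1 hx with rfl | ⟨i, rfl⟩
    · simpa using ha
    · simp [hL]
  · intro hz
    by_cases h : z = a
    · exact ⟨0, zero_mem_refTet, by simp [h]⟩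
    · refine ⟨stdE (e ⟨⟨z, hz⟩, fun h2 => h (congrArg Subtype.val h2)⟩), stdE_mem_refTet _, ?_⟩
      simp [hL]

/-! ### Inverse inequalities -/

lemma IsTet.integrableOn_cell {F : Type*} [NormedAddCommGroup F] (K : Finset E3) {g : E3 → F}
    (hg : ContinuousOn g (cell K)) : IntegrableOn g (cell K) :=
  hg.integrableOn_compact (isCompact_cell K)

lemma IsTet.memLp_cell {F : Type*} [NormedAddCommGroup F] (K : Finset E3) {g : E3 → F}
    (hg : ContinuousOn g (cell K)) (q : ℝ≥0∞) : MemLp g q (volume.restrict (cell K)) := by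
  have hc := isCompact_cell K
  obtain ⟨C, hC⟩ := hc.exists_bound_of_continuousOn hg
  have : IsFiniteMeasure (volume.restrict (cell K)) := ⟨by
    rw [Measure.restrict_apply_univ]; exact hc.measure_lt_top⟩
  exact MemLp.of_bound (hg.aestronglyMeasurable_of_isCompact hc hc.isClosed.measurableSet) C
    (ae_restrict_of_forall_mem hc.isClosed.measurableSet hC)

lemma IsTet.eq_zero_of_integral_eq_zero {K : Finset E3} {g : E3 → ℝ} (hg : Continuous g)
    (h0 : ∀ x ∈ openCell K, 0 ≤ g x) (h : ∫ x in cell K, g x = 0) : ∀ x ∈ openCell K, g x = 0 := by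
  rw [← setIntegral_openCell, setIntegral_eq_zero_iff_of_nonneg_ae
    ((ae_restrict_of_forall_mem (isOpen_openCell K).measurableSet h0))
    ((IsTet.integrableOn_cell K hg.continuousOn).mono_set (openCell_subset_cell K))] at h
  exact Measure.eqOn_open_of_ae_eq h (isOpen_openCell K) hg.continuousOn continuousOn_const

/-- Restriction of continuous functions to the closed reference tetrahedron. -/
noncomputable def restrictRef {W F : Type*} [AddCommGroup W] [Module ℝ W] [NormedAddCommGroup F]
    [NormedSpace ℝ F] (T : W →ₗ[ℝ] (E3 → F)) (hT : ∀ w, Continuous (T w)) :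
    W →ₗ[ℝ] C(cell refTet, F) where
  toFun w := ⟨fun x => T w x, (hT w).comp continuous_subtype_val⟩
  map_add' a b := by ext x; simp
  map_smul' c a := by ext x; simp

instance : CompactSpace (cell refTet) := isCompact_iff_compactSpace.1 (IsTet.isCompact_cell refTet)

/-- Restriction of continuous functions to the reference tetrahedron, in `L²`. -/
noncomputable def restrictL2 {W : Type*} [AddCommGroup W] [Module ℝ W]
    (T : W →ₗ[ℝ] (E3 → ℝ)) (hT : ∀ w, MemLp (T w) 2 (volume.restrict (cell refTet))) :
    W →ₗ[ℝ] Lp ℝ 2 (volume.restrict (cell refTet)) where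
  toFun w := (hT w).toLp (T w)
  map_add' a b := by
    rw [← MemLp.toLp_add]; simp only [map_add]
  map_smul' c a := by
    simp only [map_smul, RingHom.id_apply, ← MemLp.toLp_const_smul]

lemma norm_toLp_sq {Ω : Set E3} {f : E3 → ℝ} (hf : MemLp f 2 (volume.restrict Ω)) :
    ‖hf.toLp f‖ ^ 2 = ∫ x in Ω, f x ^ 2 := by
  rw [← real_inner_self_eq_norm_sq, L2.inner_def]
  refine integral_congr_ae ?_
  filter_upwards [hf.coeFn_toLp] with x hx
  rw [hx]; simp [sq]

/-- Equivalence of norms: a polynomial with zero `L²` norm vanishes on the open cell and therefore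
everywhere, so the `L²` norm dominates the maximum norm on this finite-dimensional space. -/
lemma exists_sq_le_refTet (k : ℕ) : ∃ C : ℝ, 0 < C ∧ ∀ p ∈ polyFun k, ∀ x ∈ cell refTet,
    p x ^ 2 ≤ C * ∫ x in cell refTet, p x ^ 2 := by
  have hc : ∀ p : polyFun k, Continuous p.1 := fun p =>
    (contDiff_of_mem_polyFun p.2 (n := 0)).continuous
  have hL : ∀ p : polyFun k, MemLp p.1 2 (volume.restrict (cell refTet)) := fun p =>
    IsTet.memLp_cell _ (hc p).continuousOn _
  have hinj : Function.Injective (restrictL2 (polyFun k).subtype hL) := by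
    rw [← LinearMap.ker_eq_bot, LinearMap.ker_eq_bot']
    intro p hp
    have h1 : ‖(hL p).toLp p.1‖ ^ 2 = 0 := by
      have : (hL p).toLp p.1 = 0 := hp
      rw [this]; simp
    rw [norm_toLp_sq] at h1
    have h2 := IsTet.eq_zero_of_integral_eq_zero (K := refTet) ((hc p).pow 2)
      (fun x _ => sq_nonneg _) h1
    exact Subtype.ext (polyFun_eq_zero_of_isOpen p.2 (IsTet.isOpen_openCell refTet)
      isTet_refTet.openCell_nonempty fun x hx => by simpa using h2 x hx)
  obtain ⟨C, hC, h⟩ := exists_bound_of_injective _ hinj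
    (restrictRef (polyFun k).subtype hc)
  refine ⟨C ^ 2, by positivity, fun p hp x hx => ?_⟩
  have h1 := h ⟨p, hp⟩
  have h2 : ‖p x‖ ≤ ‖restrictRef (polyFun k).subtype hc ⟨p, hp⟩‖ :=
    ContinuousMap.norm_coe_le_norm (restrictRef (polyFun k).subtype hc ⟨p, hp⟩) ⟨x, hx⟩
  have h3 : ‖restrictL2 (polyFun k).subtype hL ⟨p, hp⟩‖ ^ 2 = ∫ x in cell refTet, p x ^ 2 :=
    norm_toLp_sq (hL ⟨p, hp⟩)
  rw [← h3, ← mul_pow, ← sq_abs]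
  exact pow_le_pow_left₀ (abs_nonneg _) (h2.trans h1) 2

/-- Polynomials on a tetrahedron are bounded by their mean square. -/
lemma exists_sq_le_integral (k : ℕ) : ∃ C : ℝ, 0 < C ∧ ∀ K : Finset E3, IsTet K →
    ∀ p ∈ polyFun k, ∀ x ∈ cell K,
      p x ^ 2 ≤ C / volume.real (cell K) * ∫ x in cell K, p x ^ 2 := by
  obtain ⟨C, hC, h⟩ := exists_sq_le_refTet k
  have hpos : ∀ K, IsTet K → 0 < volume.real (cell K) := fun K hK => by
    rw [measureReal_congr (IsTet.cell_ae_eq K)]; exact hK.volume_openCell_pos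
  refine ⟨C * volume.real (cell refTet), mul_pos hC (hpos _ isTet_refTet), fun K hK p hp x hx => ?_⟩
  obtain ⟨Φ⟩ := hK.exists_refMap
  have h1 := h _ (comp_mem_polyFun hp Φ.map_mem_polyVec) _ (Φ.inv_mem_cell hx)
  rw [Φ.map_inv] at h1
  -- The maximum is invariant under the affine map and the integral scales by the volume ratio,
  -- which accounts for the factor `1 / |K|`.
  rw [Φ.setIntegral]
  refine h1.trans (le_of_eq ?_)
  have h2 := (hpos K hK).ne'
  have h3 := (hpos _ isTet_refTet).ne'
  field_simp

/-- Same finite-dimensional argument, with the maximum norm as norm and differentiation as the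
operator to be bounded. -/
lemma exists_fderiv_le_refTet (k : ℕ) : ∃ C : ℝ, 0 < C ∧ ∀ p ∈ polyVec k, ∀ M : ℝ,
    (∀ x ∈ cell refTet, ‖p x‖ ≤ M) → ∀ x ∈ cell refTet, ‖fderiv ℝ p x‖ ≤ C * M := by
  have hc : ∀ p : polyVec k, Continuous p.1 := fun p =>
    (contDiff_of_mem_polyVec p.2 (n := 0)).continuous
  have hd : ∀ p : polyVec k, Differentiable ℝ p.1 := fun p =>
    (contDiff_of_mem_polyVec p.2 (n := 1)).differentiable (by norm_num)
  let D : polyVec k →ₗ[ℝ] (E3 → (E3 →L[ℝ] E3)) :=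
    { toFun := fun p => fderiv ℝ p.1
      map_add' := fun p q => by
        ext1 x; exact fderiv_add (hd p x) (hd q x)
      map_smul' := fun c p => by
        ext1 x; exact fderiv_const_smul (hd p x) c }
  have hD : ∀ p, Continuous (D p) := fun p =>
    (contDiff_of_mem_polyVec p.2 (n := 1)).continuous_fderiv (by norm_num)
  have hinj : Function.Injective (restrictRef (polyVec k).subtype hc) := by
    rw [← LinearMap.ker_eq_bot, LinearMap.ker_eq_bot']
    intro p hp
    ext x i
    have h2 := polyFun_eq_zero_of_isOpen (p.2 i) (IsTet.isOpen_openCell refTet)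
      isTet_refTet.openCell_nonempty fun x hx => by
        have := congrArg (fun g : C(cell refTet, E3) => g ⟨x, IsTet.openCell_subset_cell _ hx⟩ i) hp
        exact this
    exact congrFun h2 x
  obtain ⟨C, hC, h⟩ := exists_bound_of_injective _ hinj (restrictRef D hD)
  refine ⟨C, hC, fun p hp M hM x hx => ?_⟩
  have h1 := h ⟨p, hp⟩
  have h2 : ‖fderiv ℝ p x‖ ≤ ‖restrictRef D hD ⟨p, hp⟩‖ :=
    ContinuousMap.norm_coe_le_norm (restrictRef D hD ⟨p, hp⟩) ⟨x, hx⟩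
  refine h2.trans (h1.trans (mul_le_mul_of_nonneg_left ?_ hC.le))
  refine (ContinuousMap.norm_le _ ((norm_nonneg _).trans (hM x hx))).2 fun y => hM y y.2

/-- The inverse inequality for the derivative of polynomial fields. -/
lemma exists_fderiv_le (k : ℕ) : ∃ C : ℝ, 0 < C ∧ ∀ (K : Finset E3) (Φ : RefMap K),
    ∀ p ∈ polyVec k, ∀ M : ℝ, (∀ x ∈ cell K, ‖p x‖ ≤ M) →
      ∀ x ∈ cell K, ‖fderiv ℝ p x‖ ≤ C * M * ‖(Φ.A.symm : E3 →L[ℝ] E3)‖ := by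
  obtain ⟨C, hC, h⟩ := exists_fderiv_le_refTet k
  refine ⟨C, hC, fun K Φ p hp M hM x hx => ?_⟩
  have h1 := h _ (comp_mem_polyVec hp Φ.map_mem_polyVec) M
    (fun y hy => hM _ (Φ.map_mem_cell hy)) _ (Φ.inv_mem_cell hx)
  have hd : DifferentiableAt ℝ p x :=
    (contDiff_of_mem_polyVec hp (n := 1)).differentiable (by norm_num) x
  have h2 : HasFDerivAt (fun y => p (Φ.map y)) ((fderiv ℝ p x).comp (Φ.A : E3 →L[ℝ] E3))
      (Φ.inv x) := by
    refine HasFDerivAt.comp (Φ.inv x) ?_ (Φ.hasFDerivAt_map _)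
    rw [Φ.map_inv]; exact hd.hasFDerivAt
  rw [h2.fderiv] at h1
  -- The pullback has derivative `Dp ∘ A`; undoing `A` costs one factor `‖A⁻¹‖`.
  have h3 : fderiv ℝ p x = ((fderiv ℝ p x).comp (Φ.A : E3 →L[ℝ] E3)).comp
      (Φ.A.symm : E3 →L[ℝ] E3) := by
    ext1 w; simp
  rw [h3]
  exact (ContinuousLinearMap.opNorm_comp_le _ _).trans
    (mul_le_mul_of_nonneg_right h1 (norm_nonneg _))

/-! ### Unisolvence of the BDM degrees of freedom -/

open scoped Classical in
/-- The BDM degrees of freedom of `e` on the tetrahedron `K` vanish. -/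
structure BDMOrth (k : ℕ) (K : Finset E3) (e : E3 → E3) : Prop where
  face : ∀ v ∈ K, ∃ n : E3, n ≠ 0 ∧ (∀ x ∈ K, ∀ y ∈ K, x ≠ v → y ≠ v → ⟪n, y - x⟫ = 0) ∧
    ∀ q ∈ polyFun k, faceInt (K.erase v) (fun x => ⟪e x, n⟫ * q x) = 0
  inner : 2 ≤ k → ∀ p ∈ polyVec (k - 2), ∀ q ∈ polyVec (k - 2),
    ∫ x in cell K, ⟪e x, p x + cross x (q x)⟫ = 0

/-- The gradient of a polynomial as a polynomial field. -/
noncomputable def gradPoly (R : MvPolynomial (Fin 3) ℝ) : E3 → E3 :=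
  polyField fun i => MvPolynomial.pderiv i R

lemma gradPoly_mem {k : ℕ} {R : MvPolynomial (Fin 3) ℝ} (hR : R.totalDegree ≤ k) :
    gradPoly R ∈ polyVec (k - 1) := polyField_mem fun i => totalDegree_pderiv_le hR i

lemma fderiv_evalFun (R : MvPolynomial (Fin 3) ℝ) (x w : E3) :
    fderiv ℝ (evalFun R) x w = ⟪w, gradPoly R x⟫ := by
  rw [(hasFDerivAt_evalFun R x).fderiv]
  simp [gradPoly, polyField, evalFun_apply, PiLp.inner_apply]

lemma contDiff_evalFun (R : MvPolynomial (Fin 3) ℝ) {n : WithTop ℕ∞} : ContDiff ℝ n (evalFun R) :=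
  contDiff_of_mem_polyFun (evalFun_mem le_rfl)

lemma divg_smul {q : E3 → ℝ} {F : E3 → E3} {x : E3} (hq : DifferentiableAt ℝ q x)
    (hF : DifferentiableAt ℝ F x) :
    divg (fun y => q y • F y) x = q x * divg F x + fderiv ℝ q x (F x) := by
  rw [IsTet.divg_eq_sum (F := fun y => q y • F y) (hq.smul hF), IsTet.divg_eq_sum hF]
  have h1 : ∀ i, DifferentiableAt ℝ (fun y => F y i) x := fun i =>
    (EuclideanSpace.proj i : E3 →L[ℝ] ℝ).differentiableAt.comp x hF
  have h2 : ∀ i, fderiv ℝ (fun y => (q y • F y) i) x (EuclideanSpace.single i 1)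
      = q x * fderiv ℝ (fun y => F y i) x (EuclideanSpace.single i 1)
        + fderiv ℝ q x (EuclideanSpace.single i 1) * F x i := by
    intro i
    have : (fun y => (q y • F y) i) = fun y => q y * F y i := by ext; simp
    rw [this, fderiv_fun_mul hq (h1 i)]
    simp; ring
  rw [Finset.sum_congr rfl fun i _ => h2 i, Finset.sum_add_distrib, Finset.mul_sum]
  congr 1
  have h3 : F x = ∑ i, F x i • stdE i := by ext j; simp [stdE_apply]
  conv_rhs => rw [h3]
  simp [stdE, mul_comm]

section Unisolvence

variable {k : ℕ} {p : E3 → E3}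

-- The normal component is itself an admissible face polynomial of degree `k`. Testing with it makes
-- the integral of its square zero.
open scoped Classical in
lemma BDMOrth.inner_eq_zero {K : Finset E3} (hK : IsTet K) (h : BDMOrth k K p) (hp : p ∈ polyVec k) :
    ∃ m : E3 → E3, (∀ v ∈ K, m v ≠ 0) ∧
      (∀ v ∈ K, ∀ x ∈ K, ∀ y ∈ K, x ≠ v → y ≠ v → ⟪m v, y - x⟫ = 0) ∧
      ∀ v ∈ K, ∀ x ∈ openFace (K.erase v), ⟪p x, m v⟫ = 0 := by
  have h1 := h.face
  choose! m hm0 hmo hmf using h1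
  refine ⟨m, hm0, hmo, fun v hv x hx => ?_⟩
  have h2 := hmf v hv _ (inner_const_mem_polyFun hp (m v))
  have hc : Continuous fun x => ⟪p x, m v⟫ :=
    (contDiff_of_mem_polyFun (inner_const_mem_polyFun hp (m v)) (n := 0)).continuous
  simpa using eq_zero_of_faceInt_eq_zero (hK.isTri_erase hv) (hc.mul hc)
    (fun x => mul_self_nonneg _) h2 x hx

-- Divergence theorem for `R p`; the boundary terms disappear because the normal components vanish
-- on every face.
open scoped Classical in
lemma BDMOrth.integral_by_parts {K : Finset E3} (hK : IsTet K) (h : BDMOrth k K p)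
    (hp : p ∈ polyVec k) (R : MvPolynomial (Fin 3) ℝ) :
    (∫ x in cell K, evalFun R x * divg p x) + ∫ x in cell K, ⟪p x, gradPoly R x⟫ = 0 := by
  obtain ⟨m, hm0, hmo, hmf⟩ := h.inner_eq_zero hK hp
  obtain ⟨c, hν⟩ := IsTet.exists_outwardNormals hK hm0 hmo
  have hpc : ContDiff ℝ 1 p := contDiff_of_mem_polyVec hp
  have h1 := hK.integral_divg hν ((contDiff_evalFun R (n := 1)).smul hpc)
  have h2 : ∑ v ∈ K, faceInt (K.erase v) (fun x => ⟪evalFun R x • p x, c v • m v⟫) = 0 := by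
    refine Finset.sum_eq_zero fun v hv => ?_
    rw [faceInt_congr (hK.isTri_erase hv) (g' := fun _ => 0), faceInt_const, zero_mul]
    intro x hx
    rw [real_inner_smul_left, real_inner_smul_right, hmf v hv x hx, mul_zero, mul_zero]
  have h3 : ∀ x, divg (evalFun R • p) x = evalFun R x * divg p x + ⟪p x, gradPoly R x⟫ := by
    intro x
    rw [← fderiv_evalFun]
    exact divg_smul ((contDiff_evalFun R (n := 1)).differentiable (by norm_num) x)
      (hpc.differentiable (by norm_num) x)
  rw [← integral_add]
  · simp only [← h3]
    rw [h1]; exact h2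
  · refine IsTet.integrableOn_cell K (Continuous.continuousOn ?_)
    exact (contDiff_evalFun R (n := 0)).continuous.mul
      (contDiff_of_mem_polyFun (divg_mem_polyFun hp) (n := 0)).continuous
  · refine IsTet.integrableOn_cell K (Continuous.continuousOn ?_)
    exact (contDiff_of_mem_polyFun (inner_mem_polyFun hp (gradPoly_mem le_rfl)) (n := 0)).continuous

lemma gradPoly_eq_zero {R : MvPolynomial (Fin 3) ℝ} (hR : R.totalDegree = 0) (x : E3) :
    gradPoly R x = 0 := by
  rw [MvPolynomial.totalDegree_eq_zero_iff_eq_C.1 hR]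
  ext i; simp [gradPoly, polyField]

lemma cross_zero (x : E3) : cross x 0 = 0 := by
  ext i; simp [cross]

/-- Integration by parts with `R = div p`: the gradient of `R` has degree at most `k - 2`, so it is
covered by the interior moments, and `∫ (div p)² = 0` remains. -/
lemma BDMOrth.divg_eq_zero {K : Finset E3} (hK : IsTet K) (h : BDMOrth k K p)
    (hp : p ∈ polyVec k) : ∀ x ∈ openCell K, divg p x = 0 := by
  obtain ⟨R, hR, hRp⟩ := mem_polyFun.1 (divg_mem_polyFun hp)
  have h1 := h.integral_by_parts hK hp R
  have h2 : ∫ x in cell K, ⟪p x, gradPoly R x⟫ = 0 := by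
    by_cases hk : 2 ≤ k
    · have := h.inner hk _ (gradPoly_mem (k := k - 1) hR) 0 (Submodule.zero_mem _)
      simpa [cross_zero] using this
    -- Without interior moments the divergence is constant and its gradient is zero.
    · have h0 : R.totalDegree = 0 := by omega
      simp [gradPoly_eq_zero h0]
  rw [h2, add_zero, hRp] at h1
  have hc : Continuous (divg p) := (contDiff_of_mem_polyFun (divg_mem_polyFun hp) (n := 0)).continuous
  intro x hx
  simpa using IsTet.eq_zero_of_integral_eq_zero (hc.mul hc) (fun x _ => mul_self_nonneg _) h1 x hx

/-- Once `div p = 0`, integration by parts gives orthogonality to gradients of arbitrary degree,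
beyond the prescribed moments. -/
lemma BDMOrth.integral_gradPoly {K : Finset E3} (hK : IsTet K) (h : BDMOrth k K p)
    (hp : p ∈ polyVec k) (R : MvPolynomial (Fin 3) ℝ) :
    ∫ x in cell K, ⟪p x, gradPoly R x⟫ = 0 := by
  have h1 := h.integral_by_parts hK hp R
  have h2 : ∫ x in cell K, evalFun R x * divg p x = 0 := by
    rw [← IsTet.setIntegral_openCell, setIntegral_congr_fun (g := fun _ => (0 : ℝ))
      (IsTet.isOpen_openCell K).measurableSet]
    · simp
    · intro x hx
      simp [h.divg_eq_zero hK hp x hx]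
  rwa [h2, zero_add] at h1

/-- The Koszul identity `(d + 1) m eⱼ = ∇(xⱼ m) - x × (∇m × eⱼ)` for homogeneous `m`. -/
lemma koszul {d : ℕ} {m : MvPolynomial (Fin 3) ℝ} (hm : m.IsHomogeneous d) (j : Fin 3) (x w : E3) :
    ((d : ℝ) + 1) * (evalFun m x * w j) = ⟪w, gradPoly (MvPolynomial.X j * m) x⟫
      - ⟪w, cross x (cross (gradPoly m x) (stdE j))⟫ := by
  -- Euler's identity `∑ xᵢ ∂ᵢ m = d m`; the rest is the expansion of the double vector product.
  have hE := congrArg (MvPolynomial.eval x.ofLp) hm.sum_X_mul_pderiv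
  simp only [nsmul_eq_mul, Fin.sum_univ_three] at hE
  simp only [map_add, map_mul, MvPolynomial.eval_X, map_natCast] at hE
  fin_cases j <;>
    simp [gradPoly, polyField, evalFun_apply, PiLp.inner_apply, Fin.sum_univ_three, cross,
      cross_apply, stdE_apply, MvPolynomial.pderiv_X] <;>
    linear_combination (-w _) * hE

/-- By `koszul`, each homogeneous field `m eⱼ` of degree at most `k - 1` is a gradient plus `x × q`
with `deg q ≤ k - 2`, and `p` is orthogonal to both. A general polynomial is summed from its
homogeneous components. -/
lemma BDMOrth.integral_mul_eq_zero {K : Finset E3} (hK : IsTet K) (h : BDMOrth k K p)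
    (hp : p ∈ polyVec k) (hk : 1 ≤ k) {f : E3 → ℝ} (hf : f ∈ polyFun (k - 1)) (j : Fin 3) :
    ∫ x in cell K, f x * p x j = 0 := by
  obtain ⟨R, hR, rfl⟩ := mem_polyFun.1 hf
  have hpc : Continuous fun x => p x j := (contDiff_of_mem_polyFun (hp j) (n := 0)).continuous
  have hom : ∀ d ∈ Finset.range (R.totalDegree + 1),
      ∫ x in cell K, evalFun (MvPolynomial.homogeneousComponent d R) x * p x j = 0 := by
    intro d hd
    set m := MvPolynomial.homogeneousComponent d R with hmdef
    have hm : m.IsHomogeneous d := MvPolynomial.homogeneousComponent_isHomogeneous d R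
    have hdk : d ≤ k - 1 := (Nat.lt_succ_iff.1 (Finset.mem_range.1 hd)).trans hR
    have hmd : m.totalDegree ≤ d := hm.totalDegree_le
    have h1 := h.integral_gradPoly hK hp (MvPolynomial.X j * m)
    have h2 : ∫ x in cell K, ⟪p x, cross x (cross (gradPoly m x) (stdE j))⟫ = 0 := by
      -- For `k = 1` the component is constant and the Koszul remainder is zero, so no interior
      -- moment is needed.
      by_cases hk2 : 2 ≤ k
      · have hq : (fun x => cross (gradPoly m x) (stdE j)) ∈ polyVec (k - 2) := by
          have := cross_mem_polyVec (gradPoly_mem hmd) (const_mem_polyVec 0 (stdE j))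
          exact polyVec_mono (by omega) this
        have := h.inner hk2 0 (Submodule.zero_mem _) _ hq
        simpa using this
      · have h0 : m.totalDegree = 0 := by omega
        have hz : cross 0 (stdE j) = 0 := by ext i; simp [cross]
        simp [gradPoly_eq_zero h0, hz, cross_zero]
    have hd1 : (d : ℝ) + 1 ≠ 0 := by positivity
    have h3 : ((d : ℝ) + 1) * ∫ x in cell K, evalFun m x * p x j = 0 := by
      rw [← integral_const_mul]
      simp only [koszul hm j]
      rw [integral_sub, h1, h2, sub_zero]
      · refine IsTet.integrableOn_cell K (Continuous.continuousOn ?_)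
        exact (contDiff_of_mem_polyFun (inner_mem_polyFun hp (gradPoly_mem le_rfl))
          (n := 0)).continuous
      · refine IsTet.integrableOn_cell K (Continuous.continuousOn ?_)
        have hx : (fun x : E3 => x) ∈ polyVec 1 := fun i => coord_mem_polyFun i
        exact (contDiff_of_mem_polyFun (inner_mem_polyFun hp (cross_mem_polyVec hx
          (cross_mem_polyVec (gradPoly_mem le_rfl) (const_mem_polyVec 0 (stdE j)))))
          (n := 0)).continuous
    exact (mul_eq_zero.1 h3).resolve_left hd1
  have hsum : ∀ x, evalFun R x * p x j = ∑ d ∈ Finset.range (R.totalDegree + 1),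
      evalFun (MvPolynomial.homogeneousComponent d R) x * p x j := by
    intro x
    conv_lhs => rw [← MvPolynomial.sum_homogeneousComponent R, map_sum, Finset.sum_apply,
      Finset.sum_mul]
  simp only [hsum]
  have hint : ∀ d ∈ Finset.range (R.totalDegree + 1), IntegrableOn (fun x =>
      evalFun (MvPolynomial.homogeneousComponent d R) x * p x j) (cell K) := fun d _ =>
    IsTet.integrableOn_cell K ((contDiff_evalFun _ (n := 0)).continuous.mul hpc).continuousOn
  rw [integral_finsetSum _ hint]
  exact Finset.sum_eq_zero hom

/-- A polynomial vanishing on the hyperplane `xᵢ = 0` is divisible by `xᵢ`. -/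
lemma exists_eq_X_mul {R : MvPolynomial (Fin 3) ℝ} (i : Fin 3)
    (h : MvPolynomial.bind₁ (fun j => if j = i then 0 else MvPolynomial.X j) R
      = (0 : MvPolynomial (Fin 3) ℝ)) : ∃ S, R = MvPolynomial.X i * S := by
  have h1 : ∀ R : MvPolynomial (Fin 3) ℝ, MvPolynomial.X i ∣
      R - MvPolynomial.bind₁ (fun j => if j = i then 0 else MvPolynomial.X j) R := by
    intro R
    induction R using MvPolynomial.induction_on with
    | C a => simp
    | add p q hp hq =>
      rw [map_add, add_sub_add_comm]; exact dvd_add hp hq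
    | mul_X p n hp =>
      rw [map_mul, MvPolynomial.bind₁_X_right]
      split_ifs with hn
      · subst hn; simp
      · rw [← sub_mul]; exact hp.mul_right _
  have := h1 R
  rw [h, sub_zero] at this
  exact this

/-- On the face `xᵢ = 0` the normal component is `pᵢ`, hence `pᵢ = xᵢ S` with `deg S ≤ k - 1`.
Testing with `S` gives `∫ xᵢ S² = 0`, and `xᵢ` is positive in the interior. -/
lemma BDMOrth.coord_eq_zero (h : BDMOrth k refTet p) (hp : p ∈ polyVec k) (hk : 1 ≤ k)
    (i : Fin 3) : (fun x => p x i) = 0 := by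
  classical
  obtain ⟨m, hm0, hmo, hmf⟩ := h.inner_eq_zero isTet_refTet hp
  have hi := stdE_mem_refTet i
  have hmi : m (stdE i) = m (stdE i) i • stdE i := by
    ext j
    by_cases hj : j = i
    · subst hj; simp [stdE_apply]
    · have := hmo _ hi _ zero_mem_refTet _ (stdE_mem_refTet j) (stdE_ne_zero i).symm
        (stdE_injective.ne hj)
      rw [sub_zero, real_inner_comm, inner_stdE] at this
      simp [this, stdE_apply, hj]
  have hmi0 : m (stdE i) i ≠ 0 := by
    intro h0; rw [h0, zero_smul] at hmi; exact hm0 _ hi hmi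
  obtain ⟨R, hR, hRp⟩ := mem_polyFun.1 (hp i)
  have hRx : ∀ x, evalFun R x = p x i := fun x => congrFun hRp x
  -- the substitution `xᵢ := 0`
  let π : E3 → E3 := fun x => x - x i • stdE i
  have hπ : π ∈ polyVec 1 := by
    intro j
    have : (fun x => π x j) = fun x : E3 => x j - stdE i j * x i := by
      ext x; simp [π, mul_comm]
    rw [this]
    exact sub_mem_polyFun (coord_mem_polyFun j) (const_mul_mem_polyFun _ (coord_mem_polyFun i))
  -- The projection `π` maps interior points into the open face, so the restricted polynomial
  -- vanishes on an open set of `ℝ³` and therefore identically.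
  have hz : (fun x => evalFun R (π x)) = 0 := by
    refine polyFun_eq_zero_of_isOpen (comp_mem_polyFun (evalFun_mem hR) hπ)
      (IsTet.isOpen_openCell refTet) isTet_refTet.openCell_nonempty fun x hx => ?_
    have hxf : π x ∈ openFace (refTet.erase (stdE i)) := by
      have hj : ∀ j, π x j = if j = i then 0 else x j := fun j => by
        simp only [π, PiLp.sub_apply, PiLp.smul_apply, stdE_apply, smul_eq_mul]
        split_ifs with hji
        · subst hji; ring
        · ring
      refine isTet_refTet.mem_openFace_erase hi ?_ ?_
      · rw [refTet_coord_stdE, hj, if_pos rfl]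
      · rintro ⟨u, hu⟩ hui
        rcases mem_refTet.1 hu with rfl | ⟨j, rfl⟩
        · have s1 : ∀ y : E3, isTet_refTet.coord ⟨0, hu⟩ y = 1 - ∑ j, y j := by
            intro y
            have h2 := isTet_refTet.inner_eq_coord (x := stdE 0) (n := stdE 0 + stdE 1 + stdE 2) hu
              (fun z hz hz0 => by
                rcases mem_refTet.1 hz with rfl | ⟨j, rfl⟩
                · exact absurd rfl hz0
                · simp only [inner_add_left, inner_stdE, PiLp.sub_apply, stdE_apply]
                  fin_cases j <;> simp) y
            simp only [inner_add_left, inner_stdE, PiLp.sub_apply, stdE_apply, PiLp.zero_apply]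
              at h2
            rw [Fin.sum_univ_three]
            simp at h2
            linarith
          rw [s1]
          have h3 : (0 : ℝ) < 1 - ∑ j, x j := by
            rw [← s1]
            rw [isTet_refTet.openCell_eq] at hx
            exact hx _
          have h4 : ∑ j, π x j ≤ ∑ j, x j := Finset.sum_le_sum fun j _ => by
            rw [hj]; split_ifs
            · exact (pos_of_mem_openCell_refTet hx j).le
            · exact le_rfl
          linarith
        · rw [refTet_coord_stdE, hj, if_neg (fun hji => hui (by subst hji; rfl))]
          exact pos_of_mem_openCell_refTet hx j
    have h1 := hmf _ hi _ hxf
    rw [hmi, real_inner_smul_right, real_inner_comm, inner_stdE] at h1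
    rw [hRx]
    exact (mul_eq_zero.1 h1).resolve_left hmi0
  have hbind : MvPolynomial.bind₁ (fun j => if j = i then 0 else MvPolynomial.X j) R
      = (0 : MvPolynomial (Fin 3) ℝ) := by
    refine evalFun_injective ?_
    rw [← hz]
    ext x
    simp only [evalFun_apply]
    rw [← MvPolynomial.coe_aeval_eq_eval, RingHom.coe_coe, MvPolynomial.aeval_bind₁,
      ← MvPolynomial.coe_aeval_eq_eval, RingHom.coe_coe]
    congr 2
    ext j
    simp only [π, PiLp.sub_apply, PiLp.smul_apply, stdE_apply, smul_eq_mul]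
    split_ifs with hji
    · subst hji; simp
    · simp
  obtain ⟨S, rfl⟩ := exists_eq_X_mul i hbind
  by_cases hS : S = 0
  · rw [← hRp, hS, mul_zero, map_zero]
  -- Degrees add in a polynomial ring over a domain, so division by `xᵢ` lowers the degree by
  -- exactly one; this makes `S` admissible in `integral_mul_eq_zero`.
  have hSdeg : S.totalDegree ≤ k - 1 := by
    rw [MvPolynomial.totalDegree_mul_of_isDomain (MvPolynomial.X_ne_zero i) hS,
      MvPolynomial.totalDegree_X] at hR
    omega
  have hpi : ∀ x, p x i = x i * evalFun S x := fun x => by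
    rw [← hRx]; simp [evalFun_apply]
  have h1 := h.integral_mul_eq_zero isTet_refTet hp hk (evalFun_mem hSdeg) i
  have h2 := IsTet.eq_zero_of_integral_eq_zero (K := refTet) (g := fun x => evalFun S x * p x i)
    ((contDiff_evalFun S (n := 0)).continuous.mul
      (contDiff_of_mem_polyFun (hp i) (n := 0)).continuous)
    (fun x hx => by
      rw [hpi]
      have := pos_of_mem_openCell_refTet hx i
      nlinarith [mul_self_nonneg (evalFun S x)]) h1
  refine polyFun_eq_zero_of_isOpen (hp i) (IsTet.isOpen_openCell refTet)
    isTet_refTet.openCell_nonempty fun x hx => ?_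
  have h3 := h2 x hx
  rcases mul_eq_zero.1 h3 with h4 | h4
  · rw [hpi, h4, mul_zero]
  · exact h4

/-- Unisolvence on the reference tetrahedron. -/
lemma BDMOrth.eq_zero (h : BDMOrth k refTet p) (hp : p ∈ polyVec k) (hk : 1 ≤ k) : p = 0 := by
  ext x i
  exact congrFun (h.coord_eq_zero hp hk i) x

end Unisolvence

/-! ### Stability of the BDM interpolant -/

namespace IsTet

variable {K : Finset E3} (hK : IsTet K)

/-- The gradient of a barycentric coordinate. -/
noncomputable def grad (v : K) : E3 :=
  (InnerProductSpace.toDual ℝ E3).symm (LinearMap.toContinuousLinearMap (hK.coord v).linear)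

lemma inner_grad (v : K) (x y : E3) : ⟪hK.grad v, y - x⟫ = hK.coord v y - hK.coord v x := by
  rw [grad, InnerProductSpace.toDual_symm_apply]
  exact (hK.coord v).linearMap_vsub y x

lemma inner_grad_eq_zero {v : E3} (hv : v ∈ K) {x y : E3} (hx : x ∈ K) (hy : y ∈ K) (hxv : x ≠ v)
    (hyv : y ≠ v) : ⟪hK.grad ⟨v, hv⟩, y - x⟫ = 0 := by
  rw [inner_grad, hK.coord_ne (u := ⟨x, hx⟩) fun h => hxv (congrArg Subtype.val h).symm,
    hK.coord_ne (u := ⟨y, hy⟩) fun h => hyv (congrArg Subtype.val h).symm, sub_zero]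

lemma exists_ne {v : E3} (hv : v ∈ K) (hK : IsTet K) : ∃ x ∈ K, x ≠ v := by
  classical
  obtain ⟨x, hx⟩ : ∃ x, x ∈ K.erase v := Finset.card_pos.1 (by
    rw [Finset.card_erase_of_mem hv, hK.card]; norm_num)
  exact ⟨x, Finset.mem_of_mem_erase hx, Finset.ne_of_mem_erase hx⟩

lemma grad_ne_zero (v : K) : hK.grad v ≠ 0 := by
  intro h
  obtain ⟨x, hx, hxv⟩ := exists_ne v.2 hK
  have h1 := hK.inner_grad v x v
  rw [h, inner_zero_left, hK.coord_self,
    hK.coord_ne (u := ⟨x, hx⟩) fun h => hxv (congrArg Subtype.val h).symm] at h1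
  norm_num at h1

/-- A normal of a face is a multiple of the gradient of the barycentric coordinate. -/
lemma eq_smul_grad {v n : E3} (hv : v ∈ K)
    (hn : ∀ x ∈ K, ∀ y ∈ K, x ≠ v → y ≠ v → ⟪n, y - x⟫ = 0) :
    ∃ c : ℝ, n = c • hK.grad ⟨v, hv⟩ := by
  obtain ⟨x, hx, hxv⟩ := exists_ne hv hK
  refine ⟨⟪n, v - x⟫, ext_inner_right ℝ fun w => ?_⟩
  have h1 := hK.inner_eq_coord hv (fun y hy hyv => hn x hx y hy hxv hyv) (x + w)
  rw [add_sub_cancel_left] at h1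
  have h2 := hK.inner_grad ⟨v, hv⟩ x (x + w)
  rw [add_sub_cancel_left,
    hK.coord_ne (u := ⟨x, hx⟩) fun h => hxv (congrArg Subtype.val h).symm, sub_zero] at h2
  rw [h1, real_inner_smul_left, h2]

end IsTet

lemma openFace_subset_cell_of_subset {f K : Finset E3} (h : f ⊆ K) : cell f ⊆ cell K :=
  convexHull_mono (by exact_mod_cast h)

open scoped Classical in
/-- The moments of a field, against bases of the test spaces. -/
lemma exists_bdm_refTet (k : ℕ) (hk : 1 ≤ k) : ∃ C : ℝ, 0 < C ∧ ∀ p ∈ polyVec k, ∀ g : E3 → E3,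
    ContinuousOn g (cell refTet) → ∀ δ : ℝ, (∀ x ∈ cell refTet, ‖g x‖ ≤ δ) →
    BDMOrth k refTet (fun x => g x - p x) → ∀ x ∈ cell refTet, ‖p x‖ ≤ C * δ := by
  -- Bases of the test spaces reduce the degrees of freedom to finitely many functionals.
  let b := Module.finBasis ℝ (polyFun k)
  let c := Module.finBasis ℝ (polyVec (k - 2) × polyVec (k - 2))
  let η : Fin (Module.finrank ℝ (polyVec (k - 2) × polyVec (k - 2))) → E3 → E3 := fun l x =>
    (c l).1.1 x + cross x ((c l).2.1 x)
  have hid : (fun x : E3 => x) ∈ polyVec 1 := fun i => coord_mem_polyFun i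
  have hcx : ∀ q : polyVec (k - 2) × polyVec (k - 2),
      Continuous fun x => q.1.1 x + cross x (q.2.1 x) := fun q =>
    (contDiff_of_mem_polyVec q.1.2 (n := 0)).continuous.add
      (contDiff_of_mem_polyVec (cross_mem_polyVec hid q.2.2) (n := 0)).continuous
  have hη : ∀ l, Continuous (η l) := fun l => hcx (c l)
  have hb : ∀ j, Continuous (b j).1 := fun j => (contDiff_of_mem_polyFun (b j).2 (n := 0)).continuous
  let m : refTet → E3 := isTet_refTet.grad
  have htri : ∀ v : refTet, IsTri (refTet.erase (v : E3)) := fun v => isTet_refTet.isTri_erase v.2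
  have hsub : ∀ v : refTet, cell (refTet.erase (v : E3)) ⊆ cell refTet := fun v =>
    openFace_subset_cell_of_subset (Finset.erase_subset _ _)
  have hpc : ∀ p : polyVec k, Continuous p.1 := fun p =>
    (contDiff_of_mem_polyVec p.2 (n := 0)).continuous
  -- integrability of the moments
  have hi1 : ∀ (v : refTet) (e : E3 → E3) (q : E3 → ℝ), ContinuousOn e (cell refTet) →
      Continuous q → ContinuousOn (fun x => ⟪e x, m v⟫ * q x) (cell (refTet.erase (v : E3))) :=
    fun v e q he hq => ((he.mono (hsub v)).inner continuousOn_const).mul hq.continuousOn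
  have hi2 : ∀ (e f : E3 → E3), ContinuousOn e (cell refTet) → Continuous f →
      IntegrableOn (fun x => ⟪e x, f x⟫) (cell refTet) :=
    fun e f he hf => IsTet.integrableOn_cell _ (he.inner hf.continuousOn)
  let T : polyVec k →ₗ[ℝ] ((refTet → Fin (Module.finrank ℝ (polyFun k)) → ℝ) ×
      (Fin (Module.finrank ℝ (polyVec (k - 2) × polyVec (k - 2))) → ℝ)) :=
    { toFun := fun p => (fun v j => faceInt (refTet.erase (v : E3)) (fun x => ⟪p.1 x, m v⟫ * (b j).1 x),
        -- For `k = 1` truncated subtraction would produce spurious constant test fields, so this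
        -- component is set to zero.
        fun l => if 2 ≤ k then ∫ x in cell refTet, ⟪p.1 x, η l x⟫ else 0)
      map_add' := fun p q => by
        refine Prod.ext ?_ ?_
        · ext v j
          refine Eq.trans ?_ (faceInt_add (htri v) (hi1 v _ _ (hpc p).continuousOn (hb j))
            (hi1 v _ _ (hpc q).continuousOn (hb j)))
          simp only [Submodule.coe_add, Pi.add_apply, inner_add_left, add_mul]
        · ext l
          simp only [Submodule.coe_add, Pi.add_apply, inner_add_left, Prod.mk_add_mk]
          split_ifs
          · exact integral_add (hi2 _ _ (hpc p).continuousOn (hη l))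
              (hi2 _ _ (hpc q).continuousOn (hη l))
          · simp
      map_smul' := fun a p => by
        refine Prod.ext ?_ ?_
        · ext v j
          refine Eq.trans ?_ (faceInt_const_mul a _)
          simp only [Submodule.coe_smul, Pi.smul_apply, real_inner_smul_left, mul_assoc]
        · ext l
          simp only [Submodule.coe_smul, Pi.smul_apply, real_inner_smul_left, integral_const_mul,
            RingHom.id_apply, Prod.smul_mk, smul_eq_mul]
          split_ifs <;> simp }
  -- Injectivity is unisolvence: moments vanishing on a basis vanish on the whole test space by
  -- linearity.
  have hT : Function.Injective T := by
    rw [← LinearMap.ker_eq_bot, LinearMap.ker_eq_bot']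
    intro p hp
    refine Subtype.ext (BDMOrth.eq_zero (k := k) ⟨fun v hv => ?_, fun hk2 q1 hq1 q2 hq2 => ?_⟩ p.2 hk)
    · refine ⟨m ⟨v, hv⟩, isTet_refTet.grad_ne_zero _,
        fun x hx y hy hxv hyv => isTet_refTet.inner_grad_eq_zero hv hx hy hxv hyv, fun q hq => ?_⟩
      let L : polyFun k →ₗ[ℝ] ℝ :=
        { toFun := fun q => faceInt (refTet.erase v) fun x => ⟪p.1 x, m ⟨v, hv⟩⟫ * q.1 x
          map_add' := fun q q' => by
            refine Eq.trans ?_ (faceInt_add (htri ⟨v, hv⟩)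
              (hi1 ⟨v, hv⟩ _ q.1 (hpc p).continuousOn
                (contDiff_of_mem_polyFun q.2 (n := 0)).continuous)
              (hi1 ⟨v, hv⟩ _ q'.1 (hpc p).continuousOn
                (contDiff_of_mem_polyFun q'.2 (n := 0)).continuous))
            simp only [Submodule.coe_add, Pi.add_apply, mul_add]
          map_smul' := fun a q => by
            refine Eq.trans ?_ (faceInt_const_mul a _)
            simp only [Submodule.coe_smul, Pi.smul_apply, smul_eq_mul, mul_left_comm] }
      have hL : L = 0 := b.ext fun j => congrFun (congrFun (congrArg Prod.fst hp) ⟨v, hv⟩) j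
      exact congrArg (fun L : polyFun k →ₗ[ℝ] ℝ => L ⟨q, hq⟩) hL
    · let L : polyVec (k - 2) × polyVec (k - 2) →ₗ[ℝ] ℝ :=
        { toFun := fun q => ∫ x in cell refTet, ⟪p.1 x, q.1.1 x + cross x (q.2.1 x)⟫
          map_add' := fun q q' => by
            rw [← integral_add (hi2 _ _ (hpc p).continuousOn (hcx q))
              (hi2 _ _ (hpc p).continuousOn (hcx q'))]
            congr 1
            ext x
            rw [← inner_add_right]
            congr 1
            ext i
            fin_cases i <;> simp [cross, cross_apply] <;> ring
          map_smul' := fun a q => by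
            simp only [RingHom.id_apply, smul_eq_mul]
            rw [← integral_const_mul]
            congr 1
            ext x
            rw [← real_inner_smul_right]
            congr 1
            ext i
            fin_cases i <;> simp [cross, cross_apply] }
      have hL : L = 0 := c.ext fun l => by
        have := congrFun (congrArg Prod.snd hp) l
        simp only [T, LinearMap.coe_mk, AddHom.coe_mk, if_pos hk2] at this
        exact this
      exact congrArg (fun L : polyVec (k - 2) × polyVec (k - 2) →ₗ[ℝ] ℝ => L (⟨q1, hq1⟩, ⟨q2, hq2⟩)) hL
  obtain ⟨C, hC, hCT⟩ := exists_bound_of_injective T hT (restrictRef (polyVec k).subtype hpc)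
  -- bounds of the moments of `g`
  have hcell := IsTet.isCompact_cell refTet
  have B1 : ∀ (v : refTet) j, ∃ D : ℝ, 0 ≤ D ∧ ∀ (g : E3 → E3) (δ : ℝ),
      (∀ x ∈ cell refTet, ‖g x‖ ≤ δ) →
      |faceInt (refTet.erase (v : E3)) (fun x => ⟪g x, m v⟫ * (b j).1 x)| ≤ D * δ := by
    intro v j
    obtain ⟨β, hβ⟩ := hcell.exists_bound_of_continuousOn (hb j).continuousOn
    refine ⟨‖m v‖ * |β| * area (refTet.erase (v : E3)), by
      have := (area_pos (htri v)).le; positivity, fun g δ hg => ?_⟩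
    refine (abs_faceInt_le (htri v) (C := δ * ‖m v‖ * |β|) fun x hx => ?_).trans
      (le_of_eq (by ring))
    have hx' := hsub v (openFace_subset_cell _ hx)
    rw [abs_mul]
    refine mul_le_mul ((abs_real_inner_le_norm _ _).trans
      (mul_le_mul_of_nonneg_right (hg x hx') (norm_nonneg _)))
      ((hβ x hx').trans (le_abs_self _)) (abs_nonneg _)
      (mul_nonneg ((norm_nonneg _).trans (hg x hx')) (norm_nonneg _))
  have B2 : ∀ l, ∃ D : ℝ, 0 ≤ D ∧ ∀ (g : E3 → E3) (δ : ℝ), (∀ x ∈ cell refTet, ‖g x‖ ≤ δ) →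
      |∫ x in cell refTet, ⟪g x, η l x⟫| ≤ D * δ := by
    intro l
    obtain ⟨β, hβ⟩ := hcell.exists_bound_of_continuousOn (hη l).continuousOn
    refine ⟨|β| * volume.real (cell refTet), by positivity, fun g δ hg => ?_⟩
    have := norm_setIntegral_le_of_norm_le_const (μ := volume) (C := δ * |β|) hcell.measure_lt_top
      (f := fun x => ⟪g x, η l x⟫) fun x hx =>
        (abs_real_inner_le_norm _ _).trans (mul_le_mul (hg x hx)
        ((hβ x hx).trans (le_abs_self _)) (norm_nonneg _) ((norm_nonneg _).trans (hg x hx)))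
    rw [Real.norm_eq_abs] at this
    exact this.trans (le_of_eq (by ring))
  choose D1 hD1 hB1 using B1
  choose D2 hD2 hB2 using B2
  set D := (∑ v, ∑ j, D1 v j) + ∑ l, D2 l with hDdef
  have hS1 : 0 ≤ ∑ v, ∑ j, D1 v j :=
    Finset.sum_nonneg fun v _ => Finset.sum_nonneg fun j _ => hD1 v j
  have hS2 : 0 ≤ ∑ l, D2 l := Finset.sum_nonneg fun l _ => hD2 l
  have hle1 : ∀ v j, D1 v j ≤ D := fun v j => by
    have h1 := Finset.single_le_sum (f := fun v => ∑ j, D1 v j)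
      (fun v _ => Finset.sum_nonneg fun j _ => hD1 v j) (Finset.mem_univ v)
    have h2 := Finset.single_le_sum (f := fun j => D1 v j) (fun j _ => hD1 v j) (Finset.mem_univ j)
    linarith
  have hle2 : ∀ l, D2 l ≤ D := fun l => by
    have h2 := Finset.single_le_sum (f := D2) (fun j _ => hD2 j) (Finset.mem_univ l)
    linarith
  refine ⟨C * (D + 1), by positivity, fun p hp g hg δ hδ horth x hx => ?_⟩
  have hδ0 : 0 ≤ δ := (norm_nonneg _).trans (hδ x hx)
  have hTp : ‖T ⟨p, hp⟩‖ ≤ D * δ := by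
    have hDδ : 0 ≤ D * δ := by positivity
    refine max_le ((pi_norm_le_iff_of_nonneg hDδ).2 fun v =>
      (pi_norm_le_iff_of_nonneg hDδ).2 fun j => ?_) ((pi_norm_le_iff_of_nonneg hDδ).2 fun l => ?_)
    · obtain ⟨n, hn0, hno, hnf⟩ := horth.face v v.2
      obtain ⟨a, ha⟩ := isTet_refTet.eq_smul_grad v.2 hno
      -- The normal supplied by `horth` and the one used in `T` differ by a nonzero factor, which
      -- does not affect vanishing moments. So the moments of `p` equal those of `g`.
      have ha0 : a ≠ 0 := by rintro rfl; rw [zero_smul] at ha; exact hn0 ha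
      have h1 := hnf _ (b j).2
      have h2 : ∀ x, ⟪g x - p x, n⟫ * (b j).1 x
          = a * (⟪g x, m v⟫ * (b j).1 x - ⟪p x, m v⟫ * (b j).1 x) := by
        intro x
        rw [ha, real_inner_smul_right, inner_sub_left]
        simp only [m]; ring
      simp only [h2] at h1
      rw [faceInt_const_mul, mul_eq_zero, or_iff_right ha0, faceInt_sub (htri v)
        (hi1 v _ _ hg (hb j)) (hi1 v _ _ (hpc ⟨p, hp⟩).continuousOn (hb j)), sub_eq_zero] at h1
      have h3 : (T ⟨p, hp⟩).1 v j
          = faceInt (refTet.erase (v : E3)) (fun x => ⟪p x, m v⟫ * (b j).1 x) := rfl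
      rw [h3, ← h1]
      exact (hB1 v j g δ hδ).trans (mul_le_mul_of_nonneg_right (hle1 v j) hδ0)
    · by_cases hk2 : 2 ≤ k
      · have h1 := horth.inner hk2 _ (c l).1.2 _ (c l).2.2
        simp only [inner_sub_left] at h1
        rw [integral_sub (hi2 _ _ hg (hη l)) (hi2 _ _ (hpc ⟨p, hp⟩).continuousOn (hη l)),
          sub_eq_zero] at h1
        have h3 : (T ⟨p, hp⟩).2 l = ∫ x in cell refTet, ⟪p x, η l x⟫ := by
          simp only [T, LinearMap.coe_mk, AddHom.coe_mk, if_pos hk2]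
        rw [h3, ← h1]
        exact (hB2 l g δ hδ).trans (mul_le_mul_of_nonneg_right (hle2 l) hδ0)
      · have h3 : (T ⟨p, hp⟩).2 l = 0 := by
          simp only [T, LinearMap.coe_mk, AddHom.coe_mk, if_neg hk2]
        rw [h3, norm_zero]; exact hDδ
  have h2 : ‖p x‖ ≤ ‖restrictRef (polyVec k).subtype hpc ⟨p, hp⟩‖ :=
    ContinuousMap.norm_coe_le_norm (restrictRef (polyVec k).subtype hpc ⟨p, hp⟩) ⟨x, hx⟩
  calc ‖p x‖ ≤ C * ‖T ⟨p, hp⟩‖ := h2.trans (hCT _)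
    _ ≤ C * (D * δ) := mul_le_mul_of_nonneg_left hTp hC.le
    _ ≤ C * (D + 1) * δ := by nlinarith

/-- The Piola transform of the vector product. -/
lemma exists_adjoint_cross (M : E3 →L[ℝ] E3) : ∃ d : ℝ, ∀ y w : E3,
    (ContinuousLinearMap.adjoint M) (cross (M y) (M w)) = d • cross y w := by
  have hM : ∀ y i, M y i = ∑ j, y j * M (stdE j) i := by
    intro y i
    have hy : y = ∑ j, y j • stdE j := by ext j; simp [stdE_apply]
    conv_lhs => rw [hy]
    simp
  -- The witness is `det M`. Paired with `z`, the left side becomes the triple product of `M y`, `M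
  -- w`, `M z`.
  refine ⟨M (stdE 0) 0 * (M (stdE 1) 1 * M (stdE 2) 2 - M (stdE 2) 1 * M (stdE 1) 2)
    - M (stdE 1) 0 * (M (stdE 0) 1 * M (stdE 2) 2 - M (stdE 2) 1 * M (stdE 0) 2)
    + M (stdE 2) 0 * (M (stdE 0) 1 * M (stdE 1) 2 - M (stdE 1) 1 * M (stdE 0) 2), fun y w => ?_⟩
  refine ext_inner_right ℝ fun z => ?_
  rw [ContinuousLinearMap.adjoint_inner_left, real_inner_smul_left]
  simp only [PiLp.inner_apply, Fin.sum_univ_three, cross, cross_apply]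
  simp only [hM y, hM w, hM z, Fin.sum_univ_three]
  simp
  ring

/-- A change of origin in `x × q` creates only a term `b × q`, which is again an admissible field
`p`. This makes the space of interior test fields invariant under translations. -/
lemma cross_sub_smul (x b w : E3) (d : ℝ) :
    d • cross (x - b) w = -(d • cross b w) + cross x (d • w) := by
  ext i
  fin_cases i <;> simp [cross, cross_apply] <;> ring

open scoped Classical in
/-- The degrees of freedom are preserved by the Piola transform. -/
lemma BDMOrth.pullback {k : ℕ} {K : Finset E3} (hK : IsTet K) (Φ : RefMap K) {e : E3 → E3}
    (h : BDMOrth k K e) : BDMOrth k refTet fun x => Φ.A.symm (e (Φ.map x)) := by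
  refine ⟨fun v hv => ?_, fun hk p hp q hq => ?_⟩
  · obtain ⟨n, hn0, hno, hnf⟩ := h.face (Φ.map v) (Φ.map_mem hv)
    have hadj : ∀ w, ⟪ContinuousLinearMap.adjoint (Φ.A : E3 →L[ℝ] E3) n, w⟫ = ⟪n, Φ.A w⟫ :=
      fun w => ContinuousLinearMap.adjoint_inner_left _ _ _
    -- The transported normal is `Aᵀ n`. It is not of unit length, which the existential in
    -- `BDMOrth` permits.
    refine ⟨ContinuousLinearMap.adjoint (Φ.A : E3 →L[ℝ] E3) n, fun h0 => hn0 ?_,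
      fun x hx y hy hxv hyv => ?_, fun q hq => ?_⟩
    · refine ext_inner_right ℝ fun w => ?_
      have := hadj (Φ.A.symm w)
      rw [h0, inner_zero_left, ContinuousLinearEquiv.apply_symm_apply] at this
      rw [← this, inner_zero_left]
    · rw [hadj, ← Φ.map_sub_map]
      exact hno _ (Φ.map_mem hx) _ (Φ.map_mem hy) (Φ.map_injective.ne hxv) (Φ.map_injective.ne hyv)
    · have himg : Φ.map '' ((refTet.erase v : Finset E3) : Set E3)
          = ((K.erase (Φ.map v) : Finset E3) : Set E3) := by
        rw [Finset.coe_erase, Finset.coe_erase, image_sdiff Φ.map_injective, image_singleton]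
        congr 1
        exact Φ.image
      obtain ⟨J, hJ, hJf⟩ := Φ.exists_faceInt (isTet_refTet.isTri_erase hv)
        (hK.isTri_erase (Φ.map_mem hv)) himg
      have h1 := hnf _ (comp_mem_polyFun hq Φ.inv_mem_polyVec)
      rw [hJf, mul_eq_zero, or_iff_right hJ.ne'] at h1
      rw [← h1]
      congr 1
      ext x
      rw [Φ.inv_map, real_inner_comm, hadj, ContinuousLinearEquiv.apply_symm_apply, real_inner_comm]
  · obtain ⟨d, hd⟩ := exists_adjoint_cross (Φ.A.symm : E3 →L[ℝ] E3)
    set N := ContinuousLinearMap.adjoint (Φ.A.symm : E3 →L[ℝ] E3) with hN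
    have hq' : (fun x => Φ.A (q (Φ.inv x))) ∈ polyVec (k - 2) :=
      clm_comp_mem_polyVec (comp_mem_polyVec hq Φ.inv_mem_polyVec) (Φ.A : E3 →L[ℝ] E3)
    have hp' : (fun x => N (p (Φ.inv x))) ∈ polyVec (k - 2) :=
      clm_comp_mem_polyVec (comp_mem_polyVec hp Φ.inv_mem_polyVec) N
    have hb : (fun x => -(d • cross Φ.b (Φ.A (q (Φ.inv x))))) ∈ polyVec (k - 2) := by
      have := cross_mem_polyVec (const_mem_polyVec 0 Φ.b) hq'
      rw [zero_add] at this
      exact (polyVec (k - 2)).neg_mem ((polyVec (k - 2)).smul_mem d this)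
    -- The test field on `K` is chosen so that its value at `Φ.map x` is `A⁻ᵀ (p + x × q)`; the
    -- second summand of the polynomial part compensates the translation.
    have h1 := h.inner hk _ ((polyVec (k - 2)).add_mem hp' hb) _ ((polyVec (k - 2)).smul_mem d hq')
    rw [Φ.setIntegral, mul_eq_zero, or_iff_right] at h1
    · rw [← h1]
      congr 1
      ext x
      have h2 : N (p x + cross x (q x)) = N (p x) + (-(d • cross Φ.b (Φ.A (q x)))
          + cross (Φ.map x) (d • Φ.A (q x))) := by
        rw [map_add, ← cross_sub_smul]
        congr 1
        have h3 : x = (Φ.A.symm : E3 →L[ℝ] E3) (Φ.map x - Φ.b) := by simp [RefMap.map]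
        have h4 : q x = (Φ.A.symm : E3 →L[ℝ] E3) (Φ.A (q x)) := by simp
        conv_lhs => rw [h4]
        conv_lhs => enter [2, 1]; rw [h3]
        exact hd _ _
      simp only [Pi.add_apply, Pi.smul_apply, Φ.inv_map]
      rw [add_assoc, ← h2, hN, ContinuousLinearMap.adjoint_inner_right]
      rfl
    · have hpos : ∀ K, IsTet K → 0 < volume.real (cell K) := fun K hK => by
        rw [measureReal_congr (IsTet.cell_ae_eq K)]; exact hK.volume_openCell_pos
      exact (div_pos (hpos _ hK) (hpos _ isTet_refTet)).ne'

/-- Stability of the BDM interpolant in the maximum norm. -/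
lemma exists_bdm_stable (k : ℕ) (hk : 1 ≤ k) : ∃ C : ℝ, 0 < C ∧ ∀ (K : Finset E3), IsTet K →
    ∀ Φ : RefMap K, ∀ p ∈ polyVec k, ∀ g : E3 → E3, ContinuousOn g (cell K) → ∀ δ : ℝ,
    (∀ x ∈ cell K, ‖g x‖ ≤ δ) → BDMOrth k K (fun x => g x - p x) → ∀ x ∈ cell K,
    ‖p x‖ ≤ C * ‖(Φ.A : E3 →L[ℝ] E3)‖ * ‖(Φ.A.symm : E3 →L[ℝ] E3)‖ * δ := by
  obtain ⟨C, hC, h⟩ := exists_bdm_refTet k hk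
  refine ⟨C, hC, fun K hK Φ p hp g hg δ hδ horth x hx => ?_⟩
  have hmc : Continuous Φ.map := (contDiff_of_mem_polyVec Φ.map_mem_polyVec (n := 0)).continuous
  -- The reference estimate is applied to the contravariant pullbacks `A⁻¹ p ∘ Φ` and `A⁻¹ g ∘ Φ`;
  -- the determinant of the full Piola transform would cancel.
  have h1 := h (fun x => Φ.A.symm (p (Φ.map x)))
    (clm_comp_mem_polyVec (comp_mem_polyVec hp Φ.map_mem_polyVec) (Φ.A.symm : E3 →L[ℝ] E3))
    (fun x => Φ.A.symm (g (Φ.map x)))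
    (Φ.A.symm.continuous.comp_continuousOn
      (hg.comp hmc.continuousOn fun y hy => Φ.map_mem_cell hy))
    (‖(Φ.A.symm : E3 →L[ℝ] E3)‖ * δ)
    (fun y hy => ((Φ.A.symm : E3 →L[ℝ] E3).le_opNorm _).trans
      (mul_le_mul_of_nonneg_left (hδ _ (Φ.map_mem_cell hy)) (norm_nonneg _)))
    (by simpa only [map_sub] using horth.pullback hK Φ) _ (Φ.inv_mem_cell hx)
  rw [Φ.map_inv] at h1
  have h2 : p x = (Φ.A : E3 →L[ℝ] E3) (Φ.A.symm (p x)) := by simp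
  rw [h2]
  calc ‖(Φ.A : E3 →L[ℝ] E3) (Φ.A.symm (p x))‖
      ≤ ‖(Φ.A : E3 →L[ℝ] E3)‖ * ‖Φ.A.symm (p x)‖ := ContinuousLinearMap.le_opNorm _ _
    _ ≤ ‖(Φ.A : E3 →L[ℝ] E3)‖ * (C * (‖(Φ.A.symm : E3 →L[ℝ] E3)‖ * δ)) :=
        mul_le_mul_of_nonneg_left h1 (norm_nonneg _)
    _ = _ := by ring

/-! ### Approximation by Taylor polynomials -/

section Weak

variable {F : Type*} [NormedAddCommGroup F] [NormedSpace ℝ F]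

lemma continuous_smul_of_tsupport {U : Set E3} (hU : IsOpen U) {φ : E3 → ℝ} (hφ : Continuous φ)
    (hφU : tsupport φ ⊆ U) {g : E3 → F} (hg : ContinuousOn g U) :
    Continuous fun x => φ x • g x := by
  refine continuous_of_tsupport fun x hx => ?_
  have hx' := hφU (tsupport_smul_subset_left φ g hx)
  exact hφ.continuousAt.smul (hg.continuousAt (hU.mem_nhds hx'))

lemma integrable_smul_of_tsupport {U : Set E3} (hU : IsOpen U) {φ : E3 → ℝ} (hφ : Continuous φ)
    (hc : HasCompactSupport φ) (hφU : tsupport φ ⊆ U) {g : E3 → F} (hg : ContinuousOn g U) :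
    Integrable fun x => φ x • g x :=
  (continuous_smul_of_tsupport hU hφ hφU hg).integrable_of_hasCompactSupport hc.smul_right

lemma tsupport_fderiv_apply_subset {φ : E3 → ℝ} (e : E3) :
    tsupport (fun x => fderiv ℝ φ x e) ⊆ tsupport φ :=
  _root_.tsupport_fderiv_apply_subset ℝ e

/-- Integration by parts against a test function. -/
lemma integral_fderiv_smul {U : Set E3} (hU : IsOpen U) {φ : E3 → ℝ} (hφ : ContDiff ℝ 1 φ)
    (hc : HasCompactSupport φ) (hφU : tsupport φ ⊆ U) {g : E3 → F} (hg : ContDiffOn ℝ 1 g U)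
    (e : E3) : ∫ x, fderiv ℝ φ x e • g x = -∫ x, φ x • fderiv ℝ g x e := by
  have hs : tsupport (fun x => fderiv ℝ φ x e) ⊆ tsupport φ := tsupport_fderiv_apply_subset e
  have hgc : ContinuousOn (fun x => fderiv ℝ g x e) U :=
    (hg.continuousOn_fderiv_of_isOpen hU le_rfl).clm_apply continuousOn_const
  have hφ' : Continuous fun x => fderiv ℝ φ x e :=
    (hφ.continuous_fderiv one_ne_zero).clm_apply continuous_const
  rw [integral_smul_fderiv_eq_neg_fderiv_smul_of_integrable (f := φ) (g := g) (v := e), neg_neg]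
  · exact integrable_smul_of_tsupport hU hφ'
      (hc.mono' (subset_closure.trans hs)) (hs.trans hφU) hg.continuousOn
  · exact integrable_smul_of_tsupport hU hφ.continuous hc hφU hgc
  · exact integrable_smul_of_tsupport hU hφ.continuous hc hφU hg.continuousOn
  · exact fun x _ => (hφ.differentiable one_ne_zero) x
  · exact fun x hx => (hg.differentiableOn one_ne_zero).differentiableAt (hU.mem_nhds (hφU hx))

/-- The last slot holds the innermost derivative; peeling it off allows induction on the order. -/
lemma iteratedFDeriv_succ_apply_eq {j : ℕ} {v : E3 → F} {x : E3} (hv : ContDiffAt ℝ (j + 1) v x)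
    (m : Fin (j + 1) → E3) : iteratedFDeriv ℝ (j + 1) v x m
      = iteratedFDeriv ℝ j (fun z => fderiv ℝ v z (m (Fin.last j))) x (Fin.init m) := by
  rw [iteratedFDeriv_succ_apply_right]
  have h := (ContinuousLinearMap.apply ℝ F (m (Fin.last j))).iteratedFDeriv_comp_left (i := j)
    (hv.fderiv_right (m := j) le_rfl) le_rfl
  have h2 : ((ContinuousLinearMap.apply ℝ F (m (Fin.last j))) ∘ fderiv ℝ v)
      = fun z => fderiv ℝ v z (m (Fin.last j)) := rfl
  rw [← h2, h]
  rfl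

/-- Repeated integration by parts against a test function. -/
lemma integral_iteratedFDeriv_smul {U : Set E3} (hU : IsOpen U) {ψ : E3 → ℝ}
    (hψ : ContDiff ℝ ∞ ψ) (hc : HasCompactSupport ψ) (hψU : tsupport ψ ⊆ U) (j : ℕ) :
    ∀ {v : E3 → F}, ContDiffOn ℝ j v U → ∀ y : Fin j → E3,
    ∫ x, iteratedFDeriv ℝ j ψ x y • v x
      = (-1 : ℝ) ^ j • ∫ x, ψ x • iteratedFDeriv ℝ j v x (y ∘ Fin.rev) := by
  induction j with
  | zero => intro v _ y; simp
  | succ j ih =>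
    intro v hv y
    set φ : E3 → ℝ := fun x => iteratedFDeriv ℝ j ψ x (Fin.tail y) with hφdef
    have hφ : ContDiff ℝ 1 φ := by
      have h1 : ContDiff ℝ 1 (iteratedFDeriv ℝ j ψ) :=
        hψ.iteratedFDeriv_right (m := 1) (i := j) (by exact_mod_cast le_top)
      exact (ContinuousMultilinearMap.apply ℝ (fun _ : Fin j => E3) ℝ (Fin.tail y)).contDiff.comp h1
    have hs : tsupport φ ⊆ tsupport ψ := by
      refine (closure_mono fun x hx => ?_).trans
        ((tsupport_iteratedFDeriv_subset (𝕜 := ℝ) (f := ψ) j))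
      exact fun h0 => hx (by simp only [hφdef, h0]; rfl)
    have h1 : ∀ x, iteratedFDeriv ℝ (j + 1) ψ x y = fderiv ℝ φ x (y 0) := by
      intro x
      refine (DifferentiableAt.iteratedFDeriv_succ_apply_left' ?_).trans rfl
      exact (hψ.iteratedFDeriv_right (m := 1) (i := j) (by exact_mod_cast le_top)).differentiable one_ne_zero x
    have hv1 : ContDiffOn ℝ 1 v U := hv.of_le (by exact_mod_cast Nat.le_add_left 1 j)
    -- The outermost derivative of `ψ`, along `y 0`, is the first to reach `v` and becomes the
    -- innermost there. This reverses the order of the arguments.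
    have hv' : ContDiffOn ℝ j (fun x => fderiv ℝ v x (y 0)) U :=
      (hv.fderiv_of_isOpen (m := j) hU (by norm_cast)).clm_apply contDiffOn_const
    simp only [h1]
    rw [integral_fderiv_smul hU hφ (hc.mono' (subset_closure.trans hs)) (hs.trans hψU) hv1,
      ih hv', pow_succ, mul_smul, neg_one_smul, smul_neg]
    congr 2
    refine integral_congr_ae (Eventually.of_forall fun x => ?_)
    by_cases hx : x ∈ tsupport ψ
    · have hvx : ContDiffAt ℝ (j + 1 : ℕ) v x := hv.contDiffAt (hU.mem_nhds (hψU hx))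
      simp only
      rw [iteratedFDeriv_succ_apply_eq (by exact_mod_cast hvx)]
      congr 2
      · simp
      · funext i
        simp only [Function.comp, Fin.tail, Fin.init, Fin.rev_castSucc]
    · simp only [image_eq_zero_of_notMem_tsupport hx, zero_smul]

/-- A continuous function with bounded weak derivatives is Lipschitz. -/
lemma norm_sub_le_of_weak_bound [CompleteSpace F] {U : Set E3} (hU : IsOpen U)
    {w : E3 → F} (hw : ContinuousOn w U) {L : ℝ} (hL0 : 0 ≤ L)
    (h : ∀ φ : E3 → ℝ, ContDiff ℝ ∞ φ → HasCompactSupport φ → tsupport φ ⊆ U → ∀ e : E3,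
      ‖∫ x, fderiv ℝ φ x e • w x‖ ≤ L * ‖e‖ * ∫ x, |φ x|) {x y : E3} (hxy : segment ℝ x y ⊆ U) :
    ‖w y - w x‖ ≤ L * ‖y - x‖ := by
  have hS : IsCompact (segment ℝ x y) := by
    rw [segment_eq_image_lineMap]
    exact isCompact_Icc.image AffineMap.lineMap_continuous
  obtain ⟨δ, hδ, hδU⟩ := hS.exists_cthickening_subset_open hU hxy
  have hC : IsCompact (Metric.cthickening δ (segment ℝ x y)) := hS.cthickening
  have hball : ∀ z ∈ segment ℝ x y, Metric.closedBall z δ ⊆ Metric.cthickening δ (segment ℝ x y) :=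
    fun z hz => Metric.closedBall_subset_cthickening hz δ
  -- Truncation to a compact neighbourhood of the segment makes `w` globally integrable, so that it
  -- can be mollified.
  set g : E3 → F := (Metric.cthickening δ (segment ℝ x y)).indicator w with hg
  have hgi : Integrable g := by
    rw [hg, integrable_indicator_iff hC.measurableSet]
    exact (hw.mono hδU).integrableOn_compact hC
  have key : ∀ ε > 0, ‖w y - w x‖ ≤ L * ‖y - x‖ + 2 * ε := by
    intro ε hε
    have hcont : ∀ z ∈ segment ℝ x y, ∃ η > 0, ∀ z' ∈ Metric.ball z η, dist (w z') (w z) ≤ ε := by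
      intro z hz
      obtain ⟨η, hη, h⟩ := Metric.continuousAt_iff.1 (hw.continuousAt (hU.mem_nhds (hxy hz))) ε hε
      exact ⟨η, hη, fun z' hz' => (h hz').le⟩
    obtain ⟨η1, hη1, h1⟩ := hcont x (left_mem_segment ℝ x y)
    obtain ⟨η2, hη2, h2⟩ := hcont y (right_mem_segment ℝ x y)
    -- The bound by `δ` lets mollification at points of the segment see only values of `w`; the
    -- bounds by `η1`, `η2` change the endpoint values by at most `ε`.
    set r := min δ (min η1 η2) with hr
    have hr0 : 0 < r := lt_min hδ (lt_min hη1 hη2)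
    let ρ : ContDiffBump (0 : E3) := ⟨r / 2, r, by positivity, by linarith⟩
    set f : E3 → ℝ := ρ.normed volume with hf
    set W : E3 → F := convolution f g (ContinuousLinearMap.lsmul ℝ ℝ) volume with hW
    have hfc : HasCompactSupport f := ρ.hasCompactSupport_normed
    have hfs : ContDiff ℝ ∞ f := ρ.contDiff_normed
    have hd : ∀ z, HasFDerivAt W ((convolution (fderiv ℝ f) g
        ((ContinuousLinearMap.lsmul ℝ ℝ : ℝ →L[ℝ] F →L[ℝ] F).precompL E3) volume) z) z := fun z =>
      hfc.hasFDerivAt_convolution_left _ (hfs.of_le (by exact_mod_cast le_top)) hgi.locallyIntegrable z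
    have happ : ∀ z ∈ segment ℝ x y, ∀ z' ∈ Metric.ball z r, g z' = w z' := fun z hz z' hz' =>
      indicator_of_mem (hball z hz (Metric.ball_subset_closedBall
        (Metric.ball_subset_ball (min_le_left _ _) hz'))) _
    have hend : ∀ z ∈ segment ℝ x y, (∀ z' ∈ Metric.ball z r, dist (w z') (w z) ≤ ε) →
        dist (W z) (w z) ≤ ε := by
      intro z hz hzε
      have hz0 := happ z hz z (Metric.mem_ball_self hr0)
      rw [← hz0]
      refine ρ.dist_normed_convolution_le hgi.aestronglyMeasurable fun z' hz' => ?_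
      rw [happ z hz z' hz', hz0]
      exact hzε z' hz'
    have hx1 := hend x (left_mem_segment ℝ x y) fun z' hz' => h1 z'
      (Metric.ball_subset_ball ((min_le_right _ _).trans (min_le_left _ _)) hz')
    have hy1 := hend y (right_mem_segment ℝ x y) fun z' hz' => h2 z'
      (Metric.ball_subset_ball ((min_le_right _ _).trans (min_le_right _ _)) hz')
    -- The derivative of the mollification along `e` is `-∫ ∂ₑφ w` with the reflected kernel `φ = f
    -- (z - ·)`. This is an admissible test function of unit mass, so the hypothesis bounds it by `L
    -- ‖e‖`.
    have hbd : ∀ z ∈ segment ℝ x y, ‖(convolution (fderiv ℝ f) g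
        ((ContinuousLinearMap.lsmul ℝ ℝ : ℝ →L[ℝ] F →L[ℝ] F).precompL E3) volume) z‖ ≤ L := by
      intro z hz
      refine ContinuousLinearMap.opNorm_le_bound _ hL0 fun e => ?_
      set φ : E3 → ℝ := fun s => f (z - s) with hφdef
      have hφ : ContDiff ℝ ∞ φ := hfs.comp (contDiff_const.sub contDiff_id)
      have hφs : tsupport φ ⊆ Metric.closedBall z r := by
        refine closure_minimal (fun s hs => ?_) Metric.isClosed_closedBall
        have : z - s ∈ Function.support f := hs
        rw [hf, ρ.support_normed_eq, mem_ball_zero_iff] at this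
        rw [Metric.mem_closedBall, dist_comm, dist_eq_norm]
        exact this.le
      have hφr : tsupport φ ⊆ Metric.cthickening δ (segment ℝ x y) := hφs.trans
        ((Metric.closedBall_subset_closedBall (min_le_left _ _)).trans (hball z hz))
      have hφd : ∀ s, fderiv ℝ φ s e = -fderiv ℝ f (z - s) e := by
        intro s
        have := ((hfs.differentiable (by simp)) (z - s)).hasFDerivAt.comp s
          ((hasFDerivAt_id s).const_sub z)
        have h2 : HasFDerivAt φ ((fderiv ℝ f (z - s)).comp (-ContinuousLinearMap.id ℝ E3)) s := this
        rw [h2.fderiv]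
        simp
      have hconv : Integrable fun t => (ContinuousLinearMap.lsmul ℝ ℝ : ℝ →L[ℝ] F →L[ℝ] F).precompL E3
          (fderiv ℝ f t) (g (z - t)) :=
        (hfc.fderiv ℝ).convolutionExists_left _ (hfs.continuous_fderiv (by simp))
          hgi.locallyIntegrable z
      rw [convolution_def, ContinuousLinearMap.integral_apply hconv]
      have h3 : ∫ t, ((ContinuousLinearMap.lsmul ℝ ℝ : ℝ →L[ℝ] F →L[ℝ] F).precompL E3
          (fderiv ℝ f t) (g (z - t))) e = -∫ s, fderiv ℝ φ s e • w s := by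
        rw [← integral_neg, ← integral_sub_left_eq_self _ volume z]
        refine integral_congr_ae (Eventually.of_forall fun s => ?_)
        by_cases hs : s ∈ tsupport φ
        · simp only [ContinuousLinearMap.precompL_apply, ContinuousLinearMap.lsmul_apply, hφd,
            neg_smul, neg_neg, sub_sub_cancel]
          rw [hg, indicator_of_mem (hφr hs)]
        · have : fderiv ℝ φ s e = 0 := image_eq_zero_of_notMem_tsupport
            (f := fun s => fderiv ℝ φ s e) fun h => hs (tsupport_fderiv_apply_subset e h)
          have h4 := hφd s
          rw [this, eq_comm, neg_eq_zero] at h4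
          simp only [ContinuousLinearMap.precompL_apply, ContinuousLinearMap.lsmul_apply, h4, this,
            zero_smul, neg_zero]
      rw [h3, norm_neg]
      refine (h φ hφ (IsCompact.of_isClosed_subset (isCompact_closedBall z r) isClosed_closure hφs)
        (hφr.trans hδU) e).trans (le_of_eq ?_)
      have h5 : ∫ s, |φ s| = 1 := by
        rw [← ρ.integral_normed (μ := volume), ← integral_sub_left_eq_self _ volume z]
        refine integral_congr_ae (Eventually.of_forall fun s => ?_)
        simp only [hφdef, sub_sub_cancel]
        exact abs_of_nonneg (ρ.nonneg_normed _)
      rw [h5, mul_one]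
    have hmv := (convex_segment x y).norm_image_sub_le_of_norm_hasFDerivWithin_le
      (fun z _ => (hd z).hasFDerivWithinAt) hbd (left_mem_segment ℝ x y) (right_mem_segment ℝ x y)
    calc ‖w y - w x‖ = ‖(W y - W x) - (W y - w y) + (W x - w x)‖ := by congr 1; abel
      _ ≤ ‖W y - W x‖ + ‖W y - w y‖ + ‖W x - w x‖ :=
        (norm_add_le _ _).trans (add_le_add (norm_sub_le _ _) le_rfl)
      _ ≤ L * ‖y - x‖ + 2 * ε := by
        rw [dist_eq_norm] at hx1 hy1
        linarith
  exact le_of_forall_pos_le_add fun ε hε => by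
    have := key (ε / 2) (by positivity)
    linarith

end Weak

/-- The derivative of top order of a function of `W^{k+1,∞}` is Lipschitz. -/
lemma norm_iteratedFDeriv_sub_le {U : Set E3} (hU : IsOpen U) (hconv : Convex ℝ U) {k : ℕ}
    {v : E3 → E3} (hv : ContDiffOn ℝ k v U) {g : E3 → E3 [×(k + 1)]→L[ℝ] E3}
    (hg : IsWeakDeriv U (k + 1) v g) {L : ℝ} (hL : 0 ≤ L)
    (hgL : ∀ᵐ x ∂(volume.restrict U), ‖g x‖ ≤ L) {x y : E3} (hx : x ∈ U) (hy : y ∈ U) :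
    ‖iteratedFDeriv ℝ k v y - iteratedFDeriv ℝ k v x‖ ≤ L * ‖y - x‖ := by
  refine ContinuousMultilinearMap.opNorm_le_bound (by positivity) fun z => ?_
  have hz : 0 ≤ ∏ i, ‖z i‖ := Finset.prod_nonneg fun i _ => norm_nonneg _
  have hw : ContinuousOn (fun x => iteratedFDeriv ℝ k v x z) U := by
    have h1 : ContinuousOn (iteratedFDeriv ℝ k v) U := fun x hx =>
      ((hv.contDiffAt (hU.mem_nhds hx)).iteratedFDeriv_right (m := 0)
        (by simp)).continuousAt.continuousWithinAt
    exact (ContinuousMultilinearMap.apply ℝ (fun _ : Fin k => E3) E3 z).continuous.comp_continuousOn h1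
  have key := norm_sub_le_of_weak_bound hU hw (mul_nonneg hL hz) (x := x) (y := y)
    (fun φ hφ hc hφU e => ?_) (hconv.segment_subset hx hy)
  · simpa only [sub_apply, mul_right_comm] using key
  -- With `∂ₑφ` as test function, `k` classical integrations by parts move the derivatives back onto
  -- `φ`, where the weak derivative of order `k + 1` applies.
  have hψ : ContDiff ℝ ∞ fun x => fderiv ℝ φ x e :=
    (hφ.fderiv_right (m := ∞) (by simp)).clm_apply contDiff_const
  have hs := tsupport_fderiv_apply_subset (φ := φ) e
  have h1 := integral_iteratedFDeriv_smul hU hψ (hc.mono' (subset_closure.trans hs))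
    (hs.trans hφU) k hv (z ∘ Fin.rev)
  have h2 : ∀ x, iteratedFDeriv ℝ k (fun x => fderiv ℝ φ x e) x (z ∘ Fin.rev)
      = iteratedFDeriv ℝ (k + 1) φ x (Fin.snoc (α := fun _ => E3) (z ∘ Fin.rev) e) := by
    intro x
    rw [iteratedFDeriv_succ_apply_eq (hφ.contDiffAt.of_le (by exact_mod_cast le_top)),
      Fin.snoc_last, Fin.init_snoc]
  have h3 := hg.2 φ hφ hc hφU (Fin.snoc (α := fun _ => E3) (z ∘ Fin.rev) e)
  have h4 : ∫ x, iteratedFDeriv ℝ k (fun x => fderiv ℝ φ x e) x (z ∘ Fin.rev) • v x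
      = ∫ x in U, iteratedFDeriv ℝ (k + 1) φ x (Fin.snoc (α := fun _ => E3) (z ∘ Fin.rev) e) • v x := by
    simp only [h2]
    refine (setIntegral_eq_integral_of_forall_compl_eq_zero fun x hx => ?_).symm
    have : iteratedFDeriv ℝ (k + 1) φ x = 0 := by
      by_contra h0
      exact hx (hφU (tsupport_iteratedFDeriv_subset (𝕜 := ℝ) (f := φ) (k + 1)
        (subset_closure h0)))
    rw [this]
    simp
  rw [h4, h3] at h1
  have hrev : (z ∘ Fin.rev) ∘ Fin.rev = z := by ext i; simp
  rw [hrev] at h1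
  have h5 : ‖∫ x, fderiv ℝ φ x e • iteratedFDeriv ℝ k v x z‖
      = ‖∫ x in U, φ x • g x (Fin.snoc (α := fun _ => E3) (z ∘ Fin.rev) e)‖ := by
    have := congrArg norm h1
    simpa [norm_smul] using this.symm
  have hprod : ∏ i, ‖(Fin.snoc (α := fun _ => E3) (z ∘ Fin.rev) e : Fin (k + 1) → E3) i‖
      = (∏ i, ‖z i‖) * ‖e‖ := by
    rw [Fin.prod_univ_castSucc]
    simp only [Fin.snoc_castSucc, Fin.snoc_last, Function.comp]
    congr 1
    exact Equiv.prod_comp Fin.revPerm fun i => ‖z i‖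
  have hgp : ∀ x, ‖g x‖ ≤ L → ‖g x (Fin.snoc (α := fun _ => E3) (z ∘ Fin.rev) e)‖
      ≤ L * (∏ i, ‖z i‖) * ‖e‖ := fun x hx => by
    have h6 := (g x).le_opNorm (Fin.snoc (α := fun _ => E3) (z ∘ Fin.rev) e)
    rw [hprod] at h6
    have h7 := mul_le_mul_of_nonneg_right hx (mul_nonneg hz (norm_nonneg e))
    rw [← mul_assoc L] at h7
    exact h6.trans h7
  generalize ∏ i, ‖z i‖ = Z at hz hgp hprod ⊢
  have hφi : Integrable φ := hφ.continuous.integrable_of_hasCompactSupport hc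
  rw [h5]
  calc ‖∫ x in U, φ x • g x (Fin.snoc (α := fun _ => E3) (z ∘ Fin.rev) e)‖
      ≤ ∫ x in U, L * Z * ‖e‖ * |φ x| := by
        refine norm_integral_le_of_norm_le (hφi.abs.restrict.const_mul _) ?_
        filter_upwards [hgL] with x hx
        rw [norm_smul, Real.norm_eq_abs, mul_comm]
        exact mul_le_mul_of_nonneg_right (hgp x hx) (abs_nonneg _)
    _ = L * Z * ‖e‖ * ∫ x in U, |φ x| := integral_const_mul _ _
    _ = L * Z * ‖e‖ * ∫ x, |φ x| := by
        congr 1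
        exact setIntegral_eq_integral_of_forall_compl_eq_zero fun x hx => by
          rw [image_eq_zero_of_notMem_tsupport fun h => hx (hφU h), abs_zero]

/-! ### Taylor polynomials -/

/-- Expanding every slot in the standard basis gives a sum of monomials of degree `j`. -/
lemma multilinear_diag_mem_polyFun {j : ℕ} (M : E3 [×j]→L[ℝ] E3) (i : Fin 3) :
    (fun x => M (fun _ => x) i) ∈ polyFun j := by
  have h : (fun x : E3 => M (fun _ => x) i)
      = fun x => ∑ r : Fin j → Fin 3, (∏ l, x (r l)) * M (fun l => stdE (r l)) i := by
    ext x
    have hx : (fun _ : Fin j => x) = fun _ => ∑ a, x a • stdE a := by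
      funext _; ext b; simp [stdE_apply]
    rw [hx, M.map_sum]
    simp only [M.map_smul_univ, WithLp.ofLp_sum, Finset.sum_apply, PiLp.smul_apply, smul_eq_mul]
  rw [h]
  refine sum_mem_polyFun _ fun r _ => ?_
  have := mul_mem_polyFun (l := 0)
    (prod_mem_polyFun (Finset.univ : Finset (Fin j)) (f := fun l (x : E3) => x (r l)) (d := fun _ => 1)
      fun l _ => coord_mem_polyFun (r l)) (const_mem_polyFun 0 (M (fun l => stdE (r l)) i))
  simpa using this

lemma eventually_contDiffAt {n : ℕ} {v : E3 → E3} {x : E3} (hv : ContDiffAt ℝ n v x) :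
    ∀ᶠ z in 𝓝 x, ContDiffAt ℝ n v z :=
  hv.eventually (by simp)

lemma fderiv_fderiv_comm {v : E3 → E3} {x : E3} (hv : ContDiffAt ℝ 2 v x) (a b : E3) :
    fderiv ℝ (fun z => fderiv ℝ v z a) x b = fderiv ℝ (fun z => fderiv ℝ v z b) x a := by
  have hd : DifferentiableAt ℝ (fderiv ℝ v) x :=
    (hv.fderiv_right (m := 1) (by norm_num)).differentiableAt one_ne_zero
  have h : ∀ a b, fderiv ℝ (fun z => fderiv ℝ v z a) x b = fderiv ℝ (fderiv ℝ v) x b a := by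
    intro a b
    have h1 := (ContinuousLinearMap.apply ℝ E3 a).hasFDerivAt.comp x hd.hasFDerivAt
    have h2 : HasFDerivAt (fun z => fderiv ℝ v z a)
      ((ContinuousLinearMap.apply ℝ E3 a).comp (fderiv ℝ (fderiv ℝ v) x)) x := h1
    rw [h2.fderiv]
    rfl
  rw [h, h]
  exact hv.isSymmSndFDerivAt (by simp) b a

/-- An adjacent swap of the two innermost slots is Schwarz's theorem; any other adjacent swap is
handled by induction after the last slot is peeled off. -/
lemma iteratedFDeriv_comp_swap (n : ℕ) : ∀ {v : E3 → E3} {x : E3}, ContDiffAt ℝ (n + 1 : ℕ) v x →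
    ∀ (m : Fin (n + 1) → E3) (i : Fin n),
    iteratedFDeriv ℝ (n + 1) v x (fun l => m (Equiv.swap i.castSucc i.succ l))
      = iteratedFDeriv ℝ (n + 1) v x m := by
  induction n with
  | zero => intro v x _ m i; exact i.elim0
  | succ n ih =>
    intro v x hv m i
    have hv' : ContDiffAt ℝ ((n + 1 : ℕ) + 1) v x := by exact_mod_cast hv
    have hd : ∀ e, ContDiffAt ℝ (n + 1 : ℕ) (fun z => fderiv ℝ v z e) x := fun e =>
      (hv'.fderiv_right le_rfl).clm_apply contDiffAt_const
    rw [iteratedFDeriv_succ_apply_eq hv', iteratedFDeriv_succ_apply_eq hv']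
    induction i using Fin.lastCases with
    | last =>
      rw [iteratedFDeriv_succ_apply_eq (by exact_mod_cast hd _),
        iteratedFDeriv_succ_apply_eq (by exact_mod_cast hd _)]
      have hev : ∀ a b : E3, (fun z => fderiv ℝ (fun z => fderiv ℝ v z a) z b)
          =ᶠ[𝓝 x] fun z => fderiv ℝ (fun z => fderiv ℝ v z b) z a := fun a b => by
        filter_upwards [eventually_contDiffAt hv] with z hz
        exact fderiv_fderiv_comm (hz.of_le (by exact_mod_cast Nat.le_add_left 2 n)) a b
      simp only [Fin.init, Fin.succ_last, Equiv.swap_apply_right, Equiv.swap_apply_left]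
      rw [((hev _ _).iteratedFDeriv ℝ n).eq_of_nhds]
      congr 1
      funext l
      simp only [Fin.init]
      congr 1
      refine Equiv.swap_apply_of_ne_of_ne ?_ ?_
      · simp [Fin.ext_iff]; omega
      · simp [Fin.ext_iff]; omega
    | cast i =>
      have h1 : Equiv.swap i.castSucc.castSucc i.castSucc.succ (Fin.last (n + 1)) = Fin.last (n + 1) :=
        Equiv.swap_apply_of_ne_of_ne (by simp [Fin.ext_iff]; omega) (by simp [Fin.ext_iff]; omega)
      rw [h1, ← ih (hd _) (Fin.init m) i]
      congr 1
      funext l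
      simp only [Fin.init]
      congr 1
      rw [Fin.succ_castSucc, (Fin.castSucc_injective (n + 1)).swap_apply]

/-- Iterated derivatives are symmetric. -/
lemma iteratedFDeriv_comp_perm {n : ℕ} {v : E3 → E3} {x : E3} (hv : ContDiffAt ℝ n v x)
    (m : Fin n → E3) (σ : Equiv.Perm (Fin n)) :
    iteratedFDeriv ℝ n v x (fun l => m (σ l)) = iteratedFDeriv ℝ n v x m := by
  cases n with
  | zero => congr 1; funext l; exact l.elim0
  | succ n =>
    -- Adjacent transpositions generate the symmetric group.
    have hσ : σ ∈ Submonoid.closure (range fun i : Fin n => Equiv.swap i.castSucc i.succ) := by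
      rw [Equiv.Perm.mclosure_swap_castSucc_succ]; trivial
    induction hσ using Submonoid.closure_induction generalizing m with
    | mem σ h =>
      obtain ⟨i, rfl⟩ := h
      exact iteratedFDeriv_comp_swap n hv m i
    | one => rfl
    | mul σ τ _ _ h1 h2 =>
      exact (h2 (fun l => m (σ l))).trans (h1 m)

/-- The Taylor polynomial. -/
lemma exists_taylor {k : ℕ} {v : E3 → E3} {x₀ : E3} (hv : ContDiffAt ℝ k v x₀) :
    ∃ Q ∈ polyVec k, ∀ j ≤ k, iteratedFDeriv ℝ j Q x₀ = iteratedFDeriv ℝ j v x₀ := by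
  let p : FormalMultilinearSeries ℝ E3 E3 := fun n =>
    if n ≤ k then ((n.factorial : ℝ)⁻¹) • iteratedFDeriv ℝ n v x₀ else 0
  have hp0 : ∀ m, k + 1 ≤ m → p m = 0 := fun m hm => if_neg (by omega)
  have hps := (p.hasFiniteFPowerSeriesOnBall_of_finite hp0).comp_sub x₀
  rw [zero_add] at hps
  refine ⟨fun z => p.sum (z - x₀), fun i => ?_, fun j hj => ?_⟩
  · have hsum : ∀ z, p.sum (z - x₀) i = ∑ n ∈ Finset.range (k + 1), p n (fun _ => z - x₀) i := by
      intro z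
      rw [p.sum_of_finite hp0, FormalMultilinearSeries.partialSum]
      simp
    simp only [hsum]
    refine sum_mem_polyFun _ fun n hn => ?_
    have h1 : (fun z : E3 => z - x₀) ∈ polyVec 1 := fun i =>
      sub_mem_polyFun (coord_mem_polyFun i) (const_mem_polyFun 1 (x₀ i))
    exact polyFun_mono (Nat.lt_succ_iff.1 (Finset.mem_range.1 hn))
      (comp_mem_polyFun (multilinear_diag_mem_polyFun (p n) i) h1)
  · ext1 m
    -- At the centre, the `j`-th derivative of a power series is its `j`-th coefficient summed over
    -- all permutations of the arguments. By symmetry the `j!` terms coincide and cancel the factor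
    -- `1 / j!`.
    rw [hps.toHasFPowerSeriesOnBall.iteratedFDeriv_eq_sum_of_completeSpace]
    have h2 : p j = ((j.factorial : ℝ)⁻¹) • iteratedFDeriv ℝ j v x₀ := if_pos hj
    have h3 : ∀ σ : Equiv.Perm (Fin j), iteratedFDeriv ℝ j v x₀ (fun i => m (σ i))
        = iteratedFDeriv ℝ j v x₀ m := fun σ =>
      iteratedFDeriv_comp_perm (hv.of_le (by exact_mod_cast hj)) m σ
    simp only [h2, smul_apply, h3, Finset.sum_const, Finset.card_univ,
      Fintype.card_perm, Fintype.card_fin]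
    rw [← Nat.cast_smul_eq_nsmul ℝ, smul_smul, mul_inv_cancel₀ (by positivity), one_smul]

lemma iteratedFDeriv_eq_zero_of_mem_polyVec (k : ℕ) : ∀ Q ∈ polyVec k, ∀ x,
    iteratedFDeriv ℝ (k + 1) Q x = 0 := by
  have hd : ∀ k, ∀ Q ∈ polyVec k, ∀ e : E3, (fun x => fderiv ℝ Q x e) ∈ polyVec (k - 1) := by
    intro k Q hQ e i
    have h1 : ∀ x, fderiv ℝ Q x e i = fderiv ℝ (fun z => Q z i) x e := fun x =>
      (fderiv_apply_coord ((contDiff_of_mem_polyVec hQ (n := 1)).differentiable one_ne_zero x)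
        e i)
    simp only [h1]
    exact fderiv_mem_polyFun (hQ i) e
  induction k with
  | zero =>
    intro Q hQ x
    have hc : ∀ y z, Q y = Q z := by
      intro y z
      ext i
      obtain ⟨P, hP, hPe⟩ := mem_polyFun.1 (hQ i)
      rw [Nat.le_zero, MvPolynomial.totalDegree_eq_zero_iff_eq_C] at hP
      have h2 : ∀ x, Q x i = P.coeff 0 := fun x => by
        have := congrFun hPe x
        rw [hP] at this
        simpa [evalFun] using this.symm
      rw [h2, h2]
    have : Q = fun _ => Q 0 := funext fun y => hc y 0
    rw [this]
    ext m
    simp [iteratedFDeriv_succ_apply_right]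
  | succ k ih =>
    intro Q hQ x
    ext1 m
    rw [iteratedFDeriv_succ_apply_eq (contDiff_of_mem_polyVec hQ).contDiffAt,
      ih _ (hd _ _ hQ _)]
    rfl

/-- Approximation by polynomials in `W^{k+1,∞}` of a convex set. -/
lemma exists_approx {U : Set E3} (hU : IsOpen U) (hconv : Convex ℝ U) (hne : U.Nonempty) {k : ℕ}
    (hk : 1 ≤ k) {v : E3 → E3} (hv : ContDiffOn ℝ k v U) {g : E3 → E3 [×(k + 1)]→L[ℝ] E3}
    (hg : IsWeakDeriv U (k + 1) v g) {L : ℝ} (hL : 0 ≤ L)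
    (hgL : ∀ᵐ x ∂(volume.restrict U), ‖g x‖ ≤ L) {d : ℝ} (hd : ∀ x ∈ U, ∀ y ∈ U, ‖y - x‖ ≤ d) :
    ∃ Q ∈ polyVec k, ∀ x ∈ U, DifferentiableAt ℝ (fun z => v z - Q z) x ∧
      ‖v x - Q x‖ ≤ L * d ^ (k + 1) ∧ ‖fderiv ℝ (fun z => v z - Q z) x‖ ≤ L * d ^ k ∧
      ∀ y ∈ U, ‖fderiv ℝ (fun z => v z - Q z) y - fderiv ℝ (fun z => v z - Q z) x‖
        ≤ L * d ^ (k - 1) * ‖y - x‖ := by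
  obtain ⟨x₀, hx₀⟩ := hne
  have hd0 : 0 ≤ d := (norm_nonneg _).trans (hd x₀ hx₀ x₀ hx₀)
  obtain ⟨Q, hQ, hQv⟩ := exists_taylor (hv.contDiffAt (hU.mem_nhds hx₀))
  have hQc : ∀ n : ℕ, ContDiff ℝ n Q := fun n => contDiff_of_mem_polyVec hQ
  set w : E3 → E3 := fun z => v z - Q z with hw
  have hwc : ∀ x ∈ U, ContDiffAt ℝ k w x := fun x hx =>
    (hv.contDiffAt (hU.mem_nhds hx)).sub (hQc k).contDiffAt
  have hsub : ∀ j ≤ k, ∀ x ∈ U, iteratedFDeriv ℝ j w x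
      = iteratedFDeriv ℝ j v x - iteratedFDeriv ℝ j Q x := fun j hj x hx =>
    fun_iteratedFDeriv_sub_apply ((hv.contDiffAt (hU.mem_nhds hx)).of_le (by exact_mod_cast hj))
      (hQc j).contDiffAt
  -- The top derivative of `Q` is constant, so subtracting `Q` leaves the Lipschitz constant of
  -- order `k` unchanged.
  have hQk : ∀ x y, iteratedFDeriv ℝ k Q x = iteratedFDeriv ℝ k Q y := by
    have hdiff : Differentiable ℝ (iteratedFDeriv ℝ k Q) :=
      (hQc (k + 1)).differentiable_iteratedFDeriv (by exact_mod_cast Nat.lt_succ_self k)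
    refine is_const_of_fderiv_eq_zero hdiff fun x => ?_
    rw [← norm_eq_zero, norm_fderiv_iteratedFDeriv, iteratedFDeriv_eq_zero_of_mem_polyVec k Q hQ,
      norm_zero]
  have hlip : ∀ x ∈ U, ∀ y ∈ U, ‖iteratedFDeriv ℝ k w y - iteratedFDeriv ℝ k w x‖
      ≤ L * ‖y - x‖ := by
    intro x hx y hy
    rw [hsub k le_rfl x hx, hsub k le_rfl y hy, hQk y x, sub_sub_sub_cancel_right]
    exact norm_iteratedFDeriv_sub_le hU hconv hv hg hL hgL hx hy
  have hz : ∀ j ≤ k, iteratedFDeriv ℝ j w x₀ = 0 := fun j hj => by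
    rw [hsub j hj x₀ hx₀, hQv j hj, sub_self]
  -- Induction downwards in the order: all derivatives of `w` vanish at `x₀`, and each mean value
  -- step gains one factor `d`.
  have hbd : ∀ i ≤ k, ∀ x ∈ U, ‖iteratedFDeriv ℝ (k - i) w x‖ ≤ L * d ^ (i + 1) := by
    intro i
    induction i with
    | zero =>
      intro _ x hx
      have := hlip x₀ hx₀ x hx
      rw [hz k le_rfl, sub_zero] at this
      simpa using this.trans (mul_le_mul_of_nonneg_left (hd x₀ hx₀ x hx) hL)
    | succ i ih =>
      intro hi x hx
      have hki : k - i = k - (i + 1) + 1 := by omega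
      have hdf : ∀ y ∈ U, DifferentiableAt ℝ (iteratedFDeriv ℝ (k - (i + 1)) w) y := fun y hy =>
        (hwc y hy).differentiableAt_iteratedFDeriv (by exact_mod_cast (by omega))
      have hb : ∀ y ∈ U, ‖fderiv ℝ (iteratedFDeriv ℝ (k - (i + 1)) w) y‖ ≤ L * d ^ (i + 1) :=
        fun y hy => by
          rw [norm_fderiv_iteratedFDeriv, ← hki]
          exact ih (by omega) y hy
      have := hconv.norm_image_sub_le_of_norm_fderiv_le hdf hb hx₀ hx
      rw [hz _ (by omega), sub_zero] at this
      refine this.trans ((mul_le_mul_of_nonneg_left (hd x₀ hx₀ x hx) (by positivity)).trans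
        (le_of_eq (by ring)))
  have hk1 : (1 : WithTop ℕ∞) ≤ k := by exact_mod_cast hk
  refine ⟨Q, hQ, fun x hx => ⟨((hwc x hx).of_le hk1).differentiableAt one_ne_zero, ?_, ?_,
    fun y hy => ?_⟩⟩
  · have := hbd k le_rfl x hx
    rwa [Nat.sub_self, norm_iteratedFDeriv_zero] at this
  · have := hbd (k - 1) (by omega) x hx
    rwa [show k - (k - 1) = 1 by omega, norm_iteratedFDeriv_one, Nat.sub_add_cancel hk] at this
  -- For `k ≥ 2` the gradient is Lipschitz through the classical second derivative. For `k = 1` that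
  -- derivative exists only weakly, and `hlip` itself is the claim.
  · rcases Nat.lt_or_ge 1 k with h2 | h2
    · refine hconv.norm_image_sub_le_of_norm_fderiv_le (𝕜 := ℝ) (f := fderiv ℝ w) (fun z hz => ?_)
        (fun z hz => ?_) hx hy
      · have h3 : ContDiffAt ℝ 1 (fderiv ℝ w) z :=
          (hwc z hz).fderiv_right (m := 1) (by exact_mod_cast h2)
        exact h3.differentiableAt one_ne_zero
      · have := hbd (k - 2) (by omega) z hz
        rw [show k - (k - 2) = 2 by omega, show k - 2 + 1 = k - 1 by omega] at this
        rwa [← norm_iteratedFDeriv_one, norm_iteratedFDeriv_fderiv]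
    · obtain rfl : k = 1 := by omega
      have := hlip x hx y hy
      simp only [Nat.sub_self, pow_zero, mul_one]
      refine ContinuousLinearMap.opNorm_le_bound _ (by positivity) fun e => ?_
      have h3 := (ContinuousMultilinearMap.le_opNorm (iteratedFDeriv ℝ 1 w y - iteratedFDeriv ℝ 1 w x)
        (fun _ => e)).trans (mul_le_mul_of_nonneg_right this (by positivity))
      simpa [iteratedFDeriv_one_apply] using h3

/-! ### The local interpolation error -/

/-- Lipschitz maps into a finite-dimensional space extend. The error and its gradient thereby
acquire continuous traces up to the closed element. -/
lemma exists_continuous_extension {F : Type*} [NormedAddCommGroup F] [NormedSpace ℝ F]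
    [FiniteDimensional ℝ F] {U : Set E3} {f : E3 → F} {C : ℝ} (hC : 0 ≤ C)
    (h : ∀ x ∈ U, ∀ y ∈ U, ‖f y - f x‖ ≤ C * ‖y - x‖) :
    ∃ g : E3 → F, Continuous g ∧ EqOn f g U := by
  have hl : LipschitzOnWith ⟨C, hC⟩ f U := LipschitzOnWith.of_dist_le_mul fun x hx y hy => by
    rw [dist_eq_norm, dist_eq_norm]
    exact h y hy x hx
  obtain ⟨g, hg, hgf⟩ := hl.extend_finite_dimension
  exact ⟨g, hg.continuous, hgf⟩

lemma IsTet.extendFrom_eq {K : Finset E3} (hK : IsTet K) {F : Type*} [TopologicalSpace F] [T2Space F]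
    {f g : E3 → F} (hg : ContinuousOn g (cell K)) (h : EqOn f g (openCell K)) :
    EqOn (extendFrom (openCell K) f) g (cell K) := fun x hx =>
  _root_.extendFrom_eq (hK.cell_subset_closure hx)
    (((hg x hx).mono (IsTet.openCell_subset_cell K)).congr'
      (eventually_nhdsWithin_of_forall fun _ hy => (h hy).symm))

lemma le_of_le_openCell {K : Finset E3} (hK : IsTet K) {g : E3 → ℝ} {C : ℝ}
    (hg : ContinuousOn g (cell K)) (h : ∀ x ∈ openCell K, g x ≤ C) : ∀ x ∈ cell K, g x ≤ C := by
  intro x hx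
  have h1 : Tendsto g (𝓝[openCell K] x) (𝓝 (g x)) := (hg x hx).mono (IsTet.openCell_subset_cell K)
  have : (𝓝[openCell K] x).NeBot := mem_closure_iff_nhdsWithin_neBot.1 (hK.cell_subset_closure hx)
  exact le_of_tendsto h1 (eventually_nhdsWithin_of_forall h)

/-! ### From the broken Sobolev norm to the error on an element. -/

namespace TetMesh

variable {Ω : Set E3} (M : TetMesh Ω)

lemma isTet {K : Finset E3} (hK : K ∈ M.elems) : IsTet K := ⟨M.card_elem K hK, M.indep K hK⟩

lemma mem_faces {f : Finset E3} : f ∈ M.faces ↔ ∃ K ∈ M.elems, f ⊆ K ∧ f.card = 3 := by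
  simp [faces, Finset.mem_powersetCard]

lemma mem_elemsOf {f K : Finset E3} : K ∈ M.elemsOf f ↔ K ∈ M.elems ∧ f ⊆ K := by
  simp [elemsOf]

open scoped Classical in
lemma erase_mem_faces {K : Finset E3} (hK : K ∈ M.elems) {v : E3} (hv : v ∈ K) :
    K.erase v ∈ M.faces :=
  M.mem_faces.2 ⟨K, hK, Finset.erase_subset _ _, by
    rw [Finset.card_erase_of_mem hv, M.card_elem K hK]⟩

/-- Needed because `toReal` sends an infinite supremum to zero, which would destroy the upper bound.
-/
lemma brokenWInfNorm_lt_top {m : ℕ} {v : E3 → E3} (hv : M.MemVW m v) :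
    (⨆ K ∈ M.elems, ⨆ j ∈ Finset.range (m + 1 + 1),
      eLpNorm (weakDeriv (openCell K) j v) ∞ (volume.restrict (openCell K))) < ⊤ := by
  simp only [← Finset.sup_eq_iSup]
  rw [Finset.sup_lt_iff ENNReal.zero_lt_top]
  intro K hK
  rw [Finset.sup_lt_iff ENNReal.zero_lt_top]
  intro j hj
  have h := (hv.2 K hK).1.2 j (Nat.lt_succ_iff.1 (Finset.mem_range.1 hj))
  rw [weakDeriv, dif_pos h]
  exact h.choose_spec.1.2

lemma exists_weakDeriv_bound {m : ℕ} {v : E3 → E3} (hv : M.MemVW m v) {K : Finset E3}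
    (hK : K ∈ M.elems) : ∃ g, IsWeakDeriv (openCell K) (m + 1) v g ∧
      ∀ᵐ x ∂(volume.restrict (openCell K)), ‖g x‖ ≤ M.brokenWInfNorm (m + 1) v := by
  have h := (hv.2 K hK).1.2 (m + 1) le_rfl
  refine ⟨weakDeriv (openCell K) (m + 1) v, by rw [weakDeriv, dif_pos h]; exact h.choose_spec, ?_⟩
  have h1 : eLpNorm (weakDeriv (openCell K) (m + 1) v) ∞ (volume.restrict (openCell K))
      ≤ ⨆ K ∈ M.elems, ⨆ j ∈ Finset.range (m + 1 + 1),
        eLpNorm (weakDeriv (openCell K) j v) ∞ (volume.restrict (openCell K)) :=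
    le_trans (le_iSup₂ (f := fun j (_ : j ∈ Finset.range (m + 1 + 1)) =>
        eLpNorm (weakDeriv (openCell K) j v) ∞ (volume.restrict (openCell K))) (m + 1)
        (Finset.mem_range.2 (Nat.lt_succ_self _)))
      (le_iSup₂ (f := fun K (_ : K ∈ M.elems) => ⨆ j ∈ Finset.range (m + 1 + 1),
        eLpNorm (weakDeriv (openCell K) j v) ∞ (volume.restrict (openCell K))) K hK)
  filter_upwards [ae_le_eLpNormEssSup (f := weakDeriv (openCell K) (m + 1) v)] with x hx
  rw [← eLpNorm_exponent_top] at hx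
  have h2 := ENNReal.toReal_mono (M.brokenWInfNorm_lt_top hv).ne (hx.trans h1)
  simpa [brokenWInfNorm] using h2

/-- The degrees of freedom of the interpolation error vanish. -/
lemma bdmOrth (N : M.Normals) {k : ℕ} {v : E3 → E3} {K : Finset E3} (hK : K ∈ M.elems)
    {P : Fin 3 → MvPolynomial (Fin 3) ℝ} {V : E3 → E3} (hV : ContinuousOn V (cell K))
    (hvV : EqOn v V (openCell K))
    (h1 : ∀ f ∈ M.faces, f ⊆ K → ∀ q : MvPolynomial (Fin 3) ℝ, q.totalDegree ≤ k →
      faceInt f (fun x => ⟪extendFrom (openCell K) v x - polyField P x, N.n f⟫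
        * MvPolynomial.eval x.ofLp q) = 0)
    (h2 : ∀ p q : Fin 3 → MvPolynomial (Fin 3) ℝ,
      (∀ i, (p i).totalDegree + 2 ≤ k) → (∀ i, (q i).totalDegree + 2 ≤ k) →
      ∫ x in openCell K, ⟪v x - polyField P x, polyField p x + cross x (polyField q x)⟫ = 0) :
    BDMOrth k K fun x => V x - polyField P x := by
  classical
  refine ⟨fun a ha => ?_, fun hk p hp q hq => ?_⟩
  · have hf := M.erase_mem_faces hK ha
    refine ⟨N.n (K.erase a), fun h0 => ?_, fun x hx y hy hxa hya => ?_, fun q hq => ?_⟩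
    · have := N.unit _ hf
      rw [h0, norm_zero] at this
      norm_num at this
    · exact N.orth _ hf x (Finset.mem_erase.2 ⟨hxa, hx⟩) y (Finset.mem_erase.2 ⟨hya, hy⟩)
    · obtain ⟨Q, hQ, rfl⟩ := mem_polyFun.1 hq
      have := h1 _ hf (Finset.erase_subset _ _) Q hQ
      rw [← this]
      have hsub := openFace_subset_cell_of_subset (Finset.erase_subset a K)
      refine faceInt_congr ((M.isTet hK).isTri_erase ha) fun x hx => ?_
      rw [IsTet.extendFrom_eq (M.isTet hK) hV hvV (hsub (openFace_subset_cell _ hx))]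
      rfl
  · obtain ⟨p', hp', rfl⟩ := exists_polyField hp
    obtain ⟨q', hq', rfl⟩ := exists_polyField hq
    rw [← IsTet.setIntegral_openCell, ← h2 p' q' (fun i => by have := hp' i; omega)
      fun i => by have := hq' i; omega]
    exact setIntegral_congr_fun (IsTet.isOpen_openCell K).measurableSet fun x hx => by rw [hvV hx]

/-- The error of the interpolant on an element, with its trace and the trace of its gradient. -/
lemma exists_interp_error (k : ℕ) (hk : 1 ≤ k) (cM : ℝ) (hcM : 0 < cM) : ∃ C : ℝ, 0 < C ∧
    ∀ (Ω : Set E3) (M : TetMesh Ω) (N : M.Normals), M.ShapeRegular cM → ∀ v w : E3 → E3,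
    M.MemVW k v → M.IsBDMInterpolant N k v w → ∀ K ∈ M.elems,
    ∃ (e : E3 → E3) (D : E3 → Matrix (Fin 3) (Fin 3) ℝ), ContinuousOn e (cell K) ∧
      ContinuousOn D (cell K) ∧ EqOn (v - w) e (openCell K) ∧
      EqOn (gradM (v - w)) D (openCell K) ∧
      (∀ x ∈ cell K, ‖e x‖ ≤ C * M.brokenWInfNorm (k + 1) v * Metric.diam (cell K) ^ (k + 1)) ∧
      ∀ x ∈ cell K, ∀ i j,
        |D x i j| ≤ C * M.brokenWInfNorm (k + 1) v * Metric.diam (cell K) ^ k := by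
  obtain ⟨C₁, hC₁, hst⟩ := exists_bdm_stable k hk
  obtain ⟨C₂, hC₂, hinv⟩ := exists_fderiv_le k
  -- The first bracket serves the field, the second its gradient. Each `1` comes from `v - Q` and
  -- the remainder from `p`.
  refine ⟨(1 + C₁ * (12 * cM)) + (1 + C₂ * (C₁ * (12 * cM)) * (4 * cM)), by positivity, ?_⟩
  intro Ω M N hreg v w hv hw K hK
  have hKt := M.isTet hK
  set U := openCell K with hUdef
  set G := M.brokenWInfNorm (k + 1) v with hG
  set d := Metric.diam (cell K) with hd
  have hG0 : 0 ≤ G := ENNReal.toReal_nonneg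
  have hd0 : 0 ≤ d := Metric.diam_nonneg
  obtain ⟨g, hg, hgb⟩ := M.exists_weakDeriv_bound hv hK
  have hUd : ∀ x ∈ U, ∀ y ∈ U, ‖y - x‖ ≤ d := fun x hx y hy => by
    rw [← dist_eq_norm]
    exact Metric.dist_le_diam_of_mem (IsTet.isBounded_cell K) (IsTet.openCell_subset_cell K hy)
      (IsTet.openCell_subset_cell K hx)
  have hUo : IsOpen U := IsTet.isOpen_openCell K
  have hUc : Convex ℝ U := IsTet.convex_openCell K
  obtain ⟨Q, hQ, hQv⟩ := exists_approx hUo hUc hKt.openCell_nonempty hk (hv.2 K hK).2 hg hG0 hgb hUd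
  have hlip : ∀ x ∈ U, ∀ y ∈ U, ‖(v y - Q y) - (v x - Q x)‖ ≤ G * d ^ k * ‖y - x‖ :=
    fun x hx y hy => hUc.norm_image_sub_le_of_norm_fderiv_le (f := fun z => v z - Q z)
      (fun z hz => (hQv z hz).1) (fun z hz => (hQv z hz).2.2.1) hx hy
  obtain ⟨r, hrc, hr⟩ := exists_continuous_extension (f := fun z => v z - Q z)
    (by positivity : 0 ≤ G * d ^ k) hlip
  obtain ⟨R, hRc, hR⟩ := exists_continuous_extension (f := fderiv ℝ fun z => v z - Q z)
    (by positivity : 0 ≤ G * d ^ (k - 1)) fun x hx y hy => (hQv x hx).2.2.2 y hy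
  have hrb : ∀ x ∈ cell K, ‖r x‖ ≤ G * d ^ (k + 1) :=
    le_of_le_openCell hKt hrc.norm.continuousOn fun x hx => by
      rw [← hr hx]; exact (hQv x hx).2.1
  have hRb : ∀ x ∈ cell K, ‖R x‖ ≤ G * d ^ k :=
    le_of_le_openCell hKt hRc.norm.continuousOn fun x hx => by
      rw [← hR hx]; exact (hQv x hx).2.2.1
  obtain ⟨P, hP, hwP, h1, h2⟩ := hw K hK
  have hPv : polyField P ∈ polyVec k := polyField_mem hP
  have hQc : Continuous Q := (contDiff_of_mem_polyVec hQ (n := 0)).continuous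
  have hPc : Continuous (polyField P) := (contDiff_of_mem_polyVec hPv (n := 0)).continuous
  -- Interpolation reproduces `Q`, so `p` interpolates `v - Q` and inherits its smallness by
  -- stability.
  set p : E3 → E3 := polyField P - Q with hp
  have hpk : p ∈ polyVec k := (polyVec k).sub_mem hPv hQ
  have hpc : ContDiff ℝ 1 p := contDiff_of_mem_polyVec hpk
  have horth := M.bdmOrth N hK (V := fun x => r x + Q x) (hrc.add hQc).continuousOn
    (fun x hx => by simp only [← hr hx]; abel) h1 h2
  have heq : (fun x => r x + Q x - polyField P x) = fun x => r x - p x := by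
    ext1 x; simp only [hp, Pi.sub_apply]; abel
  rw [heq] at horth
  obtain ⟨Φ⟩ := hKt.exists_refMap
  obtain ⟨x₀, ρ, hρ, hball, -, hdρ⟩ := hreg K hK
  have hA := Φ.norm_A_le
  have hA' := Φ.norm_A_symm_le hρ hball
  set α := ‖(Φ.A : E3 →L[ℝ] E3)‖
  set β := ‖(Φ.A.symm : E3 →L[ℝ] E3)‖
  have hαβ : α * β ≤ 12 * cM := by
    calc α * β ≤ 3 * d * (4 / ρ) := mul_le_mul hA hA' (norm_nonneg _) (by positivity)
      _ = 12 * (d / ρ) := by ring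
      _ ≤ 12 * cM := by
        have : d / ρ ≤ cM := by rwa [div_le_iff₀ hρ]
        linarith
  have hdβ : d * β ≤ 4 * cM := by
    calc d * β ≤ d * (4 / ρ) := mul_le_mul_of_nonneg_left hA' hd0
      _ = 4 * (d / ρ) := by ring
      _ ≤ 4 * cM := by
        have : d / ρ ≤ cM := by rwa [div_le_iff₀ hρ]
        linarith
  have hδ : 0 ≤ G * d ^ (k + 1) := by positivity
  have hpb : ∀ x ∈ cell K, ‖p x‖ ≤ C₁ * (12 * cM) * (G * d ^ (k + 1)) := fun x hx => by
    refine (hst K hKt Φ p hpk r hrc.continuousOn _ hrb horth x hx).trans ?_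
    rw [mul_assoc C₁]
    exact mul_le_mul_of_nonneg_right (mul_le_mul_of_nonneg_left hαβ hC₁.le) hδ
  -- The inverse inequality costs `‖A⁻¹‖`, which shape regularity trades for one power of the
  -- diameter.
  have hpd : ∀ x ∈ cell K, ‖fderiv ℝ p x‖ ≤ C₂ * (C₁ * (12 * cM)) * (4 * cM) * (G * d ^ k) := by
    intro x hx
    refine (hinv K Φ p hpk _ hpb x hx).trans ?_
    have h3 : C₂ * (C₁ * (12 * cM) * (G * d ^ (k + 1))) * β
        = C₂ * (C₁ * (12 * cM)) * (G * d ^ k) * (d * β) := by ring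
    rw [h3]
    refine (mul_le_mul_of_nonneg_left hdβ (by positivity)).trans (le_of_eq (by ring))
  have hEqU : EqOn (v - w) (fun x => r x - p x) U := fun x hx => by
    simp only [Pi.sub_apply, ← hr hx, hwP x hx, hp]
    abel
  refine ⟨fun x => r x - p x, fun x => Matrix.of fun i j =>
    (R x - fderiv ℝ p x) (EuclideanSpace.single j 1) i, (hrc.sub hpc.continuous).continuousOn,
    Continuous.continuousOn ?_, hEqU, fun x hx => ?_, fun x hx => ?_, fun x hx i j => ?_⟩
  · refine continuous_matrix fun i j => ?_
    exact ((EuclideanSpace.proj i : E3 →L[ℝ] ℝ).continuous.comp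
      ((hRc.sub (hpc.continuous_fderiv one_ne_zero)).clm_apply continuous_const))
  · have h3 : (v - w) =ᶠ[𝓝 x] fun z => (v z - Q z) - p z := by
      filter_upwards [hUo.mem_nhds hx] with z hz
      rw [hEqU hz]
      simp only [← hr hz]
    ext i j
    simp only [gradM, Matrix.of_apply]
    rw [h3.fderiv_eq, fderiv_fun_sub (hQv x hx).1 (hpc.differentiable one_ne_zero x), hR hx]
  · refine (norm_sub_le _ _).trans ?_
    have h4 := hrb x hx
    have h5 := hpb x hx
    have h6 : 0 ≤ (1 + C₂ * (C₁ * (12 * cM)) * (4 * cM)) * (G * d ^ (k + 1)) := by positivity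
    nlinarith
  · have h3 : |(R x - fderiv ℝ p x) (EuclideanSpace.single j 1) i| ≤ ‖R x - fderiv ℝ p x‖ := by
      refine (PiLp.norm_apply_le ((R x - fderiv ℝ p x) (EuclideanSpace.single j 1)) i).trans ?_
      refine ((R x - fderiv ℝ p x).le_opNorm _).trans (le_of_eq ?_)
      simp
    refine h3.trans ((norm_sub_le _ _).trans ?_)
    have h4 := hRb x hx
    have h5 := hpd x hx
    have h6 : 0 ≤ (1 + C₁ * (12 * cM)) * (G * d ^ k) := by positivity
    nlinarith

end TetMesh

/-! ### Faces of the mesh -/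

-- Along `n` the coordinate of the opposite vertex grows linearly from zero, while the other
-- coordinates stay positive by continuity.
open scoped Classical in
lemma IsTet.eventually_mem_openCell {K : Finset E3} (hK : IsTet K) {v : E3} (hv : v ∈ K) {n : E3}
    (hn0 : n ≠ 0) (hn : ∀ x ∈ K.erase v, ∀ y ∈ K.erase v, ⟪n, y - x⟫ = 0)
    (hpos : ∀ x ∈ K.erase v, 0 < ⟪n, v - x⟫) {x : E3} (hx : x ∈ openFace (K.erase v)) :
    ∀ᶠ s : ℝ in 𝓝[>] 0, x + s • n ∈ openCell K := by
  obtain ⟨h0, h1⟩ := hK.coord_of_mem_openFace hv hx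
  obtain ⟨y, hyK, hyv⟩ := IsTet.exists_ne hv hK
  have hy : y ∈ K.erase v := Finset.mem_erase.2 ⟨hyv, hyK⟩
  have key := hK.inner_eq_coord (x := y) (n := n) hv fun z hz hzv =>
    hn y hy z (Finset.mem_erase.2 ⟨hzv, hz⟩)
  have h2 : ∀ᶠ s : ℝ in 𝓝[>] 0, ∀ u : K, (u : E3) ≠ v → 0 < hK.coord u (x + s • n) := by
    refine eventually_all.2 fun u => ?_
    by_cases hu : (u : E3) = v
    · exact Eventually.of_forall fun s h => absurd hu h
    · have hc : Continuous fun s : ℝ => hK.coord u (x + s • n) :=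
        (hK.continuous_coord u).comp (by fun_prop)
      have h3 : ∀ᶠ s : ℝ in 𝓝 0, 0 < hK.coord u (x + s • n) :=
        hc.continuousAt.eventually (lt_mem_nhds (by simpa using h1 u hu))
      exact (h3.filter_mono nhdsWithin_le_nhds).mono fun s hs _ => hs
  filter_upwards [h2, self_mem_nhdsWithin] with s hs hs0
  rw [hK.openCell_eq]
  intro u
  by_cases hu : (u : E3) = v
  · obtain rfl : u = ⟨v, hv⟩ := Subtype.ext hu
    have k1 := key (x + s • n)
    have k2 := key x
    rw [h0, mul_zero] at k2
    rw [add_sub_right_comm, inner_add_right, k2, zero_add, real_inner_smul_right] at k1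
    have hnn : 0 < ⟪n, n⟫ := real_inner_self_pos.2 hn0
    have hp := hpos y hy
    by_contra hle
    have : ⟪n, v - y⟫ * hK.coord ⟨v, hv⟩ (x + s • n) ≤ 0 :=
      mul_nonpos_of_nonneg_of_nonpos hp.le (not_lt.1 hle)
    have hs0' : (0 : ℝ) < s := hs0
    have : 0 < s * ⟪n, n⟫ := by positivity
    linarith
  · exact hs u hu

lemma IsTri.openFace_nonempty {f : Finset E3} (hf : IsTri f) : (openFace f).Nonempty := by
  refine ⟨_, fun _ => (3 : ℝ)⁻¹, fun y _ => by norm_num, ?_, rfl⟩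
  rw [Finset.sum_const, hf.card]; norm_num

/-! ### Elements adjacent to a face and one-sided traces. -/

namespace TetMesh

variable {Ω : Set E3} (M : TetMesh Ω)

/-- By conformity a common point lies in the hull of the shared vertices, where the barycentric
coordinate of a vertex of `K` outside `L` vanishes. -/
lemma disjoint_openCell_cell {K L : Finset E3} (hK : K ∈ M.elems) (hL : L ∈ M.elems)
    (h : K ≠ L) : Disjoint (openCell K) (cell L) := by
  classical
  rw [Set.disjoint_left]
  intro x hxK hxL
  have hKt := M.isTet hK
  obtain ⟨v, hv, hvL⟩ : ∃ v ∈ K, v ∉ L := by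
    by_contra! hcon
    exact h (Finset.eq_of_subset_of_card_le hcon (by rw [M.card_elem K hK, M.card_elem L hL]))
  have hx : x ∈ convexHull ℝ ((K : Set E3) ∩ L) := by
    rw [← M.conforming K hK L hL]
    exact ⟨IsTet.openCell_subset_cell K hxK, hxL⟩
  have hsub : convexHull ℝ ((K : Set E3) ∩ L) ⊆ {z | hKt.coord ⟨v, hv⟩ z = 0} := by
    refine convexHull_min (fun u hu => ?_) ?_
    · exact hKt.coord_ne (u := ⟨u, hu.1⟩) fun h => hvL (by
        have := congrArg Subtype.val h
        simp only at this
        rw [this]; exact hu.2)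
    · exact (convex_singleton (0 : ℝ)).affine_preimage (hKt.coord ⟨v, hv⟩)
  have h1 := hsub hx
  rw [hKt.openCell_eq] at hxK
  exact (hxK ⟨v, hv⟩).ne' h1

lemma disjoint_openCell {K L : Finset E3} (hK : K ∈ M.elems) (hL : L ∈ M.elems)
    (h : K ≠ L) : Disjoint (openCell K) (openCell L) :=
  (M.disjoint_openCell_cell hK hL h).mono_right (IsTet.openCell_subset_cell L)

lemma isTri {f : Finset E3} (hf : f ∈ M.faces) : IsTri f := by
  obtain ⟨K, hK, hfK, hc⟩ := M.mem_faces.1 hf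
  exact (M.isTet hK).isTri_of_subset hfK hc

lemma mem_faces_of_mem_intFaces {f : Finset E3} (hf : f ∈ M.intFaces) : f ∈ M.faces := by
  classical
  exact (Finset.mem_filter.1 hf).1

lemma mem_intFaces {f : Finset E3} : f ∈ M.intFaces ↔
    f ∈ M.faces ∧ ∃ K ∈ M.elemsOf f, ∃ L ∈ M.elemsOf f, K ≠ L := by
  simp [intFaces]

open scoped Classical in
lemma exists_apex {f K : Finset E3} (hf : f ∈ M.faces) (hK : K ∈ M.elemsOf f) :
    ∃ v ∈ K, f = K.erase v :=
  (M.isTet (M.mem_elemsOf.1 hK).1).exists_eq_erase (M.mem_elemsOf.1 hK).2 (M.isTri hf).card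

/-- The element `K` lies on the side of the face `f` to which `σ • n_f` points. -/
def IsSide (N : M.Normals) (f : Finset E3) (σ : ℝ) (K : Finset E3) : Prop :=
  K ∈ M.elems ∧ f ⊆ K ∧ ∀ v ∈ K, v ∉ f → ∀ x ∈ f, 0 < ⟪σ • N.n f, v - x⟫

variable {M} in
lemma IsSide.eventually_mem {N : M.Normals} {f K : Finset E3} {σ : ℝ} (hf : f ∈ M.faces)
    (h : M.IsSide N f σ K) {x : E3} (hx : x ∈ openFace f) :
    ∀ᶠ s : ℝ in 𝓝[>] 0, x + s • σ • N.n f ∈ openCell K := by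
  classical
  obtain ⟨v, hv, hfe⟩ := M.exists_apex hf (M.mem_elemsOf.2 ⟨h.1, h.2.1⟩)
  have hvf : v ∉ f := hfe ▸ Finset.notMem_erase v K
  have horth : ∀ x ∈ f, ∀ y ∈ f, ⟪σ • N.n f, y - x⟫ = 0 := fun x hx y hy => by
    rw [real_inner_smul_left, N.orth f hf x hx y hy, mul_zero]
  have hpos := h.2.2 v hv hvf
  obtain ⟨y, hy⟩ : f.Nonempty := Finset.card_pos.1 (by rw [(M.isTri hf).card]; norm_num)
  have hn0 : σ • N.n f ≠ 0 := fun h0 => by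
    have := hpos y hy
    rw [h0, inner_zero_left] at this
    exact this.false
  have hKt := M.isTet h.1
  have key := hKt.eventually_mem_openCell hv hn0 (hfe ▸ horth) (hfe ▸ hpos) (hfe ▸ hx)
  exact key

-- Two elements on the same side would both contain the points just off the face, against
-- disjointness of their interiors.
variable {M} in
lemma IsSide.unique {N : M.Normals} {f K L : Finset E3} {σ : ℝ} (hf : f ∈ M.faces)
    (hK : M.IsSide N f σ K) (hL : M.IsSide N f σ L) : K = L := by
  by_contra hne
  obtain ⟨x, hx⟩ := (M.isTri hf).openFace_nonempty
  obtain ⟨s, h1, h2⟩ := ((hK.eventually_mem hf hx).and (hL.eventually_mem hf hx)).exists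
  exact Set.disjoint_left.1 (M.disjoint_openCell hK.1 hL.1 hne) h1 h2

lemma isSide_or (N : M.Normals) {f K : Finset E3} (hf : f ∈ M.faces) (hK : K ∈ M.elemsOf f) :
    M.IsSide N f (-1) K ∨ M.IsSide N f 1 K := by
  classical
  obtain ⟨v, hv, hfe⟩ := M.exists_apex hf hK
  obtain ⟨hKe, hfK⟩ := M.mem_elemsOf.1 hK
  have hn0 : N.n f ≠ 0 := fun h0 => by
    have := N.unit f hf
    rw [h0, norm_zero] at this
    norm_num at this
  obtain ⟨y, hy⟩ : f.Nonempty := Finset.card_pos.1 (by rw [(M.isTri hf).card]; norm_num)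
  have hmem : ∀ w ∈ K, w ∉ f → w = v := fun w hw hwf => by
    by_contra hne
    exact hwf (hfe ▸ Finset.mem_erase.2 ⟨hne, hw⟩)
  have h1 : ∀ x ∈ f, ⟪N.n f, v - x⟫ = ⟪N.n f, v - y⟫ := fun x hx => by
    have := N.orth f hf x hx y hy
    rw [← sub_add_sub_cancel v y x, inner_add_right, this, add_zero]
  have hne : ⟪N.n f, v - y⟫ ≠ 0 := (M.isTet hKe).inner_ne_zero hv (fun z hz hzv =>
    N.orth f hf y hy z (hfe ▸ Finset.mem_erase.2 ⟨hzv, hz⟩)) hn0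
  rcases lt_or_gt_of_ne hne with h | h
  · refine Or.inl ⟨hKe, hfK, fun w hw hwf x hx => ?_⟩
    rw [hmem w hw hwf, real_inner_smul_left, h1 x hx]
    linarith
  · refine Or.inr ⟨hKe, hfK, fun w hw hwf x hx => ?_⟩
    rw [hmem w hw hwf, real_inner_smul_left, h1 x hx]
    linarith

lemma exists_elemsOf {f : Finset E3} (hf : f ∈ M.faces) : ∃ K, K ∈ M.elemsOf f := by
  obtain ⟨K, hK, hfK, -⟩ := M.mem_faces.1 hf
  exact ⟨K, M.mem_elemsOf.2 ⟨hK, hfK⟩⟩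

-- Each side of a face carries at most one element, so an internal face has exactly two. Repeating
-- the single element on a boundary face lets averages have one formula on all faces.
open scoped Classical in
lemma exists_sides (N : M.Normals) (f : Finset E3) : ∃ K L : Finset E3, f ∈ M.faces →
    M.IsSide N f (-1) K ∧ (f ∈ M.intFaces → M.IsSide N f 1 L ∧ K ≠ L ∧ M.elemsOf f = {K, L}) ∧
      (f ∉ M.intFaces → L = K ∧ M.elemsOf f = {K}) := by
  by_cases hf : f ∈ M.faces
  swap
  -- Dummy values, so that `minus` and `plus` are total functions.
  · exact ⟨∅, ∅, fun h => absurd h hf⟩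
  by_cases hi : f ∈ M.intFaces
  · obtain ⟨-, K, hK, L, hL, hne⟩ := M.mem_intFaces.1 hi
    have main : ∀ K L, K ∈ M.elemsOf f → L ∈ M.elemsOf f → M.IsSide N f (-1) K →
        M.IsSide N f 1 L → K ≠ L → M.elemsOf f = {K, L} := by
      intro K L hK hL h1 h2 hne
      ext E
      simp only [Finset.mem_insert, Finset.mem_singleton]
      refine ⟨fun hE => ?_, fun hE => hE.elim (fun h => h ▸ hK) fun h => h ▸ hL⟩
      rcases M.isSide_or N hf hE with h | h
      · exact Or.inl (h.unique hf h1)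
      · exact Or.inr (h.unique hf h2)
    rcases M.isSide_or N hf hK with h1 | h1 <;> rcases M.isSide_or N hf hL with h2 | h2
    · exact absurd (h1.unique hf h2) hne
    · exact ⟨K, L, fun _ => ⟨h1, fun _ => ⟨h2, hne, main K L hK hL h1 h2 hne⟩,
        fun h => absurd hi h⟩⟩
    · exact ⟨L, K, fun _ => ⟨h2, fun _ => ⟨h1, hne.symm, main L K hL hK h2 h1 hne.symm⟩,
        fun h => absurd hi h⟩⟩
    · exact absurd (h1.unique hf h2) hne
  · obtain ⟨K, hK⟩ := M.exists_elemsOf hf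
    refine ⟨K, K, fun _ => ⟨?_, fun h => absurd h hi, fun _ => ⟨rfl, ?_⟩⟩⟩
    · obtain ⟨hKe, hfK⟩ := M.mem_elemsOf.1 hK
      refine ⟨hKe, hfK, fun v hv hvf x hx => ?_⟩
      have := N.outward f hf hi K hK x hx v hv hvf
      rw [real_inner_smul_left]
      linarith
    · ext E
      rw [Finset.mem_singleton]
      refine ⟨fun hE => ?_, fun h => h ▸ hK⟩
      by_contra hne
      exact hi (M.mem_intFaces.2 ⟨hf, E, hE, K, hK, hne⟩)

/-- The element from which the normal of a face points outwards. -/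
noncomputable def minus (N : M.Normals) (f : Finset E3) : Finset E3 := (M.exists_sides N f).choose

/-- The element into which the normal of an internal face points; the only element of a boundary
face. -/
noncomputable def plus (N : M.Normals) (f : Finset E3) : Finset E3 :=
  (M.exists_sides N f).choose_spec.choose

open scoped Classical in
lemma sides_spec (N : M.Normals) {f : Finset E3} (hf : f ∈ M.faces) :
    M.IsSide N f (-1) (M.minus N f) ∧ (f ∈ M.intFaces → M.IsSide N f 1 (M.plus N f) ∧
      M.minus N f ≠ M.plus N f ∧ M.elemsOf f = {M.minus N f, M.plus N f}) ∧
      (f ∉ M.intFaces → M.plus N f = M.minus N f ∧ M.elemsOf f = {M.minus N f}) :=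
  (M.exists_sides N f).choose_spec.choose_spec hf

lemma minus_mem (N : M.Normals) {f : Finset E3} (hf : f ∈ M.faces) :
    M.minus N f ∈ M.elemsOf f :=
  M.mem_elemsOf.2 ⟨(M.sides_spec N hf).1.1, (M.sides_spec N hf).1.2.1⟩

lemma plus_mem (N : M.Normals) {f : Finset E3} (hf : f ∈ M.faces) :
    M.plus N f ∈ M.elemsOf f := by
  by_cases hi : f ∈ M.intFaces
  · have := ((M.sides_spec N hf).2.1 hi).1
    exact M.mem_elemsOf.2 ⟨this.1, this.2.1⟩
  · rw [((M.sides_spec N hf).2.2 hi).1]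
    exact M.minus_mem N hf

open scoped Classical in
lemma sum_elemsOf (N : M.Normals) {f : Finset E3} (hf : f ∈ M.faces) {R : Type*}
    [AddCommMonoid R] (X : Finset E3 → R) : ∑ K ∈ M.elemsOf f, X K
      = X (M.minus N f) + if f ∈ M.intFaces then X (M.plus N f) else 0 := by
  split_ifs with hi
  · obtain ⟨-, hne, he⟩ := (M.sides_spec N hf).2.1 hi
    conv_lhs => rw [he]
    exact Finset.sum_pair hne
  · conv_lhs => rw [((M.sides_spec N hf).2.2 hi).2]
    rw [Finset.sum_singleton, add_zero]

open scoped Classical in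
/-- Sum over the faces of all elements. -/
lemma sum_elems_faces {R : Type*} [AddCommMonoid R] (X : Finset E3 → Finset E3 → R) :
    ∑ K ∈ M.elems, ∑ v ∈ K, X K (K.erase v) = ∑ f ∈ M.faces, ∑ K ∈ M.elemsOf f, X K f := by
  have h1 : ∀ K ∈ M.elems, ∑ v ∈ K, X K (K.erase v)
      = ∑ f ∈ M.faces.filter (fun f => f ⊆ K), X K f := by
    intro K hK
    refine Finset.sum_bij (fun v _ => K.erase v) (fun v hv => ?_) (fun v hv w hw h => ?_)
      (fun f hf => ?_) fun v hv => rfl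
    · exact Finset.mem_filter.2 ⟨M.erase_mem_faces hK hv, Finset.erase_subset _ _⟩
    · exact (Finset.erase_inj K hv).1 h
    · obtain ⟨hf, hfK⟩ := Finset.mem_filter.1 hf
      obtain ⟨v, hv, rfl⟩ := M.exists_apex hf (M.mem_elemsOf.2 ⟨hK, hfK⟩)
      exact ⟨v, hv, rfl⟩
  rw [Finset.sum_congr rfl h1]
  refine Finset.sum_comm' fun K f => ?_
  rw [Finset.mem_filter, M.mem_elemsOf]
  tauto

/-! ### Traces -/

/-- `τ K` is the continuous extension to the closed element `K` of the restriction of `φ`. -/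
def IsTrace {F : Type*} [TopologicalSpace F] (φ : E3 → F) (τ : Finset E3 → E3 → F) : Prop :=
  ∀ K ∈ M.elems, ContinuousOn (τ K) (cell K) ∧ EqOn φ (τ K) (openCell K)

variable {M}

section Trace

variable {F : Type*} [TopologicalSpace F] {φ : E3 → F} {τ : Finset E3 → E3 → F}

/-- Identifies the one-sided normal limits behind jumps and averages with the continuous extensions
from inside the elements. -/
lemma IsTrace.tendsto (h : M.IsTrace φ τ) {N : M.Normals} {f K : Finset E3} (hf : f ∈ M.faces)
    {σ : ℝ} (hK : M.IsSide N f σ K) {x : E3} (hx : x ∈ openFace f) :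
    Tendsto (fun s : ℝ => φ (x + s • σ • N.n f)) (𝓝[>] 0) (𝓝 (τ K x)) := by
  have hxK : x ∈ cell K := openFace_subset_cell_of_subset hK.2.1 (openFace_subset_cell f hx)
  have h1 : Tendsto (fun s : ℝ => x + s • σ • N.n f) (𝓝[>] 0) (𝓝[cell K] x) := by
    refine tendsto_nhdsWithin_iff.2 ⟨?_, (hK.eventually_mem hf hx).mono fun s hs =>
      IsTet.openCell_subset_cell K hs⟩
    have hc : Continuous fun s : ℝ => x + s • σ • N.n f := by fun_prop
    have := hc.tendsto 0
    rw [zero_smul, add_zero] at this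
    exact this.mono_left nhdsWithin_le_nhds
  refine Tendsto.congr' ?_ (((h K hK.1).1 x hxK).tendsto.comp h1)
  filter_upwards [hK.eventually_mem hf hx] with s hs
  exact ((h K hK.1).2 hs).symm

lemma IsTrace.tendsto_minus (h : M.IsTrace φ τ) (N : M.Normals) {f : Finset E3} (hf : f ∈ M.faces)
    {x : E3} (hx : x ∈ openFace f) :
    Tendsto (fun s : ℝ => φ (x - s • N.n f)) (𝓝[>] 0) (𝓝 (τ (M.minus N f) x)) := by
  have := h.tendsto hf (M.sides_spec N hf).1 hx
  simpa only [neg_smul, one_smul, smul_neg, ← sub_eq_add_neg] using this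

lemma IsTrace.tendsto_plus (h : M.IsTrace φ τ) (N : M.Normals) {f : Finset E3}
    (hf : f ∈ M.intFaces) {x : E3} (hx : x ∈ openFace f) :
    Tendsto (fun s : ℝ => φ (x + s • N.n f)) (𝓝[>] 0) (𝓝 (τ (M.plus N f) x)) := by
  have hf' := M.mem_faces_of_mem_intFaces hf
  have := h.tendsto hf' ((M.sides_spec N hf').2.1 hf).1 hx
  simpa only [one_smul] using this

variable [AddCommGroup F] [IsTopologicalAddGroup F] [T2Space F]

lemma IsTrace.jump_int (h : M.IsTrace φ τ) (N : M.Normals) {f : Finset E3} (hf : f ∈ M.intFaces)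
    {x : E3} (hx : x ∈ openFace f) :
    M.jump N f φ x = τ (M.minus N f) x - τ (M.plus N f) x := by
  rw [jump, if_pos hf]
  exact ((h.tendsto_minus N (M.mem_faces_of_mem_intFaces hf) hx).sub
    (h.tendsto_plus N hf hx)).limUnder_eq

omit [IsTopologicalAddGroup F] in
lemma IsTrace.jump_bd (h : M.IsTrace φ τ) (N : M.Normals) {f : Finset E3} (hf : f ∈ M.faces)
    (hi : f ∉ M.intFaces) {x : E3} (hx : x ∈ openFace f) :
    M.jump N f φ x = τ (M.minus N f) x := by
  rw [jump, if_neg hi]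
  exact (h.tendsto_minus N hf hx).limUnder_eq

/-- On a boundary face `plus` equals `minus`, so the half-sum is the one-sided trace. -/
lemma IsTrace.avg [Module ℝ F] [ContinuousConstSMul ℝ F] (h : M.IsTrace φ τ) (N : M.Normals)
    {f : Finset E3} (hf : f ∈ M.faces) {x : E3} (hx : x ∈ openFace f) :
    M.avg N f φ x = (2⁻¹ : ℝ) • (τ (M.minus N f) x + τ (M.plus N f) x) := by
  rw [TetMesh.avg]
  split_ifs with hi
  · exact (((h.tendsto_minus N hf hx).add (h.tendsto_plus N hi hx)).const_smul _).limUnder_eq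
  · rw [((M.sides_spec N hf).2.2 hi).1, ← two_smul ℝ, smul_smul, inv_mul_cancel₀ two_ne_zero,
      one_smul]
    exact (h.tendsto_minus N hf hx).limUnder_eq

end Trace

end TetMesh

/-! ### Geometry of the mesh -/

lemma IsTet.one_le_dist_refTet {x y : E3} (hx : x ∈ refTet) (hy : y ∈ refTet) (h : x ≠ y) :
    1 ≤ ‖x - y‖ := by
  have key : ∀ z : E3, ∀ i, |z i| ≤ ‖z‖ := fun z i => PiLp.norm_apply_le z i
  rcases mem_refTet.1 hx with rfl | ⟨i, rfl⟩ <;> rcases mem_refTet.1 hy with rfl | ⟨j, rfl⟩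
  · exact absurd rfl h
  · refine le_trans ?_ (key _ j); simp [stdE_apply]
  · refine le_trans ?_ (key _ i); simp [stdE_apply]
  · have hij : i ≠ j := fun hij => h (by rw [hij])
    refine le_trans ?_ (key _ i); simp [stdE_apply, hij]

/-- All sizes are compared with the inscribed radius: volume through the ball, edge lengths through
the bound on `A⁻¹`, and area through volume divided by height. -/
lemma exists_geometry (cM : ℝ) (hcM : 0 < cM) : ∃ C : ℝ, 0 < C ∧ ∀ K : Finset E3, IsTet K →
    ∀ (x₀ : E3) (ρ : ℝ), 0 < ρ → Metric.ball x₀ ρ ⊆ cell K → Metric.diam (cell K) ≤ cM * ρ →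
    0 < Metric.diam (cell K) ∧ Metric.diam (cell K) ^ 3 ≤ C * volume.real (cell K) ∧
    ∀ f ⊆ K, f.card = 3 → 0 < Metric.diam (cell f) ∧ Metric.diam (cell f) ≤ Metric.diam (cell K) ∧
      Metric.diam (cell K) ≤ C * Metric.diam (cell f) ∧
      area f ≤ C * Metric.diam (cell K) ^ 2 := by
  classical
  set b := volume.real (Metric.ball (0 : E3) 1) with hb
  have hb0 : 0 < b := ENNReal.toReal_pos (Metric.measure_ball_pos _ _ one_pos).ne'
    measure_ball_lt_top.ne
  have hball : ∀ (x : E3) (r : ℝ), 0 ≤ r → volume.real (Metric.ball x r) = r ^ 3 * b := fun x r hr => by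
    rw [measureReal_def, Measure.addHaar_ball _ _ hr, finrank_euclideanSpace_fin, ENNReal.toReal_mul,
      ENNReal.toReal_ofReal (by positivity)]
    rfl
  set a2 := volume.real (openSimplex 2)
  set a3 := volume.real (openSimplex 3)
  have ha2 : 0 < a2 := volume_openSimplex_pos 2
  have ha3 : 0 < a3 := volume_openSimplex_pos 3
  -- The summands serve the volume, the face diameter and the face area respectively.
  refine ⟨cM ^ 3 / b + 4 * cM + a2 / a3 * (8 * b) * cM, by positivity, fun K hK x₀ ρ hρ hsub hd => ?_⟩
  set d := Metric.diam (cell K) with hdd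
  have hbdd := IsTet.isBounded_cell K
  have hfin : volume (cell K) ≠ ⊤ := (IsTet.isCompact_cell K).measure_lt_top.ne
  have hx₀ : x₀ ∈ cell K := hsub (Metric.mem_ball_self hρ)
  have hρd : ρ ≤ d := by
    have h1 : Metric.diam (Metric.ball x₀ ρ) ≤ d := Metric.diam_mono hsub hbdd
    have : Metric.diam (Metric.ball x₀ ρ) = 2 * ρ := Metric.diam_ball_eq x₀ hρ.le
    linarith
  have hd0 : 0 < d := hρ.trans_le hρd
  have hVlow : ρ ^ 3 * b ≤ volume.real (cell K) := by
    rw [← hball x₀ ρ hρ.le]; exact measureReal_mono hsub hfin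
  have hVup : volume.real (cell K) ≤ 8 * b * d ^ 3 := by
    have h1 : cell K ⊆ Metric.ball x₀ (2 * d) := fun x hx => by
      rw [Metric.mem_ball]
      have := Metric.dist_le_diam_of_mem hbdd hx hx₀
      linarith
    have h2 := measureReal_mono (μ := volume) h1 measure_ball_lt_top.ne
    rw [hball _ _ (by positivity)] at h2
    linarith [h2, (by ring : (2 * d) ^ 3 * b = 8 * b * d ^ 3)]
  have hV0 : 0 ≤ volume.real (cell K) := measureReal_nonneg
  obtain ⟨Φ⟩ := hK.exists_refMap
  have hA := Φ.norm_A_symm_le hρ hsub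
  have hedge : ∀ u ∈ K, ∀ v ∈ K, u ≠ v → ρ / 4 ≤ ‖u - v‖ := by
    intro u hu v hv huv
    have h1 := IsTet.one_le_dist_refTet (Φ.inv_mem hu) (Φ.inv_mem hv) fun h => huv (by
      rw [← Φ.map_inv u, h, Φ.map_inv])
    have h2 : Φ.inv u - Φ.inv v = (Φ.A.symm : E3 →L[ℝ] E3) (u - v) := by
      have := Φ.map_sub_map (Φ.inv u) (Φ.inv v)
      rw [Φ.map_inv, Φ.map_inv] at this
      rw [this]; simp
    rw [h2] at h1
    have h3 := h1.trans ((ContinuousLinearMap.le_opNorm _ _).trans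
      (mul_le_mul_of_nonneg_right hA (norm_nonneg (u - v))))
    rw [div_mul_eq_mul_div, le_div_iff₀ hρ] at h3
    linarith
  refine ⟨hd0, ?_, fun f hf hc => ?_⟩
  · have h1 : d ^ 3 ≤ (cM * ρ) ^ 3 := pow_le_pow_left₀ hd0.le hd 3
    have h2 : (cM * ρ) ^ 3 = cM ^ 3 / b * (ρ ^ 3 * b) := by field_simp
    have h3 : cM ^ 3 / b * (ρ ^ 3 * b) ≤ cM ^ 3 / b * volume.real (cell K) :=
      mul_le_mul_of_nonneg_left hVlow (by positivity)
    have h4 : 0 ≤ (4 * cM + a2 / a3 * (8 * b) * cM) * volume.real (cell K) := by positivity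
    nlinarith
  · obtain ⟨v, hv, hfe⟩ := hK.exists_eq_erase hf hc
    obtain ⟨a, a', c, hab, hac, hbc, hfs⟩ := (hK.isTri_of_subset hf hc).exists_vertices
    have haf : a ∈ f := by rw [← Finset.mem_coe, hfs]; simp
    have ha'f : a' ∈ f := by rw [← Finset.mem_coe, hfs]; simp
    have hcf : c ∈ f := by rw [← Finset.mem_coe, hfs]; simp
    have hfb : Bornology.IsBounded (cell f) := IsTet.isBounded_cell f
    have hdf : ρ / 4 ≤ Metric.diam (cell f) := by
      refine (hedge a (hf haf) a' (hf ha'f) hab).trans ?_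
      rw [← dist_eq_norm]
      exact Metric.dist_le_diam_of_mem hfb (subset_convexHull ℝ _ haf) (subset_convexHull ℝ _ ha'f)
    have hdf0 : 0 < Metric.diam (cell f) := by linarith
    refine ⟨hdf0, Metric.diam_mono (openFace_subset_cell_of_subset hf) hbdd, ?_, ?_⟩
    · have h1 : d ≤ 4 * cM * Metric.diam (cell f) := by nlinarith
      have h2 : 0 ≤ (cM ^ 3 / b + a2 / a3 * (8 * b) * cM) * Metric.diam (cell f) := by positivity
      nlinarith
    · obtain ⟨n, hn, hnb, hnc⟩ := exists_unit_normal (a' - a) (c - a)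
      have hvf : v ∉ f := hfe ▸ Finset.notMem_erase v K
      have hKe : (K : Set E3) = {a, v, a', c} := by
        have : (K : Set E3) = insert v (f : Set E3) := by
          rw [← Finset.coe_insert, hfe, Finset.insert_erase hv]
        rw [this, hfs]
        ext z; simp only [mem_insert_iff, mem_singleton_iff]; tauto
      have hjac := (IsTet.setIntegral_eq hK hKe (by rw [← hfs]; exact hvf) hab hac hbc hn hnb hnc).1
      rw [← hfe] at hjac
      have hperp : ∀ y ∈ K, y ≠ v → ⟪n, y - a⟫ = 0 := by
        intro y hy hyv
        have : y ∈ (K : Set E3) := hy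
        rw [hKe] at this
        rcases this with rfl | rfl | rfl | rfl
        · simp
        · exact absurd rfl hyv
        · exact hnb
        · exact hnc
      -- The element lies within distance equal to its height from the face plane, and the ball
      -- extends almost `ρ` along both normal directions.
      have hdist : ρ ≤ |⟪n, v - a⟫| := by
        have h1 : ∀ z ∈ cell K, |⟪n, z - a⟫| ≤ |⟪n, v - a⟫| := by
          intro z hz
          rw [hK.inner_eq_coord hv hperp z, abs_mul]
          rw [hK.cell_eq] at hz
          have h2 : hK.coord ⟨v, hv⟩ z ≤ 1 := by
            rw [← hK.sum_coord z]
            exact Finset.single_le_sum (fun u _ => hz u) (Finset.mem_univ _)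
          rw [abs_of_nonneg (hz ⟨v, hv⟩)]
          exact mul_le_of_le_one_right (abs_nonneg _) h2
        by_contra hlt
        rw [not_le] at hlt
        -- A value strictly between the height and `ρ`, because the ball is open.
        set t := (|⟪n, v - a⟫| + ρ) / 2 with ht
        have ht0 : 0 < t := by positivity
        have htρ : t < ρ := by linarith
        have hmem : ∀ σ : ℝ, |σ| = t → x₀ + σ • n ∈ cell K := fun σ hσ => hsub (by
          rw [Metric.mem_ball, dist_eq_norm, add_sub_cancel_left, norm_smul, hn, mul_one,
            Real.norm_eq_abs, hσ]
          exact htρ)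
        have k1 := h1 _ (hmem t (abs_of_pos ht0))
        have k2 := h1 _ (hmem (-t) (by rw [abs_neg, abs_of_pos ht0]))
        have hnn : ⟪n, n⟫ = (1 : ℝ) := by rw [real_inner_self_eq_norm_sq, hn]; norm_num
        rw [add_sub_right_comm, inner_add_right, real_inner_smul_right, hnn, mul_one] at k1 k2
        have := abs_le.1 k1
        have := abs_le.1 k2
        linarith
      have hdist0 : 0 < |⟪n, v - a⟫| := hρ.trans_le hdist
      have harea : 0 < area f := area_pos (hK.isTri_of_subset hf hc)
      have hjac' : volume.real (cell K) / a3 = area f / a2 * |⟪n, v - a⟫| := hjac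
      have h1 : area f * |⟪n, v - a⟫| = a2 / a3 * volume.real (cell K) := by
        rw [div_mul_eq_mul_div, mul_div_assoc, hjac']
        field_simp
      have h2 : area f * ρ ≤ a2 / a3 * (8 * b) * cM * d ^ 2 * ρ := by
        calc area f * ρ ≤ area f * |⟪n, v - a⟫| := mul_le_mul_of_nonneg_left hdist harea.le
          _ = a2 / a3 * volume.real (cell K) := h1
          _ ≤ a2 / a3 * (8 * b * d ^ 3) := mul_le_mul_of_nonneg_left hVup (by positivity)
          _ = a2 / a3 * (8 * b) * d ^ 2 * d := by ring
          _ ≤ a2 / a3 * (8 * b) * d ^ 2 * (cM * ρ) := mul_le_mul_of_nonneg_left hd (by positivity)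
          _ = _ := by ring
      have h3 := le_of_mul_le_mul_right h2 hρ
      have h4 : 0 ≤ (cM ^ 3 / b + 4 * cM) * d ^ 2 := by positivity
      nlinarith

/-! ### The mesh as a partition of the domain up to null sets. -/

namespace TetMesh

variable {Ω : Set E3} (M : TetMesh Ω)

variable {M} in
lemma _root_.MHD.IsConvexPolyhedron.volume_lt_top (hΩ : IsConvexPolyhedron Ω) :
    volume (closure Ω) < ⊤ := by
  obtain ⟨s, hs⟩ := hΩ.closure_eq
  rw [hs]
  exact (s.finite_toSet.isCompact_convexHull ℝ).measure_lt_top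

lemma cell_subset_closure {K : Finset E3} (hK : K ∈ M.elems) : cell K ⊆ closure Ω := by
  rw [← M.cover]
  exact subset_iUnion₂ (s := fun K (_ : K ∈ M.elems) => convexHull ℝ (K : Set E3)) K hK

/-- A convex open set is the interior of its closure, so covering the closure suffices. -/
lemma openCell_subset (hΩ : IsConvexPolyhedron Ω) {K : Finset E3} (hK : K ∈ M.elems) :
    openCell K ⊆ Ω := by
  have h1 : openCell K ⊆ interior (closure Ω) := interior_mono (M.cell_subset_closure hK)
  rwa [hΩ.convex.interior_closure_eq_interior_of_nonempty_interior
    (by rw [hΩ.isOpen.interior_eq]; exact hΩ.nonempty), hΩ.isOpen.interior_eq] at h1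

/-- The boundaries of the finitely many convex elements are null. -/
lemma ae_eq_biUnion (hΩ : IsConvexPolyhedron Ω) :
    (Ω : Set E3) =ᵐ[volume] ⋃ K ∈ M.elems, openCell K := by
  have h0 : (⋃ K ∈ M.elems, openCell K) ⊆ Ω := iUnion₂_subset fun K hK => M.openCell_subset hΩ hK
  refine Filter.EventuallyLE.antisymm ?_ h0.eventuallyLE
  have h1 : (⋃ K ∈ M.elems, cell K : Set E3) =ᵐ[volume] ⋃ K ∈ M.elems, openCell K :=
    by
      have h2 : ∀ᵐ x ∂(volume : Measure E3), ∀ K ∈ M.elems, (x ∈ cell K) = (x ∈ openCell K) :=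
        (Finset.eventually_all M.elems).2 fun K _ => IsTet.cell_ae_eq K
      filter_upwards [h2] with x hx
      have h4 : (x ∈ ⋃ K ∈ M.elems, cell K) ↔ x ∈ ⋃ K ∈ M.elems, openCell K := by
        simp only [mem_iUnion]
        exact exists₂_congr fun K hK => (hx K hK).to_iff
      exact propext h4
  refine Filter.EventuallyLE.trans ?_ h1.le
  have h3 : Ω ⊆ ⋃ K ∈ M.elems, cell K := subset_closure.trans M.cover.ge
  exact h3.eventuallyLE

lemma pairwiseDisjoint_openCell : (M.elems : Set (Finset E3)).PairwiseDisjoint openCell :=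
  fun _ hK _ hL h => M.disjoint_openCell hK hL h

lemma integral_eq_sum (hΩ : IsConvexPolyhedron Ω) {g : E3 → ℝ}
    (hg : ∀ K ∈ M.elems, IntegrableOn g (openCell K)) :
    ∫ x in Ω, g x = ∑ K ∈ M.elems, ∫ x in openCell K, g x := by
  rw [setIntegral_congr_set (M.ae_eq_biUnion hΩ)]
  exact integral_biUnion_finset M.elems (fun K _ => (IsTet.isOpen_openCell K).measurableSet)
    M.pairwiseDisjoint_openCell hg

lemma sum_volume_le (hΩ : IsConvexPolyhedron Ω) :
    ∑ K ∈ M.elems, volume.real (cell K) ≤ volume.real (closure Ω) := by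
  have h1 : ∀ K ∈ M.elems, volume.real (cell K) = volume.real (openCell K) := fun K _ =>
    measureReal_congr (IsTet.cell_ae_eq K)
  rw [Finset.sum_congr rfl h1, ← measureReal_biUnion_finset
    M.pairwiseDisjoint_openCell (fun K _ => (IsTet.isOpen_openCell K).measurableSet)
    (fun K _ => (IsTet.volume_openCell_lt_top K).ne)]
  exact measureReal_mono (iUnion₂_subset fun K hK =>
    (M.openCell_subset hΩ hK).trans subset_closure) hΩ.volume_lt_top.ne

lemma diam_le_meshSize {K : Finset E3} (hK : K ∈ M.elems) :
    Metric.diam (cell K) ≤ M.meshSize :=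
  le_csSup (M.elems.finite_toSet.image _).bddAbove (mem_image_of_mem _ hK)

lemma meshSize_nonneg : 0 ≤ M.meshSize := by
  refine Real.sSup_nonneg ?_
  rintro _ ⟨K, _, rfl⟩
  exact Metric.diam_nonneg

end TetMesh

/-! ### Coercivity of the interior penalty form -/

lemma frob_self_nonneg (A : Matrix (Fin 3) (Fin 3) ℝ) : 0 ≤ frob A A :=
  Finset.sum_nonneg fun _ _ => Finset.sum_nonneg fun _ _ => mul_self_nonneg _

lemma norm_mulV_sq_le (A : Matrix (Fin 3) (Fin 3) ℝ) (n : E3) :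
    ‖mulV A n‖ ^ 2 ≤ frob A A * ‖n‖ ^ 2 := by
  rw [EuclideanSpace.norm_sq_eq, EuclideanSpace.norm_sq_eq, frob, Finset.sum_mul]
  refine Finset.sum_le_sum fun i _ => ?_
  have h1 : ‖mulV A n i‖ ^ 2 = (∑ j, A i j * n j) ^ 2 := by
    rw [Real.norm_eq_abs, sq_abs]; rfl
  rw [h1]
  refine (Finset.sum_mul_sq_le_sq_mul_sq _ _ _).trans (le_of_eq ?_)
  simp only [Real.norm_eq_abs, sq_abs, ← sq]

lemma continuous_mulV (n : E3) : Continuous fun A : Matrix (Fin 3) (Fin 3) ℝ => mulV A n := by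
  unfold mulV
  exact (PiLp.continuous_toLp 2 _).comp (Continuous.matrix_mulVec continuous_id continuous_const)

lemma symGrad_mem_polyFun {k : ℕ} {w : E3 → E3} (hw : w ∈ polyVec k) (i j : Fin 3) :
    (fun x => symGrad w x i j) ∈ polyFun (k - 1) := by
  have : (fun x => symGrad w x i j) = fun x => (2⁻¹ : ℝ) * (gradM w x i j + gradM w x j i) := by
    ext x; simp [symGrad, Matrix.smul_apply, Matrix.add_apply]
  rw [this]
  exact const_mul_mem_polyFun _ (add_mem_polyFun (gradM_mem_polyFun hw i j) (gradM_mem_polyFun hw j i))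

lemma continuous_symGrad {k : ℕ} {w : E3 → E3} (hw : w ∈ polyVec k) : Continuous (symGrad w) :=
  continuous_matrix fun i j =>
    (contDiff_of_mem_polyFun (symGrad_mem_polyFun hw i j) (n := 0)).continuous

lemma gradM_eqOn {U : Set E3} (hU : IsOpen U) {v w : E3 → E3} (h : EqOn v w U) :
    EqOn (gradM v) (gradM w) U := fun x hx => by
  ext i j
  simp only [gradM, Matrix.of_apply]
  rw [(h.eventuallyEq_of_mem (hU.mem_nhds hx)).fderiv_eq]

lemma symGrad_eqOn {U : Set E3} (hU : IsOpen U) {v w : E3 → E3} (h : EqOn v w U) :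
    EqOn (symGrad v) (symGrad w) U := fun x hx => by
  rw [symGrad, symGrad, gradM_eqOn hU h hx]

/-- Inverse inequality for a family of polynomials. -/
lemma exists_sum_sq_le_integral (k : ℕ) : ∃ C : ℝ, 0 < C ∧ ∀ K : Finset E3, IsTet K →
    ∀ {ι : Type} [Fintype ι] (p : ι → E3 → ℝ), (∀ i, p i ∈ polyFun k) → ∀ x ∈ cell K,
      ∑ i, p i x ^ 2 ≤ C / volume.real (cell K) * ∫ x in cell K, ∑ i, p i x ^ 2 := by
  obtain ⟨C, hC, h⟩ := exists_sq_le_integral k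
  refine ⟨C, hC, fun K hK ι _ p hp x hx => ?_⟩
  rw [integral_finsetSum (f := fun i x => p i x ^ 2) _ fun i _ => IsTet.integrableOn_cell K
    (Continuous.continuousOn ((contDiff_of_mem_polyFun (hp i) (n := 0)).continuous.pow 2)),
    Finset.mul_sum]
  exact Finset.sum_le_sum fun i _ => h K hK (p i) (hp i) x hx

lemma exists_norm_sq_le_integral (k : ℕ) : ∃ C : ℝ, 0 < C ∧ ∀ K : Finset E3, IsTet K →
    ∀ w ∈ polyVec k, ∀ x ∈ cell K,
      ‖w x‖ ^ 2 ≤ C / volume.real (cell K) * ∫ x in cell K, ‖w x‖ ^ 2 := by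
  obtain ⟨C, hC, h⟩ := exists_sum_sq_le_integral k
  refine ⟨C, hC, fun K hK w hw x hx => ?_⟩
  have := h K hK (fun (i : Fin 3) x => w x i) hw x hx
  simpa only [EuclideanSpace.norm_sq_eq, Real.norm_eq_abs, sq_abs] using this

lemma exists_frob_le_integral (k : ℕ) : ∃ C : ℝ, 0 < C ∧ ∀ K : Finset E3, IsTet K →
    ∀ w ∈ polyVec k, ∀ x ∈ cell K, frob (symGrad w x) (symGrad w x)
      ≤ C / volume.real (cell K) * ∫ x in cell K, frob (symGrad w x) (symGrad w x) := by
  obtain ⟨C, hC, h⟩ := exists_sum_sq_le_integral (k - 1)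
  refine ⟨C, hC, fun K hK w hw x hx => ?_⟩
  have := h K hK (fun (i : Fin 3 × Fin 3) x => symGrad w x i.1 i.2)
    (fun i => symGrad_mem_polyFun hw i.1 i.2) x hx
  simpa only [Fintype.sum_prod_type, frob, ← sq] using this

/-! ### Traces of piecewise polynomials and the penalty estimate. -/

namespace TetMesh

variable {Ω : Set E3} {M : TetMesh Ω}

section Trace

variable {F : Type*} [TopologicalSpace F] [AddCommGroup F] [IsTopologicalAddGroup F] [T2Space F]
  {φ : E3 → F} {τ : Finset E3 → E3 → F}

open scoped Classical in
lemma IsTrace.jump (h : M.IsTrace φ τ) (N : M.Normals) {f : Finset E3} (hf : f ∈ M.faces)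
    {x : E3} (hx : x ∈ openFace f) :
    M.jump N f φ x = τ (M.minus N f) x - if f ∈ M.intFaces then τ (M.plus N f) x else 0 := by
  split_ifs with hi
  · exact h.jump_int N hi hx
  · rw [h.jump_bd N hf hi hx, sub_zero]

omit [AddCommGroup F] [IsTopologicalAddGroup F] [T2Space F] in
lemma IsTrace.continuousOn (h : M.IsTrace φ τ) {f K : Finset E3} (hK : K ∈ M.elemsOf f) :
    ContinuousOn (τ K) (cell f) := by
  obtain ⟨h1, h2⟩ := M.mem_elemsOf.1 hK
  exact (h K h1).1.mono (openFace_subset_cell_of_subset h2)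

omit [T2Space F] in
open scoped Classical in
lemma IsTrace.continuousOn_jump (h : M.IsTrace φ τ) (N : M.Normals) {f : Finset E3}
    (hf : f ∈ M.faces) : ContinuousOn
      (fun x => τ (M.minus N f) x - if f ∈ M.intFaces then τ (M.plus N f) x else 0) (cell f) := by
  refine (h.continuousOn (M.minus_mem N hf)).sub ?_
  split_ifs
  · exact h.continuousOn (M.plus_mem N hf)
  · exact continuousOn_const

end Trace

variable (M) in
/-- `τ K` is a polynomial field that agrees with `v` on the element `K`. -/
def IsPw (k : ℕ) (v : E3 → E3) (τ : Finset E3 → E3 → E3) : Prop :=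
  ∀ K ∈ M.elems, τ K ∈ polyVec k ∧ EqOn v (τ K) (openCell K)

lemma exists_isPw {k : ℕ} {v : E3 → E3} (h : ∀ K ∈ M.elems, IsPolyOn k (openCell K) v) :
    ∃ τ, M.IsPw k v τ := by
  have h1 : ∀ K, ∃ w, K ∈ M.elems → w ∈ polyVec k ∧ EqOn v w (openCell K) := fun K => by
    by_cases hK : K ∈ M.elems
    · obtain ⟨w, hw, he⟩ := isPolyOn_iff.1 (h K hK)
      exact ⟨w, fun _ => ⟨hw, he⟩⟩
    · exact ⟨0, fun h => absurd h hK⟩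
  choose τ hτ using h1
  exact ⟨τ, fun K hK => hτ K hK⟩

variable {k : ℕ} {v : E3 → E3} {τ : Finset E3 → E3 → E3}

lemma IsPw.continuous (h : M.IsPw k v τ) {K : Finset E3} (hK : K ∈ M.elems) : Continuous (τ K) :=
  (contDiff_of_mem_polyVec (h K hK).1 (n := 0)).continuous

lemma IsPw.isTrace (h : M.IsPw k v τ) : M.IsTrace v τ := fun K hK =>
  ⟨(h.continuous hK).continuousOn, (h K hK).2⟩

lemma IsPw.isTrace_symGrad (h : M.IsPw k v τ) (n : E3) : M.IsTrace (fun y => mulV (symGrad v y) n)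
    fun K y => mulV (symGrad (τ K) y) n := fun K hK =>
  ⟨((continuous_mulV n).comp (continuous_symGrad (h K hK).1)).continuousOn, fun x hx => by
    simp only [symGrad_eqOn (IsTet.isOpen_openCell K) (h K hK).2 hx]⟩

lemma brokenInt_congr {g : E3 → ℝ} {g' : Finset E3 → E3 → ℝ}
    (h : ∀ K ∈ M.elems, EqOn g (g' K) (openCell K)) :
    M.brokenInt g = ∑ K ∈ M.elems, ∫ x in cell K, g' K x :=
  Finset.sum_congr rfl fun K hK => by
    rw [← IsTet.setIntegral_openCell]
    exact setIntegral_congr_fun (IsTet.isOpen_openCell K).measurableSet (h K hK)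

lemma brokenInt_nonneg {g : E3 → ℝ} (h : ∀ x, 0 ≤ g x) : 0 ≤ M.brokenInt g :=
  Finset.sum_nonneg fun _ _ => integral_nonneg h

/-- Sums over the elements of a face and over all faces. -/
lemma sum_faces_elemsOf (X : Finset E3 → ℝ) :
    ∑ f ∈ M.faces, ∑ K ∈ M.elemsOf f, X K = 4 * ∑ K ∈ M.elems, X K := by
  classical
  rw [← M.sum_elems_faces fun K _ => X K, Finset.mul_sum]
  refine Finset.sum_congr rfl fun K hK => ?_
  rw [Finset.sum_const, M.card_elem K hK]
  simp

/-- The local sizes of a shape regular mesh are comparable. -/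
lemma exists_sizes (cM : ℝ) (hcM : 0 < cM) : ∃ C : ℝ, 0 < C ∧ ∀ (Ω : Set E3) (M : TetMesh Ω),
    M.ShapeRegular cM → (∀ K ∈ M.elems, 0 < volume.real (cell K) ∧ 0 < Metric.diam (cell K) ∧
      Metric.diam (cell K) ^ 3 ≤ C * volume.real (cell K)) ∧
    ∀ f ∈ M.faces, ∀ K ∈ M.elemsOf f, 0 < Metric.diam (cell f) ∧
      Metric.diam (cell f) ≤ Metric.diam (cell K) ∧
      Metric.diam (cell K) ≤ C * Metric.diam (cell f) ∧
      area f ≤ C * Metric.diam (cell K) ^ 2 := by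
  obtain ⟨C, hC, h⟩ := exists_geometry cM hcM
  refine ⟨C, hC, fun Ω M hM => ⟨fun K hK => ?_, fun f hf K hK => ?_⟩⟩
  · obtain ⟨x₀, ρ, hρ, hb, -, hd⟩ := hM K hK
    obtain ⟨h1, h2, -⟩ := h K (M.isTet hK) x₀ ρ hρ hb hd
    refine ⟨?_, h1, h2⟩
    rw [measureReal_congr (IsTet.cell_ae_eq K)]
    exact (M.isTet hK).volume_openCell_pos
  · obtain ⟨hK, hfK⟩ := M.mem_elemsOf.1 hK
    obtain ⟨x₀, ρ, hρ, hb, -, hd⟩ := hM K hK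
    exact (h K (M.isTet hK) x₀ ρ hρ hb hd).2.2 f hfK (M.isTri hf).card

/-- The interior penalty form is nonnegative for a sufficiently large penalty. -/
lemma exists_aSh_nonneg (k : ℕ) (cM : ℝ) (hcM : 0 < cM) : ∃ μ₀ : ℝ, 0 < μ₀ ∧
    ∀ (Ω : Set E3) (M : TetMesh Ω) (N : M.Normals), M.ShapeRegular cM → ∀ μa, μ₀ ≤ μa →
    ∀ v : E3 → E3, (∀ K ∈ M.elems, IsPolyOn k (openCell K) v) → 0 ≤ M.aSh N μa v v := by
  classical
  obtain ⟨C₁, hC₁, hsize⟩ := exists_sizes cM hcM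
  obtain ⟨C₂, hC₂, hinv⟩ := exists_frob_le_integral k
  refine ⟨4 * (C₂ * (C₁ * C₁)), by positivity, fun Ω M N hM μa hμ v hv => ?_⟩
  obtain ⟨τ, hτ⟩ := M.exists_isPw hv
  obtain ⟨hsK, hsf⟩ := hsize Ω M hM
  set μ₀ := 4 * (C₂ * (C₁ * C₁)) with hμ₀
  have hμ₀0 : 0 < μ₀ := by positivity
  set E : Finset E3 → ℝ := fun K => ∫ x in cell K, frob (symGrad (τ K) x) (symGrad (τ K) x) with hE
  have hE0 : ∀ K, 0 ≤ E K := fun K => integral_nonneg fun x => frob_self_nonneg _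
  have hvol : M.brokenInt (fun x => frob (symGrad v x) (symGrad v x)) = ∑ K ∈ M.elems, E K :=
    M.brokenInt_congr fun K hK x hx => by
      simp only [symGrad_eqOn (IsTet.isOpen_openCell K) (hτ K hK).2 hx]
  set A : Finset E3 → E3 → E3 := fun f => M.avg N f fun y => mulV (symGrad v y) (N.n f) with hA
  set J : Finset E3 → E3 → E3 := fun f => M.jump N f v with hJ
  -- Each element is counted by four faces, so the weight `1 / 4` sums exactly to the broken energy;
  -- `μ₀` is sized to make this weight available.
  have hface : ∀ f ∈ M.faces, 2 * faceInt f (fun x => ⟪A f x, J f x⟫)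
      ≤ 4⁻¹ * ∑ K ∈ M.elemsOf f, E K
        + μ₀ * ((Metric.diam (cell f))⁻¹ * faceInt f fun x => ⟪J f x, J f x⟫) := by
    intro f hf
    have hft := M.isTri hf
    set h := Metric.diam (cell f) with hh
    have hm := M.minus_mem N hf
    have hp := M.plus_mem N hf
    have hh0 : 0 < h := (hsf f hf _ hm).1
    have harea := area_pos hft
    set S := ∑ K ∈ M.elemsOf f, E K / volume.real (cell K) with hS
    have hSK : ∀ K ∈ M.elemsOf f, E K / volume.real (cell K) ≤ S := fun K hK =>
      Finset.single_le_sum (f := fun K => E K / volume.real (cell K))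
        (fun L hL => div_nonneg (hE0 L) measureReal_nonneg) hK
    have hnK : ∀ K ∈ M.elemsOf f, ∀ x ∈ openFace f,
        ‖mulV (symGrad (τ K) x) (N.n f)‖ ^ 2 ≤ C₂ * S := by
      intro K hK x hx
      obtain ⟨hKe, hfK⟩ := M.mem_elemsOf.1 hK
      refine (norm_mulV_sq_le _ _).trans ?_
      rw [N.unit f hf, one_pow, mul_one]
      refine (hinv K (M.isTet hKe) _ (hτ K hKe).1 x
        (openFace_subset_cell_of_subset hfK (openFace_subset_cell f hx))).trans ?_
      rw [div_mul_eq_mul_div, mul_div_assoc]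
      exact mul_le_mul_of_nonneg_left (hSK K hK) hC₂.le
    have hAb : ∀ x ∈ openFace f, ‖A f x‖ ^ 2 ≤ C₂ * S := by
      intro x hx
      rw [hA]
      simp only
      rw [(hτ.isTrace_symGrad (N.n f)).avg N hf hx]
      set a := mulV (symGrad (τ (M.minus N f)) x) (N.n f)
      set b := mulV (symGrad (τ (M.plus N f)) x) (N.n f)
      have h1 : ‖a‖ ^ 2 ≤ C₂ * S := hnK _ hm x hx
      have h2 : ‖b‖ ^ 2 ≤ C₂ * S := hnK _ hp x hx
      have h3 := norm_add_le a b
      have h4 : ‖(2⁻¹ : ℝ) • (a + b)‖ = 2⁻¹ * ‖a + b‖ := by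
        rw [norm_smul]; norm_num
      rw [h4]
      nlinarith [sq_nonneg (‖a‖ - ‖b‖), norm_nonneg (a + b), norm_nonneg a, norm_nonneg b]
    -- The factor `1 / |K|` of the inverse inequality is absorbed because `h_f` times the face area
    -- is comparable to the element volume.
    have hSE : h * area f * S ≤ C₁ * C₁ * ∑ K ∈ M.elemsOf f, E K := by
      rw [hS, Finset.mul_sum, Finset.mul_sum]
      refine Finset.sum_le_sum fun K hK => ?_
      obtain ⟨hKe, hfK⟩ := M.mem_elemsOf.1 hK
      obtain ⟨hV, hd, hd3⟩ := hsK K hKe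
      obtain ⟨-, h1, -, h2⟩ := hsf f hf K hK
      have h3 : h * area f ≤ C₁ * C₁ * volume.real (cell K) := by
        calc h * area f ≤ Metric.diam (cell K) * (C₁ * Metric.diam (cell K) ^ 2) :=
              mul_le_mul h1 h2 harea.le hd.le
          _ = C₁ * Metric.diam (cell K) ^ 3 := by ring
          _ ≤ C₁ * (C₁ * volume.real (cell K)) := mul_le_mul_of_nonneg_left hd3 hC₁.le
          _ = _ := by ring
      calc h * area f * (E K / volume.real (cell K))
          ≤ C₁ * C₁ * volume.real (cell K) * (E K / volume.real (cell K)) :=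
            mul_le_mul_of_nonneg_right h3 (div_nonneg (hE0 K) hV.le)
        _ = C₁ * C₁ * E K := by field_simp
    -- the jump as a continuous function
    set j : E3 → E3 := fun x => τ (M.minus N f) x - if f ∈ M.intFaces then τ (M.plus N f) x else 0
      with hj
    have hjc : ContinuousOn j (cell f) := hτ.isTrace.continuousOn_jump N hf
    have hJj : ∀ x ∈ openFace f, J f x = j x := fun x hx => hτ.isTrace.jump N hf hx
    have e1 : faceInt f (fun x => ⟪J f x, J f x⟫) = faceInt f fun x => ⟪j x, j x⟫ :=
      faceInt_congr hft fun x hx => by rw [hJj x hx]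
    have hAc : ContinuousOn (fun x => (2⁻¹ : ℝ) • (mulV (symGrad (τ (M.minus N f)) x) (N.n f)
        + mulV (symGrad (τ (M.plus N f)) x) (N.n f))) (cell f) :=
      continuousOn_const.fun_smul (((hτ.isTrace_symGrad (N.n f)).continuousOn hm).fun_add
        ((hτ.isTrace_symGrad (N.n f)).continuousOn hp))
    have e2 : 2 * faceInt f (fun x => ⟪A f x, J f x⟫) ≤ faceInt f fun x =>
        μ₀⁻¹ * h * (C₂ * S) + μ₀ * h⁻¹ * ⟪j x, j x⟫ := by
      rw [← faceInt_const_mul, faceInt_congr hft (g := fun x => 2 * ⟪A f x, J f x⟫)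
        (g' := fun x => 2 * ⟪(2⁻¹ : ℝ) • (mulV (symGrad (τ (M.minus N f)) x) (N.n f)
        + mulV (symGrad (τ (M.plus N f)) x) (N.n f)), j x⟫) fun x hx => by
          rw [hJj x hx, ← (hτ.isTrace_symGrad (N.n f)).avg N hf hx]]
      refine faceInt_mono hft (continuousOn_const.mul (hAc.inner hjc))
        (continuousOn_const.add (continuousOn_const.mul (hjc.inner hjc))) fun x hx => ?_
      have h1 := hAb x hx
      rw [hA] at h1
      simp only at h1
      rw [(hτ.isTrace_symGrad (N.n f)).avg N hf hx] at h1
      set a := (2⁻¹ : ℝ) • (mulV (symGrad (τ (M.minus N f)) x) (N.n f)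
        + mulV (symGrad (τ (M.plus N f)) x) (N.n f))
      have h2 := real_inner_le_norm a (j x)
      rw [real_inner_self_eq_norm_sq]
      -- Young's inequality with weight `μ₀ / h_f`, which matches the penalty term.
      have h3 : 2 * (‖a‖ * ‖j x‖) ≤ μ₀⁻¹ * h * ‖a‖ ^ 2 + μ₀ * h⁻¹ * ‖j x‖ ^ 2 := by
        have h5 : μ₀⁻¹ * h * (μ₀ * h⁻¹) = 1 := by field_simp
        have h6 : 0 ≤ μ₀⁻¹ * h * (‖a‖ - μ₀ * h⁻¹ * ‖j x‖) ^ 2 := by positivity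
        have h7 : μ₀⁻¹ * h * (‖a‖ - μ₀ * h⁻¹ * ‖j x‖) ^ 2 = μ₀⁻¹ * h * ‖a‖ ^ 2
            - 2 * (‖a‖ * ‖j x‖) * (μ₀⁻¹ * h * (μ₀ * h⁻¹))
            + μ₀ * h⁻¹ * ‖j x‖ ^ 2 * (μ₀⁻¹ * h * (μ₀ * h⁻¹)) := by ring
        rw [h7, h5] at h6
        linarith
      have h4 : μ₀⁻¹ * h * ‖a‖ ^ 2 ≤ μ₀⁻¹ * h * (C₂ * S) :=
        mul_le_mul_of_nonneg_left h1 (by positivity)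
      linarith
    have hjj : ContinuousOn (fun x => μ₀ * h⁻¹ * ⟪j x, j x⟫) (cell f) :=
      continuousOn_const.mul (hjc.inner hjc)
    rw [faceInt_add hft continuousOn_const hjj,
      faceInt_const, faceInt_const_mul, ← e1] at e2
    refine e2.trans ?_
    have e3 : μ₀⁻¹ * h * (C₂ * S) * area f ≤ 4⁻¹ * ∑ K ∈ M.elemsOf f, E K := by
      calc μ₀⁻¹ * h * (C₂ * S) * area f = μ₀⁻¹ * C₂ * (h * area f * S) := by ring
        _ ≤ μ₀⁻¹ * C₂ * (C₁ * C₁ * ∑ K ∈ M.elemsOf f, E K) :=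
            mul_le_mul_of_nonneg_left hSE (by positivity)
        _ = 4⁻¹ * ∑ K ∈ M.elemsOf f, E K := by
            rw [hμ₀]; field_simp
    linarith
  have hsum := Finset.sum_le_sum hface
  rw [← Finset.mul_sum, Finset.sum_add_distrib, ← Finset.mul_sum, ← Finset.mul_sum,
    M.sum_faces_elemsOf] at hsum
  have hJ0 : 0 ≤ ∑ f ∈ M.faces, (Metric.diam (cell f))⁻¹ * faceInt f fun x => ⟪J f x, J f x⟫ :=
    Finset.sum_nonneg fun f hf => mul_nonneg (inv_nonneg.2 Metric.diam_nonneg)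
      (integral_nonneg fun x => real_inner_self_nonneg)
  have hsymm : ∑ f ∈ M.faces, faceInt f (fun x => ⟪J f x, A f x⟫)
      = ∑ f ∈ M.faces, faceInt f fun x => ⟪A f x, J f x⟫ :=
    Finset.sum_congr rfl fun f _ => by simp only [real_inner_comm]
  have hμJ := mul_le_mul_of_nonneg_right hμ hJ0
  rw [aSh, hvol]
  change 0 ≤ ∑ K ∈ M.elems, E K - ∑ f ∈ M.faces, faceInt f (fun x => ⟪A f x, J f x⟫)
    - ∑ f ∈ M.faces, faceInt f (fun x => ⟪J f x, A f x⟫)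
    + μa * ∑ f ∈ M.faces, (Metric.diam (cell f))⁻¹ * faceInt f fun x => ⟪J f x, J f x⟫
  rw [hsymm]
  linarith

end TetMesh

/-! ### The convective form -/

lemma mulV_gradM (v : E3 → E3) (x a : E3) : mulV (gradM v x) a = fderiv ℝ v x a := by
  have ha : a = ∑ j, a j • EuclideanSpace.single j (1 : ℝ) := by
    ext i
    fin_cases i <;> simp [Fin.sum_univ_three]
  ext i
  conv_rhs => rw [ha]
  simp only [mulV, gradM, Matrix.mulVec, dotProduct, Matrix.of_apply, map_sum, map_smul,
    WithLp.ofLp_sum, Finset.sum_apply, PiLp.smul_apply, smul_eq_mul]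
  exact Finset.sum_congr rfl fun j _ => mul_comm _ _

lemma IsTet.coord_eq_zero {K : Finset E3} (hK : IsTet K) {S : Set E3} (hS : S ⊆ K) {u : E3}
    (hu : u ∈ K) (huS : u ∉ S) {x : E3} (hx : x ∈ convexHull ℝ S) : hK.coord ⟨u, hu⟩ x = 0 := by
  have hsub : convexHull ℝ S ⊆ {z | hK.coord ⟨u, hu⟩ z = 0} := by
    refine convexHull_min (fun y hy => ?_) ?_
    · exact hK.coord_ne (u := ⟨y, hS hy⟩) fun h => huS (by
        have := congrArg Subtype.val h
        simp only at this
        rw [this]; exact hy)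
    · exact (convex_singleton (0 : ℝ)).affine_preimage (hK.coord ⟨u, hu⟩)
  exact hsub hx

namespace TetMesh

variable {Ω : Set E3} (M : TetMesh Ω)

/-- At a point of an open face all vertices of that face have positive barycentric coordinates. By
conformity they must be vertices of any mesh face containing the point. -/
lemma eq_of_mem_openFace {f f' : Finset E3} (hf : f ∈ M.faces) (hf' : f' ∈ M.faces) {x : E3}
    (hx : x ∈ openFace f) (hx' : x ∈ cell f') : f = f' := by
  classical
  obtain ⟨K, hK⟩ := M.exists_elemsOf hf
  obtain ⟨L, hL⟩ := M.exists_elemsOf hf'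
  obtain ⟨hKe, hfK⟩ := M.mem_elemsOf.1 hK
  obtain ⟨hLe, hfL⟩ := M.mem_elemsOf.1 hL
  have hpos : ∀ E (hE : E ∈ M.elems), f ⊆ E → ∀ u (hu : u ∈ E), u ∈ f →
      0 < (M.isTet hE).coord ⟨u, hu⟩ x := by
    intro E hE hfE u hu huf
    obtain ⟨v, hv, rfl⟩ := M.exists_apex hf (M.mem_elemsOf.2 ⟨hE, hfE⟩)
    exact ((M.isTet hE).coord_of_mem_openFace hv hx).2 ⟨u, hu⟩ (Finset.ne_of_mem_erase huf)
  have hfL' : f ⊆ L := by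
    intro u hu
    by_contra huL
    have hxx : x ∈ convexHull ℝ ((K : Set E3) ∩ L) := by
      rw [← M.conforming K hKe L hLe]
      exact ⟨openFace_subset_cell_of_subset hfK (openFace_subset_cell f hx),
        openFace_subset_cell_of_subset hfL hx'⟩
    have h0 := (M.isTet hKe).coord_eq_zero inter_subset_left (hfK hu) (fun h => huL h.2) hxx
    exact (hpos K hKe hfK u (hfK hu) hu).ne' h0
  refine Finset.eq_of_subset_of_card_le (fun u hu => ?_) (by
    rw [(M.isTri hf).card, (M.isTri hf').card])
  by_contra huf
  have h0 := (M.isTet hLe).coord_eq_zero (S := (f' : Set E3)) (by exact_mod_cast hfL) (hfL' hu)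
    (by exact_mod_cast huf) hx'
  exact (hpos L hLe hfL' u (hfL' hu) hu).ne' h0

-- The sign records on which side of the face the element lies.
open scoped Classical in
lemma outwardNormals (N : M.Normals) {K : Finset E3} (hK : K ∈ M.elems) :
    IsTet.OutwardNormals K fun v =>
      (if K = M.minus N (K.erase v) then (1 : ℝ) else -1) • N.n (K.erase v) := by
  have hside : ∀ v ∈ K, ∀ x ∈ K.erase v, 0 < ⟪(if K = M.minus N (K.erase v) then (-1 : ℝ) else 1) •
      N.n (K.erase v), v - x⟫ := by
    intro v hv x hx
    have hf := M.erase_mem_faces hK hv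
    have hm : K ∈ M.elemsOf (K.erase v) := M.mem_elemsOf.2 ⟨hK, Finset.erase_subset _ _⟩
    split_ifs with h
    · have := (M.sides_spec N hf).1
      rw [← h] at this
      exact this.2.2 v hv (Finset.notMem_erase v K) x hx
    · rcases M.isSide_or N hf hm with h1 | h1
      · exact absurd (h1.unique hf (M.sides_spec N hf).1) h
      · exact h1.2.2 v hv (Finset.notMem_erase v K) x hx
  refine ⟨fun v hv => ?_, fun v hv x hx y hy => ?_, fun v hv x hx => ?_⟩
  · rw [norm_smul, N.unit _ (M.erase_mem_faces hK hv)]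
    split_ifs <;> norm_num
  · rw [real_inner_smul_left, N.orth _ (M.erase_mem_faces hK hv) x hx y hy, mul_zero]
  · have := hside v hv x hx
    rw [real_inner_smul_left] at this ⊢
    split_ifs at this ⊢ <;> linarith

open scoped Classical in
/-- The divergence theorem on the mesh. -/
lemma sum_integral_divg (N : M.Normals) {F : Finset E3 → E3 → E3}
    (hF : ∀ K ∈ M.elems, ContDiff ℝ 1 (F K)) :
    ∑ K ∈ M.elems, ∫ x in cell K, divg (F K) x
      = ∑ f ∈ M.faces, ((faceInt f fun x => ⟪F (M.minus N f) x, N.n f⟫)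
        - if f ∈ M.intFaces then faceInt f fun x => ⟪F (M.plus N f) x, N.n f⟫ else 0) := by
  have h1 : ∀ K ∈ M.elems, ∫ x in cell K, divg (F K) x
      = ∑ v ∈ K, (if K = M.minus N (K.erase v) then (1 : ℝ) else -1)
        * faceInt (K.erase v) fun x => ⟪F K x, N.n (K.erase v)⟫ := by
    intro K hK
    rw [(M.isTet hK).integral_divg (M.outwardNormals N hK) (hF K hK)]
    refine Finset.sum_congr rfl fun v hv => ?_
    rw [← faceInt_const_mul]
    simp only [real_inner_smul_right]
  rw [Finset.sum_congr rfl h1, M.sum_elems_faces fun K f =>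
    (if K = M.minus N f then (1 : ℝ) else -1) * faceInt f fun x => ⟪F K x, N.n f⟫]
  refine Finset.sum_congr rfl fun f hf => ?_
  rw [M.sum_elemsOf N hf, if_pos rfl, one_mul]
  split_ifs with hi h
  · exact absurd h.symm ((M.sides_spec N hf).2.1 hi).2.1
  · ring
  · ring

/-! ### Piecewise polynomial solenoidal fields and the upwind form. -/

section DivFree

variable {M} {k : ℕ} {χ : E3 → E3} {σ : Finset E3 → E3 → E3}

lemma IsPw.sum_integral_fderiv_eq_zero (hΩ : IsConvexPolyhedron Ω) (hσ : M.IsPw k χ σ)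
    (hdiv : HasDivZeroNormal Ω χ 0) {q : E3 → ℝ} (hq : ContDiff ℝ ∞ q) (hc : HasCompactSupport q) :
    ∑ K ∈ M.elems, ∫ x in cell K, fderiv ℝ q x (σ K x) = 0 := by
  have h1 := hdiv q hq hc
  simp only [Pi.zero_apply, zero_mul, integral_zero, neg_zero] at h1
  have h2 : ∀ x, ⟪χ x, gradient q x⟫ = fderiv ℝ q x (χ x) := fun x => by
    rw [inner_gradient_right]; rfl
  simp only [h2] at h1
  have hqc : Continuous (fderiv ℝ q) := hq.continuous_fderiv (by simp)
  have h3 : ∀ K ∈ M.elems, EqOn (fun x => fderiv ℝ q x (χ x)) (fun x => fderiv ℝ q x (σ K x))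
      (openCell K) := fun K hK x hx => by simp only [(hσ K hK).2 hx]
  rw [M.integral_eq_sum hΩ fun K hK => ?_] at h1
  · rw [← h1]
    refine Finset.sum_congr rfl fun K hK => ?_
    rw [← IsTet.setIntegral_openCell]
    exact (setIntegral_congr_fun (IsTet.isOpen_openCell K).measurableSet (h3 K hK)).symm
  · refine IntegrableOn.congr_fun ?_ (h3 K hK).symm (IsTet.isOpen_openCell K).measurableSet
    exact (IsTet.integrableOn_cell K (hqc.clm_apply (hσ.continuous hK)).continuousOn).mono_set
      (IsTet.openCell_subset_cell K)

lemma integral_divg_smul {K : Finset E3} {q : E3 → ℝ} (hq : ContDiff ℝ 1 q) {F : E3 → E3}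
    (hF : F ∈ polyVec k) : ∫ x in cell K, divg (fun y => q y • F y) x
      = (∫ x in cell K, q x * divg F x) + ∫ x in cell K, fderiv ℝ q x (F x) := by
  have hF1 : ContDiff ℝ 1 F := contDiff_of_mem_polyVec hF
  rw [← integral_add]
  · refine integral_congr_ae (Eventually.of_forall fun x => ?_)
    exact divg_smul (hq.differentiable one_ne_zero x) (hF1.differentiable one_ne_zero x)
  · exact IsTet.integrableOn_cell K (hq.continuous.mul
      (contDiff_of_mem_polyFun (divg_mem_polyFun hF) (n := 0)).continuous).continuousOn
  · exact IsTet.integrableOn_cell K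
      ((hq.continuous_fderiv one_ne_zero).clm_apply hF1.continuous).continuousOn

/-- A piecewise polynomial solenoidal field is divergence-free in each element. -/
lemma IsPw.divg_eq_zero (hΩ : IsConvexPolyhedron Ω) (hσ : M.IsPw k χ σ)
    (hdiv : HasDivZeroNormal Ω χ 0) {K : Finset E3} (hK : K ∈ M.elems) : divg (σ K) = 0 := by
  classical
  have hKt := M.isTet hK
  have hpoly := divg_mem_polyFun (hσ K hK).1
  have hcont : Continuous (divg (σ K)) := (contDiff_of_mem_polyFun hpoly (n := 0)).continuous
  have hU := IsTet.isOpen_openCell K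
  refine polyFun_eq_zero_of_isOpen hpoly hU hKt.openCell_nonempty ?_
  -- Test functions supported in one open element see neither the faces nor the other elements, so
  -- only the elementwise divergence is tested.
  have hae : ∀ᵐ x ∂volume, x ∈ openCell K → divg (σ K) x = 0 := by
    refine hU.ae_eq_zero_of_integral_contDiff_smul_eq_zero
      (hcont.locallyIntegrable.locallyIntegrableOn _) fun q hq hc hqU => ?_
    have hq1 : ContDiff ℝ 1 q := hq.of_le (by exact_mod_cast le_top)
    have h1 := hσ.sum_integral_fderiv_eq_zero hΩ hdiv hq hc
    rw [Finset.sum_eq_single_of_mem K hK fun L hL hne => ?_] at h1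
    · obtain ⟨m, hm⟩ : ∃ m : E3 → E3, ∀ v ∈ K, m v ≠ 0 ∧
          ∀ x ∈ K, ∀ y ∈ K, x ≠ v → y ≠ v → ⟪m v, y - x⟫ = 0 :=
        ⟨fun v => if hv : v ∈ K then hKt.grad ⟨v, hv⟩ else 0, fun v hv => by
          simp only [dif_pos hv]
          exact ⟨hKt.grad_ne_zero _, fun x hx y hy hxv hyv =>
            hKt.inner_grad_eq_zero hv hx hy hxv hyv⟩⟩
      obtain ⟨c, hν⟩ := IsTet.exists_outwardNormals hKt (fun v hv => (hm v hv).1)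
        fun v hv => (hm v hv).2
      have hFc : ContDiff ℝ 1 fun y => q y • σ K y := hq1.smul (contDiff_of_mem_polyVec (hσ K hK).1)
      have h2 := hKt.integral_divg hν hFc
      rw [integral_divg_smul hq1 (hσ K hK).1, h1, add_zero] at h2
      rw [Finset.sum_eq_zero fun v hv => ?_] at h2
      · have h3 : ∫ x, q x • divg (σ K) x = ∫ x in cell K, q x * divg (σ K) x :=
          (setIntegral_eq_integral_of_forall_compl_eq_zero fun x hx => by
            rw [image_eq_zero_of_notMem_tsupport fun h =>
              hx (IsTet.openCell_subset_cell K (hqU h)), zero_smul]).symm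
        rw [h3, h2]
      · rw [faceInt_congr (hKt.isTri_erase hv) (g' := fun _ => 0) fun x hx => ?_, faceInt_const,
          zero_mul]
        have hx0 : x ∉ tsupport q := fun h => by
          have h4 := hqU h
          rw [hKt.openCell_eq] at h4
          exact (h4 ⟨v, hv⟩).ne' (hKt.coord_of_mem_openFace hv hx).1
        rw [image_eq_zero_of_notMem_tsupport hx0, zero_smul, inner_zero_left]
    · refine setIntegral_eq_zero_of_forall_eq_zero fun x hx => ?_
      have hx0 : x ∉ tsupport q := fun h =>
        Set.disjoint_left.1 (M.disjoint_openCell_cell hK hL hne.symm) (hqU h) hx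
      rw [image_eq_zero_of_notMem_tsupport fun h => hx0 (tsupport_fderiv_subset ℝ h)]
      rfl
  have hae' : divg (σ K) =ᵐ[volume.restrict (openCell K)] fun _ => 0 :=
    (ae_restrict_iff' hU.measurableSet).2 hae
  exact Measure.eqOn_open_of_ae_eq hae' hU hcont.continuousOn continuousOn_const

open scoped Classical in
/-- The normal component of a piecewise polynomial solenoidal field is continuous across internal
faces and vanishes on boundary faces. -/
lemma IsPw.normal_jump_eq_zero (hΩ : IsConvexPolyhedron Ω) (hσ : M.IsPw k χ σ)
    (hdiv : HasDivZeroNormal Ω χ 0) (N : M.Normals) {f : Finset E3} (hf : f ∈ M.faces) {x : E3}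
    (hx : x ∈ openFace f) : ⟪σ (M.minus N f) x, N.n f⟫
      = if f ∈ M.intFaces then ⟪σ (M.plus N f) x, N.n f⟫ else 0 := by
  have hmE := (M.mem_elemsOf.1 (M.minus_mem N hf)).1
  have hpE := (M.mem_elemsOf.1 (M.plus_mem N hf)).1
  set S : E3 → ℝ := fun x => ⟪σ (M.minus N f) x, N.n f⟫
    - if f ∈ M.intFaces then ⟪σ (M.plus N f) x, N.n f⟫ else 0 with hS
  have hSp : S ∈ polyFun k := by
    refine sub_mem_polyFun (inner_const_mem_polyFun (hσ _ hmE).1 _) ?_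
    split_ifs
    · exact inner_const_mem_polyFun (hσ _ hpE).1 _
    · exact const_mem_polyFun k 0
  have hSc : Continuous S := (contDiff_of_mem_polyFun hSp (n := 0)).continuous
  suffices h : S x = 0 from sub_eq_zero.1 h
  have hclosed : IsClosed (⋃ f' ∈ M.faces.erase f, cell f') :=
    isClosed_biUnion_finset fun f' _ => (IsTet.isCompact_cell f').isClosed
  -- A point of an open face has positive distance from all other faces, which permits localization.
  have hxU : x ∈ (⋃ f' ∈ M.faces.erase f, cell f')ᶜ := by
    simp only [mem_compl_iff, mem_iUnion, not_exists]
    intro f' hf' hx'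
    exact Finset.ne_of_mem_erase hf'
      (M.eq_of_mem_openFace hf (Finset.mem_of_mem_erase hf') hx hx').symm
  obtain ⟨r, hr, hrU⟩ := Metric.isOpen_iff.1 hclosed.isOpen_compl x hxU
  let g : ContDiffBump x := ⟨r / 3, r / 2, by positivity, by linarith⟩
  -- The normal jump itself, cut off near `x`, is the test function; the distributional identity
  -- becomes `∫ g S² = 0` on `f`. For a boundary face `S` is the one-sided normal component.
  set q : E3 → ℝ := fun y => g y * S y with hq
  have hqs : ContDiff ℝ ∞ q := g.contDiff.mul (contDiff_of_mem_polyFun hSp)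
  have hqc : HasCompactSupport q := g.hasCompactSupport.mul_right
  have hq1 : ContDiff ℝ 1 q := hqs.of_le (by exact_mod_cast le_top)
  have h1 := hσ.sum_integral_fderiv_eq_zero hΩ hdiv hqs hqc
  have h2 := M.sum_integral_divg N (F := fun K y => q y • σ K y) fun K hK =>
    hq1.smul (contDiff_of_mem_polyVec (hσ K hK).1)
  have h3 : ∀ K ∈ M.elems, ∫ x in cell K, divg (fun y => q y • σ K y) x
      = ∫ x in cell K, fderiv ℝ q x (σ K x) := by
    intro K hK
    rw [integral_divg_smul hq1 (hσ K hK).1, hσ.divg_eq_zero hΩ hdiv hK]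
    simp
  rw [Finset.sum_congr rfl h3, h1, Finset.sum_eq_single_of_mem f hf fun f' hf' hne => ?_] at h2
  · have h4 : faceInt f (fun y => g y * S y ^ 2) = 0 := by
      rw [h2]
      have hσm : Continuous fun y => ⟪q y • σ (M.minus N f) y, N.n f⟫ :=
        (hqs.continuous.smul (hσ.continuous hmE)).inner continuous_const
      have hσp : Continuous fun y => ⟪q y • σ (M.plus N f) y, N.n f⟫ :=
        (hqs.continuous.smul (hσ.continuous hpE)).inner continuous_const
      by_cases hi : f ∈ M.intFaces
      · rw [if_pos hi, ← faceInt_sub (M.isTri hf) hσm.continuousOn hσp.continuousOn]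
        congr 1
        ext y
        simp only [hq, hS, if_pos hi, real_inner_smul_left]
        ring
      · rw [if_neg hi, sub_zero]
        congr 1
        ext y
        simp only [hq, hS, if_neg hi, real_inner_smul_left]
        ring
    have h5 := eq_zero_of_faceInt_eq_zero (M.isTri hf) (g := fun y => g y * S y ^ 2)
      (g.continuous.mul (hSc.pow 2)) (fun y => mul_nonneg g.nonneg (sq_nonneg _)) h4 x hx
    have h6 : g x = 1 := g.one_of_mem_closedBall (Metric.mem_closedBall_self g.rIn_pos.le)
    rw [h6, one_mul] at h5
    exact pow_eq_zero_iff two_ne_zero |>.1 h5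
  · have hz : ∀ y ∈ openFace f', q y = 0 := by
      intro y hy
      have hyr : y ∉ Metric.ball x r := fun h => hrU h (mem_iUnion₂.2
        ⟨f', Finset.mem_erase.2 ⟨hne, hf'⟩, openFace_subset_cell f' hy⟩)
      have : g y = 0 := g.zero_of_le_dist (by
        rw [Metric.mem_ball, not_lt] at hyr
        exact (by linarith : r / 2 ≤ r).trans hyr)
      simp only [hq, this, zero_mul]
    have hz' : ∀ K, faceInt f' (fun y => ⟪q y • σ K y, N.n f'⟫) = 0 := fun K => by
      rw [faceInt_congr (M.isTri hf') (g' := fun _ => 0) fun y hy => by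
        rw [hz y hy, zero_smul, inner_zero_left], faceInt_const, zero_mul]
    rw [hz', hz', ite_self, sub_zero]

/-- The convective form is nonnegative. -/
lemma ch_nonneg (hΩ : IsConvexPolyhedron Ω) (hχ : ∀ K ∈ M.elems, IsPolyOn k (openCell K) χ)
    (hdiv : HasDivZeroNormal Ω χ 0) (N : M.Normals) {u : E3 → E3}
    (hu : ∀ K ∈ M.elems, IsPolyOn k (openCell K) u) : 0 ≤ M.ch N χ u u := by
  classical
  obtain ⟨σ, hσ⟩ := M.exists_isPw hχ
  obtain ⟨τ, hτ⟩ := M.exists_isPw hu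
  have hτ1 : ∀ K ∈ M.elems, ContDiff ℝ 1 (τ K) := fun K hK => contDiff_of_mem_polyVec (hτ K hK).1
  -- Because `div χ = 0` in each element, `(∇u χ) · u = ½ div (|u|² χ)`.
  have hb : M.brokenInt (fun x => ⟪mulV (gradM u x) (χ x), u x⟫)
      = ∑ K ∈ M.elems, ∫ x in cell K, divg (fun y => (2⁻¹ * ⟪τ K y, τ K y⟫) • σ K y) x := by
    rw [M.brokenInt_congr (g' := fun K x => ⟪mulV (gradM (τ K) x) (σ K x), τ K x⟫)]
    · refine Finset.sum_congr rfl fun K hK => ?_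
      have hq1 : ContDiff ℝ 1 fun y => 2⁻¹ * ⟪τ K y, τ K y⟫ :=
        contDiff_const.mul ((hτ1 K hK).inner ℝ (hτ1 K hK))
      rw [integral_divg_smul hq1 (hσ K hK).1, hσ.divg_eq_zero hΩ hdiv hK]
      simp only [Pi.zero_apply, mul_zero, integral_zero, zero_add]
      refine integral_congr_ae (Eventually.of_forall fun x => ?_)
      have hd := (hτ1 K hK).differentiable one_ne_zero x
      have h1 : HasFDerivAt (fun y => 2⁻¹ * ⟪τ K y, τ K y⟫) _ x :=
        (hd.hasFDerivAt.inner ℝ hd.hasFDerivAt).const_mul 2⁻¹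
      simp only [mulV_gradM]
      rw [h1.fderiv]
      simp only [smul_apply, ContinuousLinearMap.comp_apply,
        ContinuousLinearMap.prod_apply, fderivInnerCLM_apply, smul_eq_mul]
      rw [real_inner_comm (fderiv ℝ (τ K) x (σ K x)) (τ K x)]
      ring
    · intro K hK x hx
      simp only [gradM_eqOn (IsTet.isOpen_openCell K) (hτ K hK).2 hx, (hσ K hK).2 hx,
        (hτ K hK).2 hx]
  have hg : ∀ K ∈ M.elems, ContDiff ℝ 1 fun y => (2⁻¹ * ⟪τ K y, τ K y⟫) • σ K y := fun K hK =>
    (contDiff_const.mul ((hτ1 K hK).inner ℝ (hτ1 K hK))).smul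
      (contDiff_of_mem_polyVec (hσ K hK).1)
  -- The jump of `½ |u|²` is the jump of `u` times its average and `χ · n` is continuous, so the
  -- volume term cancels the consistency term and only upwinding remains.
  have hsum : M.brokenInt (fun x => ⟪mulV (gradM u x) (χ x), u x⟫) = ∑ f ∈ M.intFaces,
      faceInt f (fun x => M.normalComp N f χ x * ⟪M.jump N f u x, M.avg N f u x⟫) := by
    rw [hb, M.sum_integral_divg N hg, ← Finset.sum_filter_add_sum_filter_not M.faces
      (fun f => f ∈ M.intFaces)]
    rw [Finset.sum_eq_zero (s := M.faces.filter fun f => f ∉ M.intFaces), add_zero]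
    · have hfilter : M.faces.filter (fun f => f ∈ M.intFaces) = M.intFaces := by
        ext f
        rw [Finset.mem_filter, and_iff_right_iff_imp]
        exact M.mem_faces_of_mem_intFaces
      rw [hfilter]
      refine Finset.sum_congr rfl fun f hi => ?_
      have hf := M.mem_faces_of_mem_intFaces hi
      have hmE := (M.mem_elemsOf.1 (M.minus_mem N hf)).1
      have hpE := (M.mem_elemsOf.1 (M.plus_mem N hf)).1
      rw [if_pos hi, ← faceInt_sub (M.isTri hf)
        ((hg _ hmE).continuous.inner continuous_const).continuousOn
        ((hg _ hpE).continuous.inner continuous_const).continuousOn]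
      refine faceInt_congr (M.isTri hf) fun x hx => ?_
      have h1 := hσ.normal_jump_eq_zero hΩ hdiv N hf hx
      rw [if_pos hi] at h1
      rw [normalComp, hσ.isTrace.avg N hf hx, hτ.isTrace.avg N hf hx, hτ.isTrace.jump_int N hi hx]
      simp only [real_inner_smul_left, real_inner_smul_right, inner_add_left, inner_sub_left,
        inner_add_right, h1]
      rw [real_inner_comm (τ (M.minus N f) x) (τ (M.plus N f) x)]
      ring
    · intro f hf
      obtain ⟨hf, hi⟩ := Finset.mem_filter.1 hf
      rw [if_neg hi, sub_zero, faceInt_congr (M.isTri hf) (g' := fun _ => 0) fun x hx => ?_,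
        faceInt_const, zero_mul]
      have h1 := hσ.normal_jump_eq_zero hΩ hdiv N hf hx
      rw [if_neg hi] at h1
      rw [real_inner_smul_left, h1, mul_zero]
  rw [ch, hsum, sub_self, zero_add]
  exact Finset.sum_nonneg fun f _ => integral_nonneg fun x =>
    mul_nonneg (abs_nonneg _) real_inner_self_nonneg

end DivFree

/-- The form of the three-field method is nonnegative on the diagonal. -/
lemma exists_A3f_nonneg (k : ℕ) (cM : ℝ) (hcM : 0 < cM) : ∃ μ₀ : ℝ, 0 < μ₀ ∧
    ∀ (Ω : Set E3), IsConvexPolyhedron Ω → ∀ (M : TetMesh Ω) (N : M.Normals), M.ShapeRegular cM →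
    ∀ νS νM μa : ℝ, 0 < νS → 0 < νM → μ₀ ≤ μa → ∀ u B : E3 → E3, M.MemZh k u →
    0 ≤ M.A3f N νS νM μa u B u B u B := by
  obtain ⟨μ₀, hμ₀, h⟩ := exists_aSh_nonneg k cM hcM
  refine ⟨μ₀, hμ₀, fun Ω hΩ M N hM νS νM μa hνS hνM hμa u B hu => ?_⟩
  have h1 := h Ω M N hM μa hμa u hu.1.1
  have h2 := ch_nonneg hΩ hu.1.1 hu.2.2 N hu.1.1
  have hdd : 0 ≤ M.divDiv B B := M.brokenInt_nonneg fun x => mul_self_nonneg _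
  have haM : 0 ≤ M.aM B B := add_nonneg (M.brokenInt_nonneg fun x => real_inner_self_nonneg) hdd
  have hJ : 0 ≤ M.Jh N B u u := Finset.sum_nonneg fun f _ =>
    mul_nonneg (zero_le_one.trans (le_max_right _ _)) (add_nonneg
      (integral_nonneg fun x => real_inner_self_nonneg)
      (mul_nonneg (sq_nonneg _) (integral_nonneg fun x => frob_self_nonneg _)))
  have := mul_nonneg hνS.le h1
  have := mul_nonneg hνM.le haM
  rw [A3f]
  linarith

end TetMesh

/-! ### The energy estimate -/

/-- A Gronwall-type bound: `φ' ≤ 2 g √φ` implies `φ ≤ 2 φ(0) + 4 (∫ g)²`. -/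
lemma le_of_deriv_le_sqrt {φ g : ℝ → ℝ} {T : ℝ} (hT : 0 < T)
    (hφ : AbsolutelyContinuousOnInterval φ 0 T) (hg : IntegrableOn g (Ioo 0 T))
    (hg0 : ∀ t, 0 ≤ g t) (h0 : ∀ t ∈ Icc 0 T, 0 ≤ φ t)
    (hd : ∀ᵐ t ∂(volume.restrict (Ioo 0 T)), ∃ d, HasDerivAt φ d t ∧ d ≤ 2 * g t * √(φ t)) :
    ∀ t ∈ Icc 0 T, φ t ≤ 2 * φ 0 + 4 * (∫ t in Ioo 0 T, g t) ^ 2 := by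
  have hc : ContinuousOn φ (Icc 0 T) := by
    have := hφ.continuousOn
    rwa [uIcc_of_le hT.le] at this
  -- At a maximum point the inequality integrates to `m² - φ(0) ≤ 2 m S`, with no exponential in
  -- `T`.
  obtain ⟨s, hs, hmax⟩ := isCompact_Icc.exists_isMaxOn (nonempty_Icc.2 hT.le) hc
  set m := √(φ s) with hm
  have hm2 : m ^ 2 = φ s := Real.sq_sqrt (h0 s hs)
  have hm0 : 0 ≤ m := Real.sqrt_nonneg _
  set S := ∫ t in Ioo 0 T, g t with hS
  have hsub : Ioo 0 s ⊆ Ioo 0 T := Ioo_subset_Ioo_right hs.2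
  have hac : AbsolutelyContinuousOnInterval φ 0 s := hφ.mono (by
    rw [uIcc_of_le hT.le, uIcc_of_le hs.1]
    exact Icc_subset_Icc_right hs.2)
  have h1 : φ s - φ 0 ≤ 2 * m * S := by
    rw [← hac.integral_deriv_eq_sub, intervalIntegral.integral_of_le hs.1,
      integral_Ioc_eq_integral_Ioo]
    have hi : IntegrableOn (deriv φ) (Ioo 0 s) :=
      (hac.intervalIntegrable_deriv.1).mono_set Ioo_subset_Ioc_self
    have hgi : IntegrableOn (fun t => 2 * m * g t) (Ioo 0 s) := (hg.mono_set hsub).const_mul _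
    have h2 : ∀ᵐ t ∂(volume.restrict (Ioo 0 s)), deriv φ t ≤ 2 * m * g t := by
      filter_upwards [ae_restrict_of_ae_restrict_of_subset hsub hd,
        ae_restrict_mem measurableSet_Ioo] with t ⟨d, hdt, hle⟩ ht
      rw [hdt.deriv]
      refine hle.trans ?_
      have h3 : √(φ t) ≤ m := Real.sqrt_le_sqrt (hmax ⟨ht.1.le, ht.2.le.trans hs.2⟩)
      nlinarith [hg0 t, mul_le_mul_of_nonneg_left h3 (hg0 t)]
    refine (setIntegral_mono_ae_restrict hi hgi h2).trans ?_
    rw [integral_const_mul]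
    exact mul_le_mul_of_nonneg_left (setIntegral_mono_set hg (Eventually.of_forall hg0)
      hsub.eventuallyLE) (by positivity)
  intro t ht
  refine (hmax ht : φ t ≤ φ s).trans ?_
  rw [← hm2] at h1 ⊢
  -- Young: `2 m S ≤ m² / 2 + 2 S²`, and half of `m²` is absorbed.
  nlinarith [sq_nonneg (m - 2 * S)]

/-! ### Pairings in `L²` and linearity of the discrete constraints. -/

section L2

variable {Ω : Set E3} {v w : E3 → E3}

lemma integrable_inner_of_memLp (hv : MemLp v 2 (volume.restrict Ω))
    (hw : MemLp w 2 (volume.restrict Ω)) : IntegrableOn (fun x => ⟪v x, w x⟫) Ω := by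
  refine (L2.integrable_inner (𝕜 := ℝ) (hv.toLp v) (hw.toLp w)).congr ?_
  filter_upwards [hv.coeFn_toLp, hw.coeFn_toLp] with x h1 h2
  rw [h1, h2]

lemma inner_toLp (hv : MemLp v 2 (volume.restrict Ω)) (hw : MemLp w 2 (volume.restrict Ω)) :
    ⟪hv.toLp v, hw.toLp w⟫ = ip Ω v w := by
  rw [L2.inner_def, ip]
  refine integral_congr_ae ?_
  filter_upwards [hv.coeFn_toLp, hw.coeFn_toLp] with x h1 h2
  rw [h1, h2]

lemma ip_le (F : Lp E3 2 (volume.restrict Ω)) (hv : MemLp v 2 (volume.restrict Ω)) :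
    ip Ω F v ≤ ‖F‖ * √(ip Ω v v) := by
  have h1 : ip Ω F v = ⟪F, hv.toLp v⟫ := by
    rw [L2.inner_def, ip]
    refine integral_congr_ae ?_
    filter_upwards [hv.coeFn_toLp] with x h1
    rw [h1]
  rw [h1, ← inner_toLp hv hv, real_inner_self_eq_norm_sq, Real.sqrt_sq (norm_nonneg _)]
  exact real_inner_le_norm _ _

lemma memLp_gradient {q : E3 → ℝ} (hq : ContDiff ℝ ∞ q) (hc : HasCompactSupport q) :
    MemLp (gradient q) 2 (volume.restrict Ω) := by
  have h1 : gradient q = (InnerProductSpace.toDual ℝ E3).symm ∘ fderiv ℝ q := rfl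
  have h2 : Continuous (gradient q) := by
    rw [h1]
    exact (LinearIsometryEquiv.continuous _).comp (hq.continuous_fderiv (by simp))
  have h3 : HasCompactSupport (gradient q) := by
    rw [h1]
    exact (hc.fderiv ℝ).comp_left (map_zero _)
  exact (h2.memLp_of_hasCompactSupport h3).restrict _

lemma MemH0DivFree.add (hv : MemH0DivFree Ω v) (hw : MemH0DivFree Ω w) :
    MemH0DivFree Ω (v + w) := by
  refine ⟨hv.1.add hw.1, fun q hq hc => ?_⟩
  have hg := memLp_gradient (Ω := Ω) hq hc
  have h1 := hv.2 q hq hc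
  have h2 := hw.2 q hq hc
  simp only [Pi.zero_apply, zero_mul, integral_zero, neg_zero] at h1 h2 ⊢
  simp only [Pi.add_apply, inner_add_left]
  rw [integral_add (integrable_inner_of_memLp hv.1 hg) (integrable_inner_of_memLp hw.1 hg), h1, h2,
    add_zero]

lemma MemH0DivFree.smul (c : ℝ) (hv : MemH0DivFree Ω v) : MemH0DivFree Ω (c • v) := by
  refine ⟨hv.1.const_smul c, fun q hq hc => ?_⟩
  have h1 := hv.2 q hq hc
  simp only [Pi.zero_apply, zero_mul, integral_zero, neg_zero] at h1 ⊢
  simp only [Pi.smul_apply, real_inner_smul_left, integral_const_mul, h1, mul_zero]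

lemma MemH0DivFree.memH0Div (hv : MemH0DivFree Ω v) : MemH0Div Ω v :=
  ⟨hv.1, 0, MemLp.zero, hv.2⟩

lemma IsPolyOn.add {k : ℕ} {S : Set E3} (hv : IsPolyOn k S v) (hw : IsPolyOn k S w) :
    IsPolyOn k S (v + w) := by
  obtain ⟨p, hp, hvp⟩ := isPolyOn_iff.1 hv
  obtain ⟨q, hq, hwq⟩ := isPolyOn_iff.1 hw
  exact isPolyOn_iff.2 ⟨p + q, add_mem hp hq, fun x hx => congrArg₂ (· + ·) (hvp hx) (hwq hx)⟩

lemma IsPolyOn.smul {k : ℕ} {S : Set E3} (c : ℝ) (hv : IsPolyOn k S v) :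
    IsPolyOn k S (c • v) := by
  obtain ⟨p, hp, hvp⟩ := isPolyOn_iff.1 hv
  exact isPolyOn_iff.2 ⟨c • p, Submodule.smul_mem _ c hp, fun x hx => congrArg (c • ·) (hvp hx)⟩

lemma isPolyOn_zero (k : ℕ) (S : Set E3) : IsPolyOn k S 0 :=
  isPolyOn_iff.2 ⟨0, zero_mem _, fun _ _ => rfl⟩

end L2

/-! ### Finite-dimensional discrete spaces and the energy estimate. -/

namespace TetMesh

variable {Ω : Set E3} (M : TetMesh Ω)

/-- The discrete kernel as a space of fields. -/
def spaceZh (k : ℕ) : Submodule ℝ (E3 → E3) where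
  carrier := {v | M.MemZh k v}
  zero_mem' :=
    have h : MemH0DivFree Ω (0 : E3 → E3) := ⟨MemLp.zero, fun q _ _ => by simp⟩
    ⟨⟨fun K _ => isPolyOn_zero k _, h.memH0Div⟩, h⟩
  add_mem' {v w} hv hw :=
    ⟨⟨fun K hK => (hv.1.1 K hK).add (hw.1.1 K hK), (hv.2.add hw.2).memH0Div⟩, hv.2.add hw.2⟩
  smul_mem' c v hv :=
    ⟨⟨fun K hK => (hv.1.1 K hK).smul c, (hv.2.smul c).memH0Div⟩, hv.2.smul c⟩

/-- The magnetic space as a space of fields. -/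
def spaceWh (N : M.Normals) (k : ℕ) : Submodule ℝ (E3 → E3) where
  carrier := {v | M.MemWh N k v}
  zero_mem' := ⟨fun K _ => isPolyOn_zero k _, continuousOn_const, fun f _ _ x _ => by simp⟩
  add_mem' {v w} hv hw := ⟨fun K hK => (hv.1 K hK).add (hw.1 K hK), hv.2.1.add hw.2.1,
    fun f hf hi x hx => by
      rw [Pi.add_apply, inner_add_left, hv.2.2 f hf hi x hx, hw.2.2 f hf hi x hx, add_zero]⟩
  smul_mem' c v hv := ⟨fun K hK => (hv.1 K hK).smul c, hv.2.1.const_smul c,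
    fun f hf hi x hx => by
      rw [Pi.smul_apply, real_inner_smul_left, hv.2.2 f hf hi x hx, mul_zero]⟩

variable {M}

lemma memLp_indicator {k : ℕ} {p : E3 → E3} (hp : p ∈ polyVec k) (K : Finset E3) :
    MemLp ((openCell K).indicator p) 2 (volume.restrict Ω) := by
  have hc : Continuous p := (contDiff_of_mem_polyVec hp (n := 0)).continuous
  have hm : MeasurableSet (openCell K) := (IsTet.isOpen_openCell K).measurableSet
  rw [memLp_indicator_iff_restrict hm, Measure.restrict_restrict hm]
  obtain ⟨C, hC⟩ := (IsTet.isCompact_cell K).exists_bound_of_continuousOn hc.continuousOn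
  have hfin : IsFiniteMeasure (volume.restrict (openCell K ∩ Ω)) := ⟨by
    rw [Measure.restrict_apply_univ]
    exact (measure_mono (inter_subset_left.trans (IsTet.openCell_subset_cell K))).trans_lt
      (IsTet.isCompact_cell K).measure_lt_top⟩
  refine MemLp.of_bound hc.aestronglyMeasurable C ?_
  refine ae_restrict_of_ae_restrict_of_subset inter_subset_left ?_
  filter_upwards [ae_restrict_mem hm] with x hx
  exact hC x (IsTet.openCell_subset_cell K hx)

lemma IsPw.ae_eq_sum_indicator {k : ℕ} {v : E3 → E3} {τ : Finset E3 → E3 → E3}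
    (h : M.IsPw k v τ) (hΩ : IsConvexPolyhedron Ω) :
    v =ᵐ[volume.restrict Ω] ∑ K ∈ M.elems, (openCell K).indicator (τ K) := by
  rw [Measure.restrict_congr_set (M.ae_eq_biUnion hΩ)]
  have hm : MeasurableSet (⋃ K ∈ M.elems, openCell K) :=
    Finset.measurableSet_biUnion _ fun K _ => (IsTet.isOpen_openCell K).measurableSet
  filter_upwards [ae_restrict_mem hm] with x hx
  obtain ⟨K, hK, hxK⟩ := mem_iUnion₂.1 hx
  rw [Finset.sum_apply, Finset.sum_eq_single_of_mem K hK fun L hL hne =>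
    indicator_of_notMem (fun hxL => (disjoint_left.1 (M.pairwiseDisjoint_openCell hL hK hne)) hxL hxK)
      _, indicator_of_mem hxK]
  exact (h K hK).2 hxK

lemma memLp_of_isPolyOn {k : ℕ} {v : E3 → E3} (hΩ : IsConvexPolyhedron Ω)
    (h : ∀ K ∈ M.elems, IsPolyOn k (openCell K) v) : MemLp v 2 (volume.restrict Ω) := by
  obtain ⟨τ, hτ⟩ := M.exists_isPw h
  exact (memLp_congr_ae (hτ.ae_eq_sum_indicator hΩ)).2
    (memLp_finsetSum' _ fun K hK => memLp_indicator (hτ K hK).1 K)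

/-- The class in `L²` of the extension by zero of a polynomial field from an element. -/
noncomputable def indicatorLp (Ω : Set E3) (k : ℕ) (K : Finset E3) :
    polyVec k →ₗ[ℝ] Lp E3 2 (volume.restrict Ω) where
  toFun p := (memLp_indicator p.2 K).toLp _
  map_add' p q := by
    rw [← MemLp.toLp_add]
    exact MemLp.toLp_congr _ _ (Eventually.of_forall fun x => by
      rw [Submodule.coe_add, indicator_add'])
  map_smul' c p := by
    rw [RingHom.id_apply, ← MemLp.toLp_const_smul]
    exact MemLp.toLp_congr _ _ (Eventually.of_forall fun x => by
      rw [Submodule.coe_smul, Pi.smul_apply]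
      exact congrFun (indicator_const_smul (openCell K) c (p : E3 → E3)) x)

lemma IsPw.sum_indicatorLp {k : ℕ} {v : E3 → E3} {τ : Finset E3 → E3 → E3}
    (h : M.IsPw k v τ) (hΩ : IsConvexPolyhedron Ω) (hv : MemLp v 2 (volume.restrict Ω)) :
    ∑ K : M.elems, indicatorLp Ω k K ⟨τ K, (h K K.2).1⟩ = hv.toLp v := by
  refine Lp.ext ((Lp.coeFn_finsetSum _ _).trans ?_)
  have h2 := h.ae_eq_sum_indicator hΩ
  have h3 : ∀ᵐ x ∂(volume.restrict Ω), ∀ K : M.elems,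
      indicatorLp Ω k K ⟨τ K, (h K K.2).1⟩ x = (openCell K).indicator (τ K) x :=
    ae_all_iff.2 fun K => (memLp_indicator (Ω := Ω) (h K K.2).1 K).coeFn_toLp
  filter_upwards [h2, h3, hv.coeFn_toLp] with x h2 h3 h4
  rw [h4, h2, Finset.sum_apply, Finset.sum_apply, Finset.sum_congr rfl fun K _ => h3 K]
  exact Finset.sum_coe_sort M.elems fun K => (openCell K).indicator (τ K) x

/-- Parseval's identity in a space of piecewise polynomials of bounded degree. -/
lemma exists_parseval {k : ℕ} (hΩ : IsConvexPolyhedron Ω) (V : Submodule ℝ (E3 → E3))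
    (hV : ∀ v ∈ V, ∀ K ∈ M.elems, IsPolyOn k (openCell K) v) :
    ∃ (n : ℕ) (b : Fin n → E3 → E3), (∀ i, b i ∈ V) ∧
      ∀ v ∈ V, ∀ w ∈ V, ip Ω v w = ∑ i, ip Ω v (b i) * ip Ω w (b i) := by
  have hmem : ∀ v : V, MemLp (v : E3 → E3) 2 (volume.restrict Ω) := fun v =>
    memLp_of_isPolyOn hΩ (hV v v.2)
  obtain ⟨L, hL⟩ : ∃ L : V →ₗ[ℝ] Lp E3 2 (volume.restrict Ω), ∀ v, L v = (hmem v).toLp v :=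
    ⟨{  toFun := fun v => (hmem v).toLp v
        map_add' := fun v w => MemLp.toLp_add (hmem v) (hmem w)
        map_smul' := fun c v => MemLp.toLp_const_smul c (hmem v) }, fun _ => rfl⟩
  -- `V` consists of functions that are unconstrained off the open elements, so it need not be
  -- finite-dimensional. Its image in `L²` is, being contained in the range of `Ψ`.
  let Ψ : (M.elems → polyVec k) →ₗ[ℝ] Lp E3 2 (volume.restrict Ω) :=
    ∑ K : M.elems, (indicatorLp Ω k K).comp (LinearMap.proj K)
  have hle : LinearMap.range L ≤ LinearMap.range Ψ := by
    rintro _ ⟨v, rfl⟩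
    obtain ⟨τ, hτ⟩ := M.exists_isPw (hV v v.2)
    refine ⟨fun K => ⟨τ K, (hτ K K.2).1⟩, ?_⟩
    rw [LinearMap.sum_apply, hL]
    exact hτ.sum_indicatorLp hΩ (hmem v)
  have hfd : FiniteDimensional ℝ (LinearMap.range L) := Submodule.finiteDimensional_of_le hle
  obtain ⟨n, ⟨b⟩⟩ : ∃ n, Nonempty (OrthonormalBasis (Fin n) ℝ (LinearMap.range L)) :=
    ⟨_, ⟨stdOrthonormalBasis ℝ _⟩⟩
  -- The basis vectors are `L²` classes; representatives in `V` are picked so that they can serve as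
  -- test fields.
  choose g hg using fun i => (b i).2
  refine ⟨n, fun i => g i, fun i => (g i).2, fun v hv w hw => ?_⟩
  have hip : ∀ v w : V, ⟪L v, L w⟫ = ip Ω v w := fun v w => by
    rw [hL, hL, inner_toLp]
  have h1 := b.sum_inner_mul_inner ⟨L ⟨v, hv⟩, LinearMap.mem_range_self _ _⟩
    ⟨L ⟨w, hw⟩, LinearMap.mem_range_self _ _⟩
  simp only [Submodule.coe_inner, ← hg] at h1
  rw [hip] at h1
  rw [← h1]
  refine Finset.sum_congr rfl fun i _ => ?_
  rw [hip, hip]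
  simp only [ip, real_inner_comm]

/-- Stability of the semidiscrete solution in `L^∞(0, T; L²)`. -/
lemma IsThreeFieldSolution.energy_le {N : M.Normals} {k : ℕ} {νS νM μa T : ℝ}
    {F G : ℝ → Lp E3 2 (volume.restrict Ω)} {uh Bh : ℝ → E3 → E3}
    (h : M.IsThreeFieldSolution N k νS νM μa T F G uh Bh) (hΩ : IsConvexPolyhedron Ω) (hT : 0 < T)
    (hF : MemLp F 2 (volume.restrict (Ioo 0 T))) (hG : MemLp G 2 (volume.restrict (Ioo 0 T)))
    (hA : ∀ u B, M.MemZh k u → 0 ≤ M.A3f N νS νM μa u B u B u B) {t : ℝ} (ht : t ∈ Icc 0 T) :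
    ip Ω (uh t) (uh t) + ip Ω (Bh t) (Bh t) ≤ 2 * (ip Ω (uh 0) (uh 0) + ip Ω (Bh 0) (Bh 0))
      + 4 * ((∫ t in Ioo 0 T, ‖F t‖) + ∫ t in Ioo 0 T, ‖G t‖) ^ 2 := by
  have hWp : ∀ H, M.MemWh N k H → ∀ K ∈ M.elems, IsPolyOn k (openCell K) H := fun H hH K hK => by
    obtain ⟨P, hP, he⟩ := hH.1 K hK
    exact ⟨P, hP, fun x hx => he x (IsTet.openCell_subset_cell K hx)⟩
  obtain ⟨n, b, hb, hbp⟩ := exists_parseval hΩ (M.spaceZh k) fun v hv => hv.1.1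
  obtain ⟨m, c, hc, hcp⟩ := exists_parseval hΩ (M.spaceWh N k) hWp
  -- Absolute continuity is given only against fixed test fields. By Parseval the energy is a finite
  -- sum of squares of such pairings.
  set φ : ℝ → ℝ := fun t => ∑ i, ip Ω (uh t) (b i) ^ 2 + ∑ j, ip Ω (Bh t) (c j) ^ 2 with hφ
  have hφe : ∀ t ∈ Icc 0 T, φ t = ip Ω (uh t) (uh t) + ip Ω (Bh t) (Bh t) := fun t ht => by
    rw [hφ, hbp _ (h.mem_Zh t ht) _ (h.mem_Zh t ht), hcp _ (h.mem_Wh t ht) _ (h.mem_Wh t ht)]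
    simp only [sq]
  have hsum : ∀ {ι : Type} [Fintype ι] (f : ι → ℝ → ℝ),
      (∀ i, AbsolutelyContinuousOnInterval (f i) 0 T) →
      AbsolutelyContinuousOnInterval (fun t => ∑ i, f i t ^ 2) 0 T := by
    intro ι _ f hf
    classical
    have : ∀ s : Finset ι, AbsolutelyContinuousOnInterval (fun t => ∑ i ∈ s, f i t ^ 2) 0 T := by
      intro s
      induction s using Finset.induction_on with
      | empty =>
        simp only [Finset.sum_empty]
        exact ((LipschitzWith.const (0 : ℝ)).lipschitzOnWith).absolutelyContinuousOnInterval
      | insert i s hi ih =>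
        simp only [Finset.sum_insert hi, sq]
        simp only [sq] at ih
        exact ((hf i).fun_mul (hf i)).fun_add ih
    exact this _
  have hac : AbsolutelyContinuousOnInterval φ 0 T :=
    (hsum _ fun i => h.ac_u _ (hb i)).fun_add (hsum _ fun j => h.ac_B _ (hc j))
  have hFi : IntegrableOn (fun t => ‖F t‖) (Ioo 0 T) := (hF.integrable one_le_two).norm
  have hGi : IntegrableOn (fun t => ‖G t‖) (Ioo 0 T) := (hG.integrable one_le_two).norm
  have hip0 : ∀ v, ip Ω v 0 = 0 := fun v => by simp [ip]
  have hip0' : ∀ v : E3 → E3, 0 ≤ ip Ω v v := fun v => integral_nonneg fun x => real_inner_self_nonneg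
  have key := le_of_deriv_le_sqrt hT hac (hFi.add hGi)
    (fun t => add_nonneg (norm_nonneg _) (norm_nonneg _))
    (fun t ht => add_nonneg (Finset.sum_nonneg fun i _ => sq_nonneg _)
      (Finset.sum_nonneg fun i _ => sq_nonneg _)) ?_ t ht
  · rw [hφe t ht, hφe 0 (left_mem_Icc.2 hT.le)] at key
    simp only [Pi.add_apply] at key
    rwa [integral_add hFi hGi] at key
  filter_upwards [h.equation, ae_restrict_mem measurableSet_Ioo] with t he htI
  have ht' : t ∈ Icc 0 T := Ioo_subset_Icc_self htI
  -- Testing with a zero second or first component separates the derivatives of velocity and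
  -- magnetic pairings.
  have hdu : ∀ i, ∃ d, HasDerivAt (fun s => ip Ω (uh s) (b i)) d t := fun i => by
    have := he (b i) 0 (hb i) (M.spaceWh N k).zero_mem
    simp only [hip0, add_zero] at this
    exact ⟨_, this⟩
  have hdB : ∀ j, ∃ d, HasDerivAt (fun s => ip Ω (Bh s) (c j)) d t := fun j => by
    have := he 0 (c j) (M.spaceZh k).zero_mem (hc j)
    simp only [hip0, zero_add] at this
    exact ⟨_, this⟩
  choose du hdu using hdu
  choose dB hdB using hdB
  have hderiv : HasDerivAt φ (∑ i, 2 * (du i * ip Ω (uh t) (b i))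
      + ∑ j, 2 * (dB j * ip Ω (Bh t) (c j))) t := by
    refine (HasDerivAt.fun_sum fun i _ => ?_).add (HasDerivAt.fun_sum fun j _ => ?_)
    · exact ((hdu i).pow 2).congr_deriv (by push_cast; ring)
    · exact ((hdB j).pow 2).congr_deriv (by push_cast; ring)
  refine ⟨_, hderiv, ?_⟩
  -- The test fields are the solution frozen at time `t`. By Parseval the derivative of the pairing
  -- is half of `φ'`, and uniqueness of derivatives identifies it with the equation.
  have h1 := he (uh t) (Bh t) (h.mem_Zh t ht') (h.mem_Wh t ht')
  have h2 : HasDerivAt (fun s => ip Ω (uh s) (uh t) + ip Ω (Bh s) (Bh t))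
      (∑ i, du i * ip Ω (uh t) (b i) + ∑ j, dB j * ip Ω (Bh t) (c j)) t := by
    have h3 : HasDerivAt (fun s => ∑ i, ip Ω (uh s) (b i) * ip Ω (uh t) (b i)
        + ∑ j, ip Ω (Bh s) (c j) * ip Ω (Bh t) (c j)) _ t :=
      (HasDerivAt.fun_sum fun i _ => (hdu i).mul_const _).add
        (HasDerivAt.fun_sum fun j _ => (hdB j).mul_const _)
    refine h3.congr_of_eventuallyEq ?_
    filter_upwards [isOpen_Ioo.mem_nhds htI] with s hs
    rw [hbp _ (h.mem_Zh s (Ioo_subset_Icc_self hs)) _ (h.mem_Zh t ht'),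
      hcp _ (h.mem_Wh s (Ioo_subset_Icc_self hs)) _ (h.mem_Wh t ht')]
  have h3 := h1.unique h2
  rw [← Finset.mul_sum, ← Finset.mul_sum, ← mul_add, ← h3]
  have h4 := hA (uh t) (Bh t) (h.mem_Zh t ht')
  have h5 := ip_le (F t) (h.mem_Zh t ht').2.1
  have h6 := ip_le (G t) (memLp_of_isPolyOn hΩ (hWp _ (h.mem_Wh t ht')))
  have h7 : √(ip Ω (uh t) (uh t)) ≤ √(φ t) :=
    Real.sqrt_le_sqrt (by rw [hφe t ht']; exact le_add_of_nonneg_right (hip0' _))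
  have h8 : √(ip Ω (Bh t) (Bh t)) ≤ √(φ t) :=
    Real.sqrt_le_sqrt (by rw [hφe t ht']; exact le_add_of_nonneg_left (hip0' _))
  have h9 := mul_le_mul_of_nonneg_left h7 (norm_nonneg (F t))
  have h10 := mul_le_mul_of_nonneg_left h8 (norm_nonneg (G t))
  simp only [Pi.add_apply]
  linarith

end TetMesh

/-! ### The interpolation error in the stabilized norm -/

namespace TetMesh

variable {Ω : Set E3} (M : TetMesh Ω)

/-- The scaled squared `L²` norm of `χ` on the patch of `f`, which dominates its squared sup norm. -/
noncomputable def patchSq (C : ℝ) (f : Finset E3) (χ : E3 → E3) : ℝ :=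
  ∑ K ∈ M.elemsOf f, C / volume.real (cell K) * ∫ x in openCell K, ‖χ x‖ ^ 2

variable {M} {k : ℕ} {C : ℝ} {χ : E3 → E3}

lemma patchSq_nonneg (hC : 0 ≤ C) (f : Finset E3) : 0 ≤ M.patchSq C f χ :=
  Finset.sum_nonneg fun _ _ => mul_nonneg (div_nonneg hC measureReal_nonneg)
    (integral_nonneg fun _ => sq_nonneg _)

lemma IsPw.norm_sq_le_patchSq {τ : Finset E3 → E3 → E3} (hτ : M.IsPw k χ τ) (hC0 : 0 ≤ C)
    (hC : ∀ K : Finset E3, IsTet K → ∀ w ∈ polyVec k, ∀ x ∈ cell K,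
      ‖w x‖ ^ 2 ≤ C / volume.real (cell K) * ∫ x in cell K, ‖w x‖ ^ 2)
    {f K : Finset E3} (hK : K ∈ M.elemsOf f) {x : E3} (hx : x ∈ cell K) :
    ‖τ K x‖ ^ 2 ≤ M.patchSq C f χ := by
  have hKe := (M.mem_elemsOf.1 hK).1
  refine (hC K (M.isTet hKe) _ (hτ K hKe).1 x hx).trans ?_
  have h1 : ∫ x in cell K, ‖τ K x‖ ^ 2 = ∫ x in openCell K, ‖χ x‖ ^ 2 := by
    rw [← IsTet.setIntegral_openCell]
    exact setIntegral_congr_fun (IsTet.isOpen_openCell K).measurableSet fun y hy => by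
      simp only [(hτ K hKe).2 hy]
  rw [h1]
  exact Finset.single_le_sum (f := fun K => C / volume.real (cell K) * ∫ x in openCell K, ‖χ x‖ ^ 2)
    (fun K _ => mul_nonneg (div_nonneg hC0 measureReal_nonneg)
      (integral_nonneg fun _ => sq_nonneg _)) hK

/-- The linear weight is raised to a quadratic one, `|s| ≤ 1 + s²`, so that upwinding and interior
penalty are treated alike through the `L²` energy. -/
lemma abs_normalComp_le (hχ : ∀ K ∈ M.elems, IsPolyOn k (openCell K) χ) (hC0 : 0 ≤ C)
    (hC : ∀ K : Finset E3, IsTet K → ∀ w ∈ polyVec k, ∀ x ∈ cell K,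
      ‖w x‖ ^ 2 ≤ C / volume.real (cell K) * ∫ x in cell K, ‖w x‖ ^ 2)
    (N : M.Normals) {f : Finset E3} (hf : f ∈ M.faces) {x : E3} (hx : x ∈ openFace f) :
    |M.normalComp N f χ x| ≤ 1 + M.patchSq C f χ := by
  obtain ⟨τ, hτ⟩ := M.exists_isPw hχ
  have hcell : ∀ K ∈ M.elemsOf f, x ∈ cell K := fun K hK =>
    openFace_subset_cell_of_subset (M.mem_elemsOf.1 hK).2 (openFace_subset_cell f hx)
  have h1 := hτ.norm_sq_le_patchSq hC0 hC (M.minus_mem N hf) (hcell _ (M.minus_mem N hf))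
  have h2 := hτ.norm_sq_le_patchSq hC0 hC (M.plus_mem N hf) (hcell _ (M.plus_mem N hf))
  rw [normalComp, hτ.isTrace.avg N hf hx]
  have h3 := abs_real_inner_le_norm ((2⁻¹ : ℝ) • (τ (M.minus N f) x + τ (M.plus N f) x)) (N.n f)
  rw [N.unit f hf, mul_one, norm_smul, Real.norm_of_nonneg (by norm_num)] at h3
  have h4 := norm_add_le (τ (M.minus N f) x) (τ (M.plus N f) x)
  nlinarith [sq_nonneg (‖τ (M.minus N f) x‖ - 1), sq_nonneg (‖τ (M.plus N f) x‖ - 1)]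

/-- The inverse inequality bounds the field at each point of the patch by the scaled `L²` norm on
the element containing it. -/
lemma cipWeight_le (hχ : ∀ K ∈ M.elems, IsPolyOn k (cell K) χ) (hC0 : 0 ≤ C)
    (hC : ∀ K : Finset E3, IsTet K → ∀ w ∈ polyVec k, ∀ x ∈ cell K,
      ‖w x‖ ^ 2 ≤ C / volume.real (cell K) * ∫ x in cell K, ‖w x‖ ^ 2) (f : Finset E3) :
    M.cipWeight f χ ≤ 1 + M.patchSq C f χ := by
  have hS := patchSq_nonneg (M := M) (χ := χ) hC0 f
  have hb : ∀ x ∈ M.patch f, ‖χ x‖ ≤ √(M.patchSq C f χ) := by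
    intro x hx
    obtain ⟨K, hK, hxK⟩ := mem_iUnion₂.1 hx
    have hp : ∀ K, ∃ w, K ∈ M.elems → w ∈ polyVec k ∧ EqOn χ w (cell K) := fun K => by
      by_cases hK : K ∈ M.elems
      · obtain ⟨w, hw, he⟩ := isPolyOn_iff.1 (hχ K hK)
        exact ⟨w, fun _ => ⟨hw, he⟩⟩
      · exact ⟨0, fun h => absurd h hK⟩
    choose τ hτ using hp
    have hpw : M.IsPw k χ τ := fun K hK =>
      ⟨(hτ K hK).1, (hτ K hK).2.mono (IsTet.openCell_subset_cell K)⟩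
    rw [(hτ K (M.mem_elemsOf.1 hK).1).2 hxK]
    exact Real.le_sqrt_of_sq_le (hpw.norm_sq_le_patchSq hC0 hC hK hxK)
  have hm : MeasurableSet (M.patch f) := Finset.measurableSet_biUnion _ fun K _ =>
    (IsTet.isCompact_cell K).isClosed.measurableSet
  have h1 : supNorm (M.patch f) χ ≤ √(M.patchSq C f χ) := by
    refine ENNReal.toReal_le_of_le_ofReal (Real.sqrt_nonneg _) ?_
    rw [eLpNorm_exponent_top]
    exact eLpNormEssSup_le_of_ae_bound (ae_restrict_of_forall_mem hm hb)
  have h2 : supNorm (M.patch f) χ ^ 2 ≤ M.patchSq C f χ := by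
    rw [← Real.sq_sqrt hS]
    exact pow_le_pow_left₀ ENNReal.toReal_nonneg h1 2
  exact max_le (h2.trans (by linarith)) (by linarith)

lemma ip_self_eq_sum (hΩ : IsConvexPolyhedron Ω) (hχ : MemLp χ 2 (volume.restrict Ω)) :
    ip Ω χ χ = ∑ K ∈ M.elems, ∫ x in openCell K, ‖χ x‖ ^ 2 := by
  rw [ip, M.integral_eq_sum hΩ fun K hK =>
    (integrable_inner_of_memLp hχ hχ).mono_set (M.openCell_subset hΩ hK)]
  simp only [real_inner_self_eq_norm_sq]

/-! ### Summation over faces under shape regularity. -/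

section Sizes

variable {C₂ : ℝ}
  (hel : ∀ K ∈ M.elems, 0 < volume.real (cell K) ∧ 0 < Metric.diam (cell K) ∧
      Metric.diam (cell K) ^ 3 ≤ C₂ * volume.real (cell K))
  (hfa : ∀ f ∈ M.faces, ∀ K ∈ M.elemsOf f, 0 < Metric.diam (cell f) ∧
      Metric.diam (cell f) ≤ Metric.diam (cell K) ∧
      Metric.diam (cell K) ≤ C₂ * Metric.diam (cell f) ∧
      area f ≤ C₂ * Metric.diam (cell K) ^ 2)
include hel hfa

lemma diam_pow_three_le {f K : Finset E3} (hf : f ∈ M.faces) (hK : K ∈ M.elemsOf f) :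
    Metric.diam (cell f) ^ 3 ≤ C₂ * volume.real (cell K) :=
  (pow_le_pow_left₀ Metric.diam_nonneg (hfa f hf K hK).2.1 3).trans
    (hel K (M.mem_elemsOf.1 hK).1).2.2

/-- The cube of a face diameter is bounded by an adjacent volume, and each element is counted by
four faces. -/
lemma sum_diam_pow_three_le (hΩ : IsConvexPolyhedron Ω) (N : M.Normals) (hC₂ : 0 ≤ C₂) :
    ∑ f ∈ M.faces, Metric.diam (cell f) ^ 3 ≤ 4 * C₂ * volume.real (closure Ω) := by
  have h1 : ∀ f ∈ M.faces, Metric.diam (cell f) ^ 3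
      ≤ ∑ K ∈ M.elemsOf f, C₂ * volume.real (cell K) := fun f hf =>
    (diam_pow_three_le hel hfa hf (M.minus_mem N hf)).trans
      (Finset.single_le_sum (f := fun K => C₂ * volume.real (cell K))
        (fun K _ => mul_nonneg hC₂ measureReal_nonneg) (M.minus_mem N hf))
  refine (Finset.sum_le_sum h1).trans ?_
  rw [M.sum_faces_elemsOf, ← Finset.mul_sum, mul_assoc]
  exact mul_le_mul_of_nonneg_left (mul_le_mul_of_nonneg_left (M.sum_volume_le hΩ) hC₂) (by norm_num)

/-- Three powers of the face diameter pay for the factor `1 / |K|` in `patchSq`, and the fourth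
remains as `h`. Squared maximum norms are thus exchanged for the global squared `L²` norm. -/
lemma sum_patchSq_le (hΩ : IsConvexPolyhedron Ω) (N : M.Normals) (hC₂ : 0 ≤ C₂) (hC : 0 ≤ C)
    (hχ : MemLp χ 2 (volume.restrict Ω)) :
    ∑ f ∈ M.faces, (1 + M.patchSq C f χ) * Metric.diam (cell f) ^ 4
      ≤ 4 * C₂ * M.meshSize * (volume.real (closure Ω) + C * ip Ω χ χ) := by
  have hh := M.meshSize_nonneg
  have h1 : ∀ f ∈ M.faces, (1 + M.patchSq C f χ) * Metric.diam (cell f) ^ 4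
      ≤ M.meshSize * C₂ * ∑ K ∈ M.elemsOf f,
        (volume.real (cell K) + C * ∫ x in openCell K, ‖χ x‖ ^ 2) := by
    intro f hf
    have hm := M.minus_mem N hf
    have hd0 : 0 ≤ Metric.diam (cell f) := Metric.diam_nonneg
    have hdh : Metric.diam (cell f) ≤ M.meshSize :=
      (hfa f hf _ hm).2.1.trans (M.diam_le_meshSize (M.mem_elemsOf.1 hm).1)
    have h2 : Metric.diam (cell f) ^ 3 ≤ C₂ * ∑ K ∈ M.elemsOf f, volume.real (cell K) :=
      (diam_pow_three_le hel hfa hf hm).trans (mul_le_mul_of_nonneg_left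
        (Finset.single_le_sum (fun K _ => measureReal_nonneg) hm) hC₂)
    have h3 : Metric.diam (cell f) ^ 3 * M.patchSq C f χ
        ≤ C₂ * ∑ K ∈ M.elemsOf f, C * ∫ x in openCell K, ‖χ x‖ ^ 2 := by
      rw [patchSq, Finset.mul_sum, Finset.mul_sum]
      refine Finset.sum_le_sum fun K hK => ?_
      have hv := (hel K (M.mem_elemsOf.1 hK).1).1
      have hq : 0 ≤ ∫ x in openCell K, ‖χ x‖ ^ 2 := integral_nonneg fun _ => sq_nonneg _
      calc Metric.diam (cell f) ^ 3 * (C / volume.real (cell K) * ∫ x in openCell K, ‖χ x‖ ^ 2)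
          ≤ C₂ * volume.real (cell K) * (C / volume.real (cell K) * ∫ x in openCell K, ‖χ x‖ ^ 2) :=
            mul_le_mul_of_nonneg_right (diam_pow_three_le hel hfa hf hK) (by positivity)
        _ = C₂ * (C * ∫ x in openCell K, ‖χ x‖ ^ 2) := by field_simp
    rw [Finset.sum_add_distrib]
    have h4 : 0 ≤ (1 + M.patchSq C f χ) * Metric.diam (cell f) ^ 3 :=
      mul_nonneg (by linarith [patchSq_nonneg (M := M) (χ := χ) hC f]) (by positivity)
    calc (1 + M.patchSq C f χ) * Metric.diam (cell f) ^ 4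
        = Metric.diam (cell f) * ((1 + M.patchSq C f χ) * Metric.diam (cell f) ^ 3) := by ring
      _ ≤ M.meshSize * ((1 + M.patchSq C f χ) * Metric.diam (cell f) ^ 3) :=
          mul_le_mul_of_nonneg_right hdh h4
      _ ≤ _ := by
          rw [mul_assoc]
          exact mul_le_mul_of_nonneg_left (by linarith) hh
  refine (Finset.sum_le_sum h1).trans ?_
  rw [← Finset.mul_sum, M.sum_faces_elemsOf, Finset.sum_add_distrib, ← Finset.mul_sum,
    ← ip_self_eq_sum hΩ hχ]
  have h5 := mul_le_mul_of_nonneg_left (M.sum_volume_le hΩ) (by positivity : 0 ≤ 4 * C₂ * M.meshSize)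
  linarith

variable {φ : E3 → E3} {e : Finset E3 → E3 → E3} {D : Finset E3 → E3 → Matrix (Fin 3) (Fin 3) ℝ}
  {δ : ℝ}

omit hel in
lemma norm_jump_sq_le (hδ : 0 ≤ δ) (hC₂ : 0 ≤ C₂) (he : M.IsTrace φ e)
    (heb : ∀ K ∈ M.elems, ∀ x ∈ cell K, ‖e K x‖ ≤ δ * Metric.diam (cell K) ^ (k + 1))
    (N : M.Normals) {f : Finset E3} (hf : f ∈ M.faces) {x : E3} (hx : x ∈ openFace f) :
    ‖M.jump N f φ x‖ ^ 2 ≤ 4 * δ ^ 2 * (C₂ * Metric.diam (cell f)) ^ (2 * k + 2) := by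
  classical
  have hb : ∀ K ∈ M.elemsOf f, ‖e K x‖ ≤ δ * (C₂ * Metric.diam (cell f)) ^ (k + 1) := fun K hK => by
    obtain ⟨hKe, hfK⟩ := M.mem_elemsOf.1 hK
    refine (heb K hKe x (openFace_subset_cell_of_subset hfK (openFace_subset_cell f hx))).trans ?_
    exact mul_le_mul_of_nonneg_left
      (pow_le_pow_left₀ Metric.diam_nonneg (hfa f hf K hK).2.2.1 _) hδ
  have h0 : 0 ≤ δ * (C₂ * Metric.diam (cell f)) ^ (k + 1) :=
    mul_nonneg hδ (pow_nonneg (mul_nonneg hC₂ Metric.diam_nonneg) _)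
  have h1 : ‖M.jump N f φ x‖ ≤ 2 * (δ * (C₂ * Metric.diam (cell f)) ^ (k + 1)) := by
    rw [he.jump N hf hx]
    refine (norm_sub_le _ _).trans ?_
    rw [two_mul]
    refine add_le_add (hb _ (M.minus_mem N hf)) ?_
    split_ifs
    · exact hb _ (M.plus_mem N hf)
    · rwa [norm_zero]
  refine (pow_le_pow_left₀ (norm_nonneg _) h1 2).trans (le_of_eq ?_)
  ring

omit hel in
lemma frob_jump_le (hδ : 0 ≤ δ) (hD : M.IsTrace (gradM φ) D)
    (hDb : ∀ K ∈ M.elems, ∀ x ∈ cell K, ∀ i j, |D K x i j| ≤ δ * Metric.diam (cell K) ^ k)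
    (N : M.Normals) {f : Finset E3} (hi : f ∈ M.intFaces) {x : E3} (hx : x ∈ openFace f) :
    frob (M.jump N f (gradM φ) x) (M.jump N f (gradM φ) x)
      ≤ 36 * δ ^ 2 * (C₂ * Metric.diam (cell f)) ^ (2 * k) := by
  have hf := M.mem_faces_of_mem_intFaces hi
  have hb : ∀ K ∈ M.elemsOf f, ∀ i j, |D K x i j| ≤ δ * (C₂ * Metric.diam (cell f)) ^ k :=
    fun K hK i j => by
      obtain ⟨hKe, hfK⟩ := M.mem_elemsOf.1 hK
      refine (hDb K hKe x (openFace_subset_cell_of_subset hfK (openFace_subset_cell f hx)) i j).trans ?_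
      exact mul_le_mul_of_nonneg_left
        (pow_le_pow_left₀ Metric.diam_nonneg (hfa f hf K hK).2.2.1 _) hδ
  rw [hD.jump_int N hi hx, frob]
  have h1 : ∀ i j : Fin 3, (D (M.minus N f) x - D (M.plus N f) x) i j
      * (D (M.minus N f) x - D (M.plus N f) x) i j
      ≤ (2 * (δ * (C₂ * Metric.diam (cell f)) ^ k)) ^ 2 := fun i j => by
    rw [← sq]
    refine sq_le_sq' ?_ ?_ <;>
    · rw [Matrix.sub_apply]
      have h2 := abs_le.1 (hb _ (M.minus_mem N hf) i j)
      have h3 := abs_le.1 (hb _ (M.plus_mem N hf) i j)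
      linarith [h2.1, h2.2, h3.1, h3.2]
  -- Nine entries, each with square at most four times the squared one-sided bound.
  refine (Finset.sum_le_sum fun i _ => Finset.sum_le_sum fun j _ => h1 i j).trans (le_of_eq ?_)
  simp only [Finset.sum_const, Finset.card_univ, Fintype.card_fin, nsmul_eq_mul]
  push_cast
  ring

omit hel in
lemma area_le (hC₂ : 0 ≤ C₂) (N : M.Normals) {f : Finset E3} (hf : f ∈ M.faces) :
    area f ≤ C₂ ^ 3 * Metric.diam (cell f) ^ 2 := by
  obtain ⟨-, -, h1, h2⟩ := hfa f hf _ (M.minus_mem N hf)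
  refine h2.trans ?_
  have h3 := mul_le_mul_of_nonneg_left (pow_le_pow_left₀ Metric.diam_nonneg h1 2) hC₂
  exact h3.trans (le_of_eq (by ring))

/-- The stabilized norm of a piecewise regular field with small traces. -/
lemma stabSq_le (hΩ : IsConvexPolyhedron Ω) (N : M.Normals) (hδ : 0 ≤ δ) (hC₂ : 0 < C₂)
    (hC0 : 0 ≤ C) (hC : ∀ K : Finset E3, IsTet K → ∀ w ∈ polyVec k, ∀ x ∈ cell K,
      ‖w x‖ ^ 2 ≤ C / volume.real (cell K) * ∫ x in cell K, ‖w x‖ ^ 2)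
    (he : M.IsTrace φ e) (hD : M.IsTrace (gradM φ) D)
    (heb : ∀ K ∈ M.elems, ∀ x ∈ cell K, ‖e K x‖ ≤ δ * Metric.diam (cell K) ^ (k + 1))
    (hDb : ∀ K ∈ M.elems, ∀ x ∈ cell K, ∀ i j, |D K x i j| ≤ δ * Metric.diam (cell K) ^ k)
    {νS μa : ℝ} (hνS : 0 ≤ νS) (hμa : 0 ≤ μa) {Θ : E3 → E3}
    (hχ : ∀ K ∈ M.elems, IsPolyOn k (openCell K) χ) (hχ2 : MemLp χ 2 (volume.restrict Ω))
    (hΘ : ∀ K ∈ M.elems, IsPolyOn k (cell K) Θ) (hΘ2 : MemLp Θ 2 (volume.restrict Ω)) :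
    M.stabSq N νS μa χ Θ φ ≤ δ ^ 2 * M.meshSize ^ (2 * k) *
      (νS * (9 * volume.real (closure Ω)
        + μa * ((4 * C₂ ^ (2 * k + 5) + 36 * C₂ ^ (2 * k + 3))
          * (4 * C₂ * volume.real (closure Ω))))
      + (4 * C₂ ^ (2 * k + 5) + 36 * C₂ ^ (2 * k + 3)) * (4 * C₂ * M.meshSize
        * (2 * volume.real (closure Ω) + C * (ip Ω χ χ + ip Ω Θ Θ)))) := by
  set A := 4 * C₂ ^ (2 * k + 5) + 36 * C₂ ^ (2 * k + 3) with hA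
  have hA0 : 0 ≤ A := by positivity
  set h := M.meshSize with hh
  have hh0 : 0 ≤ h := M.meshSize_nonneg
  set B := δ ^ 2 * h ^ (2 * k) with hB
  have hB0 : 0 ≤ B := by positivity
  have hdh : ∀ f ∈ M.faces, Metric.diam (cell f) ≤ h := fun f hf =>
    (hfa f hf _ (M.minus_mem N hf)).2.1.trans
      (M.diam_le_meshSize (M.mem_elemsOf.1 (M.minus_mem N hf)).1)
  have harea0 : ∀ f ∈ M.faces, 0 ≤ area f := fun f hf => (area_pos (M.isTri hf)).le
  -- Only `2k` powers of the face diameter are replaced by `h`; four are kept for the sums over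
  -- faces.
  have hpow : ∀ f ∈ M.faces, ∀ c : ℝ, 0 ≤ c →
      c * δ ^ 2 * Metric.diam (cell f) ^ (2 * k) * Metric.diam (cell f) ^ 4
        ≤ c * B * Metric.diam (cell f) ^ 4 := fun f hf c hc => by
    have := pow_le_pow_left₀ Metric.diam_nonneg (hdh f hf) (2 * k)
    have h1 : c * δ ^ 2 * Metric.diam (cell f) ^ (2 * k) ≤ c * B := by
      rw [hB, ← mul_assoc]
      exact mul_le_mul_of_nonneg_left this (by positivity)
    exact mul_le_mul_of_nonneg_right h1 (pow_nonneg Metric.diam_nonneg 4)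
  have hJ : ∀ f ∈ M.faces, 4 * δ ^ 2 * (C₂ * Metric.diam (cell f)) ^ (2 * k + 2) * area f
      ≤ 4 * C₂ ^ (2 * k + 5) * B * Metric.diam (cell f) ^ 4 := fun f hf => by
    have hd : 0 ≤ Metric.diam (cell f) := Metric.diam_nonneg
    refine (mul_le_mul_of_nonneg_left (area_le hfa hC₂.le N hf) (by positivity)).trans ?_
    refine le_trans (le_of_eq ?_) (hpow f hf (4 * C₂ ^ (2 * k + 5)) (by positivity))
    ring
  have hJ' : ∀ f ∈ M.faces, 4 * δ ^ 2 * (C₂ * Metric.diam (cell f)) ^ (2 * k + 2) * area f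
      ≤ A * B * Metric.diam (cell f) ^ 4 := fun f hf => (hJ f hf).trans (by
    have hd : 0 ≤ Metric.diam (cell f) := Metric.diam_nonneg
    have : 0 ≤ 36 * C₂ ^ (2 * k + 3) * B * Metric.diam (cell f) ^ 4 := by positivity
    rw [hA]
    linarith)
  have hjb := fun f (hf : f ∈ M.faces) x (hx : x ∈ openFace f) =>
    norm_jump_sq_le hfa hδ hC₂.le he heb N hf hx
  have hjump : ∀ f ∈ M.faces, faceInt f (fun x => ‖M.jump N f φ x‖ ^ 2)
      ≤ 4 * δ ^ 2 * (C₂ * Metric.diam (cell f)) ^ (2 * k + 2) * area f := fun f hf =>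
    faceInt_le (M.isTri hf) (fun x _ => sq_nonneg _) (hjb f hf)
  have hint : M.intFaces ⊆ M.faces := fun f hf => M.mem_faces_of_mem_intFaces hf
  -- broken symmetric gradient
  have hsym : M.brokenInt (fun x => frob (symGrad φ x) (symGrad φ x))
      ≤ B * (9 * volume.real (closure Ω)) := by
    have h1 : ∀ K ∈ M.elems, ∫ x in openCell K, frob (symGrad φ x) (symGrad φ x)
        ≤ 9 * B * volume.real (cell K) := fun K hK => by
      rw [measureReal_congr (IsTet.cell_ae_eq K)]
      refine (le_abs_self _).trans ?_
      refine norm_setIntegral_le_of_norm_le_const (f := fun x => frob (symGrad φ x) (symGrad φ x))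
        (IsTet.volume_openCell_lt_top K) fun x hx => ?_
      rw [Real.norm_of_nonneg (frob_self_nonneg _)]
      have h2 : ∀ i j, |gradM φ x i j| ≤ δ * h ^ k := fun i j => by
        rw [(hD K hK).2 hx]
        exact (hDb K hK x (IsTet.openCell_subset_cell K hx) i j).trans
          (mul_le_mul_of_nonneg_left
            (pow_le_pow_left₀ Metric.diam_nonneg (M.diam_le_meshSize hK) k) hδ)
      have h3 : ∀ i j : Fin 3, symGrad φ x i j * symGrad φ x i j ≤ (δ * h ^ k) ^ 2 := fun i j => by
        rw [← sq]
        have h4 := abs_le.1 (h2 i j)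
        have h5 := abs_le.1 (h2 j i)
        refine sq_le_sq' ?_ ?_ <;>
        · rw [symGrad, Matrix.smul_apply, Matrix.add_apply, Matrix.transpose_apply, smul_eq_mul]
          linarith [h4.1, h4.2, h5.1, h5.2]
      refine (Finset.sum_le_sum fun i _ => Finset.sum_le_sum fun j _ => h3 i j).trans (le_of_eq ?_)
      simp only [Finset.sum_const, Finset.card_univ, Fintype.card_fin, nsmul_eq_mul, hB]
      push_cast
      ring
    refine (Finset.sum_le_sum h1).trans ?_
    rw [← Finset.mul_sum]
    exact (mul_le_mul_of_nonneg_left (M.sum_volume_le hΩ) (by positivity)).trans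
      (le_of_eq (by ring))
  -- penalty
  have hpen : ∑ f ∈ M.faces, (Metric.diam (cell f))⁻¹ * faceInt f (fun x => ‖M.jump N f φ x‖ ^ 2)
      ≤ B * (A * (4 * C₂ * volume.real (closure Ω))) := by
    have h1 : ∀ f ∈ M.faces, (Metric.diam (cell f))⁻¹ * faceInt f (fun x => ‖M.jump N f φ x‖ ^ 2)
        ≤ A * B * Metric.diam (cell f) ^ 3 := fun f hf => by
      have hd := (hfa f hf _ (M.minus_mem N hf)).1
      refine (mul_le_mul_of_nonneg_left ((hjump f hf).trans (hJ' f hf)) (by positivity)).trans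
        (le_of_eq ?_)
      field_simp
    refine (Finset.sum_le_sum h1).trans ?_
    rw [← Finset.mul_sum]
    exact (mul_le_mul_of_nonneg_left (sum_diam_pow_three_le hel hfa hΩ N hC₂.le)
      (by positivity)).trans (le_of_eq (by ring))
  have hnonneg : ∀ ψ : E3 → E3, ∀ f ∈ M.faces, f ∉ M.intFaces →
      0 ≤ A * B * ((1 + M.patchSq C f ψ) * Metric.diam (cell f) ^ 4) := fun ψ f _ _ => by
    have := patchSq_nonneg (M := M) (χ := ψ) hC0 f
    have hd : 0 ≤ Metric.diam (cell f) := Metric.diam_nonneg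
    positivity
  -- upwinding
  have hupw : M.upwSq N χ φ ≤ A * B * (4 * C₂ * h * (volume.real (closure Ω) + C * ip Ω χ χ)) := by
    refine le_trans ?_ (mul_le_mul_of_nonneg_left
      (sum_patchSq_le hel hfa hΩ N hC₂.le hC0 hχ2) (by positivity))
    rw [Finset.mul_sum]
    refine le_trans ?_ (Finset.sum_le_sum_of_subset_of_nonneg hint (hnonneg χ))
    refine Finset.sum_le_sum fun f hi => ?_
    have hf := hint hi
    have hS := patchSq_nonneg (M := M) (χ := χ) hC0 f
    refine (faceInt_le (C := (1 + M.patchSq C f χ)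
      * (4 * δ ^ 2 * (C₂ * Metric.diam (cell f)) ^ (2 * k + 2))) (M.isTri hf)
      (fun x _ => mul_nonneg (abs_nonneg _) (sq_nonneg _)) fun x hx =>
      mul_le_mul (abs_normalComp_le hχ hC0 hC N hf hx) (hjb f hf x hx) (sq_nonneg _)
        (by linarith)).trans ?_
    rw [mul_assoc]
    exact (mul_le_mul_of_nonneg_left (hJ' f hf) (by linarith)).trans (le_of_eq (by ring))
  -- continuous interior penalty
  have hcip : M.cipSq N Θ φ ≤ A * B * (4 * C₂ * h * (volume.real (closure Ω) + C * ip Ω Θ Θ)) := by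
    refine le_trans ?_ (mul_le_mul_of_nonneg_left
      (sum_patchSq_le hel hfa hΩ N hC₂.le hC0 hΘ2) (by positivity))
    rw [Finset.mul_sum]
    refine le_trans ?_ (Finset.sum_le_sum_of_subset_of_nonneg hint (hnonneg Θ))
    refine Finset.sum_le_sum fun f hi => ?_
    have hf := hint hi
    have hd : 0 ≤ Metric.diam (cell f) := Metric.diam_nonneg
    have hS := patchSq_nonneg (M := M) (χ := Θ) hC0 f
    have h1 : faceInt f (fun x => frob (M.jump N f (gradM φ) x) (M.jump N f (gradM φ) x))
        ≤ 36 * δ ^ 2 * (C₂ * Metric.diam (cell f)) ^ (2 * k) * area f :=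
      faceInt_le (M.isTri hf) (fun x _ => frob_self_nonneg _) fun x hx =>
        frob_jump_le hfa hδ hD hDb N hi hx
    have h2 : Metric.diam (cell f) ^ 2 *
        faceInt f (fun x => frob (M.jump N f (gradM φ) x) (M.jump N f (gradM φ) x))
        ≤ 36 * C₂ ^ (2 * k + 3) * B * Metric.diam (cell f) ^ 4 := by
      refine (mul_le_mul_of_nonneg_left (h1.trans (mul_le_mul_of_nonneg_left
        (area_le hfa hC₂.le N hf) (by positivity))) (by positivity)).trans ?_
      refine le_trans (le_of_eq ?_) (hpow f hf (36 * C₂ ^ (2 * k + 3)) (by positivity))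
      ring
    have h3 := (hjump f hf).trans (hJ f hf)
    have h4 : faceInt f (fun x => ‖M.jump N f φ x‖ ^ 2) + Metric.diam (cell f) ^ 2 *
        faceInt f (fun x => frob (M.jump N f (gradM φ) x) (M.jump N f (gradM φ) x))
        ≤ A * B * Metric.diam (cell f) ^ 4 := by
      rw [hA]
      linarith
    refine (mul_le_mul (cipWeight_le hΘ hC0 hC f) h4 ?_ (by linarith)).trans (le_of_eq (by ring))
    exact add_nonneg (integral_nonneg fun x => sq_nonneg _) (mul_nonneg (sq_nonneg _)
      (integral_nonneg fun x => frob_self_nonneg _))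
  have h1 := mul_le_mul_of_nonneg_left (add_le_add hsym
    (mul_le_mul_of_nonneg_left hpen hμa)) hνS
  rw [stabSq, norm1hSq]
  refine (add_le_add (add_le_add h1 hupw) hcip).trans (le_of_eq ?_)
  ring

end Sizes

end TetMesh

lemma l2Norm_sq (Ω : Set E3) (v : E3 → E3) : l2Norm Ω v ^ 2 = ip Ω v v := by
  rw [l2Norm, ip, Real.sq_sqrt (integral_nonneg fun _ => sq_nonneg _)]
  simp only [real_inner_self_eq_norm_sq]

end MHD

/-! ### Assembly of the estimate. -/

theorem mainTheorem9 (Ω : Set E3) (hΩ : IsConvexPolyhedron Ω) (k : ℕ) (hk : 1 ≤ k)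
    (cM : ℝ) (hcM : 0 < cM) :
    ∃ μ₀ : ℝ, 0 < μ₀ ∧ ∀ (T : ℝ) (c₀ : ℝ), 0 < T → 0 ≤ c₀ → ∃ C : ℝ, 0 < C ∧
      ∀ (M : TetMesh Ω) (N : M.Normals), M.ShapeRegular cM →
      ∀ (νS νM μa : ℝ), 0 < νS → 0 < νM → μ₀ ≤ μa →
      ∀ (F G : ℝ → Lp E3 2 (volume.restrict Ω)),
        MemLp F 2 (volume.restrict (Ioo 0 T)) → MemLp G 2 (volume.restrict (Ioo 0 T)) →
      ∀ (u₀ B₀ : Lp E3 2 (volume.restrict Ω)), MemH0DivFree Ω u₀ → MemH0DivFree Ω B₀ →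
      ∀ (uh Bh : ℝ → E3 → E3), M.IsThreeFieldSolution N k νS νM μa T F G uh Bh →
        l2Norm Ω (uh 0) ≤ c₀ * ‖u₀‖ → l2Norm Ω (Bh 0) ≤ c₀ * ‖B₀‖ →
      ∀ (u Iu : ℝ → E3 → E3),
        (∀ᵐ t ∂(volume.restrict (Ioo 0 T)),
          M.MemVW k (u t) ∧ M.IsBDMInterpolant N k (u t) (Iu t)) →
        ∀ᵐ t ∂(volume.restrict (Ioo 0 T)),
          M.stabSq N νS μa (uh t) (Bh t) (u t - Iu t) ≤
            C * (lambdaStabSq νS μa M.meshSize (gammaDataSq T F G u₀ B₀)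
              * M.brokenWInfNorm (k + 1) (u t) ^ 2 * M.meshSize ^ (2 * k)) := by
  obtain ⟨μ₀, hμ₀, hA3⟩ := TetMesh.exists_A3f_nonneg k cM hcM
  obtain ⟨C₁, hC₁, hinterp⟩ := TetMesh.exists_interp_error k hk cM hcM
  obtain ⟨C₂, hC₂, hsizes⟩ := TetMesh.exists_sizes cM hcM
  obtain ⟨C₃, hC₃, hinv⟩ := exists_norm_sq_le_integral k
  refine ⟨μ₀, hμ₀, fun T c₀ hT hc₀ => ?_⟩
  set V := volume.real (closure Ω) with hV
  have hV0 : 0 ≤ V := measureReal_nonneg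
  set A := 4 * C₂ ^ (2 * k + 5) + 36 * C₂ ^ (2 * k + 3) with hA
  have hA0 : 0 ≤ A := by positivity
  -- The energy bound gives `2 c₀²` times the initial data and `4 (a + b)² ≤ 8 (a² + b²)` for the
  -- loads.
  set R := 2 * c₀ ^ 2 + 8 with hR
  have hR0 : 0 ≤ R := by positivity
  -- The summands belong to the symmetric gradient, the penalty, and the two face seminorms; the
  -- final `1` ensures positivity.
  refine ⟨C₁ ^ 2 * (9 * V + A * (4 * C₂ * V) + A * (4 * C₂ * (2 * V + C₃ * R)) + 1),
    by positivity, ?_⟩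
  intro M N hM νS νM μa hνS hνM hμa F G hF hG u₀ B₀ _ _ uh Bh hsol hu0 hB0 u Iu hu
  obtain ⟨hel, hfa⟩ := hsizes Ω M hM
  filter_upwards [hu, ae_restrict_mem measurableSet_Ioo] with t ⟨hv, hI⟩ htI
  have ht : t ∈ Icc 0 T := Ioo_subset_Icc_self htI
  have hμa0 : 0 ≤ μa := hμ₀.le.trans hμa
  set γ := gammaDataSq T F G u₀ B₀ with hγ
  set W := M.brokenWInfNorm (k + 1) (u t) with hW
  have hW0 : 0 ≤ W := ENNReal.toReal_nonneg
  set h := M.meshSize with hh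
  have hh0 : 0 ≤ h := M.meshSize_nonneg
  have hγ0 : 0 ≤ γ := by rw [hγ, gammaDataSq]; positivity
  have hener : ip Ω (uh t) (uh t) + ip Ω (Bh t) (Bh t) ≤ R * γ := by
    have h1 := hsol.energy_le hΩ hT hF hG
      (fun v B hv => hA3 Ω hΩ M N hM νS νM μa hνS hνM hμa v B hv) ht
    have hl2 : ∀ v, 0 ≤ l2Norm Ω v := fun v => Real.sqrt_nonneg _
    have h2 := pow_le_pow_left₀ (hl2 _) hu0 2
    have h3 := pow_le_pow_left₀ (hl2 _) hB0 2
    rw [l2Norm_sq] at h2 h3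
    rw [hγ, gammaDataSq, hR]
    set a := ∫ t in Ioo 0 T, ‖F t‖
    set b := ∫ t in Ioo 0 T, ‖G t‖
    have h4 : 0 ≤ c₀ ^ 2 * (a ^ 2 + b ^ 2) := by positivity
    have h5 : (a + b) ^ 2 ≤ 2 * (a ^ 2 + b ^ 2) := by linarith [sq_nonneg (a - b), add_sq a b, sub_sq a b]
    rw [mul_pow] at h2 h3
    linarith [sq_nonneg ‖u₀‖, sq_nonneg ‖B₀‖]
  have hex : ∀ K, ∃ (e : E3 → E3) (D : E3 → Matrix (Fin 3) (Fin 3) ℝ), K ∈ M.elems →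
      ContinuousOn e (cell K) ∧ ContinuousOn D (cell K) ∧ EqOn (u t - Iu t) e (openCell K) ∧
      EqOn (gradM (u t - Iu t)) D (openCell K) ∧
      (∀ x ∈ cell K, ‖e x‖ ≤ C₁ * W * Metric.diam (cell K) ^ (k + 1)) ∧
      ∀ x ∈ cell K, ∀ i j, |D x i j| ≤ C₁ * W * Metric.diam (cell K) ^ k := fun K => by
    by_cases hK : K ∈ M.elems
    · obtain ⟨e, D, h⟩ := hinterp Ω M N hM (u t) (Iu t) hv hI K hK
      exact ⟨e, D, fun _ => h⟩
    · exact ⟨0, 0, fun h => absurd h hK⟩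
  choose e D heD using hex
  have hB2 : ∀ K ∈ M.elems, IsPolyOn k (cell K) (Bh t) := (hsol.mem_Wh t ht).1
  have hBm : MemLp (Bh t) 2 (volume.restrict Ω) :=
    TetMesh.memLp_of_isPolyOn (M := M) hΩ fun K hK => by
      obtain ⟨P, hP, he⟩ := hB2 K hK
      exact ⟨P, hP, fun x hx => he x (IsTet.openCell_subset_cell K hx)⟩
  have key := TetMesh.stabSq_le hel hfa hΩ N (mul_nonneg hC₁.le hW0) hC₂ hC₃.le hinv
    (fun K hK => ⟨(heD K hK).1, (heD K hK).2.2.1⟩)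
    (fun K hK => ⟨(heD K hK).2.1, (heD K hK).2.2.2.1⟩)
    (fun K hK => (heD K hK).2.2.2.2.1) (fun K hK => (heD K hK).2.2.2.2.2) hνS.le hμa0
    (hsol.mem_Zh t ht).1.1 (hsol.mem_Zh t ht).2.1 hB2 hBm
  refine key.trans ?_
  set Λ := lambdaStabSq νS μa h γ with hΛ
  have hΛ1 : νS * (1 + μa + μa⁻¹) ≤ Λ := le_max_left _ _
  have hΛ2 : h * (γ + 1) ≤ Λ := le_max_right _ _
  have hinv0 : 0 ≤ νS * μa⁻¹ := mul_nonneg hνS.le (inv_nonneg.2 hμa0)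
  have hΛ0 : 0 ≤ Λ := (by positivity : 0 ≤ h * (γ + 1)).trans hΛ2
  have hνμ : 0 ≤ νS * μa := mul_nonneg hνS.le hμa0
  have hΛ3 : νS + νS * μa + νS * μa⁻¹ ≤ Λ := le_trans (le_of_eq (by ring)) hΛ1
  have b1 : νS * (9 * V) ≤ 9 * V * Λ := by
    calc νS * (9 * V) = 9 * V * νS := by ring
      _ ≤ _ := mul_le_mul_of_nonneg_left (by linarith) (by positivity)
  have b2 : νS * (μa * (A * (4 * C₂ * V))) ≤ A * (4 * C₂ * V) * Λ := by
    have h1 : νS * μa ≤ Λ := by linarith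
    calc νS * (μa * (A * (4 * C₂ * V))) = A * (4 * C₂ * V) * (νS * μa) := by ring
      _ ≤ _ := mul_le_mul_of_nonneg_left h1 (by positivity)
  -- The energy estimate enters here: discrete `L²` norms become data, and the spare factor `h`
  -- gives the second entry of the maximum in `Λ²`.
  have b3 : A * (4 * C₂ * h * (2 * V + C₃ * (ip Ω (uh t) (uh t) + ip Ω (Bh t) (Bh t))))
      ≤ A * (4 * C₂ * (2 * V + C₃ * R)) * Λ := by
    have h1 : 2 * V + C₃ * (ip Ω (uh t) (uh t) + ip Ω (Bh t) (Bh t))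
        ≤ (2 * V + C₃ * R) * (γ + 1) := by
      have h2 := mul_le_mul_of_nonneg_left hener hC₃.le
      have h3 : 0 ≤ 2 * V * γ := by positivity
      have h4 : 0 ≤ C₃ * R := by positivity
      linarith
    calc A * (4 * C₂ * h * (2 * V + C₃ * (ip Ω (uh t) (uh t) + ip Ω (Bh t) (Bh t))))
        ≤ A * (4 * C₂ * h * ((2 * V + C₃ * R) * (γ + 1))) := by gcongr
      _ = A * (4 * C₂ * (2 * V + C₃ * R)) * (h * (γ + 1)) := by ring
      _ ≤ _ := mul_le_mul_of_nonneg_left hΛ2 (by positivity)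
  calc (C₁ * W) ^ 2 * h ^ (2 * k) * (νS * (9 * V + μa * (A * (4 * C₂ * V)))
        + A * (4 * C₂ * h * (2 * V + C₃ * (ip Ω (uh t) (uh t) + ip Ω (Bh t) (Bh t)))))
      ≤ (C₁ * W) ^ 2 * h ^ (2 * k)
        * ((9 * V + A * (4 * C₂ * V) + A * (4 * C₂ * (2 * V + C₃ * R)) + 1) * Λ) :=
        mul_le_mul_of_nonneg_left (by linarith) (by positivity)
    _ = _ := by ring
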